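/- **Setting.** Work over $\mathbb{Q}$ with formal power series of bounded degree in variables $x_1,x_2,\dots$ and $\theta_1,\theta_2,\dots$, where $\theta_i\theta_j=-\theta_j\theta_i$ (so $\theta_i^2=0$) and $x_i\theta_j=\theta_jx_i$. $\mathbf{sNCSym}$ is the space of such series with noncommuting $x_i$ that are invariant under all finite permutations of indices acting simultaneously on the $x_i$ and the $\theta_i$; $\rho$ is the linear projection that makes the $x_i$ commute (with infinite sums allowed), and $\mathbf{sSym}=\rho(\mathbf{sNCSym})$. **Superpartitions.** $\Lambda=(\Lambda_1,\dots,\Lambda_m;\Lambda_{m+1},\dots,\Lambda_k)\in\mathrm{sPar}_{n,m}$ means $\Lambda_1>\dots>\Lambda_m\ge 0$, $\Lambda_{m+1}\ge\dots\ge\Lambda_k>0$, $\sum\Lambda_i=n$. Put $\Lambda!=\prod\Lambda_i!$. Let $\Lambda^+$ and $\Lambda^\oplus$ be the partitions with parts $\Lambda_1,\dots,\Lambda_k$, respectively $\Lambda_1+1,\dots,\Lambda_m+1,\Lambda_{m+1},\dots,\Lambda_k$; the $m$ cells of $\Lambda^\oplus/\Lambda^+$ are the circles of $\Lambda$. In commuting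 variables, $m_\Lambda$ is the sum of the distinct monomials $\theta_{i_1}\cdots\theta_{i_m}x_{i_1}^{\Lambda_1}\cdots x_{i_k}^{\Lambda_k}$ ($i_1,\dots,i_k$ distinct), and $h_\Lambda=\tilde h_{\Lambda_1}\cdots\tilde h_{\Lambda_m}h_{\Lambda_{m+1}}\cdots h_{\Lambda_k}$, where $h_r$ is the sum of $m_\Omega$ over $\Omega\in\mathrm{sPar}_{r,0}$ and $\tilde h_r$ the sum of $(\Omega_1+1)m_\Omega$ over $\Omega\in\mathrm{sPar}_{r,1}$. **Set superpartitions.** A set superpartition $I$ of bidegree $(n,m)$ consists of fermionic blocks $I_1,\dots,I_m\subseteq\{0,\dots,n\}$, each containing $0$, and nonempty nonfermionic blocks $\subseteq\{1,\dots,n\}$, such that every $j\in\{1,\dots,n\}$ lies in exactly one block and $\min(I_i\setminus I_j)<\min(I_j\setminus I_i)$ for $i<j\le m$ ($\min\emptyset=0$). $m_I$ is the sum of $\theta_{a_1}\cdots\theta_{a_m}x_{b_1}\cdots x_{b_n}$ over all $(a,b)$ such that $a_i=b_j$ iff $j\in I_i$, and $b_i=b_j$ iff $i,j$ lie in the same block.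 $h_I$ is the sum of $c_{a,b}\,\theta_{a_1}\cdots\theta_{a_m}x_{b_1}\cdots x_{b_n}$ over all $(a,b)$ with distinct $a_i$ such that $\{a_i\}\setminus\{b_j\}$ has at most one element. Here $c_{a,b}$ is the product of the factorials of the sizes of the classes on the $m+n$ positions (the $m$ zeros and $1,\dots,n$) obtained by intersecting the partition into blocks of $I$ with the partition into positions carrying the same index. $I$ has type $\Lambda$ if the numbers $|I_i|-1$ ($i\le m$) are distinct and are the $\Lambda_1,\dots,\Lambda_m$ in some order, and the sizes of the nonfermionic blocks are $\Lambda_{m+1},\dots,\Lambda_k$ in some order; then $\varepsilon(I)$ is the number of neighbour transpositions needed to sort $(|I_1|-1,\dots,|I_m|-1)$ decreasingly. **Forms and lifting.** There are a unique bilinear form on $\mathbf{sNCSym}$ with $\langle m_I,h_J\rangle=(-1)^{\binom m2}n!\,\delta_{I,J}$ ($(n,m)$ the bidegree of $I$), a unique bilinear form on $\mathbf{sSym}$ with $\langle m_\Lambda,h_\Omega\rangle=(-1)^{\binom m2}\delta_{\Lambda,\Omega}$ ($m$ the fermionic degree of $\Lambda$), and a unique linear map $\tilde\rho:\mathbf{sSym}\to\mathbf{sNCSym}$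 with $\tilde\rho(m_\Lambda)=\frac{\Lambda!}{n!}\sum_{I\text{ of type }\Lambda}(-1)^{\varepsilon(I)}m_I$ for $\Lambda\in\mathrm{sPar}_{n,m}$. **Tableaux.** A super semistandard tableau of the first (second) kind of shape $\Lambda$ is a sequence of superpartitions $\emptyset=\Lambda_{(0)},\Lambda_{(1)},\dots$, eventually equal to $\Lambda$, such that each step from $M=\Lambda_{(i-1)}$ to $N=\Lambda_{(i)}$ satisfies: $N^+/M^+$ is a horizontal strip, and either (unbarred step) $N$ has as many circles as $M$, or (barred step) $N$ has exactly one more; in the latter case remove one circle of $N$, called the new circle. Then, from top to bottom, the $j$-th circle of $M$, in row $r$, corresponds to the $j$-th (remaining) circle of $N$, where: * if row $r$ of $N^+/M^+$ is empty, the latter is also in row $r$; * if it is nonempty, then, in the first kind, the latter is in row $r+1$; in the second kind, it is either in row $r$ and (unless $r$ is the top row) directly below a box of $M^+$, or in row $r+1$ and in the same column as before. The new circle must satisfy: in the first kind, its column contains no box of $N^+/M^+$ and every column to its left contains one; in the second kind, $N^\oplus/M^\oplus$ is a horizontal strip whose rightmost cell is the new circle. Boxes of $\Lambda_{(i)}^+/\Lambda_{(i-1)}^+$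 and the new circle of step $i$ get the label $i$, and circles keep their labels when they move. The weight lists the numbers $|\Lambda_{(i)}^+/\Lambda_{(i-1)}^+|$, barred for barred steps. For a tableau $T$ of shape $\Lambda\in\mathrm{sPar}_{n,m}$ let $c_1,\dots,c_m$ be the labels of its circles from top to bottom and $d_1,\dots,d_n$ those of its boxes in reading order. Put $$S_\Lambda=\sum_T\theta_{c_1}\cdots\theta_{c_m}\sum_{\sigma\in\mathfrak S_n}x_{d_{\sigma(1)}}\cdots x_{d_{\sigma(n)}},\qquad s_\Lambda=\sum_{\Omega\in\mathrm{sPar}_{n,m}}K_{\Lambda,\Omega}m_\Omega,\qquad K_{\Lambda,\Omega}=\sum_T(-1)^{\operatorname{inv}(c_1\cdots c_m)},$$ the first sum over all tableaux of the first kind of shape $\Lambda$, the last over those of weight $(\bar\Omega_1,\dots,\bar\Omega_m,\Omega_{m+1},\dots,\Omega_k)$. Define $\bar S_\Lambda$, $\bar s_\Lambda$, $\bar K_{\Lambda,\Omega}$ in the same way with tableaux of the second kind. **Proposition.** For all $\Lambda,\Omega\in\mathrm{sPar}_{n,m}$ the functions $S_\Lambda,\bar S_\Lambda$ lie in $\mathbf{sNCSym}$,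 the functions $s_\Lambda,\bar s_\Lambda$ lie in $\mathbf{sSym}$, and $$\rho(S_\Lambda)=n!\,s_\Lambda,\qquad\tilde\rho(n!\,s_\Lambda)=S_\Lambda,\qquad\langle S_\Lambda,S_\Omega\rangle=(n!)^2\langle s_\Lambda,s_\Omega\rangle,$$ $$\rho(\bar S_\Lambda)=n!\,\bar s_\Lambda,\qquad\tilde\rho(n!\,\bar s_\Lambda)=\bar S_\Lambda,\qquad\langle\bar S_\Lambda,\bar S_\Omega\rangle=(n!)^2\langle\bar s_\Lambda,\bar s_\Omega\rangle.$$ -/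

import Mathlib

open Finset
open scoped Nat

noncomputable section

namespace Superspace

/-! ### Signs

Variables are indexed by `ℕ`: the index `i : ℕ` stands for `x_{i+1}`, `θ_{i+1}`.  In the same way
`[n]` is modelled by `Fin n`, and the `i`-th step of a tableau carries the label `i`. -/

/-- Number of inversions of a word. -/
def inversions (l : List ℕ) : ℕ :=
  ((univ : Finset (Fin l.length × Fin l.length)).filter
    fun p => p.1 < p.2 ∧ l.get p.2 < l.get p.1).card

/-- The coefficient with which `θ_{a_1} ⋯ θ_{a_m}` equals the product of the same variables in
increasing order: `0` if an index is repeated, the sign of the sorting permutation otherwise. -/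
def thetaSign (a : List ℕ) : ℚ := if a.Nodup then (-1) ^ inversions a else 0

/-! ### Noncommuting variables -/

/-- Formal series in noncommuting `x` and anticommuting `θ` (commuting with the `x`).
`f A w` is the coefficient of the normal-ordered monomial
`(∏_{i ∈ A}^{increasing} θ_i) x_{w_1} ⋯ x_{w_n}`. -/
abbrev NC : Type := Finset ℕ → List ℕ → ℚ

/-- The monomial `θ_{a_1} ⋯ θ_{a_m} x_{w_1} ⋯ x_{w_n}`. -/
def NC.mono (a w : List ℕ) : NC := fun A v => if a.toFinset = A ∧ w = v then thetaSign a else 0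

/-- Formal (coefficientwise) sum of a family of series. -/
def NC.formalSum {ι : Type} (u : ι → NC) : NC := fun A w => ∑ᶠ i, u i A w

/-- A permutation of the variables: `x_i ↦ x_{σ i}` and `θ_i ↦ θ_{σ i}` simultaneously. -/
def NC.act (σ : Equiv.Perm ℕ) : NC →ₗ[ℚ] NC where
  toFun f := fun A w =>
    thetaSign (((A.map σ.symm.toEmbedding).sort).map σ) *
      f (A.map σ.symm.toEmbedding) (w.map σ.symm)
  map_add' f g := by funext A w; simp [mul_add]
  map_smul' c f := by funext A w; simp [mul_left_comm]

/-- `sNCSym`: the series of bounded degree that are invariant under all finite permutations of the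
variables. -/
def sNCSym : Submodule ℚ NC where
  carrier := {f | (∃ d, ∀ A w, f A w ≠ 0 → A.card + w.length ≤ d) ∧
    ∀ σ : Equiv.Perm ℕ, {i | σ i ≠ i}.Finite → NC.act σ f = f}
  zero_mem' := ⟨⟨0, fun A w h => absurd rfl h⟩, fun σ _ => map_zero _⟩
  add_mem' := by
    rintro f g ⟨⟨d, hd⟩, hf⟩ ⟨⟨e, he⟩, hg⟩
    refine ⟨⟨max d e, fun A w h => ?_⟩, fun σ hσ => by rw [map_add, hf σ hσ, hg σ hσ]⟩
    by_cases h1 : f A w = 0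
    · have h2 : g A w ≠ 0 := fun h2 => h (by simp [h1, h2])
      exact (he A w h2).trans (le_max_right _ _)
    · exact (hd A w h1).trans (le_max_left _ _)
  smul_mem' := by
    rintro c f ⟨⟨d, hd⟩, hf⟩
    refine ⟨⟨d, fun A w h => hd A w fun h0 => h (by simp [h0])⟩, fun σ hσ => ?_⟩
    rw [map_smul, hf σ hσ]

/-! ### Commuting variables -/

/-- Formal series in commuting `x` and anticommuting `θ`.  `f A α` is the coefficient of
`(∏_{i ∈ A}^{increasing} θ_i) ∏ x_i^{α_i}`. -/
abbrev Comm : Type := Finset ℕ → (ℕ →₀ ℕ) → ℚ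

/-- The monomial `θ_{a_1} ⋯ θ_{a_m} x^α`. -/
def Comm.mono (a : List ℕ) (α : ℕ →₀ ℕ) : Comm :=
  fun A β => if a.toFinset = A ∧ α = β then thetaSign a else 0

/-- Formal (coefficientwise) sum of a family of series. -/
def Comm.formalSum {ι : Type} (u : ι → Comm) : Comm := fun A α => ∑ᶠ i, u i A α

/-- Product of series: `θ_B θ_C = ± θ_{B ∪ C}` for disjoint `B`, `C`, and `0` otherwise. -/
def Comm.mul (f g : Comm) : Comm := fun A α =>
  ∑ B ∈ A.powerset, ∑ p ∈ antidiagonal α,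
    thetaSign (B.sort ++ (A \ B).sort) * (f B p.1 * g (A \ B) p.2)

/-- The projection that makes the `x`-variables commute: the coefficient of `θ_A x^α` is the sum of
the coefficients of all `θ_A x_w` with `w` a rearrangement of `x^α`. -/
def rho : NC →ₗ[ℚ] Comm where
  toFun f := fun A α => ∑ w ∈ (Multiset.lists (Finsupp.toMultiset α)).toFinset, f A w
  map_add' f g := by funext A α; simp [Finset.sum_add_distrib]
  map_smul' c f := by funext A α; simp [Finset.mul_sum]

/-- `sSym`, the image of `sNCSym` under the projection. -/
def sSym : Submodule ℚ Comm := sNCSym.map rho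

/-! ### Superpartitions -/

/-- A superpartition `(Λ_1, …, Λ_m; Λ_{m+1}, …, Λ_k)`: `a` is strictly decreasing (a component `0`
is allowed), `s` is a partition into positive parts. -/
@[ext] structure SPar where
  a : List ℕ
  s : List ℕ
  a_sorted : a.Pairwise (· > ·)
  s_sorted : s.Pairwise (· ≥ ·)
  s_pos : ∀ x ∈ s, 0 < x

namespace SPar

/-- The empty superpartition. -/
def empty : SPar := ⟨[], [], by simp, by simp, by simp⟩

variable (L : SPar)

/-- `(Λ_1, …, Λ_k)`. -/
def parts : List ℕ := L.a ++ L.s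

def deg : ℕ := L.parts.sum

/-- Fermionic degree. -/
def df : ℕ := L.a.length

/-- `Λ! = Λ_1! ⋯ Λ_k!`. -/
def fact : ℕ := (L.parts.map Nat.factorial).prod

/-- Length of row `r` (counted from `0`) of the diagram of `Λ^+ = sort(Λ_1, …, Λ_k)`. -/
def plus (r : ℕ) : ℕ := (L.parts.insertionSort (· ≥ ·)).getD r 0

/-- Length of row `r` of the diagram of
`Λ^⊕ = sort(Λ_1 + 1, …, Λ_m + 1, Λ_{m+1}, …, Λ_k)`. -/
def oplus (r : ℕ) : ℕ := ((L.a.map (· + 1) ++ L.s).insertionSort (· ≥ ·)).getD r 0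

/-- The rows that end with a circle (a box of `Λ^⊕ / Λ^+`), from top to bottom.  The circle of row
`r` sits in column `Λ^+_r` (columns counted from `0`). -/
def circleRows : List ℕ := (List.range L.parts.length).filter fun r => L.oplus r ≠ L.plus r

end SPar

/-! ### Monomial and complete homogeneous functions in commuting variables -/

/-- `m_Λ`: the sum, without repetition, of the terms
`θ_{i_1} ⋯ θ_{i_m} x_{i_1}^{Λ_1} ⋯ x_{i_k}^{Λ_k}` with `i_1, …, i_k` distinct. -/
def monomialComm (L : SPar) : Comm :=
  Comm.formalSum fun u : {u : Comm // ∃ i : List ℕ, i.Nodup ∧ i.length = L.parts.length ∧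
    u = Comm.mono (i.take L.df) (List.zipWith Finsupp.single i L.parts).sum} => u.1

/-- `h_r = ∑_{|Λ| = r, df Λ = 0} m_Λ`. -/
def hBos (r : ℕ) : Comm := ∑ᶠ (L : SPar) (_ : L.deg = r ∧ L.df = 0), monomialComm L

/-- `h̃_k = ∑_{|Λ| = k, df Λ = 1} (Λ_1 + 1) m_Λ`. -/
def hFer (k : ℕ) : Comm :=
  ∑ᶠ (L : SPar) (_ : L.deg = k ∧ L.df = 1), ((L.parts.headD 0 : ℚ) + 1) • monomialComm L

/-- `h_Λ = h̃_{Λ_1} ⋯ h̃_{Λ_m} h_{Λ_{m+1}} ⋯ h_{Λ_k}`. -/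
def completeComm (L : SPar) : Comm :=
  (L.a.map hFer ++ L.s.map hBos).foldr Comm.mul (Comm.mono [] 0)

/-! ### Set superpartitions -/

/-- A set superpartition `I = (I_1, …, I_m, I_{m+1}, …, I_k)` of bidegree `(n, m)`, given by its
standardization: the equivalence relation on `m` zeros (`Sum.inl i` is the zero of the `i`-th
fermionic block `I_i`) and the elements of `[n]` (`Sum.inr j`) whose classes are the blocks.  Zeros
lie in different blocks; the nonfermionic blocks are unordered, their order being forced; and the
fermionic blocks are ordered by `min (I_i \ I_j) < min (I_j \ I_i)`, where `min ∅ = 0`, so that at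
most one of them is `{0}`. -/
structure SetSPar where
  n : ℕ
  m : ℕ
  rel : Setoid (Fin m ⊕ Fin n)
  sep : ∀ i j : Fin m, rel (Sum.inl i) (Sum.inl j) → i = j
  sorted : ∀ i j : Fin m, i < j →
    sInf ((fun l : Fin n => (l : ℕ) + 1) '' {l | rel (Sum.inl i) (Sum.inr l)}) <
      sInf ((fun l : Fin n => (l : ℕ) + 1) '' {l | rel (Sum.inl j) (Sum.inr l)})

namespace SetSPar

variable (I : SetSPar)

open Classical in
/-- `|I_i| - 1` for a fermionic block. -/
def ferSize (i : Fin I.m) : ℕ :=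
  ((univ : Finset (Fin I.n)).filter fun l => I.rel (Sum.inl i) (Sum.inr l)).card

open Classical in
/-- The nonfermionic blocks. -/
def bosBlocks : Finset (Finset (Fin I.n)) :=
  ((univ : Finset (Fin I.n)).filter fun j => ∀ i, ¬ I.rel (Sum.inl i) (Sum.inr j)).image
    fun j => univ.filter fun l => I.rel (Sum.inr j) (Sum.inr l)

/-- `Λ(I) = Λ`: the numbers `|I_i| - 1`, `i ≤ m`, are distinct and sort to `Λ^a`, and the sizes of
the nonfermionic blocks sort to `Λ^s`. -/
def HasType (L : SPar) : Prop :=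
  (List.ofFn I.ferSize).Perm L.a ∧ I.bosBlocks.val.map Finset.card = (L.s : Multiset ℕ)

/-- `ε(I)`: the number of transpositions of neighbours needed to sort `(|I_1| - 1, …, |I_m| - 1)`
decreasingly. -/
def eps : ℕ :=
  ((univ : Finset (Fin I.m × Fin I.m)).filter
    fun p => p.1 < p.2 ∧ I.ferSize p.1 < I.ferSize p.2).card

/-- The monomial function `m_I`: the sum of `θ_{a_1} ⋯ θ_{a_m} x_{b_1} ⋯ x_{b_n}` over all
`(a, b)` with `a_i = b_j` iff `j ∈ I_i`, and `b_i = b_j` iff `i`, `j` lie in the same block. -/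
def monomial : NC :=
  NC.formalSum fun p : {p : (Fin I.m → ℕ) × (Fin I.n → ℕ) //
      (∀ i j, p.1 i = p.2 j ↔ I.rel (Sum.inl i) (Sum.inr j)) ∧
      (∀ i j, p.2 i = p.2 j ↔ I.rel (Sum.inr i) (Sum.inr j))} =>
    NC.mono (List.ofFn p.1.1) (List.ofFn p.1.2)

open Classical in
/-- Product of the factorials of the sizes of the classes of an equivalence relation. -/
def blockFact {m n : ℕ} (r : Setoid (Fin m ⊕ Fin n)) : ℕ :=
  ∏ C ∈ (univ : Finset (Fin m ⊕ Fin n)).image (fun x => univ.filter fun y => r x y), (C.card)!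

/-- The complete homogeneous function `h_I = ∑_u c_u u`, over the monomials
`u = θ_{a_1} ⋯ θ_{a_m} x_{b_1} ⋯ x_{b_n}` for which `{a_i} \ {b_j}` has at most one element, with
`c_u = (I ⊓ L)!`.  Here `L` is the partial set supercomposition with `u ∈ M(L)`: positions are in the
same block when their variables have the same index. The coarsening order on standardizations is the
order of equivalence relations, with meet `⊓`. -/
def complete : NC :=
  NC.formalSum fun p : {p : (Fin I.m → ℕ) × (Fin I.n → ℕ) //
      Function.Injective p.1 ∧ (Set.range p.1 \ Set.range p.2).Subsingleton} =>
    (blockFact (I.rel ⊓ Setoid.ker (Sum.elim p.1.1 p.1.2)) : ℚ) •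
      NC.mono (List.ofFn p.1.1) (List.ofFn p.1.2)

end SetSPar

/-! ### Bilinear forms and lifting map -/

open Classical in
/-- `B` is the form with `⟨m_I, h_J⟩ = (-1)^(m choose 2) n! δ_{I,J}` (and all
`m_I`, `h_J` are in `sNCSym`), with `(n, m)` the bidegree of `I`. -/
def IsInnerNC (B : LinearMap.BilinForm ℚ sNCSym) : Prop :=
  ∀ I J : SetSPar, ∃ f g : sNCSym, (f : NC) = I.monomial ∧ (g : NC) = J.complete ∧
    B f g = if I = J then (-1) ^ (I.m.choose 2) * (I.n ! : ℚ) else 0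

open Classical in
/-- `B` is the form with `⟨m_Λ, h_Ω⟩ = (-1)^(m choose 2) δ_{Λ,Ω}` (and all
`m_Λ`, `h_Ω` are in `sSym`), with `m = df Λ`. -/
def IsInnerComm (B : LinearMap.BilinForm ℚ sSym) : Prop :=
  ∀ L O : SPar, ∃ f g : sSym, (f : Comm) = monomialComm L ∧ (g : Comm) = completeComm O ∧
    B f g = if L = O then (-1) ^ (L.df.choose 2) else 0

/-- The lifting map: `m_Λ ↦ (Λ! / n!) ∑_{Λ(I) = Λ} (-1)^ε(I) m_I`. -/
def IsLift (R : sSym →ₗ[ℚ] sNCSym) : Prop :=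
  ∀ L : SPar, ∃ f : sSym, (f : Comm) = monomialComm L ∧
    (R f : NC) = ((L.fact : ℚ) / (L.deg ! : ℚ)) •
      ∑ᶠ (I : SetSPar) (_ : I.HasType L), ((-1 : ℚ) ^ I.eps) • I.monomial

/-! ### Super semistandard Young tableaux -/

/-- The two kinds of tableaux, of Kostka numbers and of Schur functions. -/
inductive Kind
  | first
  | second

/-- `ν / μ` is a horizontal strip, for diagrams with row lengths `μ r`, `ν r`. -/
def HStrip (μ ν : ℕ → ℕ) : Prop := ∀ r, μ r ≤ ν r ∧ ν (r + 1) ≤ μ r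

/-- How a circle in row `r` of `M` may move when `M^+` grows to `N^+`; `t` is its new row.

If row `r` of `N^+ / M^+` is empty, the circle stays in row `r`.  If it is nonempty:
* first kind: the circle moves to row `r + 1`;
* second kind: the circle either remains in row `r`, with a box of `M^+` directly above it unless
  `r` is the top row, or it moves to row `r + 1`, remaining in its column. -/
def CircleMove (κ : Kind) (M N : SPar) (r t : ℕ) : Prop :=
  if N.plus r = M.plus r then t = r
  else match κ with
    | .first => t = r + 1
    | .second => (t = r ∧ ∀ q, q + 1 = r → N.plus r < M.plus q) ∨
        (t = r + 1 ∧ N.plus t = M.plus r)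

/-- The condition that distinguishes the new circle, in row `t` of `N`, of a barred step.
* First kind: the column `c` of the new circle has no box of `N^+ / M^+`, every column to the left
  of it has one.
* Second kind: `N^⊕ / M^⊕` is a horizontal strip, and the new circle is its rightmost box. -/
def IsNewCircle (κ : Kind) (M N : SPar) (t : ℕ) : Prop :=
  match κ with
  | .first => (¬ ∃ r, M.plus r ≤ N.plus t ∧ N.plus t < N.plus r) ∧
      ∀ c < N.plus t, ∃ r, M.plus r ≤ c ∧ c < N.plus r
  | .second => HStrip M.oplus N.oplus ∧ M.oplus t ≤ N.plus t ∧
      ∀ r c, M.oplus r ≤ c → c < N.oplus r → c ≤ N.plus t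

/-- The step with label `i` of a tableau, from `M` to `N`.  The lists `lab`, `lab'` are the labels of
the circles of `M`, `N` from top to bottom.  In an unbarred step the `j`-th circle of `M` becomes the
`j`-th circle of `N`.  In a barred step this holds after removal of one new circle (the `k`-th, in
row `t`) from `N`, and this circle gets the label `i`. -/
def Step (κ : Kind) (i : ℕ) (M : SPar) (lab : List ℕ) (N : SPar) (lab' : List ℕ) : Prop :=
  HStrip M.plus N.plus ∧
    ((List.Forall₂ (CircleMove κ M N) M.circleRows N.circleRows ∧ lab' = lab) ∨
      ∃ k t, N.circleRows[k]? = some t ∧ IsNewCircle κ M N t ∧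
        List.Forall₂ (CircleMove κ M N) M.circleRows (N.circleRows.eraseIdx k) ∧
        lab' = lab.insertIdx k i)

/-- A super semistandard Young tableau of shape `Λ` as a filling: `shape i` is the superpartition
formed by the boxes and circles with labels `< i`.  Labels that are not used correspond to trivial
steps, and `circ` lists the labels of the circles of `Λ` from top to bottom.  All data are determined
by `shape`. -/
structure Tableau (κ : Kind) (L : SPar) where
  shape : ℕ → SPar
  lab : ℕ → List ℕ
  circ : List ℕ
  shape_zero : shape 0 = SPar.empty
  lab_zero : lab 0 = []
  step : ∀ i, Step κ i (shape i) (lab i) (shape (i + 1)) (lab (i + 1))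
  eventually : ∃ N, ∀ i, N ≤ i → shape i = L ∧ lab i = circ

namespace Tableau

variable {κ : Kind} {L : SPar} (T : Tableau κ L)

/-- The labels of the boxes, row by row. -/
def boxWord : List ℕ :=
  (List.range L.parts.length).flatMap fun r =>
    (List.range (L.plus r)).map fun c => sInf {i | c < (T.shape (i + 1)).plus r}

/-- `θ_{c(T^a_1)} ⋯ θ_{c(T^a_m)} ∑_σ x_{c(T^s_{σ(1)})} ⋯ x_{c(T^s_{σ(n)})}`. -/
def term : NC :=
  ∑ σ : Equiv.Perm (Fin T.boxWord.length),
    NC.mono T.circ (List.ofFn fun j => T.boxWord.get (σ j))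

/-- `T` has weight `(Ω̄_1, …, Ω̄_m, Ω_{m+1}, …, Ω_k)`. -/
def HasWeight (O : SPar) : Prop :=
  ∀ i, (T.shape (i + 1)).deg = (T.shape i).deg + O.parts.getD i 0 ∧
    (T.shape (i + 1)).df = (T.shape i).df + if i < O.df then 1 else 0

end Tableau

/-- `S_Λ` (first kind) and `S̄_Λ` (second kind) in noncommuting variables. -/
def schurNC (κ : Kind) (L : SPar) : NC := NC.formalSum fun T : Tableau κ L => T.term

/-- `K_{Λ,Ω}` (first kind) and `K̄_{Λ,Ω}` (second kind). -/
def kostka (κ : Kind) (L O : SPar) : ℤ :=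
  ∑ᶠ (T : Tableau κ L) (_ : T.HasWeight O), (-1) ^ inversions T.circ

/-- `s_Λ` (first kind) and `s̄_Λ` (second kind): `∑_Ω K_{Λ,Ω} m_Ω`. -/
def schurComm (κ : Kind) (L : SPar) : Comm :=
  ∑ᶠ (O : SPar) (_ : O.deg = L.deg ∧ O.df = L.df), (kostka κ L O : ℚ) • monomialComm O

end Superspace

end

open Finset
open scoped Nat

noncomputable section

namespace Superspace

/-! ### Boxes of compositions and links between neighbouring coordinates -/

/-- The links of `p` in the box `[0, d]`: the `r` for which a unit can be moved from coordinate `r`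
to coordinate `r + 1`. -/
def links (d p : ℕ →₀ ℕ) : Finset ℕ := d.support.filter fun r => 0 < p r ∧ p (r + 1) < d (r + 1)

lemma mem_links {d p : ℕ →₀ ℕ} (hp : p ≤ d) {r : ℕ} :
    r ∈ links d p ↔ 0 < p r ∧ p (r + 1) < d (r + 1) := by
  have := hp r
  simp only [links, mem_filter, Finsupp.mem_support_iff]
  constructor
  · exact fun h => h.2
  · exact fun h => ⟨by omega, h⟩

/-- Indicator of a set of links, at the lower end. -/
def lowInd (S : Finset ℕ) : ℕ →₀ ℕ := Finsupp.indicator S fun _ _ => 1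

/-- Indicator of a set of links, at the upper end. -/
def highInd (S : Finset ℕ) : ℕ →₀ ℕ := (lowInd S).mapDomain Nat.succ

lemma lowInd_apply (S : Finset ℕ) (r : ℕ) : lowInd S r = if r ∈ S then 1 else 0 := by
  simp [lowInd, Finsupp.indicator_apply]

lemma highInd_zero (S : Finset ℕ) : highInd S 0 = 0 := by
  rw [highInd, Finsupp.mapDomain_of_notMem_range]; simp

lemma highInd_succ (S : Finset ℕ) (r : ℕ) : highInd S (r + 1) = if r ∈ S then 1 else 0 := by
  rw [highInd, ← Nat.succ_eq_add_one, Finsupp.mapDomain_apply Nat.succ_injective, lowInd_apply]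

lemma degree_highInd (S : Finset ℕ) : (highInd S).degree = (lowInd S).degree := by
  rw [highInd, Finsupp.degree_mapDomain]

lemma subset_links_iff {d p : ℕ →₀ ℕ} (S : Finset ℕ) :
    (p ≤ d ∧ S ⊆ links d p) ↔ lowInd S ≤ p ∧ p + highInd S ≤ d := by
  constructor
  · rintro ⟨hp, hS⟩
    constructor
    · intro r
      rw [lowInd_apply]
      split_ifs with h
      · exact ((mem_links hp).1 (hS h)).1
      · exact Nat.zero_le _
    · intro r
      rw [Finsupp.add_apply]
      rcases r with _ | r
      · simpa [highInd_zero] using hp 0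
      · rw [highInd_succ]
        split_ifs with h
        · exact ((mem_links hp).1 (hS h)).2
        · exact hp _
  · rintro ⟨h1, h2⟩
    have hp : p ≤ d := le_trans (le_add_of_nonneg_right (zero_le)) h2
    refine ⟨hp, fun r hr => (mem_links hp).2 ⟨?_, ?_⟩⟩
    · have := h1 r
      rw [lowInd_apply, if_pos hr] at this
      omega
    · have := h2 (r + 1)
      rw [Finsupp.add_apply, highInd_succ, if_pos hr] at this
      omega

lemma degree_mono {p d : ℕ →₀ ℕ} (h : p ≤ d) : p.degree ≤ d.degree := by
  obtain ⟨q, rfl⟩ := exists_add_of_le h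
  simp

lemma card_subset_links (d : ℕ →₀ ℕ) (S : Finset ℕ) (k : ℕ) :
    ((Iic d).filter fun p => S ⊆ links d p ∧ p.degree = k).card =
      ((Iic d).filter fun p => S ⊆ links d p ∧ d.degree - p.degree = k).card := by
  have key : ∀ p, lowInd S ≤ p → p + highInd S ≤ d →
      ∃ q, q + (p + highInd S) = lowInd S + d := by
    intro p h1 h2
    obtain ⟨q, hq⟩ := exists_add_of_le h2
    exact ⟨lowInd S + q, by rw [hq]; abel⟩
  have key2 : ∀ p, lowInd S ≤ p → p + highInd S ≤ d → ∀ q, q + (p + highInd S) = lowInd S + d →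
      lowInd S ≤ q ∧ q + highInd S ≤ d ∧ q.degree + p.degree = d.degree := by
    intro p h1 h2 q hq
    refine ⟨fun r => ?_, fun r => ?_, ?_⟩
    · have a := h2 r; have b := DFunLike.congr_fun hq r
      simp only [Finsupp.add_apply] at a b
      omega
    · have a := h1 r; have b := DFunLike.congr_fun hq r
      simp only [Finsupp.add_apply] at b ⊢
      omega
    · have := congrArg Finsupp.degree hq
      simp only [map_add, degree_highInd] at this
      omega
  refine Finset.card_nbij' (fun p => lowInd S + d - (p + highInd S))
    (fun p => lowInd S + d - (p + highInd S)) ?_ ?_ ?_ ?_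
  · intro p hp
    simp only [coe_filter, mem_Iic, Set.mem_ofPred_eq] at hp ⊢
    obtain ⟨h1, h2⟩ := (subset_links_iff S).1 ⟨hp.1, hp.2.1⟩
    obtain ⟨q, hq⟩ := key p h1 h2
    obtain ⟨h3, h4, h5⟩ := key2 p h1 h2 q hq
    obtain ⟨h6, h7⟩ := (subset_links_iff S).2 ⟨h3, h4⟩
    rw [← hq, add_tsub_cancel_right]
    exact ⟨h6, h7, by omega⟩
  · intro p hp
    simp only [coe_filter, mem_Iic, Set.mem_ofPred_eq] at hp ⊢
    obtain ⟨h1, h2⟩ := (subset_links_iff S).1 ⟨hp.1, hp.2.1⟩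
    obtain ⟨q, hq⟩ := key p h1 h2
    obtain ⟨h3, h4, h5⟩ := key2 p h1 h2 q hq
    obtain ⟨h6, h7⟩ := (subset_links_iff S).2 ⟨h3, h4⟩
    rw [← hq, add_tsub_cancel_right]
    exact ⟨h6, h7, by omega⟩
  all_goals
    intro p hp
    simp only [coe_filter, mem_Iic, Set.mem_ofPred_eq] at hp
    obtain ⟨h1, h2⟩ := (subset_links_iff S).1 ⟨hp.1, hp.2.1⟩
    obtain ⟨q, hq⟩ := key p h1 h2
    dsimp only
    rw [← hq, add_tsub_cancel_right, hq, tsub_eq_iff_eq_add_of_le, ← hq]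
    · abel
    · rw [← hq, ← add_assoc, add_comm, add_comm q p, add_assoc, add_comm q, ]
      exact le_add_of_nonneg_left (zero_le)

lemma links_subset (d p : ℕ →₀ ℕ) : links d p ⊆ d.support := filter_subset _ _

lemma card_eq_links (d : ℕ →₀ ℕ) (k : ℕ) (S : Finset ℕ) :
    ((Iic d).filter fun p => links d p = S ∧ p.degree = k).card =
      ((Iic d).filter fun p => links d p = S ∧ d.degree - p.degree = k).card := by
  have expand : ∀ (S : Finset ℕ) (g : (ℕ →₀ ℕ) → ℕ),
      ((Iic d).filter fun p => S ⊆ links d p ∧ g p = k).card =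
        ∑ T ∈ d.support.powerset.filter (S ⊆ ·),
          ((Iic d).filter fun p => links d p = T ∧ g p = k).card := by
    intro S g
    rw [Finset.card_eq_sum_card_fiberwise (f := fun p => links d p)
      (t := d.support.powerset.filter (S ⊆ ·))]
    · refine sum_congr rfl fun T hT => ?_
      congr 1
      ext p
      simp only [mem_filter, mem_Iic, mem_powerset] at hT ⊢
      constructor
      · rintro ⟨⟨a, b, c⟩, rfl⟩; exact ⟨a, rfl, c⟩
      · rintro ⟨a, rfl, c⟩; exact ⟨⟨a, hT.2, c⟩, rfl⟩
    · intro p hp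
      simp only [coe_filter, mem_Iic, mem_powerset, Set.mem_ofPred_eq] at hp ⊢
      exact ⟨links_subset d p, hp.2.1⟩
  induction h : (d.support \ S).card using Nat.strong_induction_on generalizing S with
  | _ n ih =>
    by_cases hS : S ⊆ d.support
    · have h1 := card_subset_links d S k
      rw [expand S (fun p => p.degree), expand S (fun p => d.degree - p.degree)] at h1
      have hmem : S ∈ d.support.powerset.filter (S ⊆ ·) := by simp [hS]
      rw [← add_sum_erase _ _ hmem, ← add_sum_erase _ _ hmem] at h1
      have h2 : ∀ T ∈ (d.support.powerset.filter (S ⊆ ·)).erase S,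
          ((Iic d).filter fun p => links d p = T ∧ p.degree = k).card =
          ((Iic d).filter fun p => links d p = T ∧ d.degree - p.degree = k).card := by
        intro T hT
        simp only [mem_erase, mem_filter, mem_powerset] at hT
        refine ih _ ?_ T rfl
        rw [← h]
        apply card_lt_card
        rw [ssubset_iff_subset_ne]
        refine ⟨sdiff_subset_sdiff subset_rfl hT.2.2, fun h3 => hT.1 ?_⟩
        have := congrArg (d.support \ ·) h3
        simp only [Finset.sdiff_sdiff_eq_self hT.2.1, Finset.sdiff_sdiff_eq_self hS] at this
        exact this
      rw [sum_congr rfl h2] at h1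
      omega
    · rw [filter_false_of_mem, filter_false_of_mem]
      · rintro p - ⟨rfl, -⟩; exact hS (links_subset d p)
      · rintro p - ⟨rfl, -⟩; exact hS (links_subset d p)

variable {W : Type*} [AddCommGroup W]

/-- Sums over a box of a function of the size and of the links are invariant under reversal of the
size. -/
theorem sum_box_reverse (d : ℕ →₀ ℕ) (Ψ : ℕ → Finset ℕ → W) :
    ∑ p ∈ Iic d, Ψ p.degree (links d p) = ∑ p ∈ Iic d, Ψ (d.degree - p.degree) (links d p) := by
  have expand : ∀ g : (ℕ →₀ ℕ) → ℕ, (∀ p, p ≤ d → g p ≤ d.degree) →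
      ∑ p ∈ Iic d, Ψ (g p) (links d p) = ∑ x ∈ range (d.degree + 1) ×ˢ d.support.powerset,
        ((Iic d).filter fun p => links d p = x.2 ∧ g p = x.1).card • Ψ x.1 x.2 := by
    intro g hg
    rw [← sum_fiberwise_of_maps_to (s := Iic d) (g := fun p => (g p, links d p))
      (t := range (d.degree + 1) ×ˢ d.support.powerset)]
    · refine sum_congr rfl fun x _ => ?_
      rw [← sum_const]
      refine sum_congr (by ext p; simp [Prod.ext_iff, and_comm]) fun p hp => ?_
      simp only [mem_filter] at hp
      rw [hp.2.1, hp.2.2]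
    · intro p hp
      simp only [mem_product, mem_range, mem_powerset]
      exact ⟨by have := hg p (mem_Iic.1 hp); omega, links_subset d p⟩
  rw [expand (fun p => p.degree) fun p hp => degree_mono hp,
    expand (fun p => d.degree - p.degree) fun p _ => Nat.sub_le _ _]
  exact sum_congr rfl fun x _ => by rw [card_eq_links]

/-- `S` and `S'` differ at most in links between `R` and its complement. -/
def AgreeOff (R : Set ℕ) (S S' : Finset ℕ) : Prop :=
  ∀ r, (r ∈ R ↔ r + 1 ∈ R) → (r ∈ S ↔ r ∈ S')

open Classical in
/-- Variant of `sum_box_reverse` for the faces of the box where the coordinates in a region `R` are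
minimal, respectively maximal. -/
theorem sum_face_reverse (d : ℕ →₀ ℕ) (R : Set ℕ) (Ψ : ℕ → Finset ℕ → W)
    (hΨ : ∀ k S S', AgreeOff R S S' → Ψ k S = Ψ k S') :
    ∑ p ∈ Iic d with ∀ i ∈ R, p i = 0, Ψ p.degree (links d p) =
      ∑ p ∈ Iic d with ∀ i ∈ R, p i = d i, Ψ (d.degree - p.degree) (links d p) := by
  set d' := d.filter (· ∉ R)
  set dR := d.filter (· ∈ R)
  have hd : dR + d' = d := Finsupp.filter_add_filter_not _ _
  have hd'0 : ∀ i ∈ R, d' i = 0 := fun i hi => by simp [d', hi]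
  have hd'1 : ∀ i ∉ R, d' i = d i := fun i hi => by simp [d', hi]
  have hR0 : ∀ i ∉ R, dR i = 0 := fun i hi => by simp [dR, hi]
  have hR1 : ∀ i ∈ R, dR i = d i := fun i hi => by simp [dR, hi]
  have hle : d' ≤ d := by rw [← hd]; exact le_add_of_nonneg_left zero_le
  have h1 : ((Iic d).filter fun p => ∀ i ∈ R, p i = 0) = Iic d' := by
    ext p
    simp only [mem_filter, mem_Iic]
    constructor
    · rintro ⟨h, h2⟩ i
      by_cases hi : i ∈ R
      · rw [h2 i hi]; exact Nat.zero_le _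
      · rw [hd'1 i hi]; exact h i
    · intro h
      exact ⟨h.trans hle, fun i hi => Nat.le_zero.1 ((h i).trans (hd'0 i hi).le)⟩
  rw [h1]
  have h2 : ∑ p ∈ Iic d, (if ∀ i ∈ R, p i = d i then Ψ (d.degree - p.degree) (links d p) else 0) =
      ∑ p ∈ Iic d', Ψ (d.degree - (dR + p).degree) (links d (dR + p)) := by
    rw [← sum_filter]
    refine sum_nbij' (fun p => p.filter (· ∉ R)) (fun p => dR + p) ?_ ?_ ?_ ?_ ?_
    · intro p hp
      simp only [mem_filter, mem_Iic] at hp ⊢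
      intro i
      by_cases hi : i ∈ R
      · simp [hi]
      · simpa [hi, hd'1] using hp.1 i
    · intro p hp
      simp only [mem_filter, mem_Iic] at hp ⊢
      refine ⟨by rw [← hd]; exact add_le_add_right hp _, fun i hi => ?_⟩
      have := hp i
      rw [hd'0 i hi] at this
      simp [hR1 i hi]; omega
    · intro p hp
      simp only [mem_filter, mem_Iic] at hp ⊢
      ext i
      by_cases hi : i ∈ R
      · simp [hi, hR1, hp.2 i hi]
      · simp [hi, hR0]
    · intro p hp
      simp only [mem_Iic] at hp
      ext i
      by_cases hi : i ∈ R
      · have := hp i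
        rw [hd'0 i hi] at this
        simp [hi]; omega
      · simp [hi, hR0]
    · intro p hp
      simp only [mem_filter, mem_Iic] at hp
      have : dR + p.filter (· ∉ R) = p := by
        ext i
        by_cases hi : i ∈ R
        · simp [hi, hR1, hp.2 i hi]
        · simp [hi, hR0]
      rw [this]
  rw [sum_filter, h2]
  have h3 := sum_box_reverse d' Ψ
  have hdeg : d.degree = dR.degree + d'.degree := by rw [← hd, map_add]
  calc _ = ∑ p ∈ Iic d', Ψ p.degree (links d' p) := by
        refine sum_congr rfl fun p hp => hΨ _ _ _ fun r hr => ?_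
        rw [mem_Iic] at hp
        rw [mem_links (hp.trans hle), mem_links hp]
        by_cases hi : r ∈ R
        · have := hp r
          rw [hd'0 r hi] at this
          have h0 : p r = 0 := by omega
          simp [h0]
        · rw [hd'1 (r + 1) fun h => hi (hr.2 h)]
    _ = _ := h3
    _ = _ := by
        refine sum_congr rfl fun p hp => ?_
        rw [mem_Iic] at hp
        have hp2 : dR + p ≤ d := by rw [← hd]; exact add_le_add_right hp _
        have e : d.degree - (dR + p).degree = d'.degree - p.degree := by
          rw [hdeg, map_add]; omega
        rw [e]
        refine hΨ _ _ _ fun r hr => ?_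
        rw [mem_links hp2, mem_links hp]
        by_cases hi : r ∈ R
        · have a := hp r
          have b := hR1 (r + 1) (hr.1 hi)
          rw [hd'0 r hi] at a
          simp only [Finsupp.add_apply]
          omega
        · have a := hd'1 (r + 1) fun h => hi (hr.2 h)
          have b := hR0 (r + 1) fun h => hi (hr.2 h)
          have c := hR0 r hi
          simp only [Finsupp.add_apply]
          omega

/-! ### Vectors attached to faces of a box, and their products -/

/-- The space spanned by the rows. -/
abbrev RowSpace : Type := ℕ →₀ ℚ

abbrev Wedge : Type := ExteriorAlgebra ℚ RowSpace

/-- The basis vector of row `r`. -/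
abbrev rowVec (r : ℕ) : RowSpace := Finsupp.single r 1

/-- The embedding of vectors in the exterior algebra. -/
abbrev rowι : RowSpace →ₗ[ℚ] Wedge := ExteriorAlgebra.ι ℚ

lemma rowι_mul_swap (x y : RowSpace) : rowι x * rowι y = -(rowι y * rowι x) :=
  eq_neg_of_add_eq_zero_left (ExteriorAlgebra.ι_add_mul_swap x y)

lemma rowι_mul_self (x : RowSpace) : rowι x * rowι x = 0 := ExteriorAlgebra.ι_sq_zero x

lemma map_mul_rowι_congr {f g : RowSpace →ₗ[ℚ] RowSpace} {w : RowSpace}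
    (h : ∀ r, ∃ c : ℚ, f (rowVec r) = g (rowVec r) + c • w) (ω : Wedge) :
    ExteriorAlgebra.map f ω * rowι w = ExteriorAlgebra.map g ω * rowι w := by
  have h' : ∀ x, ∃ c : ℚ, f x = g x + c • w := by
    intro x
    induction x using Finsupp.induction_linear with
    | zero => exact ⟨0, by simp⟩
    | add x y hx hy =>
      obtain ⟨a, ha⟩ := hx
      obtain ⟨b, hb⟩ := hy
      exact ⟨a + b, by rw [map_add, map_add, ha, hb, add_smul]; abel⟩
    | single r b =>
      obtain ⟨c, hc⟩ := h r
      refine ⟨b * c, ?_⟩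
      have : Finsupp.single r b = b • rowVec r := by simp [rowVec]
      rw [this, map_smul, map_smul, hc, smul_add, smul_smul]
  induction ω using CliffordAlgebra.right_induction with
  | algebraMap r =>
    rw [show algebraMap ℚ (CliffordAlgebra (0 : QuadraticForm ℚ RowSpace)) r =
      algebraMap ℚ Wedge r from rfl, AlgHom.commutes, AlgHom.commutes]
  | add x y hx hy => rw [map_add, map_add, add_mul, add_mul, hx, hy]
  | mul_ι x ω hx =>
    obtain ⟨c, hc⟩ := h' x
    have e : (CliffordAlgebra.ι (0 : QuadraticForm ℚ RowSpace)) x = rowι x := rfl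
    rw [e, map_mul, map_mul, ExteriorAlgebra.map_apply_ι, ExteriorAlgebra.map_apply_ι, hc,
      mul_assoc, mul_assoc, map_add, map_smul, add_mul, smul_mul_assoc]
    change _ * (_ + c • (rowι w * rowι w)) = _
    rw [rowι_mul_self, smul_zero, add_zero]
    change _ * (rowι (g x) * rowι w) = _ * (rowι (g x) * rowι w)
    rw [rowι_mul_swap (g x), mul_neg, mul_neg, ← mul_assoc, ← mul_assoc, hx]

section Face

variable (d : ℕ →₀ ℕ) (J : Finset ℕ) (R : ℕ → Set ℕ) (w : ℕ → RowSpace) (w0 : RowSpace)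
  (Q : Finset ℕ → Wedge)

open Classical in
/-- The sum of the vectors `w j` for which `p` is minimal on the region `R j`. -/
def lowVec (p : ℕ →₀ ℕ) : RowSpace := w0 + ∑ j ∈ J, if ∀ i ∈ R j, p i = 0 then w j else 0

open Classical in
/-- The sum of the vectors `w j` for which `p` is maximal on the region `R j`. -/
def highVec (p : ℕ →₀ ℕ) : RowSpace := w0 + ∑ j ∈ J, if ∀ i ∈ R j, p i = d i then w j else 0

variable {d J R w w0 Q} (hQ : ∀ j ∈ J, ∀ S S', AgreeOff (R j) S S' → Q S * rowι (w j) = Q S' * rowι (w j))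

include hQ in
open Classical in
lemma sum_face_vec (c : ℕ → ℚ) {j : ℕ} (hj : j ∈ J) (z : Wedge) :
    ∑ p ∈ Iic d, c p.degree • (Q (links d p) *
        rowι (if ∀ i ∈ R j, p i = 0 then w j else 0) * z) =
      ∑ p ∈ Iic d, c (d.degree - p.degree) • (Q (links d p) *
        rowι (if ∀ i ∈ R j, p i = d i then w j else 0) * z) := by
  have := sum_face_reverse d (R j) (fun k S => c k • (Q S * rowι (w j) * z))
    (fun k S S' h => by simp only [hQ j hj S S' h])
  rw [sum_filter, sum_filter] at this
  convert this using 2 with p hp p hp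
  · split_ifs <;> simp
  · split_ifs <;> simp

include hQ in
theorem sum_low_eq_high (c : ℕ → ℚ) (z : Wedge) :
    ∑ p ∈ Iic d, c p.degree • (Q (links d p) * rowι (lowVec J R w w0 p) * z) =
      ∑ p ∈ Iic d, c (d.degree - p.degree) • (Q (links d p) * rowι (highVec d J R w w0 p) * z) := by
  simp only [lowVec, highVec, map_add, map_sum, mul_add, mul_sum, add_mul, sum_mul, smul_add,
    smul_sum, sum_add_distrib]
  congr 1
  · exact sum_box_reverse d fun k S => c k • (Q S * rowι w0 * z)
  · rw [sum_comm, sum_comm (s := Iic d)]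
    exact sum_congr rfl fun j hj => sum_face_vec hQ c hj z

include hQ in
theorem sum_low_mul_high (hR : ∀ i ∈ J, ∀ j ∈ J, R i ⊆ R j ∨ R j ⊆ R i) (c : ℕ → ℚ)
    (hc : ∀ k ≤ d.degree, c (d.degree - (d.degree - k)) = c k) :
    ∑ p ∈ Iic d, c p.degree • (Q (links d p) * rowι (lowVec J R w w0 p) *
        rowι (highVec d J R w w0 p)) =
      -∑ p ∈ Iic d, c (d.degree - p.degree) • (Q (links d p) * rowι (lowVec J R w w0 p) *
        rowι (highVec d J R w w0 p)) := by
  classical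
  set cc : ℕ → ℚ := fun k => c (d.degree - k) with hcc
  have hcc' : ∀ p ∈ Iic d, cc (d.degree - p.degree) = c p.degree := fun p hp =>
    hc _ (degree_mono (mem_Iic.1 hp))
  set lo : ℕ → (ℕ →₀ ℕ) → RowSpace := fun j p => if ∀ i ∈ R j, p i = 0 then w j else 0 with hlo
  set hi : ℕ → (ℕ →₀ ℕ) → RowSpace := fun j p => if ∀ i ∈ R j, p i = d i then w j else 0 with hhi
  -- the mixed terms
  have mix : ∀ b : ℕ → ℚ, ∀ i ∈ J, ∀ j ∈ J, R j ⊆ R i →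
      ∑ p ∈ Iic d, b p.degree • (Q (links d p) * rowι (lo i p) * rowι (hi j p)) =
      -∑ p ∈ Iic d, b (d.degree - p.degree) • (Q (links d p) * rowι (lo j p) * rowι (hi i p)) := by
    intro b i hiJ j hj hsub
    by_cases hd : ∀ k ∈ R j, d k = 0
    · have h1 : ∀ p ∈ Iic d, hi j p = w j := by
        intro p hp
        simp only [hhi]
        rw [if_pos]
        intro k hk
        have := mem_Iic.1 hp k
        rw [hd k hk] at this ⊢
        omega
      have h2 : ∀ p ∈ Iic d, lo j p = w j := by
        intro p hp
        simp only [hlo]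
        rw [if_pos]
        intro k hk
        have := mem_Iic.1 hp k
        rw [hd k hk] at this
        omega
      rw [← sum_neg_distrib]
      calc _ = ∑ p ∈ Iic d, b p.degree • (Q (links d p) * rowι (lo i p) * rowι (w j)) :=
            sum_congr rfl fun p hp => by rw [h1 p hp]
        _ = _ := sum_face_vec hQ b hiJ (rowι (w j))
        _ = _ := sum_congr rfl fun p hp => by
            rw [h2 p hp, mul_assoc, mul_assoc, rowι_mul_swap, mul_neg, smul_neg]
    · push Not at hd
      obtain ⟨k, hk, hk0⟩ := hd
      rw [sum_eq_zero, sum_eq_zero, neg_zero]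
      · intro p _
        simp only [hlo, hhi]
        by_cases hp : ∀ k ∈ R j, p k = 0
        · have h : ¬ ∀ k ∈ R i, p k = d k := fun h => hk0 (by rw [← h k (hsub hk), hp k hk])
          rw [if_neg h, map_zero, mul_zero, smul_zero]
        · rw [if_neg hp, map_zero, mul_zero, zero_mul, smul_zero]
      · intro p _
        simp only [hlo, hhi]
        by_cases hp : ∀ k ∈ R i, p k = 0
        · have h : ¬ ∀ k ∈ R j, p k = d k := fun h => hk0 (by rw [← h k hk, hp k (hsub hk)])
          rw [if_neg h, map_zero, mul_zero, smul_zero]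
        · rw [if_neg hp, map_zero, mul_zero, zero_mul, smul_zero]
  have mix' : ∀ i ∈ J, ∀ j ∈ J,
      ∑ p ∈ Iic d, c p.degree • (Q (links d p) * rowι (lo i p) * rowι (hi j p)) =
      -∑ p ∈ Iic d, cc p.degree • (Q (links d p) * rowι (lo j p) * rowι (hi i p)) := by
    intro i hiJ j hj
    rcases hR j hj i hiJ with h | h
    · exact mix c i hiJ j hj h
    · have := mix cc j hj i hiJ h
      rw [this, neg_neg]
      exact sum_congr rfl fun p hp => by rw [hcc' p hp]
  have cross : ∀ b : ℕ → ℚ, ∀ j ∈ J,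
      ∑ p ∈ Iic d, b p.degree • (Q (links d p) * rowι (lo j p) * rowι w0) =
      ∑ p ∈ Iic d, b (d.degree - p.degree) • (Q (links d p) * rowι (hi j p) * rowι w0) :=
    fun b j hj => sum_face_vec hQ b hj (rowι w0)
  have cross' : ∀ j ∈ J,
      ∑ p ∈ Iic d, c p.degree • (Q (links d p) * rowι w0 * rowι (hi j p)) =
      -∑ p ∈ Iic d, cc p.degree • (Q (links d p) * rowι (lo j p) * rowι w0) := by
    intro j hj
    rw [cross cc j hj, ← sum_neg_distrib]
    refine sum_congr rfl fun p hp => ?_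
    rw [hcc' p hp, mul_assoc, mul_assoc, rowι_mul_swap, mul_neg, smul_neg]
  have cross'' : ∀ j ∈ J,
      ∑ p ∈ Iic d, c p.degree • (Q (links d p) * rowι (lo j p) * rowι w0) =
      -∑ p ∈ Iic d, cc p.degree • (Q (links d p) * rowι w0 * rowι (hi j p)) := by
    intro j hj
    rw [cross c j hj, ← sum_neg_distrib]
    refine sum_congr rfl fun p hp => ?_
    rw [mul_assoc, mul_assoc, rowι_mul_swap w0, mul_neg, smul_neg, neg_neg]
  have expand : ∀ b : ℕ → ℚ, ∑ p ∈ Iic d, b p.degree • (Q (links d p) *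
      rowι (lowVec J R w w0 p) * rowι (highVec d J R w w0 p)) =
      (∑ j ∈ J, ∑ p ∈ Iic d, b p.degree • (Q (links d p) * rowι (lo j p) * rowι w0)) +
      (∑ j ∈ J, ∑ p ∈ Iic d, b p.degree • (Q (links d p) * rowι w0 * rowι (hi j p))) +
      ∑ i ∈ J, ∑ j ∈ J, ∑ p ∈ Iic d,
        b p.degree • (Q (links d p) * rowι (lo i p) * rowι (hi j p)) := by
    intro b
    rw [sum_comm (s := J), sum_comm (s := J),
      sum_congr rfl fun i _ => sum_comm (s := J) (t := Iic d), sum_comm (s := J),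
      ← sum_add_distrib, ← sum_add_distrib]
    refine sum_congr rfl fun p _ => ?_
    have e1 : rowι (lowVec J R w w0 p) = rowι w0 + ∑ j ∈ J, rowι (lo j p) := by
      simp only [lowVec, map_add, map_sum, hlo]
    have e2 : rowι (highVec d J R w w0 p) = rowι w0 + ∑ j ∈ J, rowι (hi j p) := by
      simp only [highVec, map_add, map_sum, hhi]
    have e3 : Q (links d p) * rowι w0 * rowι w0 = 0 := by
      rw [mul_assoc, rowι_mul_self, mul_zero]
    rw [e1, e2, mul_add (Q _), add_mul, mul_add (Q _ * _), mul_add (Q _ * _), e3, zero_add]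
    simp only [mul_sum, sum_mul, smul_add, smul_sum]
    rw [sum_comm (s := J) (t := J) (f := fun i j => b p.degree • (Q (links d p) * rowι (lo j p) * rowι (hi i p)))]
    abel
  change _ = -∑ p ∈ Iic d, cc p.degree • (Q (links d p) * rowι (lowVec J R w w0 p) *
        rowι (highVec d J R w w0 p))
  rw [expand, expand cc, sum_congr rfl cross'', sum_congr rfl cross',
    sum_congr rfl fun i hi => sum_congr rfl (mix' i hi)]
  rw [sum_comm (s := J) (t := J)]
  simp only [sum_neg_distrib]
  abel

end Face

/-! ### The steps of tableaux as operators -/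

/-- Row `r` of `P` is shorter than the row of `M` above it. -/
def RoomAbove (M P : ℕ →₀ ℕ) (r : ℕ) : Prop := ∀ q, q + 1 = r → P r < M q

lemma roomAbove_zero (M P : ℕ →₀ ℕ) : RoomAbove M P 0 := fun q h => by omega

lemma roomAbove_succ (M P : ℕ →₀ ℕ) (r : ℕ) : RoomAbove M P (r + 1) ↔ P (r + 1) < M r :=
  ⟨fun h => h r rfl, fun h q hq => by obtain rfl : q = r := by omega
                                      exact h⟩

/-- The new rows of a circle of row `r` of `M`, when the diagram grows to `P`. -/
def stepImage (κ : Kind) (M P : ℕ →₀ ℕ) (r : ℕ) : RowSpace :=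
  open Classical in
  match κ with
  | .first => if P r = M r then rowVec r else rowVec (r + 1)
  | .second => (if RoomAbove M P r then (1 : ℚ) else 0) • rowVec r +
      (if M r < P r ∧ P (r + 1) = M r then (1 : ℚ) else 0) • rowVec (r + 1)

/-- The motion of the circles, when the diagram grows from `M` to `P`. -/
def stepMap (κ : Kind) (M P : ℕ →₀ ℕ) : RowSpace →ₗ[ℚ] RowSpace :=
  Finsupp.linearCombination ℚ (stepImage κ M P)

lemma stepMap_rowVec (κ : Kind) (M P : ℕ →₀ ℕ) (r : ℕ) :
    stepMap κ M P (rowVec r) = stepImage κ M P r := by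
  simp [stepMap]

/-- The rows in which a new circle can be created. -/
def NewRow (κ : Kind) (M P : ℕ →₀ ℕ) (t : ℕ) : Prop :=
  match κ with
  | .first => RoomAbove M P t ∧ ∀ r, t < r → ¬ RoomAbove M P r
  | .second => RoomAbove M P t ∧ ∀ i < t, P i = M i

/-- A bound for the rows of `M` and the row below them. -/
def rowBound (M : ℕ →₀ ℕ) : ℕ := M.support.sup id + 2

lemma rowBound_spec {M : ℕ →₀ ℕ} {r : ℕ} (h : M r ≠ 0) : r + 2 ≤ rowBound M := by
  have : r ≤ M.support.sup id := le_sup (f := id) (Finsupp.mem_support_iff.2 h)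
  simpa [rowBound] using this

lemma rowBound_pos (M : ℕ →₀ ℕ) : 2 ≤ rowBound M := by simp [rowBound]

lemma rowBound_mono {M P : ℕ →₀ ℕ} (h : M ≤ P) : rowBound M ≤ rowBound P := by
  have : M.support ⊆ P.support := Finsupp.support_mono h
  exact Nat.add_le_add_right (sup_mono this) 2

lemma RoomAbove.lt_rowBound {M P : ℕ →₀ ℕ} {t : ℕ} (h : RoomAbove M P t) : t < rowBound M := by
  rcases t with _ | t
  · have := rowBound_pos M; omega
  · have := rowBound_spec (M := M) (r := t) (by have := h t rfl; omega)
    omega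

lemma NewRow.room {κ : Kind} {M P : ℕ →₀ ℕ} {t : ℕ} (h : NewRow κ M P t) : RoomAbove M P t := by
  cases κ <;> exact h.1

open Classical in
/-- The sum of the rows in which a new circle can be created. -/
def stepVec (κ : Kind) (M P : ℕ →₀ ℕ) : RowSpace :=
  ∑ t ∈ range (rowBound M), if NewRow κ M P t then rowVec t else 0

lemma sum_range_rowVec_apply (n : ℕ) (p : ℕ → Prop) [DecidablePred p] (s : ℕ) :
    (∑ t ∈ range n, if p t then rowVec t else 0) s = if s < n ∧ p s then (1 : ℚ) else 0 := by
  rw [Finsupp.finsetSum_apply]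
  have : ∀ t ∈ range n, (if p t then rowVec t else 0) s =
      if t = s then (if p s then (1 : ℚ) else 0) else 0 := by
    intro t _
    by_cases h : t = s
    · subst h; simp only [if_true]; split_ifs <;> simp
    · split_ifs <;> simp [h]
  rw [sum_congr rfl this, sum_ite_eq']
  simp only [mem_range]
  split_ifs <;> simp_all

open Classical in
lemma stepVec_apply (κ : Kind) (M P : ℕ →₀ ℕ) (s : ℕ) :
    stepVec κ M P s = if NewRow κ M P s then 1 else 0 := by
  rw [stepVec, sum_range_rowVec_apply]
  congr 1
  exact propext ⟨fun h => h.2, fun h => ⟨h.room.lt_rowBound, h⟩⟩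

/-- The operator of a step, barred or unbarred. -/
def transfer (κ : Kind) (b : Bool) (M P : ℕ →₀ ℕ) (ω : Wedge) : Wedge :=
  ExteriorAlgebra.map (stepMap κ M P) ω * bif b then rowι (stepVec κ M P) else 1

/-! ### Pairs of steps -/

/-- The lower bounds for `P` in `M ⊆ P ⊆ N`, where both steps are horizontal strips. -/
def lowRow (M N : ℕ →₀ ℕ) : ℕ →₀ ℕ :=
  Finsupp.onFinset (M.support ∪ N.support.image Nat.pred) (fun r => max (M r) (N (r + 1))) <| by
    intro r h
    simp only [mem_union, Finsupp.mem_support_iff, mem_image]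
    by_cases h0 : M r = 0
    · exact Or.inr ⟨r + 1, by omega, rfl⟩
    · exact Or.inl h0

/-- The upper bounds for `P` in `M ⊆ P ⊆ N`, where both steps are horizontal strips. -/
def highRow (M N : ℕ →₀ ℕ) : ℕ →₀ ℕ :=
  Finsupp.onFinset N.support (fun r => match r with
    | 0 => N 0
    | r + 1 => min (N (r + 1)) (M r)) <| by
    intro r h
    simp only [Finsupp.mem_support_iff]
    rcases r with _ | r
    · exact h
    · dsimp only at h; omega

lemma lowRow_apply (M N : ℕ →₀ ℕ) (r : ℕ) : lowRow M N r = max (M r) (N (r + 1)) := rfl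
lemma highRow_zero (M N : ℕ →₀ ℕ) : highRow M N 0 = N 0 := rfl
lemma highRow_succ (M N : ℕ →₀ ℕ) (r : ℕ) : highRow M N (r + 1) = min (N (r + 1)) (M r) := rfl

lemma mem_Icc_row {M N P : ℕ →₀ ℕ} :
    P ∈ Icc (lowRow M N) (highRow M N) ↔ HStrip M P ∧ HStrip P N := by
  rw [mem_Icc]
  constructor
  · rintro ⟨h1, h2⟩
    refine ⟨fun r => ?_, fun r => ?_⟩
    · have a := h1 r; have b := h2 (r + 1)
      rw [lowRow_apply] at a; rw [highRow_succ] at b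
      omega
    · have a := h1 r; have b := h2 r
      rw [lowRow_apply] at a
      rcases r with _ | r
      · rw [highRow_zero] at b; omega
      · rw [highRow_succ] at b; omega
  · rintro ⟨h1, h2⟩
    refine ⟨fun r => ?_, fun r => ?_⟩
    · have a := h1 r; have b := h2 r
      rw [lowRow_apply]; omega
    · rcases r with _ | r
      · rw [highRow_zero]; exact (h2 0).1
      · rw [highRow_succ]
        have a := h1 r; have b := h2 (r + 1)
        omega

lemma degree_eq_sum_range {M : ℕ →₀ ℕ} {B : ℕ} (h : ∀ r, M r ≠ 0 → r < B) :
    M.degree = ∑ r ∈ range B, M r := by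
  rw [Finsupp.degree_apply]
  refine sum_subset (fun r hr => mem_range.2 (h r (Finsupp.mem_support_iff.1 hr))) ?_
  intro r _ hr
  simpa using hr

lemma degree_low_add_high (M N : ℕ →₀ ℕ) :
    (lowRow M N).degree + (highRow M N).degree = M.degree + N.degree := by
  set B := rowBound M + rowBound N
  have hM : ∀ r, M r ≠ 0 → r < B := fun r h => by have := rowBound_spec h; omega
  have hN : ∀ r, N r ≠ 0 → r < B := fun r h => by have := rowBound_spec h; omega
  rw [degree_eq_sum_range (M := lowRow M N) (B := B + 1),
    degree_eq_sum_range (M := highRow M N) (B := B + 2), degree_eq_sum_range (M := M) (B := B + 1),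
    degree_eq_sum_range (M := N) (B := B + 2), sum_range_succ' _ (B + 1),
    sum_range_succ' (fun r => N r) (B + 1), highRow_zero, ← add_assoc, ← add_assoc,
    ← sum_add_distrib, ← sum_add_distrib]
  · congr 1
    refine sum_congr rfl fun r _ => ?_
    rw [lowRow_apply, highRow_succ]
    omega
  · intro r h; have := hN r h; omega
  · intro r h; have := hM r h; omega
  · intro r h
    rcases r with _ | r
    · omega
    · rw [highRow_succ] at h
      have := hN (r + 1) (by omega); omega
  · intro r h
    rw [lowRow_apply] at h
    by_cases h0 : M r = 0
    · have := hN (r + 1) (by omega); omega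
    · have := hM r h0; omega

section Composite

variable {M N P : ℕ →₀ ℕ}

/-- The size of the box of possible `P`. -/
def rowBox (M N : ℕ →₀ ℕ) : ℕ →₀ ℕ := highRow M N - lowRow M N

lemma mem_links_row (h1 : HStrip M P) (h2 : HStrip P N) (r : ℕ) :
    r ∈ links (rowBox M N) (P - lowRow M N) ↔
      (M r < P r ∧ N (r + 1) < P r) ∧ P (r + 1) < N (r + 1) ∧ P (r + 1) < M r := by
  have h := mem_Icc.1 (mem_Icc_row.2 ⟨h1, h2⟩)
  have hle : P - lowRow M N ≤ rowBox M N := tsub_le_tsub_right h.2 _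
  rw [mem_links hle]
  have a := h.1 r; have b := h.2 (r + 1); have c := h.1 (r + 1)
  simp only [rowBox, Finsupp.tsub_apply, lowRow_apply, highRow_succ] at a b c ⊢
  omega

lemma sub_low_eq_zero (h1 : HStrip M P) (h2 : HStrip P N) (r : ℕ) :
    (P - lowRow M N) r = 0 ↔ P r = max (M r) (N (r + 1)) := by
  have h := (mem_Icc.1 (mem_Icc_row.2 ⟨h1, h2⟩)).1 r
  rw [Finsupp.tsub_apply]
  rw [lowRow_apply] at h ⊢
  omega

lemma sub_low_eq_box (h1 : HStrip M P) (h2 : HStrip P N) (r : ℕ) :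
    (P - lowRow M N) r = rowBox M N r ↔ P r = highRow M N r := by
  have h := mem_Icc.1 (mem_Icc_row.2 ⟨h1, h2⟩)
  have a := h.1 r; have b := h.2 r
  rw [Finsupp.tsub_apply, rowBox, Finsupp.tsub_apply]
  omega

/-- The rows of `P` can vary. -/
def RowGap (M N : ℕ →₀ ℕ) (r : ℕ) : Prop :=
  M r < N r ∧ N (r + 1) < N r ∧ ∀ q, q + 1 = r → M r < M q ∧ N (r + 1) < M q

open Classical in
/-- The motion of a circle in two steps from `M` to `N`, in terms of the links. -/
def boxImage (κ : Kind) (M N : ℕ →₀ ℕ) (S : Finset ℕ) (r : ℕ) : RowSpace :=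
  match κ with
  | .first => if N r = M r then rowVec r else if M r < N (r + 1) then rowVec (r + 2) else
      if r ∈ S then rowVec (r + 2) else rowVec (r + 1)
  | .second => (if RoomAbove M N r ∨ ∃ q, q + 1 = r ∧ q ∈ S then (1 : ℚ) else 0) • rowVec r +
      (if M r ≤ N (r + 1) then (if RowGap M N r then (1 : ℚ) else 0) - (if r ∈ S then 1 else 0)
        else 0) • rowVec (r + 1) +
      (if N (r + 2) = M r ∧ M r < N (r + 1) then (1 : ℚ) else 0) • rowVec (r + 2)

/-- The motion of the circles in two steps from `M` to `N`, in terms of the links. -/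
def boxMap (κ : Kind) (M N : ℕ →₀ ℕ) (S : Finset ℕ) : RowSpace →ₗ[ℚ] RowSpace :=
  Finsupp.linearCombination ℚ (boxImage κ M N S)

lemma boxMap_rowVec (κ : Kind) (M N : ℕ →₀ ℕ) (S : Finset ℕ) (r : ℕ) :
    boxMap κ M N S (rowVec r) = boxImage κ M N S r := by
  simp [boxMap]

lemma stepMap_comp (κ : Kind) (h1 : HStrip M P) (h2 : HStrip P N) :
    stepMap κ P N ∘ₗ stepMap κ M P = boxMap κ M N (links (rowBox M N) (P - lowRow M N)) := by
  classical
  refine Finsupp.lhom_ext' fun r => LinearMap.ext_ring ?_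
  change stepMap κ P N (stepMap κ M P (rowVec r)) = boxMap κ M N _ (rowVec r)
  rw [stepMap_rowVec, boxMap_rowVec]
  have a := h1 r; have b := h2 r; have c := h1 (r + 1); have d := h2 (r + 1)
  have hl := mem_links_row h1 h2
  cases κ with
  | first =>
    simp only [stepImage, boxImage, hl]
    split_ifs with e1 e2 e3 e4 e2 e3 e4 <;>
      simp only [stepMap_rowVec, stepImage] <;> split_ifs <;> first | rfl | (exfalso; omega)
  | second =>
    have e0 : (if RoomAbove M P r then (1 : ℚ) else 0) * (if RoomAbove P N r then 1 else 0) =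
        if RoomAbove M N r ∨ ∃ q, q + 1 = r ∧ q ∈ links (rowBox M N) (P - lowRow M N)
          then (1 : ℚ) else 0 := by
      rcases r with _ | r
      · simp [roomAbove_zero]
      · have a' := h1 r; have b' := h2 r
        simp only [roomAbove_succ, add_left_inj, exists_eq_left, hl]
        split_ifs <;> first | (exfalso; omega) | norm_num
    have e1 : (if RoomAbove M P r then (1 : ℚ) else 0) *
          (if P r < N r ∧ N (r + 1) = P r then 1 else 0) +
        (if M r < P r ∧ P (r + 1) = M r then 1 else 0) *
          (if RoomAbove P N (r + 1) then 1 else 0) =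
        if M r ≤ N (r + 1) then (if RowGap M N r then (1 : ℚ) else 0) -
          (if r ∈ links (rowBox M N) (P - lowRow M N) then 1 else 0) else 0 := by
      rcases r with _ | r
      · simp only [roomAbove_zero, roomAbove_succ, RowGap, hl]
        have : ∀ q, ¬ (q + 1 = 0) := by omega
        simp only [this, false_imp_iff, implies_true, and_true, if_true, one_mul, zero_add] at a b c d ⊢
        split_ifs <;> first | (exfalso; omega) | norm_num
      · have a' := h1 r; have b' := h2 r
        have : RowGap M N (r + 1) ↔ M (r + 1) < N (r + 1) ∧ N (r + 1 + 1) < N (r + 1) ∧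
            M (r + 1) < M r ∧ N (r + 1 + 1) < M r := by
          refine and_congr_right fun _ => and_congr_right fun _ =>
            ⟨fun h => h r rfl, fun h q hq => ?_⟩
          obtain rfl : q = r := by omega
          exact h
        simp only [roomAbove_succ, hl, this]
        split_ifs <;> first | (exfalso; omega) | norm_num
    have e2 : (if M r < P r ∧ P (r + 1) = M r then (1 : ℚ) else 0) *
          (if P (r + 1) < N (r + 1) ∧ N (r + 1 + 1) = P (r + 1) then 1 else 0) =
        if N (r + 2) = M r ∧ M r < N (r + 1) then (1 : ℚ) else 0 := by
      have h22 : r + 1 + 1 = r + 2 := rfl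
      rw [h22] at *
      split_ifs <;> first | (exfalso; omega) | norm_num
    simp only [stepImage, boxImage, map_add, map_smul, stepMap_rowVec, smul_add, smul_smul]
    rw [e0, e2, ← e1, add_smul]
    abel

end Composite

section NewVectors

variable {M N P : ℕ →₀ ℕ}

/-- The regions of rows that belong to the possible new circles. -/
def faceRegion (κ : Kind) (j : ℕ) : Set ℕ :=
  match κ with
  | .first => {i | j ≤ i}
  | .second => {i | i < j}

open Classical in
/-- The vectors of the possible new circles, given a pair of steps from `M` to `N`. -/
def faceVec (κ : Kind) (M N : ℕ →₀ ℕ) (j : ℕ) : RowSpace :=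
  match κ with
  | .first => if ∀ i, j ≤ i → M i ≤ N (i + 1) then rowVec j - rowVec (j + 1) else 0
  | .second => if (∀ i, i + 1 < j → N (i + 1) ≤ M i) ∧ RoomAbove N N j then rowVec j else 0

/-- The common part of the vectors of new circles. -/
def faceBase (κ : Kind) (N : ℕ →₀ ℕ) : RowSpace :=
  match κ with
  | .first => rowVec (rowBound N + 1)
  | .second => 0

lemma faceRegion_chain (κ : Kind) (i j : ℕ) :
    faceRegion κ i ⊆ faceRegion κ j ∨ faceRegion κ j ⊆ faceRegion κ i := by
  cases κ
  · rcases le_total i j with h | h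
    · exact Or.inr fun x (hx : j ≤ x) => h.trans hx
    · exact Or.inl fun x (hx : i ≤ x) => h.trans hx
  · rcases le_total i j with h | h
    · exact Or.inl fun x (hx : x < i) => hx.trans_le h
    · exact Or.inr fun x (hx : x < j) => hx.trans_le h

open Classical in
lemma rowVec_telescope {n t : ℕ} (h : t ≤ n) :
    rowVec t = rowVec n + ∑ j ∈ range n, if t ≤ j then rowVec j - rowVec (j + 1) else 0 := by
  induction n, h using Nat.le_induction with
  | base =>
    rw [sum_eq_zero, add_zero]
    intro j hj
    rw [if_neg]
    simpa using hj
  | succ n hn ih =>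
    rw [sum_range_succ, if_pos hn]
    rw [ih]
    abel

lemma exists_newRow_first (M P : ℕ →₀ ℕ) : ∃ t, NewRow .first M P t := by
  classical
  refine ⟨Nat.findGreatest (RoomAbove M P) (rowBound M), ?_, fun r hr h => ?_⟩
  · exact Nat.findGreatest_spec (P := RoomAbove M P) (Nat.zero_le _) (roomAbove_zero M P)
  · have := Nat.le_findGreatest (P := RoomAbove M P) h.lt_rowBound.le h
    omega

lemma newRow_first_unique {t t' : ℕ} (h : NewRow .first M P t) (h' : NewRow .first M P t') :
    t = t' := by
  rcases lt_trichotomy t t' with h1 | h1 | h1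
  · exact absurd h'.1 (h.2 _ h1)
  · exact h1
  · exact absurd h.1 (h'.2 _ h1)

lemma stepVec_first {t : ℕ} (h : NewRow .first M P t) : stepVec .first M P = rowVec t := by
  ext s
  rw [stepVec_apply, Finsupp.single_apply]
  by_cases hs : t = s
  · subst hs; simp [h]
  · rw [if_neg fun h' => hs (newRow_first_unique h h'), if_neg hs]

lemma newRow_first_le (h1 : HStrip M P) {t : ℕ} (h : NewRow .first M P t) (j : ℕ) :
    t ≤ j ↔ ∀ i, j ≤ i → P (i + 1) = M i := by
  constructor
  · intro hj i hi
    have := h.2 (i + 1) (by omega)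
    rw [roomAbove_succ] at this
    have := (h1 i).2
    omega
  · intro hj
    by_contra hlt
    obtain ⟨t, rfl⟩ : ∃ s, t = s + 1 := ⟨t - 1, by omega⟩
    have a := h.1
    rw [roomAbove_succ] at a
    have := hj t (by omega)
    omega

lemma stepVec_first_low (h1 : HStrip M P) (h2 : HStrip P N) :
    stepVec .first P N = lowVec (range (rowBound N + 1)) (faceRegion .first) (faceVec .first M N)
      (faceBase .first N) (P - lowRow M N) := by
  classical
  obtain ⟨t, ht⟩ := exists_newRow_first P N
  have hb : rowBound P ≤ rowBound N := rowBound_mono fun r => (h2 r).1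
  have hlt := ht.1.lt_rowBound
  rw [stepVec_first ht, rowVec_telescope (n := rowBound N + 1) (by omega), lowVec]
  refine congrArg₂ (· + ·) rfl (sum_congr rfl fun j _ => ?_)
  simp only [faceVec, ← ite_and]
  refine if_congr ?_ rfl rfl
  rw [newRow_first_le h2 ht]
  simp only [sub_low_eq_zero h1 h2, faceRegion, Set.mem_ofPred_eq]
  constructor
  · intro h
    have : ∀ i, j ≤ i → P i = max (M i) (N (i + 1)) ∧ M i ≤ N (i + 1) := fun i hi => by
      have a := h i hi; have b := h1 i; omega
    exact ⟨fun i hi => (this i hi).1, fun i hi => (this i hi).2⟩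
  · rintro ⟨a, b⟩ i hi
    have := a i hi; have := b i hi; omega

lemma stepVec_first_high (h1 : HStrip M P) (h2 : HStrip P N) :
    stepMap .first P N (stepVec .first M P) = highVec (rowBox M N) (range (rowBound N + 1))
      (faceRegion .first) (faceVec .first M N) (faceBase .first N) (P - lowRow M N) := by
  classical
  obtain ⟨t, ht⟩ := exists_newRow_first M P
  have hb : rowBound P ≤ rowBound N := rowBound_mono fun r => (h2 r).1
  have hb' : rowBound M ≤ rowBound P := rowBound_mono fun r => (h1 r).1
  have hlt := ht.1.lt_rowBound
  rw [stepVec_first ht, stepMap_rowVec]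
  set T := if N t = P t then t else t + 1 with hT
  have e : stepImage .first P N t = rowVec T := by
    simp only [stepImage, hT]; split_ifs <;> rfl
  have hT' : T ≤ rowBound N + 1 := by rw [hT]; split_ifs <;> omega
  rw [e, rowVec_telescope hT', highVec]
  refine congrArg₂ (· + ·) rfl (sum_congr rfl fun j _ => ?_)
  simp only [faceVec, ← ite_and]
  refine if_congr ?_ rfl rfl
  simp only [sub_low_eq_box h1 h2, faceRegion, Set.mem_ofPred_eq]
  have hle := newRow_first_le h1 ht
  constructor
  · intro h
    have htj : t ≤ j := by rw [hT] at h; split_ifs at h <;> omega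
    have h3 := (hle j).1 htj
    constructor
    · intro i hi
      have hsucc : ∀ i, j ≤ i → P (i + 1) = highRow M N (i + 1) := fun i hi => by
        rw [highRow_succ]; have := h3 i hi; have := h2 (i + 1); omega
      rcases eq_or_lt_of_le hi with rfl | hi
      · rcases eq_or_lt_of_le htj with rfl | htj
        · have hN : N t = P t := by by_contra hne; rw [hT, if_neg hne] at h; omega
          rcases t with _ | t
          · rw [highRow_zero, hN]
          · have := (roomAbove_succ _ _ _).1 ht.1
            rw [highRow_succ]; omega
        · obtain ⟨k, rfl⟩ : ∃ k, j = k + 1 := ⟨j - 1, by omega⟩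
          have := (hle k).1 (by omega) k le_rfl
          have := h2 (k + 1)
          rw [highRow_succ]; omega
      · obtain ⟨k, rfl⟩ : ∃ k, i = k + 1 := ⟨i - 1, by omega⟩
        exact hsucc k (by omega)
    · intro i hi
      have := h3 i hi; have := h2 (i + 1); omega
  · rintro ⟨a, b⟩
    have htj : t ≤ j := (hle j).2 fun i hi => by
      have := b i hi
      have h5 := a (i + 1) (by omega)
      rw [highRow_succ] at h5; omega
    rw [hT]
    split_ifs with hN
    · exact htj
    · rcases eq_or_lt_of_le htj with rfl | htj
      · exfalso
        have := a t le_rfl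
        rcases t with _ | t
        · exact hN (by rw [this, highRow_zero])
        · have := (roomAbove_succ _ _ _).1 ht.1
          have := a (t + 1) le_rfl
          rw [highRow_succ] at this; omega
      · exact htj

open Classical in
lemma stepMap_second_apply (x : RowSpace) :
    stepMap .second M P x 0 = x 0 ∧ ∀ s, stepMap .second M P x (s + 1) =
      x (s + 1) * (if P (s + 1) < M s then 1 else 0) +
        x s * (if M s < P s ∧ P (s + 1) = M s then 1 else 0) := by
  induction x using Finsupp.induction_linear with
  | zero => simp
  | add x y hx hy =>
    refine ⟨by simp [hx.1, hy.1], fun s => ?_⟩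
    rw [map_add (stepMap .second M P), Finsupp.add_apply, hx.2, hy.2, Finsupp.add_apply, Finsupp.add_apply]
    ring
  | single r b =>
    have e : stepMap .second M P (Finsupp.single r b) = b • stepImage .second M P r := by
      simp [stepMap]
    rw [e]
    constructor
    · rcases r with _ | r
      · simp only [stepImage, roomAbove_zero]; split_ifs <;> simp
      · simp only [stepImage]; split_ifs <;> simp
    · intro s
      by_cases h1 : r = s + 1
      · subst h1
        simp only [stepImage, roomAbove_succ]; split_ifs <;> simp
      · by_cases h2 : r = s
        · subst h2
          simp only [stepImage]; split_ifs <;> simp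
        · simp only [stepImage]; split_ifs <;> simp [h1, h2]

lemma roomAbove_lt_bound {M P : ℕ →₀ ℕ} (h : M ≤ P) {t : ℕ} {Q : ℕ →₀ ℕ} (hr : RoomAbove M Q t) :
    t < rowBound P + 1 := by
  have := hr.lt_rowBound; have := rowBound_mono h; omega

open Classical in
lemma sum_faceVec_second_apply (p : ℕ → Prop) (s : ℕ) :
    (0 + ∑ j ∈ range (rowBound N + 1), if p j then faceVec .second M N j else 0 : RowSpace) s =
      if ((∀ i, i + 1 < s → N (i + 1) ≤ M i) ∧ RoomAbove N N s) ∧ p s then (1 : ℚ) else 0 := by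
  simp only [zero_add, faceVec, ← ite_and]
  rw [sum_range_rowVec_apply]
  refine if_congr ?_ rfl rfl
  constructor
  · rintro ⟨_, a, b⟩; exact ⟨b, a⟩
  · rintro ⟨b, a⟩; exact ⟨roomAbove_lt_bound le_rfl b.2, a, b⟩

lemma stepVec_second_high (h1 : HStrip M P) (h2 : HStrip P N) :
    stepVec .second P N = highVec (rowBox M N) (range (rowBound N + 1)) (faceRegion .second)
      (faceVec .second M N) (faceBase .second N) (P - lowRow M N) := by
  classical
  ext s
  rw [stepVec_apply, highVec, faceBase, sum_faceVec_second_apply]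
  refine if_congr ?_ rfl rfl
  simp only [sub_low_eq_box h1 h2, faceRegion, Set.mem_ofPred_eq, NewRow]
  constructor
  · rintro ⟨a, b⟩
    refine ⟨⟨fun i hi => ?_, fun q hq => ?_⟩, fun i hi => ?_⟩
    · have := b (i + 1) hi; have := h1 i; omega
    · have := a q hq; have := b q (by omega); omega
    · have := b i hi
      rcases i with _ | i
      · rw [highRow_zero, this]
      · rw [highRow_succ]; have := h1 i; omega
  · rintro ⟨⟨a, b⟩, c⟩
    have d : ∀ i < s, N i = P i := fun i hi => by
      have := c i hi
      rcases i with _ | i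
      · rw [this, highRow_zero]
      · rw [highRow_succ] at this; have := a i hi; omega
    exact ⟨fun q hq => by rw [← d q (by omega)]; exact b q hq, d⟩

lemma stepVec_second_low (h1 : HStrip M P) (h2 : HStrip P N) :
    stepMap .second P N (stepVec .second M P) = lowVec (range (rowBound N + 1))
      (faceRegion .second) (faceVec .second M N) (faceBase .second N) (P - lowRow M N) := by
  classical
  ext s
  rw [lowVec, faceBase, sum_faceVec_second_apply]
  simp only [sub_low_eq_zero h1 h2, faceRegion, Set.mem_ofPred_eq]
  rcases s with _ | s
  · rw [(stepMap_second_apply _).1, stepVec_apply, if_pos, if_pos]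
    · exact ⟨⟨fun i hi => by omega, roomAbove_zero _ _⟩, fun i hi => by omega⟩
    · exact ⟨roomAbove_zero _ _, fun i hi => by omega⟩
  · rw [(stepMap_second_apply _).2, stepVec_apply, stepVec_apply]
    by_cases hE : ∀ i < s, P i = M i
    · have e1 : NewRow .second M P (s + 1) ↔ P s = M s ∧ P (s + 1) < M s := by
        simp only [NewRow, roomAbove_succ]
        constructor
        · rintro ⟨a, b⟩; exact ⟨b s (by omega), a⟩
        · rintro ⟨a, b⟩
          refine ⟨b, fun i hi => ?_⟩
          rcases eq_or_lt_of_le (Nat.le_of_lt_succ hi) with rfl | hi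
          · exact a
          · exact hE i hi
      have e2 : NewRow .second M P s ↔ RoomAbove M P s := ⟨fun h => h.1, fun h => ⟨h, hE⟩⟩
      have e3 : P s < N s → RoomAbove M P s := by
        intro h
        rcases s with _ | s
        · exact roomAbove_zero _ _
        · rw [roomAbove_succ]
          have := hE s (by omega); have := h2 s; omega
      have e4 : (((∀ i, i + 1 < s + 1 → N (i + 1) ≤ M i) ∧ RoomAbove N N (s + 1)) ∧
          ∀ i < s + 1, P i = max (M i) (N (i + 1))) ↔
          N (s + 1) < N s ∧ P s = max (M s) (N (s + 1)) := by
        rw [roomAbove_succ]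
        constructor
        · rintro ⟨⟨a, b⟩, c⟩; exact ⟨b, c s (by omega)⟩
        · rintro ⟨a, b⟩
          refine ⟨⟨fun i hi => ?_, a⟩, fun i hi => ?_⟩
          · have := hE i (by omega); have := h2 i; omega
          · rcases eq_or_lt_of_le (Nat.le_of_lt_succ hi) with rfl | hi
            · exact b
            · have := hE i (by omega); have := h2 i; omega
      rw [if_congr e4 rfl rfl, if_congr e1 rfl rfl, if_congr e2 rfl rfl]
      have := h1 s; have := h2 s; have := h2 (s + 1)
      by_cases h4 : P s < N s
      · have := e3 h4
        simp only [this, if_true, h4, true_and, one_mul]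
        split_ifs <;> first | (exfalso; omega) | norm_num
      · split_ifs <;> first | (exfalso; omega) | norm_num
    · have n1 : ¬ NewRow .second M P (s + 1) := fun h => hE fun i hi => h.2 i (by omega)
      have n2 : ¬ NewRow .second M P s := fun h => hE h.2
      have n3 : ¬ (((∀ i, i + 1 < s + 1 → N (i + 1) ≤ M i) ∧ RoomAbove N N (s + 1)) ∧
          ∀ i < s + 1, P i = max (M i) (N (i + 1))) := by
        rintro ⟨⟨a, b⟩, c⟩
        apply hE
        intro i hi
        have := c i (by omega); have := a i (by omega); have := h1 i
        omega
      rw [if_neg n1, if_neg n2, if_neg n3]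
      simp

end NewVectors

lemma boxMap_mul_faceVec (κ : Kind) (M N : ℕ →₀ ℕ) (ω : Wedge) (j : ℕ) (S S' : Finset ℕ)
    (h : AgreeOff (faceRegion κ j) S S') :
    ExteriorAlgebra.map (boxMap κ M N S) ω * rowι (faceVec κ M N j) =
      ExteriorAlgebra.map (boxMap κ M N S') ω * rowι (faceVec κ M N j) := by
  classical
  cases κ with
  | first =>
    simp only [faceVec]
    split_ifs with hj
    · refine map_mul_rowι_congr (fun r => ?_) ω
      rw [boxMap_rowVec, boxMap_rowVec]
      by_cases hr : r + 1 = j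
      · subst hr
        simp only [boxImage]
        split_ifs
        · exact ⟨0, by simp⟩
        · exact ⟨0, by simp⟩
        · exact ⟨0, by simp⟩
        · exact ⟨-1, by simp⟩
        · exact ⟨1, by simp⟩
        · exact ⟨0, by simp⟩
      · refine ⟨0, ?_⟩
        have := h r (by simp only [faceRegion, Set.mem_ofPred_eq]; omega)
        simp only [boxImage, this, zero_smul, add_zero]
    · simp
  | second =>
    simp only [faceVec]
    split_ifs with hj
    · refine map_mul_rowι_congr (fun r => ?_) ω
      rw [boxMap_rowVec, boxMap_rowVec]
      have hag : ∀ r, r + 1 ≠ j → (r ∈ S ↔ r ∈ S') := fun r hr =>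
        h r (by simp only [faceRegion, Set.mem_ofPred_eq]; omega)
      by_cases hr : r + 1 = j
      · subst hr
        have : (∃ q, q + 1 = r ∧ q ∈ S) ↔ ∃ q, q + 1 = r ∧ q ∈ S' :=
          exists_congr fun q => and_congr_right fun hq => hag q (by omega)
        simp only [boxImage, this]
        refine ⟨(if M r ≤ N (r + 1) then (if RowGap M N r then (1 : ℚ) else 0) -
          (if r ∈ S then 1 else 0) else 0) - (if M r ≤ N (r + 1) then
          (if RowGap M N r then (1 : ℚ) else 0) - (if r ∈ S' then 1 else 0) else 0), ?_⟩
        rw [sub_smul]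
        abel
      · by_cases hr2 : r = j
        · subst hr2
          simp only [boxImage, hag r (by omega)]
          refine ⟨(if RoomAbove M N r ∨ ∃ q, q + 1 = r ∧ q ∈ S then (1 : ℚ) else 0) -
            (if RoomAbove M N r ∨ ∃ q, q + 1 = r ∧ q ∈ S' then (1 : ℚ) else 0), ?_⟩
          rw [sub_smul]
          abel
        · have : (∃ q, q + 1 = r ∧ q ∈ S) ↔ ∃ q, q + 1 = r ∧ q ∈ S' :=
            exists_congr fun q => and_congr_right fun hq => hag q (by omega)
          refine ⟨0, ?_⟩
          simp only [boxImage, this, hag r hr, zero_smul, add_zero]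
    · simp

lemma sum_Icc_eq_sum_Iic {W : Type*} [AddCommMonoid W] {L H : ℕ →₀ ℕ} (h : L ≤ H)
    (g : (ℕ →₀ ℕ) → W) : ∑ P ∈ Icc L H, g P = ∑ p ∈ Iic (H - L), g (L + p) := by
  refine sum_nbij' (fun P => P - L) (fun p => L + p) ?_ ?_ ?_ ?_ ?_
  · intro P hP
    rw [mem_Icc] at hP
    exact mem_Iic.2 (tsub_le_tsub_right hP.2 _)
  · intro p hp
    rw [mem_Iic] at hp
    refine mem_Icc.2 ⟨le_add_of_nonneg_right zero_le, ?_⟩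
    rw [← add_tsub_cancel_of_le h]
    exact add_le_add_right hp _
  · intro P hP
    exact add_tsub_cancel_of_le (mem_Icc.1 hP).1
  · intro p _
    exact add_tsub_cancel_left _ _
  · intro P hP
    rw [add_tsub_cancel_of_le (mem_Icc.1 hP).1]

/-- A product of two steps, in terms of the links and the faces. -/
lemma transfer_transfer (κ : Kind) {M N P : ℕ →₀ ℕ} (h1 : HStrip M P) (h2 : HStrip P N)
    (b b' : Bool) (ω : Wedge) :
    transfer κ b' P N (transfer κ b M P ω) =
      ExteriorAlgebra.map (boxMap κ M N (links (rowBox M N) (P - lowRow M N))) ω *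
        (bif b then rowι (stepMap κ P N (stepVec κ M P)) else 1) *
        (bif b' then rowι (stepVec κ P N) else 1) := by
  rw [transfer, transfer, map_mul, ← stepMap_comp κ h1 h2, ← ExteriorAlgebra.map_comp_map]
  congr 2
  cases b
  · simp
  · simp [ExteriorAlgebra.map_apply_ι]

open Classical in
/-- Unbarred steps commute with all steps, and barred steps anticommute. -/
theorem transfer_comm (κ : Kind) (b b' : Bool) (M N : ℕ →₀ ℕ) (a a' : ℕ)
    (hdeg : N.degree = M.degree + a + a') (ω : Wedge) :
    ∑ P ∈ Icc (lowRow M N) (highRow M N), (if P.degree = M.degree + a then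
        transfer κ b' P N (transfer κ b M P ω) else 0) =
      (if b && b' then (-1 : ℚ) else 1) • ∑ P ∈ Icc (lowRow M N) (highRow M N),
        (if P.degree = M.degree + a' then transfer κ b P N (transfer κ b' M P ω) else 0) := by
  by_cases hLH : lowRow M N ≤ highRow M N
  swap
  · rw [Icc_eq_empty hLH]; simp
  set L := lowRow M N
  set d := rowBox M N
  set c : ℕ → ℕ → ℚ := fun a k => if L.degree + k = M.degree + a then 1 else 0 with hc
  have hsum : L.degree + (highRow M N).degree = M.degree + N.degree := degree_low_add_high M N
  have hd : L.degree + d.degree = (highRow M N).degree := by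
    rw [← map_add]; congr 1; exact add_tsub_cancel_of_le hLH
  have hrev : ∀ a a', N.degree = M.degree + a + a' → ∀ k ≤ d.degree,
      c a' k = c a (d.degree - k) := by
    intro a a' hdeg k hk
    simp only [hc]
    refine if_congr ?_ rfl rfl
    omega
  set Q : Finset ℕ → Wedge := fun S => ExteriorAlgebra.map (boxMap κ M N S) ω
  have key : ∀ (b b' : Bool) (a : ℕ), ∑ P ∈ Icc L (highRow M N), (if P.degree = M.degree + a then
        transfer κ b' P N (transfer κ b M P ω) else 0) =
      ∑ p ∈ Iic d, c a p.degree • (Q (links d p) *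
        (bif b then rowι (stepMap κ (L + p) N (stepVec κ M (L + p))) else 1) *
        (bif b' then rowι (stepVec κ (L + p) N) else 1)) := by
    intro b b' a
    rw [sum_Icc_eq_sum_Iic hLH]
    refine sum_congr rfl fun p hp => ?_
    have hP : L + p ∈ Icc L (highRow M N) := by
      rw [mem_Iic] at hp
      refine mem_Icc.2 ⟨le_add_of_nonneg_right zero_le, ?_⟩
      rw [← add_tsub_cancel_of_le hLH]
      exact add_le_add_right hp _
    obtain ⟨h1, h2⟩ := mem_Icc_row.1 hP
    rw [transfer_transfer κ h1 h2, map_add]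
    simp only [hc, ite_smul, one_smul, zero_smul]
    refine if_congr Iff.rfl ?_ rfl
    rw [add_tsub_cancel_left]
  have hP : ∀ p ∈ Iic d, HStrip M (L + p : ℕ →₀ ℕ) ∧ HStrip (L + p : ℕ →₀ ℕ) N := by
    intro p hp
    rw [mem_Iic] at hp
    refine mem_Icc_row.1 (mem_Icc.2 ⟨le_add_of_nonneg_right zero_le, ?_⟩)
    rw [← add_tsub_cancel_of_le hLH]
    exact add_le_add_right hp _
  set J := range (rowBound N + 1)
  set lo := lowVec J (faceRegion κ) (faceVec κ M N) (faceBase κ N)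
  set hi := highVec d J (faceRegion κ) (faceVec κ M N) (faceBase κ N)
  have hQ : ∀ j ∈ J, ∀ S S', AgreeOff (faceRegion κ j) S S' →
      Q S * rowι (faceVec κ M N j) = Q S' * rowι (faceVec κ M N j) :=
    fun j _ S S' h => boxMap_mul_faceVec κ M N ω j S S' h
  have hvec : (κ = .first ∧ ∀ p ∈ Iic d, stepMap κ (L + p) N (stepVec κ M (L + p)) = hi p ∧
        stepVec κ (L + p) N = lo p) ∨
      (κ = .second ∧ ∀ p ∈ Iic d, stepMap κ (L + p) N (stepVec κ M (L + p)) = lo p ∧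
        stepVec κ (L + p) N = hi p) := by
    cases κ
    · refine Or.inl ⟨rfl, fun p hp => ?_⟩
      obtain ⟨h1, h2⟩ := hP p hp
      have e1 := stepVec_first_high h1 h2
      have e2 := stepVec_first_low h1 h2
      rw [add_tsub_cancel_left] at e1 e2
      exact ⟨e1, e2⟩
    · refine Or.inr ⟨rfl, fun p hp => ?_⟩
      obtain ⟨h1, h2⟩ := hP p hp
      have e1 := stepVec_second_low h1 h2
      have e2 := stepVec_second_high h1 h2
      rw [add_tsub_cancel_left] at e1 e2
      exact ⟨e1, e2⟩
  have lowhigh : ∀ a a', N.degree = M.degree + a + a' →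
      ∑ p ∈ Iic d, c a p.degree • (Q (links d p) * rowι (lo p)) =
      ∑ p ∈ Iic d, c a' p.degree • (Q (links d p) * rowι (hi p)) := by
    intro a a' hdeg
    have := sum_low_eq_high (d := d) (w0 := faceBase κ N) hQ (c a) 1
    simp only [mul_one] at this
    rw [this]
    exact sum_congr rfl fun p hp => by rw [hrev a a' hdeg _ (degree_mono (mem_Iic.1 hp))]
  have anti : ∀ a a', N.degree = M.degree + a + a' →
      ∑ p ∈ Iic d, c a p.degree • (Q (links d p) * rowι (lo p) * rowι (hi p)) =
      -∑ p ∈ Iic d, c a' p.degree • (Q (links d p) * rowι (lo p) * rowι (hi p)) := by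
    intro a a' hdeg
    have := sum_low_mul_high (d := d) (w0 := faceBase κ N) hQ
      (fun i _ j _ => faceRegion_chain κ i j) (c a) (fun k hk => by congr 1; omega)
    rw [this]
    exact congrArg _
      (sum_congr rfl fun p hp => by rw [hrev a a' hdeg _ (degree_mono (mem_Iic.1 hp))])
  have hdeg' : N.degree = M.degree + a' + a := by omega
  rw [key, key]
  have unbarred : ∀ a, ∑ p ∈ Iic d, c a p.degree • Q (links d p) * 1 =
      ∑ p ∈ Iic d, c a p.degree • Q (links d p) := fun a => by simp
  rcases hvec with ⟨-, hv⟩ | ⟨-, hv⟩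
  · have e1 : ∀ a (z : (ℕ →₀ ℕ) → Wedge), ∑ p ∈ Iic d, c a p.degree • (Q (links d p) *
        rowι (stepMap κ (L + p) N (stepVec κ M (L + p))) * z p) =
        ∑ p ∈ Iic d, c a p.degree • (Q (links d p) * rowι (hi p) * z p) :=
      fun a z => sum_congr rfl fun p hp => by rw [(hv p hp).1]
    have e2 : ∀ a (z : (ℕ →₀ ℕ) → Wedge), ∑ p ∈ Iic d, c a p.degree • (Q (links d p) * z p *
        rowι (stepVec κ (L + p) N)) =
        ∑ p ∈ Iic d, c a p.degree • (Q (links d p) * z p * rowι (lo p)) :=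
      fun a z => sum_congr rfl fun p hp => by rw [(hv p hp).2]
    have e3 : ∀ a, ∑ p ∈ Iic d, c a p.degree • (Q (links d p) * rowι (hi p) * rowι (lo p)) =
        -∑ p ∈ Iic d, c a p.degree • (Q (links d p) * rowι (lo p) * rowι (hi p)) := by
      intro a
      rw [← sum_neg_distrib]
      refine sum_congr rfl fun p _ => ?_
      rw [mul_assoc, rowι_mul_swap, mul_neg, smul_neg, ← mul_assoc]
    have e1' := fun a => e1 a fun _ => 1
    have e2' := fun a => e2 a fun _ => 1
    simp only [mul_one] at e1' e2'
    cases b <;> cases b' <;> simp only [cond_true, cond_false, Bool.and_true, Bool.and_false,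
      if_true, e1, e2, e1', e2', mul_one, Bool.false_eq_true, if_false, one_smul]
    · rw [sum_box_reverse d fun k S => c a k • Q S]
      exact sum_congr rfl fun p hp => by rw [hrev a a' hdeg _ (degree_mono (mem_Iic.1 hp))]
    · exact lowhigh a a' hdeg
    · exact (lowhigh a' a hdeg').symm
    · rw [e3, e3, anti a a' hdeg, neg_smul, one_smul]
  · have e1 : ∀ a (z : (ℕ →₀ ℕ) → Wedge), ∑ p ∈ Iic d, c a p.degree • (Q (links d p) *
        rowι (stepMap κ (L + p) N (stepVec κ M (L + p))) * z p) =
        ∑ p ∈ Iic d, c a p.degree • (Q (links d p) * rowι (lo p) * z p) :=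
      fun a z => sum_congr rfl fun p hp => by rw [(hv p hp).1]
    have e2 : ∀ a (z : (ℕ →₀ ℕ) → Wedge), ∑ p ∈ Iic d, c a p.degree • (Q (links d p) * z p *
        rowι (stepVec κ (L + p) N)) =
        ∑ p ∈ Iic d, c a p.degree • (Q (links d p) * z p * rowι (hi p)) :=
      fun a z => sum_congr rfl fun p hp => by rw [(hv p hp).2]
    have e1' := fun a => e1 a fun _ => 1
    have e2' := fun a => e2 a fun _ => 1
    simp only [mul_one] at e1' e2'
    cases b <;> cases b' <;> simp only [cond_true, cond_false, Bool.and_true, Bool.and_false,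
      if_true, e1, e2, e1', e2', mul_one, Bool.false_eq_true, if_false, one_smul]
    · rw [sum_box_reverse d fun k S => c a k • Q S]
      exact sum_congr rfl fun p hp => by rw [hrev a a' hdeg _ (degree_mono (mem_Iic.1 hp))]
    · exact (lowhigh a' a hdeg').symm
    · exact lowhigh a a' hdeg
    · rw [anti a a' hdeg, neg_smul, one_smul]

/-! ### Superpartitions as partitions with circled corners -/

lemma lt_getD_iff {l : List ℕ} (hl : l.Pairwise (· ≥ ·)) (r c : ℕ) :
    c < l.getD r 0 ↔ r < l.countP (c < ·) := by
  induction l generalizing r with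
  | nil => simp
  | cons x t ih =>
    rw [List.pairwise_cons] at hl
    rw [List.countP_cons]
    by_cases hx : c < x
    · rcases r with _ | r
      · simp [hx]
      · simp only [List.getD_cons_succ, ih hl.2, hx, decide_true, if_true]; omega
    · have h0 : t.countP (c < ·) = 0 := by
        rw [List.countP_eq_zero]
        intro y hy
        have := hl.1 y hy
        simp; omega
      rw [h0]
      rcases r with _ | r
      · simp [hx]
      · simp only [List.getD_cons_succ, ih hl.2, h0]
        simp [hx]

lemma sum_range_getD (l : List ℕ) : ∑ r ∈ range l.length, l.getD r 0 = l.sum := by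
  induction l with
  | nil => simp
  | cons x t ih =>
    rw [List.length_cons, sum_range_succ', List.getD_cons_zero, List.sum_cons, add_comm]
    simp only [List.getD_cons_succ, ih]

namespace SPar

variable (L : SPar)

/-- The length of column `c` of `Λ^+`. -/
def col (c : ℕ) : ℕ := L.parts.countP (c < ·)

lemma lt_plus_iff (r c : ℕ) : c < L.plus r ↔ r < L.col c := by
  rw [plus, lt_getD_iff (List.pairwise_insertionSort _ _), col,
    (List.perm_insertionSort _ _).countP_eq]

lemma a_nodup : L.a.Nodup := L.a_sorted.imp fun h => Nat.ne_of_gt h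

lemma countP_succ (l : List ℕ) (c : ℕ) :
    (l.map (· + 1)).countP (c < ·) = l.countP (c < ·) + l.count c := by
  induction l with
  | nil => simp
  | cons x t ih =>
    rw [List.map_cons, List.countP_cons, List.countP_cons, List.count_cons, ih]
    rcases lt_trichotomy c x with h | h | h
    · simp [h, h.ne', show c < x + 1 by omega]; omega
    · subst h; simp; omega
    · simp [show ¬ c < x + 1 by omega, show ¬ c < x by omega, h.ne]

lemma countP_lt_eq (l : List ℕ) (c : ℕ) :
    l.countP (c < ·) = l.countP (c + 1 < ·) + l.count (c + 1) := by
  induction l with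
  | nil => simp
  | cons x t ih =>
    rw [List.countP_cons, List.countP_cons, List.count_cons, ih]
    rcases lt_trichotomy (c + 1) x with h | h | h
    · simp [h, h.ne', show c < x by omega]; omega
    · subst h; simp; omega
    · simp [show ¬ c + 1 < x by omega, show ¬ c < x by omega, h.ne]

lemma count_a (c : ℕ) : L.a.count c = if c ∈ L.a then 1 else 0 := by
  split_ifs with h
  · exact List.count_eq_one_of_mem L.a_nodup h
  · exact List.count_eq_zero_of_not_mem h

lemma lt_oplus_iff (r c : ℕ) : c < L.oplus r ↔ r < L.col c + if c ∈ L.a then 1 else 0 := by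
  rw [oplus, lt_getD_iff (List.pairwise_insertionSort _ _),
    (List.perm_insertionSort _ _).countP_eq, col, parts, List.countP_append, List.countP_append,
    countP_succ, count_a]
  constructor <;> intro h <;> omega

lemma plus_succ_le (r : ℕ) : L.plus (r + 1) ≤ L.plus r := by
  by_contra h
  have h1 := (L.lt_plus_iff (r + 1) (L.plus r)).1 (by omega)
  have h2 := mt (L.lt_plus_iff r (L.plus r)).2 (lt_irrefl _)
  omega

lemma plus_antitone : Antitone L.plus := antitone_nat_of_succ_le L.plus_succ_le

lemma plus_eq_zero {r : ℕ} (h : L.parts.length ≤ r) : L.plus r = 0 := by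
  rw [plus, List.getD_eq_default]
  simpa using h

/-- The rows of `Λ^+`, as a finitely supported function. -/
def rows : ℕ →₀ ℕ := Finsupp.onFinset (range L.parts.length) L.plus fun r h => by
  rw [mem_range]
  by_contra h'
  exact h (L.plus_eq_zero (by omega))

@[simp] lemma coe_rows : ⇑L.rows = L.plus := rfl

lemma degree_rows : L.rows.degree = L.deg := by
  rw [degree_eq_sum_range (B := L.parts.length)]
  · have := sum_range_getD (L.parts.insertionSort (· ≥ ·))
    rw [List.length_insertionSort] at this
    rw [deg, ← (List.perm_insertionSort (· ≥ ·) L.parts).sum_eq, ← this]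
    rfl
  · intro r h
    by_contra h'
    exact h (L.plus_eq_zero (by omega))

lemma plus_col {c : ℕ} (h : c ∈ L.a) : L.plus (L.col c) = c ∧ L.oplus (L.col c) = c + 1 := by
  have h1 : ¬ c < L.plus (L.col c) := by rw [lt_plus_iff]; exact lt_irrefl _
  have h2 : c < L.oplus (L.col c) := by rw [lt_oplus_iff, if_pos h]; omega
  constructor
  · refine le_antisymm (not_lt.1 h1) ?_
    rcases c with _ | c
    · exact Nat.zero_le _
    · have e := countP_lt_eq L.parts c
      rw [← col, ← col] at e
      rw [Nat.succ_le_iff, lt_plus_iff]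
      have : 0 < L.parts.count (c + 1) := List.count_pos_iff.2 (List.mem_append_left _ h)
      omega
  · refine le_antisymm ?_ h2
    by_contra h3
    have h4 := (L.lt_oplus_iff _ _).1 (not_le.1 h3)
    have h5 := countP_lt_eq L.parts c
    have h6 : L.a.count (c + 1) ≤ L.parts.count (c + 1) := by
      rw [parts, List.count_append]; omega
    rw [count_a] at h6
    rw [← col, ← col] at h5
    omega

lemma oplus_ne_plus_iff (r : ℕ) : L.oplus r ≠ L.plus r ↔ ∃ c ∈ L.a, L.col c = r := by
  constructor
  · intro h
    by_contra! h'
    apply h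
    refine eq_of_forall_lt_iff fun c => ?_
    rw [lt_oplus_iff, lt_plus_iff]
    split_ifs with hc
    · have := h' c hc; omega
    · simp
  · rintro ⟨c, hc, rfl⟩
    rw [(L.plus_col hc).1, (L.plus_col hc).2]
    omega

lemma col_lt_col {c c' : ℕ} (h : c' ∈ L.parts) (hlt : c < c') : L.col c' < L.col c := by
  have : ∀ k, L.col (c' + k) ≤ L.col c' := by
    intro k
    exact List.countP_mono_left fun x _ hx => by simp at hx ⊢; omega
  obtain ⟨d, rfl⟩ : ∃ d, c' = d + 1 := ⟨c' - 1, by omega⟩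
  have h1 : L.col d ≤ L.col c := List.countP_mono_left fun x _ hx => by simp at hx ⊢; omega
  have h2 := countP_lt_eq L.parts d
  have : 0 < L.parts.count (d + 1) := List.count_pos_iff.2 h
  rw [← col, ← col] at h2
  omega

lemma circleRows_eq : L.circleRows = L.a.map L.col := by
  refine List.Pairwise.eq_of_mem_iff (r := (· < ·)) ?_ ?_ fun r => ?_
  · exact List.pairwise_lt_range.filter _
  · rw [List.pairwise_map]
    refine L.a_sorted.imp_of_mem fun {x y} hx _ hxy => ?_
    exact L.col_lt_col (List.mem_append_left _ hx) hxy
  · simp only [circleRows, List.mem_filter, List.mem_range, decide_eq_true_eq, List.mem_map]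
    rw [oplus_ne_plus_iff]
    refine and_iff_right_of_imp ?_
    rintro ⟨c, hc, rfl⟩
    exact List.countP_lt_length_iff.2 ⟨c, List.mem_append_left _ hc, by simp⟩

lemma circleRows_pairwise : L.circleRows.Pairwise (· < ·) := List.pairwise_lt_range.filter _

lemma circleRows_nodup : L.circleRows.Nodup := L.circleRows_pairwise.imp fun h => Nat.ne_of_lt h

lemma map_plus_circleRows : L.circleRows.map L.plus = L.a := by
  rw [circleRows_eq, List.map_map]
  conv_rhs => rw [← List.map_id L.a]
  exact List.map_congr_left fun c hc => (L.plus_col hc).1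

@[simp] lemma length_circleRows : L.circleRows.length = L.df := by
  rw [circleRows_eq, List.length_map, df]

lemma oplus_eq (r : ℕ) : L.oplus r = L.plus r + if r ∈ L.circleRows then 1 else 0 := by
  have : r ∈ L.circleRows ↔ ∃ c ∈ L.a, L.col c = r := by rw [circleRows_eq, List.mem_map]
  split_ifs with h
  · obtain ⟨c, hc, rfl⟩ := this.1 h
    rw [(L.plus_col hc).1, (L.plus_col hc).2]
  · by_contra h'
    exact h (this.2 ((L.oplus_ne_plus_iff r).1 h'))

lemma roomAbove_of_mem {r : ℕ} (h : r ∈ L.circleRows) : RoomAbove L.rows L.rows r := by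
  rintro q rfl
  rw [circleRows_eq, List.mem_map] at h
  obtain ⟨c, hc, hcr⟩ := h
  rw [coe_rows, ← hcr, (L.plus_col hc).1, lt_plus_iff]
  omega

lemma col_eq_of_plus_eq {L O : SPar} (h : L.plus = O.plus) : L.col = O.col := by
  funext c
  refine eq_of_forall_lt_iff fun r => ?_
  rw [← lt_plus_iff, ← lt_plus_iff, h]

theorem ext_rows {L O : SPar} (h1 : L.plus = O.plus) (h2 : L.circleRows = O.circleRows) :
    L = O := by
  have ha : L.a = O.a := by rw [← map_plus_circleRows, ← map_plus_circleRows, h1, h2]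
  have hcol := col_eq_of_plus_eq h1
  have hs : L.s.Perm O.s := by
    rw [List.perm_iff_count]
    intro c
    rcases c with _ | c
    · rw [List.count_eq_zero_of_not_mem, List.count_eq_zero_of_not_mem]
      · exact fun h => lt_irrefl _ (O.s_pos _ h)
      · exact fun h => lt_irrefl _ (L.s_pos _ h)
    · have e1 := countP_lt_eq L.parts c
      have e2 := countP_lt_eq O.parts c
      have e3 := congrFun hcol c
      have e4 := congrFun hcol (c + 1)
      rw [← col, ← col] at e1 e2
      have e5 : L.parts.count (c + 1) = O.parts.count (c + 1) := by omega
      rw [parts, parts, List.count_append, List.count_append, ha] at e5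
      omega
  exact SPar.ext ha (hs.eq_of_pairwise (fun a b _ _ h h' => le_antisymm h' h) L.s_sorted O.s_sorted)

theorem exists_rows {lam : ℕ →₀ ℕ} (hl : ∀ r, lam (r + 1) ≤ lam r) {C : List ℕ}
    (hC : C.Pairwise (· < ·)) (hcorner : ∀ r ∈ C, RoomAbove lam lam r) :
    ∃ N : SPar, N.rows = lam ∧ N.circleRows = C := by
  have hanti : Antitone lam := antitone_nat_of_succ_le hl
  set B := rowBound lam
  have hCn : C.Nodup := hC.imp fun h => Nat.ne_of_lt h
  set D := (List.range B).filter fun r => r ∉ C ∧ 0 < lam r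
  let N : SPar :=
    { a := C.map lam
      s := D.map lam
      a_sorted := by
        rw [List.pairwise_map]
        refine hC.imp_of_mem fun {x y} hx hy hxy => ?_
        obtain ⟨q, rfl⟩ : ∃ q, y = q + 1 := ⟨y - 1, by omega⟩
        exact (hcorner _ hy q rfl).trans_le (hanti (by omega))
      s_sorted := by
        rw [List.pairwise_map]
        exact (List.pairwise_lt_range.filter _).imp fun h => hanti (le_of_lt h)
      s_pos := by
        intro x hx
        simp only [List.mem_map, D, List.mem_filter, decide_eq_true_eq] at hx
        obtain ⟨r, hr, rfl⟩ := hx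
        exact hr.2.2 }
  have hcol : ∀ c, N.col c = ((List.range B).map lam).countP (c < ·) := by
    intro c
    have e1 : N.col c = C.countP (fun r => c < lam r) + D.countP (fun r => c < lam r) := by
      simp only [col, parts, N, List.countP_append, List.countP_map]
      rfl
    have e2 : C.Perm ((List.range B).filter (· ∈ C)) := by
      refine (List.perm_ext_iff_of_nodup hCn (List.nodup_range.filter _)).2 fun r => ?_
      simp only [List.mem_filter, List.mem_range, decide_eq_true_eq]
      exact ⟨fun h => ⟨(hcorner r h).lt_rowBound, h⟩, fun h => h.2⟩
    rw [e1, e2.countP_eq, List.countP_map]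
    simp only [D, List.countP_filter]
    generalize List.range B = l
    induction l with
    | nil => rfl
    | cons x t ih =>
      simp only [List.countP_cons, Function.comp_apply] at ih ⊢
      by_cases h1 : x ∈ C <;> by_cases h2 : c < lam x
      · simp [h1, h2]; simp at ih; omega
      · simp [h1, h2]; simp at ih; omega
      · have : 0 < lam x := by omega
        simp [h1, h2, this]; simp at ih; omega
      · simp [h1, h2]; simp at ih; omega
  have hlt : ∀ r c, r < N.col c ↔ c < lam r := by
    intro r c
    rw [hcol, ← lt_getD_iff]
    · by_cases hr : r < B
      · rw [List.getD_eq_getElem _ _ (by simpa using hr)]; simp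
      · rw [List.getD_eq_default _ _ (by simpa using hr)]
        have : lam r = 0 := by
          by_contra h; have := rowBound_spec h; omega
        rw [this]
    · rw [List.pairwise_map]
      exact List.pairwise_lt_range.imp fun h => hanti (le_of_lt h)
  have hrows : N.plus = lam := by
    funext r
    refine eq_of_forall_lt_iff fun c => ?_
    rw [lt_plus_iff, hlt]
  refine ⟨N, by ext r; rw [coe_rows, hrows], ?_⟩
  rw [circleRows_eq]
  change (C.map lam).map N.col = C
  rw [List.map_map]
  conv_rhs => rw [← List.map_id C]
  refine List.map_congr_left fun r hr => ?_
  refine eq_of_forall_lt_iff fun q => ?_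
  rw [Function.comp_apply, hlt, id]
  constructor
  · intro h
    by_contra h'
    exact absurd (hanti (not_lt.1 h')) (by omega)
  · intro h
    obtain ⟨k, rfl⟩ : ∃ k, r = k + 1 := ⟨r - 1, by omega⟩
    exact (hcorner _ hr k rfl).trans_le (hanti (by omega))

end SPar

/-! ### Signs of words -/

lemma sum_get_eq_countP (l : List ℕ) (p : ℕ → Prop) [DecidablePred p] :
    (∑ j : Fin l.length, if p (l.get j) then 1 else 0) = l.countP p := by
  induction l with
  | nil => rfl
  | cons x t ih =>
    rw [List.countP_cons, ← ih]
    refine (Fin.sum_univ_succ (n := t.length) _).trans ?_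
    rw [add_comm]
    by_cases h : p x <;> simp [h]

lemma inversions_eq_sum (l : List ℕ) : inversions l =
    ∑ i : Fin l.length, ∑ j : Fin l.length, if i < j ∧ l.get j < l.get i then 1 else 0 := by
  rw [inversions, card_filter, ← univ_product_univ, sum_product]

lemma inversions_cons (x : ℕ) (l : List ℕ) :
    inversions (x :: l) = l.countP (· < x) + inversions l := by
  rw [inversions_eq_sum, inversions_eq_sum]
  refine (Fin.sum_univ_succ (n := l.length) _).trans ?_
  congr 1
  · rw [← sum_get_eq_countP]
    refine (Fin.sum_univ_succ (n := l.length) _).trans ?_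
    simp
  · refine sum_congr rfl fun i _ => ?_
    refine (Fin.sum_univ_succ (n := l.length) _).trans ?_
    simp

lemma inversions_nil : inversions [] = 0 := rfl

/-- The product of the signs of the differences of the entries of a word. -/
def wordSign {m : ℕ} (g : Fin m → ℤ) : ℚ :=
  ∏ j, ∏ i ∈ Iio j, ((g j - g i).sign : ℚ)

lemma wordSign_comp_perm {m : ℕ} (g : Fin m → ℤ) (τ : Equiv.Perm (Fin m)) :
    wordSign (g ∘ τ) = (Equiv.Perm.sign τ : ℤ) * wordSign g := by
  have := Equiv.Perm.prod_Iio_comp_eq_sign_mul_prod (R := ℚ) τ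
    (f := fun i j => ((g j - g i).sign : ℚ)) (fun i j => by
      rw [← Int.cast_neg, ← Int.sign_neg, neg_sub])
  simpa [wordSign] using this

lemma wordSign_succ {m : ℕ} (g : Fin (m + 1) → ℤ) :
    wordSign g = (∏ j : Fin m, ((g j.succ - g 0).sign : ℚ)) * wordSign fun j => g j.succ := by
  have e : ∀ {n : ℕ} (h : Fin n → ℤ), wordSign h =
      ∏ j, ∏ i, if i < j then ((h j - h i).sign : ℚ) else 1 := by
    intro n h
    refine prod_congr rfl fun j _ => ?_
    rw [← prod_filter]
    exact prod_congr (by ext; simp) fun _ _ => rfl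
  rw [e, e, Fin.prod_univ_succ]
  simp only [Fin.prod_univ_succ, Fin.not_lt_zero, if_false, Fin.succ_pos, if_true,
    Fin.succ_lt_succ_iff, prod_const_one, one_mul, prod_mul_distrib]

lemma wordSign_of_strictMono {m : ℕ} {g : Fin m → ℤ} (h : StrictMono g) : wordSign g = 1 := by
  refine prod_eq_one fun j _ => prod_eq_one fun i hi => ?_
  rw [Int.sign_eq_one_of_pos]
  · simp
  · have := h (mem_Iio.1 hi); omega

lemma wordSign_mul_self {m : ℕ} {g : Fin m → ℤ} (h : Function.Injective g) :
    wordSign g * wordSign g = 1 := by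
  rw [wordSign, ← prod_mul_distrib]
  refine prod_eq_one fun j _ => ?_
  rw [← prod_mul_distrib]
  refine prod_eq_one fun i hi => ?_
  have : g j - g i ≠ 0 := fun h0 => (mem_Iio.1 hi).ne (h (by omega)).symm
  rcases lt_or_gt_of_ne this with h | h
  · rw [Int.sign_eq_neg_one_of_neg h]; norm_num
  · rw [Int.sign_eq_one_of_pos h]; norm_num

lemma thetaSign_cons (x : ℕ) (l : List ℕ) :
    thetaSign (x :: l) = (l.map fun y : ℕ => (((y : ℤ) - (x : ℤ)).sign : ℚ)).prod * thetaSign l := by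
  rw [thetaSign, thetaSign]
  by_cases hx : x ∈ l
  · rw [if_neg (by simp [hx]), List.prod_eq_zero, zero_mul]
    exact List.mem_map.2 ⟨x, hx, by simp⟩
  · by_cases hl : l.Nodup
    · rw [if_pos (by simp [hx, hl]), if_pos hl, inversions_cons, pow_add]
      congr 1
      clear hl
      induction l with
      | nil => simp
      | cons y t ih =>
        simp only [List.mem_cons, not_or] at hx
        rw [List.map_cons, List.prod_cons, ← ih hx.2, List.countP_cons]
        rcases lt_or_gt_of_ne hx.1 with h | h
        · rw [Int.sign_eq_one_of_pos (by omega)]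
          simp [show ¬ y < x by omega]
        · rw [Int.sign_eq_neg_one_of_neg (by omega)]
          simp [h, pow_succ]
    · rw [if_neg (by simp [hl]), if_neg hl, mul_zero]

lemma thetaSign_ofFn {m : ℕ} (a : Fin m → ℕ) :
    thetaSign (List.ofFn a) = wordSign fun i => (a i : ℤ) := by
  induction m with
  | zero => simp [thetaSign, wordSign, inversions_nil]
  | succ m ih =>
    rw [List.ofFn_succ, thetaSign_cons, wordSign_succ, ih, List.map_ofFn, List.prod_ofFn]
    rfl

lemma thetaSign_ofFn_comp {m : ℕ} (a : Fin m → ℕ) (τ : Equiv.Perm (Fin m)) :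
    thetaSign (List.ofFn (a ∘ τ)) = (Equiv.Perm.sign τ : ℤ) * thetaSign (List.ofFn a) := by
  rw [thetaSign_ofFn, thetaSign_ofFn, ← wordSign_comp_perm]; rfl

lemma thetaSign_of_pairwise {l : List ℕ} (h : l.Pairwise (· < ·)) : thetaSign l = 1 := by
  induction l with
  | nil => simp [thetaSign, inversions_nil]
  | cons x t ih =>
    rw [List.pairwise_cons] at h
    rw [thetaSign_cons, ih h.2, mul_one, List.prod_eq_one]
    intro y hy
    obtain ⟨z, hz, rfl⟩ := List.mem_map.1 hy
    rw [Int.sign_eq_one_of_pos (by have := h.1 z hz; omega)]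
    simp

lemma thetaSign_sort (A : Finset ℕ) : thetaSign A.sort = 1 :=
  thetaSign_of_pairwise (sortedLT_sort A).pairwise

lemma thetaSign_mul_self {l : List ℕ} (h : l.Nodup) : thetaSign l * thetaSign l = 1 := by
  rw [thetaSign, if_pos h, ← mul_pow]; norm_num

lemma thetaSign_ne_zero {l : List ℕ} (h : l.Nodup) : thetaSign l ≠ 0 := fun h0 => by
  simpa [h0] using thetaSign_mul_self h

/-! ### The circles of a step -/

lemma Forall₂.exists_right {α β : Type*} {R : α → β → Prop} {l : List α} {l' : List β}
    (h : List.Forall₂ R l l') {x : α} (hx : x ∈ l) : ∃ y ∈ l', R x y := by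
  induction h with
  | nil => simp at hx
  | cons h _ ih =>
    rcases List.mem_cons.1 hx with rfl | hx
    · exact ⟨_, List.mem_cons_self, h⟩
    · obtain ⟨y, hy, hxy⟩ := ih hx
      exact ⟨y, List.mem_cons_of_mem _ hy, hxy⟩

lemma Forall₂.exists_left {α β : Type*} {R : α → β → Prop} {l : List α} {l' : List β}
    (h : List.Forall₂ R l l') {y : β} (hy : y ∈ l') : ∃ x ∈ l, R x y :=
  Forall₂.exists_right h.flip hy

/-- The motion of a circle, in terms of the rows. -/
def RowMove (κ : Kind) (M P : ℕ →₀ ℕ) (r t : ℕ) : Prop :=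
  if P r = M r then t = r
  else match κ with
    | .first => t = r + 1
    | .second => (t = r ∧ RoomAbove M P r) ∨ (t = r + 1 ∧ P t = M r)

lemma circleMove_iff {κ : Kind} {M N : SPar} {r t : ℕ} :
    CircleMove κ M N r t ↔ RowMove κ M.rows N.rows r t := Iff.rfl

lemma RowMove.eq_or {κ : Kind} {M P : ℕ →₀ ℕ} {r t : ℕ} (h : RowMove κ M P r t) :
    t = r ∨ t = r + 1 := by
  unfold RowMove at h
  split_ifs at h with h1
  · exact Or.inl h
  · cases κ with
    | first => exact Or.inr h
    | second => exact h.imp And.left And.left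

lemma RowMove.corner {κ : Kind} {M P : ℕ →₀ ℕ} (hs : HStrip M P) {r t : ℕ}
    (h : RowMove κ M P r t) (hr : RoomAbove M M r) : RoomAbove P P t := by
  rintro q rfl
  have h1 := hs q; have h2 := hs r
  unfold RowMove at h
  split_ifs at h with h0
  · subst h; have := hr q rfl; omega
  · cases κ with
    | first => obtain rfl : q = r := by simpa using h
               omega
    | second =>
      rcases h with ⟨rfl, h⟩ | ⟨h, h'⟩
      · have := h q rfl; omega
      · obtain rfl : q = r := by simpa using h
        omega

open Classical in
/-- The possible new rows of a circle. -/
def rowMoves (κ : Kind) (M P : ℕ →₀ ℕ) (r : ℕ) : Finset ℕ :=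
  ({r, r + 1} : Finset ℕ).filter (RowMove κ M P r)

lemma mem_rowMoves {κ : Kind} {M P : ℕ →₀ ℕ} {r t : ℕ} :
    t ∈ rowMoves κ M P r ↔ RowMove κ M P r t := by
  simp only [rowMoves, mem_filter, mem_insert, mem_singleton, and_iff_right_iff_imp]
  exact RowMove.eq_or

lemma stepImage_eq_sum {κ : Kind} {M P : ℕ →₀ ℕ} (hs : HStrip M P) {r : ℕ}
    (hr : RoomAbove M M r) : stepImage κ M P r = ∑ t ∈ rowMoves κ M P r, rowVec t := by
  classical
  have hroom : P r = M r → RoomAbove M P r := fun h q hq => by rw [h]; exact hr q hq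
  rw [rowMoves, sum_filter, sum_pair (by omega)]
  have h1 := hs r
  cases κ with
  | first =>
    simp only [stepImage, RowMove]
    by_cases h : P r = M r <;> simp [h]
  | second =>
    simp only [stepImage, RowMove]
    by_cases h : P r = M r
    · simp [h, hroom h]
    · have h' : M r < P r := by omega
      by_cases h2 : RoomAbove M P r <;> by_cases h3 : P (r + 1) = M r <;> simp [h, h', h2, h3]

/-- Attach a head to a list. -/
def consEmb : ℕ × List ℕ ↪ List ℕ where
  toFun p := p.1 :: p.2
  inj' p q h := by
    rw [List.cons.injEq] at h
    exact Prod.ext h.1 h.2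

lemma consEmb_apply (p : ℕ × List ℕ) : consEmb p = p.1 :: p.2 := rfl

/-- The possible new rows of several circles. -/
def moves (κ : Kind) (M P : ℕ →₀ ℕ) : List ℕ → Finset (List ℕ)
  | [] => {[]}
  | r :: C => (rowMoves κ M P r ×ˢ moves κ M P C).map consEmb

lemma mem_moves {κ : Kind} {M P : ℕ →₀ ℕ} {C D : List ℕ} :
    D ∈ moves κ M P C ↔ List.Forall₂ (RowMove κ M P) C D := by
  induction C generalizing D with
  | nil => simp [moves]
  | cons r C ih =>
    simp only [moves, mem_map, mem_product, consEmb_apply, Prod.exists, ih,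
      mem_rowMoves, List.forall₂_cons_left_iff]
    constructor
    · rintro ⟨t, D', ⟨h1, h2⟩, rfl⟩; exact ⟨t, D', h1, h2, rfl⟩
    · rintro ⟨t, D', h1, h2, rfl⟩; exact ⟨t, D', ⟨h1, h2⟩, rfl⟩

/-- The exterior product of the rows of a list. -/
def rowWedge (C : List ℕ) : Wedge := (C.map fun r => rowι (rowVec r)).prod

@[simp] lemma rowWedge_nil : rowWedge [] = 1 := rfl

lemma rowWedge_cons (r : ℕ) (C : List ℕ) : rowWedge (r :: C) = rowι (rowVec r) * rowWedge C := by
  rw [rowWedge, List.map_cons, List.prod_cons, rowWedge]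

lemma rowWedge_eq_ιMulti (C : List ℕ) :
    rowWedge C = ExteriorAlgebra.ιMulti ℚ C.length fun i => rowVec (C.get i) := by
  rw [ExteriorAlgebra.ιMulti_apply, rowWedge]
  congr 1
  rw [← List.ofFn_get C, List.map_ofFn]
  simp
  rfl

lemma rowWedge_of_not_nodup {C : List ℕ} (h : ¬ C.Nodup) : rowWedge C = 0 := by
  rw [rowWedge_eq_ιMulti]
  rw [List.nodup_iff_injective_get, Function.Injective] at h
  push Not at h
  obtain ⟨i, j, hij, hne⟩ := h
  exact AlternatingMap.map_eq_zero_of_eq _ _ (by simp only [hij]) hne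

lemma map_rowWedge {κ : Kind} {M P : ℕ →₀ ℕ} (hs : HStrip M P) {C : List ℕ}
    (hC : ∀ r ∈ C, RoomAbove M M r) :
    ExteriorAlgebra.map (stepMap κ M P) (rowWedge C) = ∑ D ∈ moves κ M P C, rowWedge D := by
  induction C with
  | nil => simp [moves]
  | cons r C ih =>
    rw [rowWedge_cons, map_mul, ih fun r hr => hC r (List.mem_cons_of_mem _ hr),
      ExteriorAlgebra.map_apply_ι, stepMap_rowVec, stepImage_eq_sum hs (hC r List.mem_cons_self),
      map_sum, sum_mul_sum, moves, sum_map, sum_product]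
    simp only [consEmb_apply, rowWedge_cons]

lemma pairwise_of_moves {κ : Kind} {M P : ℕ →₀ ℕ} {C D : List ℕ} (hC : C.Pairwise (· < ·))
    (h : List.Forall₂ (RowMove κ M P) C D) (hD : D.Nodup) : D.Pairwise (· < ·) := by
  induction h with
  | nil => exact List.Pairwise.nil
  | @cons _ s _ _ h h' ih =>
    rw [List.pairwise_cons] at hC ⊢
    rw [List.nodup_cons] at hD
    refine ⟨fun t ht => ?_, ih hC.2 hD.2⟩
    obtain ⟨r, hr, hrt⟩ := Forall₂.exists_left h' ht
    have h1 := hC.1 r hr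
    have h2 := h.eq_or; have h3 := hrt.eq_or
    have h4 : t ≠ s := by rintro rfl; exact hD.1 ht
    omega

/-! ### Insertion of a row -/

/-- The position at which `t` has to be inserted in an increasing list. -/
def rowPos (D : List ℕ) (t : ℕ) : ℕ := D.countP (· < t)

lemma rowPos_le (D : List ℕ) (t : ℕ) : rowPos D t ≤ D.length := List.countP_le_length

lemma rowPos_cons_of_lt {x t : ℕ} {D : List ℕ} (h : x < t) :
    rowPos (x :: D) t = rowPos D t + 1 := by
  simp [rowPos, h]

lemma rowPos_eq_zero {t : ℕ} {D : List ℕ} (h : ∀ x ∈ D, t ≤ x) : rowPos D t = 0 := by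
  rw [rowPos, List.countP_eq_zero]
  intro x hx
  have := h x hx
  simpa using this

lemma mem_insertRow {D : List ℕ} {k t s : ℕ} (hk : k ≤ D.length) :
    s ∈ D.insertIdx k t ↔ s = t ∨ s ∈ D := List.mem_insertIdx hk

lemma pairwise_insertRow {D : List ℕ} (hD : D.Pairwise (· < ·)) {t : ℕ} (ht : t ∉ D) :
    (D.insertIdx (rowPos D t) t).Pairwise (· < ·) := by
  induction D with
  | nil => simp [rowPos]
  | cons x D ih =>
    rw [List.mem_cons, not_or] at ht
    have hD' := List.pairwise_cons.1 hD
    rcases lt_or_gt_of_ne ht.1 with h | h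
    · rw [rowPos_eq_zero]
      · rw [List.insertIdx_zero, List.pairwise_cons]
        refine ⟨fun y hy => ?_, hD⟩
        rcases List.mem_cons.1 hy with rfl | hy
        · exact h
        · exact h.trans (hD'.1 y hy)
      · intro y hy
        rcases List.mem_cons.1 hy with rfl | hy
        · exact h.le
        · exact (h.trans (hD'.1 y hy)).le
    · rw [rowPos_cons_of_lt h, List.insertIdx_succ_cons, List.pairwise_cons]
      refine ⟨fun y hy => ?_, ih hD'.2 ht.2⟩
      rcases (mem_insertRow (rowPos_le _ _)).1 hy with rfl | hy
      · exact h
      · exact hD'.1 y hy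

lemma rowPos_eraseIdx {E : List ℕ} (hE : E.Pairwise (· < ·)) {k t : ℕ} (h : E[k]? = some t) :
    rowPos (E.eraseIdx k) t = k ∧ t ∉ E.eraseIdx k ∧ (E.eraseIdx k).insertIdx k t = E := by
  induction E generalizing k with
  | nil => simp at h
  | cons x E ih =>
    rw [List.pairwise_cons] at hE
    rcases k with _ | k
    · obtain rfl : x = t := by simpa using h
      simp only [List.eraseIdx_zero, List.tail_cons, List.insertIdx_zero, and_true]
      exact ⟨rowPos_eq_zero fun y hy => (hE.1 y hy).le, fun hx => lt_irrefl _ (hE.1 _ hx)⟩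
    · rw [List.getElem?_cons_succ] at h
      obtain ⟨h1, h2, h3⟩ := ih hE.2 h
      have hlt : x < t := hE.1 t (List.mem_of_getElem? h)
      rw [List.eraseIdx_cons_succ, List.insertIdx_succ_cons, h3, rowPos_cons_of_lt hlt, h1,
        List.mem_cons, not_or]
      exact ⟨rfl, ⟨hlt.ne', h2⟩, rfl⟩

lemma rowWedge_mul_rowVec (D : List ℕ) (t k : ℕ) (hk : k ≤ D.length) :
    rowWedge D * rowι (rowVec t) = (-1 : ℚ) ^ (D.length - k) • rowWedge (D.insertIdx k t) := by
  induction D generalizing k with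
  | nil =>
    obtain rfl : k = 0 := by simpa using hk
    simp [rowWedge]
  | cons x D ih =>
    rcases k with _ | k
    · rw [rowWedge_cons, mul_assoc, ih 0 (Nat.zero_le _), List.insertIdx_zero,
        List.insertIdx_zero, rowWedge_cons, rowWedge_cons, rowWedge_cons, mul_smul_comm,
        ← mul_assoc, ← mul_assoc, rowι_mul_swap (rowVec t), List.length_cons, neg_mul, smul_neg,
        Nat.sub_zero, Nat.sub_zero, pow_succ, mul_neg_one, neg_smul, neg_neg]
    · rw [rowWedge_cons, mul_assoc, ih k (by simpa using hk), List.insertIdx_succ_cons,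
        rowWedge_cons, mul_smul_comm, List.length_cons, Nat.add_sub_add_right]

lemma inversions_insertIdx {l : List ℕ} {i : ℕ} (hl : ∀ j ∈ l, j < i) {k : ℕ}
    (hk : k ≤ l.length) : inversions (l.insertIdx k i) = inversions l + (l.length - k) := by
  induction l generalizing k with
  | nil =>
    obtain rfl : k = 0 := by simpa using hk
    simp [inversions_cons]
  | cons x l ih =>
    rcases k with _ | k
    · rw [List.insertIdx_zero, inversions_cons, add_comm, Nat.sub_zero]
      congr 1
      rw [List.countP_eq_length]
      intro j hj
      simpa using hl j hj
    · rw [List.insertIdx_succ_cons, inversions_cons, inversions_cons,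
        ih (fun j hj => hl j (List.mem_cons_of_mem _ hj)) (by simpa using hk),
        List.length_cons, Nat.add_sub_add_right, ← add_assoc]
      congr 2
      rw [(List.perm_insertIdx i l (by simpa using hk)).countP_eq, List.countP_cons]
      have := hl x List.mem_cons_self
      simp [this.le]

/-! ### New circles -/

theorem isNewCircle_iff {κ : Kind} {M N : SPar} {k t : ℕ} (hs : HStrip M.plus N.plus)
    (ht : N.circleRows[k]? = some t)
    (hmv : List.Forall₂ (RowMove κ M.rows N.rows) M.circleRows (N.circleRows.eraseIdx k)) :
    IsNewCircle κ M N t ↔ NewRow κ M.rows N.rows t := by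
  have htE : t ∈ N.circleRows := List.mem_of_getElem? ht
  have hcor : ∀ q, q + 1 = t → N.plus t < N.plus q := N.roomAbove_of_mem htE
  have hMa := M.plus_antitone
  have hNa := N.plus_antitone
  cases κ with
  | first =>
    simp only [IsNewCircle, NewRow]
    refine and_congr ?_ ?_
    · constructor
      · rintro h q rfl
        by_contra hq
        exact h ⟨q, not_lt.1 hq, hcor q rfl⟩
      · rintro h ⟨r, h1, h2⟩
        have hrt : r < t := by
          by_contra h'
          have := hNa (not_lt.1 h'); omega
        obtain ⟨q, rfl⟩ : ∃ q, t = q + 1 := ⟨t - 1, by omega⟩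
        have h3 : N.plus (q + 1) < M.plus q := h q rfl
        have := hMa (show r ≤ q by omega); omega
    · constructor
      · intro h r hr hroom
        obtain ⟨q, rfl⟩ : ∃ q, r = q + 1 := ⟨r - 1, by omega⟩
        have h3 : N.plus (q + 1) < M.plus q := hroom q rfl
        have h4 := (hs q).1
        have h5 := hNa (show t ≤ q by omega)
        obtain ⟨r', h6, h7⟩ := h (N.plus (q + 1)) (by omega)
        have h8 : r' < q + 1 := by
          by_contra h'
          have := hNa (not_lt.1 h'); omega
        have := hMa (show r' ≤ q by omega)
        omega
      · intro h c hc
        have hex : ∃ r, M.plus r ≤ c := ⟨M.parts.length, by rw [M.plus_eq_zero le_rfl]; omega⟩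
        classical
        refine ⟨Nat.find hex, Nat.find_spec hex, ?_⟩
        set r := Nat.find hex
        by_cases hr : r ≤ t
        · have := hNa hr; omega
        · obtain ⟨q, hq⟩ : ∃ q, r = q + 1 := ⟨r - 1, by omega⟩
          have h1 : ¬ M.plus q ≤ c := Nat.find_min hex (by omega)
          have h2 := h r (by omega)
          by_contra h3
          refine h2 fun q' hq' => ?_
          obtain rfl : q' = q := by omega
          change N.plus r < M.plus q'
          omega
  | second =>
    obtain ⟨-, htD, hins⟩ := rowPos_eraseIdx N.circleRows_pairwise ht
    set D := N.circleRows.eraseIdx k with hD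
    have hklt : k < N.circleRows.length := (List.getElem?_eq_some_iff.1 ht).1
    have hE : ∀ r, r ∈ N.circleRows ↔ r = t ∨ r ∈ D := by
      intro r
      conv_lhs => rw [← hins]
      refine mem_insertRow ?_
      rw [hD, List.length_eraseIdx_of_lt hklt]; omega
    have hMcor : ∀ r ∈ M.circleRows, ∀ q, q + 1 = r → M.plus r < M.plus q :=
      fun r hr => M.roomAbove_of_mem hr
    have hfw : ∀ r ∈ M.circleRows, ∃ s ∈ D, RowMove .second M.rows N.rows r s :=
      fun r hr => Forall₂.exists_right hmv hr
    have hbw : ∀ s ∈ D, ∃ r ∈ M.circleRows, RowMove .second M.rows N.rows r s :=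
      fun s hs => Forall₂.exists_left hmv hs
    have hmove : ∀ r s, RowMove .second M.rows N.rows r s → (N.plus r = M.plus r ∧ s = r) ∨
        (N.plus r ≠ M.plus r ∧ ((s = r ∧ ∀ q, q + 1 = r → N.plus r < M.plus q) ∨
          (s = r + 1 ∧ N.plus s = M.plus r))) := by
      intro r s h
      unfold RowMove at h
      split_ifs at h with h0
      · exact Or.inl ⟨h0, h⟩
      · exact Or.inr ⟨h0, h⟩
    have hstay : ∀ r ∈ M.circleRows, N.plus r = M.plus r → r ∈ D := by
      intro r hr h
      obtain ⟨s, hs1, hs2⟩ := hfw r hr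
      rcases hmove r s hs2 with h1 | h1
      · exact h1.2 ▸ hs1
      · exact absurd h h1.1
    simp only [IsNewCircle, NewRow, SPar.coe_rows, HStrip, SPar.oplus_eq]
    constructor
    · rintro ⟨h1, h2, h3⟩
      have heq : ∀ r < t, M.plus r + (if r ∈ M.circleRows then 1 else 0) =
          N.plus r + if r ∈ N.circleRows then 1 else 0 := by
        intro r hr
        refine le_antisymm (h1 r).1 ?_
        by_contra h4
        have h5 := h3 r _ le_rfl (not_le.1 h4)
        obtain ⟨q, rfl⟩ : ∃ q, t = q + 1 := ⟨t - 1, by omega⟩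
        have h6 := (h1 q).2
        rw [if_pos htE] at h6
        have h7 := hMa (show r ≤ q by omega)
        rcases Nat.lt_or_ge r q with h | h
        · have h8 : (if q ∈ M.circleRows then 1 else 0) ≤ M.plus r - M.plus q := by
            split_ifs with hq
            · obtain ⟨q', rfl⟩ : ∃ q', q = q' + 1 := ⟨q - 1, by omega⟩
              have := hMcor _ hq q' rfl
              have := hMa (show r ≤ q' by omega)
              omega
            · omega
          omega
        · obtain rfl : r = q := by omega
          omega
      have hrow : ∀ r < t, N.plus r = M.plus r := by
        intro r hr
        by_contra hne
        have h4 := heq r hr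
        have h5 := (hs r).1
        have hrC : r ∈ M.circleRows := by
          by_contra h; rw [if_neg h] at h4; omega
        have hrE : r ∉ N.circleRows := by
          intro h; rw [if_pos h, if_pos hrC] at h4; omega
        obtain ⟨s, hsD, hs2⟩ := hfw r hrC
        rcases hmove r s hs2 with h6 | ⟨-, ⟨rfl, -⟩ | ⟨rfl, h6⟩⟩
        · exact hne h6.1
        · exact hrE ((hE s).2 (Or.inr hsD))
        · have h7 : r + 1 ≠ t := fun h => htD (h ▸ hsD)
          have h8 := heq (r + 1) (by omega)
          rw [if_pos ((hE _).2 (Or.inr hsD))] at h8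
          have h9 : M.plus (r + 1) + (if r + 1 ∈ M.circleRows then 1 else 0) ≤ M.plus r := by
            split_ifs with h
            · exact hMcor _ h r rfl
            · exact M.plus_succ_le r
          omega
      refine ⟨?_, hrow⟩
      rintro q rfl
      have := hcor q rfl
      rw [hrow q (by omega)] at this
      exact this
    · rintro ⟨hroom, hrow⟩
      have hroom' : ∀ q, q + 1 = t → N.plus t < M.plus q := hroom
      refine ⟨fun r => ⟨?_, ?_⟩, ?_, ?_⟩
      · have h1 := (hs r).1
        split_ifs with a b b
        · omega
        · have : N.plus r ≠ M.plus r := fun h => b ((hE r).2 (Or.inr (hstay r a h)))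
          omega
        · omega
        · omega
      · have h1 := (hs r).2
        split_ifs with a b b
        · omega
        · rcases (hE _).1 a with h | h
          · have := hroom' r h; rw [← h] at this; omega
          · obtain ⟨r', hr', hmv'⟩ := hbw _ h
            rcases hmove r' _ hmv' with ⟨h2, h3⟩ | ⟨h2, ⟨h3, h4⟩ | ⟨h3, h4⟩⟩
            · subst h3
              have := hMcor _ hr' r rfl; omega
            · subst h3
              have := h4 r rfl; omega
            · obtain rfl : r = r' := by omega
              exact absurd hr' b
        · omega
        · omega
      · have h1 := (hs t).1
        split_ifs with a
        · have : N.plus t ≠ M.plus t := fun h => htD (hstay t a h)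
          omega
        · omega
      · intro r c h1 h2
        rcases Nat.lt_or_ge r t with h | h
        · exfalso
          have h3 := hrow r h
          split_ifs at h1 h2 with a b b
          · omega
          · omega
          · rcases (hE _).1 b with h4 | h4
            · omega
            · obtain ⟨r', hr', hmv'⟩ := hbw _ h4
              have h5 := hmv'.eq_or
              rcases hmove r' _ hmv' with ⟨h2, h3⟩ | ⟨h2, -⟩
              · subst h3; exact a hr'
              · exact h2 (hrow r' (by omega))
          · omega
        · have h3 := hNa h
          split_ifs at h2 <;> omega

/-! ### Sums over the steps from a given superpartition -/

lemma HStrip.antitone {M P : ℕ →₀ ℕ} (hs : HStrip M P) (r : ℕ) : P (r + 1) ≤ P r :=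
  (hs r).2.trans (hs r).1

open Classical in
/-- The superpartition with given rows and circles. -/
def ofRows (P : ℕ →₀ ℕ) (E : List ℕ) : SPar :=
  if h : ∃ N : SPar, N.rows = P ∧ N.circleRows = E then h.choose else SPar.empty

lemma ofRows_spec {P : ℕ →₀ ℕ} (hP : ∀ r, P (r + 1) ≤ P r) {E : List ℕ} (hE : E.Pairwise (· < ·))
    (hc : ∀ r ∈ E, RoomAbove P P r) : (ofRows P E).rows = P ∧ (ofRows P E).circleRows = E := by
  have h := SPar.exists_rows hP hE hc
  rw [ofRows, dif_pos h]
  exact h.choose_spec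

lemma ofRows_eq {N : SPar} : ofRows N.rows N.circleRows = N := by
  have h := ofRows_spec (P := N.rows) N.plus_succ_le N.circleRows_pairwise
    fun r hr => N.roomAbove_of_mem hr
  exact SPar.ext_rows (congrArg DFunLike.coe h.1) h.2

section

variable {κ : Kind} {i : ℕ} {M : SPar} {l : List ℕ} {P : ℕ →₀ ℕ} (hs : HStrip M.rows P)

lemma forall₂_roomAbove (hs : HStrip M.rows P) {D : List ℕ}
    (h : List.Forall₂ (RowMove κ M.rows P) M.circleRows D) : ∀ t ∈ D, RoomAbove P P t := by
  intro t ht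
  obtain ⟨r, hr, hrt⟩ := Forall₂.exists_left h ht
  exact hrt.corner hs (M.roomAbove_of_mem hr)

lemma NewRow.corner {M P : ℕ →₀ ℕ} (hs : HStrip M P) {t : ℕ} (h : NewRow κ M P t) :
    RoomAbove P P t := fun q hq => (h.room q hq).trans_le (hs q).1

include hs in
lemma exists_next_unbarred : ∃ S : Finset (SPar × List ℕ),
    (∀ x, x ∈ S ↔ x.1.rows = P ∧ Step κ i M l x.1 x.2 ∧ x.1.df = M.df) ∧
    ∑ x ∈ S, (-1 : ℚ) ^ inversions x.2 • rowWedge x.1.circleRows =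
      (-1 : ℚ) ^ inversions l • transfer κ false M.rows P (rowWedge M.circleRows) := by
  classical
  set S0 := (moves κ M.rows P M.circleRows).filter List.Nodup with hS0
  have hspec : ∀ D ∈ S0, (ofRows P D).rows = P ∧ (ofRows P D).circleRows = D := by
    intro D hD
    rw [hS0, mem_filter, mem_moves] at hD
    exact ofRows_spec hs.antitone (pairwise_of_moves M.circleRows_pairwise hD.1 hD.2)
      (forall₂_roomAbove hs hD.1)
  refine ⟨S0.image fun D => (ofRows P D, l), ?_, ?_⟩
  · rintro ⟨N, l'⟩
    rw [mem_image]
    constructor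
    · rintro ⟨D, hD, h⟩
      obtain ⟨rfl, rfl⟩ := Prod.mk.inj h
      obtain ⟨h1, h2⟩ := hspec D hD
      rw [hS0, mem_filter, mem_moves] at hD
      have hf : List.Forall₂ (CircleMove κ M (ofRows P D)) M.circleRows
          (ofRows P D).circleRows := by
        rw [h2]
        exact hD.1.imp fun r t h => circleMove_iff.2 (h1.symm ▸ h)
      refine ⟨h1, ⟨?_, Or.inl ⟨hf, rfl⟩⟩, ?_⟩
      · change HStrip M.rows (ofRows P D).rows
        rw [h1]; exact hs
      · rw [← SPar.length_circleRows, ← SPar.length_circleRows]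
        exact hf.length_eq.symm
    · rintro ⟨h1, ⟨-, h2⟩, h3⟩
      dsimp only at h1 h2 h3
      rcases h2 with ⟨h2, rfl⟩ | ⟨k, t, hk, -, h2, -⟩
      · refine ⟨N.circleRows, ?_, ?_⟩
        · rw [hS0, mem_filter, mem_moves]
          exact ⟨h2.imp fun r t h => h1 ▸ circleMove_iff.1 h, N.circleRows_nodup⟩
        · rw [← h1, ofRows_eq]
      · exfalso
        have h4 := h2.length_eq
        have h5 := (List.getElem?_eq_some_iff.1 hk).1
        rw [List.length_eraseIdx_of_lt h5, SPar.length_circleRows, SPar.length_circleRows] at h4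
        rw [SPar.length_circleRows] at h5
        omega
  · rw [sum_image]
    · rw [transfer, map_rowWedge hs fun r hr => M.roomAbove_of_mem hr, cond_false, mul_one,
        smul_sum, hS0, sum_filter]
      refine sum_congr rfl fun D hD => ?_
      split_ifs with h
      · rw [(hspec D (mem_filter.2 ⟨hD, h⟩)).2]
      · rw [rowWedge_of_not_nodup h, smul_zero]
    · intro D hD D' hD' h
      have h1 := congrArg SPar.circleRows (Prod.mk.inj h).1
      rwa [(hspec D hD).2, (hspec D' hD').2] at h1

include hs in
lemma exists_next_barred (hl : l.length = M.df) (hlt : ∀ j ∈ l, j < i) :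
    ∃ S : Finset (SPar × List ℕ),
    (∀ x, x ∈ S ↔ x.1.rows = P ∧ Step κ i M l x.1 x.2 ∧ x.1.df = M.df + 1) ∧
    ∑ x ∈ S, (-1 : ℚ) ^ inversions x.2 • rowWedge x.1.circleRows =
      (-1 : ℚ) ^ inversions l • transfer κ true M.rows P (rowWedge M.circleRows) := by
  classical
  set S0 := (moves κ M.rows P M.circleRows ×ˢ range (rowBound M.rows)).filter
    (fun p => NewRow κ M.rows P p.2 ∧ p.1.Nodup ∧ p.2 ∉ p.1) with hS0
  have hS0' : ∀ p, p ∈ S0 ↔ List.Forall₂ (RowMove κ M.rows P) M.circleRows p.1 ∧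
      NewRow κ M.rows P p.2 ∧ p.1.Nodup ∧ p.2 ∉ p.1 := by
    intro p
    rw [hS0, mem_filter, mem_product, mem_moves, mem_range]
    exact ⟨fun h => ⟨h.1.1, h.2⟩, fun h => ⟨⟨h.1, h.2.1.room.lt_rowBound⟩, h.2⟩⟩
  have hlen : ∀ p ∈ S0, p.1.length = l.length := fun p hp => by
    rw [hl, ← SPar.length_circleRows, ((hS0' p).1 hp).1.length_eq]
  set ins : List ℕ × ℕ → List ℕ := fun p => p.1.insertIdx (rowPos p.1 p.2) p.2 with hins
  have hpw : ∀ p ∈ S0, (ins p).Pairwise (· < ·) := by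
    intro p hp
    obtain ⟨h1, h2, h3, h4⟩ := (hS0' p).1 hp
    exact pairwise_insertRow (pairwise_of_moves M.circleRows_pairwise h1 h3) h4
  have hspec : ∀ p ∈ S0, (ofRows P (ins p)).rows = P ∧ (ofRows P (ins p)).circleRows = ins p := by
    intro p hp
    obtain ⟨h1, h2, h3, h4⟩ := (hS0' p).1 hp
    refine ofRows_spec hs.antitone (hpw p hp) fun r hr => ?_
    rcases (mem_insertRow (rowPos_le _ _)).1 hr with rfl | hr
    · exact h2.corner hs
    · exact forall₂_roomAbove hs h1 r hr
  have hget : ∀ p ∈ S0, (ins p)[rowPos p.1 p.2]? = some p.2 := fun p hp =>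
    List.getElem?_insertIdx_self.trans (if_pos (rowPos_le _ _))
  have her : ∀ p : List ℕ × ℕ, (ins p).eraseIdx (rowPos p.1 p.2) = p.1 := fun p =>
    List.eraseIdx_insertIdx_self ..
  have hil : i ∉ l := fun h => lt_irrefl _ (hlt i h)
  refine ⟨S0.image fun p => (ofRows P (ins p), l.insertIdx (rowPos p.1 p.2) i), ?_, ?_⟩
  · rintro ⟨N, l'⟩
    rw [mem_image]
    constructor
    · rintro ⟨p, hp, h⟩
      obtain ⟨rfl, rfl⟩ := Prod.mk.inj h
      obtain ⟨h1, h2⟩ := hspec p hp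
      obtain ⟨h3, h4, -, -⟩ := (hS0' p).1 hp
      have hs' : HStrip M.plus (ofRows P (ins p)).plus := by
        change HStrip M.rows (ofRows P (ins p)).rows
        rw [h1]; exact hs
      have hg : (ofRows P (ins p)).circleRows[rowPos p.1 p.2]? = some p.2 := by
        rw [h2]; exact hget p hp
      have hf : List.Forall₂ (RowMove κ M.rows (ofRows P (ins p)).rows) M.circleRows
          ((ofRows P (ins p)).circleRows.eraseIdx (rowPos p.1 p.2)) := by
        rw [h2, her, h1]; exact h3
      refine ⟨h1, ⟨hs', Or.inr ⟨rowPos p.1 p.2, p.2, hg, ?_, ?_, rfl⟩⟩, ?_⟩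
      · rw [isNewCircle_iff hs' hg hf, h1]; exact h4
      · exact hf.imp fun r t h => circleMove_iff.2 h
      · rw [← SPar.length_circleRows, h2, hins, List.length_insertIdx_of_le_length (rowPos_le _ _),
          hlen p hp, hl]
    · rintro ⟨h1, ⟨hs', h2⟩, h3⟩
      dsimp only at h1 h2 h3 hs'
      rcases h2 with ⟨h2, -⟩ | ⟨k, t, hk, hnew, h2, rfl⟩
      · exfalso
        have h4 := h2.length_eq
        rw [SPar.length_circleRows, SPar.length_circleRows] at h4
        omega
      · have h2' : List.Forall₂ (RowMove κ M.rows N.rows) M.circleRows (N.circleRows.eraseIdx k) :=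
          h2.imp fun r t h => circleMove_iff.1 h
        obtain ⟨e1, e2, e3⟩ := rowPos_eraseIdx N.circleRows_pairwise hk
        refine ⟨(N.circleRows.eraseIdx k, t), ?_, ?_⟩
        · rw [hS0']
          refine ⟨h1 ▸ h2', ?_, N.circleRows_nodup.eraseIdx k, e2⟩
          rw [← h1]
          exact (isNewCircle_iff hs' hk h2').1 hnew
        · simp only [hins, e1, e3]
          rw [← h1, ofRows_eq]
  · rw [sum_image]
    · rw [transfer, map_rowWedge hs fun r hr => M.roomAbove_of_mem hr, cond_true, stepVec,
        map_sum, sum_mul_sum, ← sum_product', smul_sum, hS0, sum_filter]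
      refine sum_congr rfl fun p hp => ?_
      by_cases hn : NewRow κ M.rows P p.2
      · rw [if_pos hn]
        split_ifs with h
        · have hpS : p ∈ S0 := mem_filter.2 ⟨hp, h⟩
          rw [(hspec p hpS).2, rowWedge_mul_rowVec p.1 p.2 _ (rowPos_le _ _), smul_smul, ← pow_add,
            inversions_insertIdx hlt (by rw [← hlen p hpS]; exact rowPos_le _ _), hlen p hpS]
        · have h' : ¬ (ins p).Nodup := by
            intro hnd
            refine h ⟨hn, ?_, ?_⟩
            · rw [← her p]; exact hnd.eraseIdx _
            · have := (List.perm_insertIdx p.2 p.1 (rowPos_le p.1 p.2)).nodup_iff.1 hnd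
              exact (List.nodup_cons.1 this).1
          rw [rowWedge_mul_rowVec p.1 p.2 _ (rowPos_le _ _), rowWedge_of_not_nodup h', smul_zero,
            smul_zero]
      · rw [if_neg hn, if_neg fun h => hn h.1, map_zero, mul_zero, smul_zero]
    · intro p hp q hq h
      obtain ⟨h1, h2⟩ := Prod.mk.inj h
      have h3 := congrArg SPar.circleRows h1
      rw [(hspec p hp).2, (hspec q hq).2] at h3
      have hk : rowPos p.1 p.2 = rowPos q.1 q.2 := by
        have e : ∀ p ∈ S0, (l.insertIdx (rowPos p.1 p.2) i).idxOf i = rowPos p.1 p.2 := by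
          intro p hp
          have hle : rowPos p.1 p.2 ≤ l.length := by rw [← hlen p hp]; exact rowPos_le _ _
          generalize rowPos p.1 p.2 = k at hle
          clear * - hil hle
          induction l generalizing k with
          | nil => obtain rfl : k = 0 := by simpa using hle
                   simp
          | cons x l ih =>
            rw [List.mem_cons, not_or] at hil
            rcases k with _ | k
            · simp
            · rw [List.insertIdx_succ_cons, List.idxOf_cons_ne _ (Ne.symm hil.1),
                ih hil.2 k (by simpa using hle)]
        rw [← e p hp, ← e q hq, h2]
      refine Prod.ext ?_ ?_
      · rw [← her p, ← her q, h3, hk]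
      · have e1 := hget p hp
        have e2 := hget q hq
        rw [h3, hk, e2] at e1
        exact (Option.some.inj e1).symm

end

lemma degree_finite {M : ℕ →₀ ℕ} {P : ℕ →₀ ℕ} (hs : HStrip M P) :
    P ∈ Finset.finsuppAntidiag (range (rowBound M)) P.degree := by
  have hsub : P.support ⊆ range (rowBound M) := by
    intro r hr
    rw [mem_range]
    rw [Finsupp.mem_support_iff] at hr
    rcases r with _ | r
    · have := rowBound_pos M; omega
    · have h1 := (hs r).2
      have := rowBound_spec (M := M) (r := r) (by omega)
      omega
  rw [Finset.mem_finsuppAntidiag]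
  refine ⟨?_, hsub⟩
  rw [Finsupp.degree_apply]
  exact (sum_subset hsub fun r _ hr => by simpa using hr).symm

open Classical in
theorem exists_next (κ : Kind) {i : ℕ} (b : Bool) (a : ℕ) {M : SPar} {l : List ℕ}
    (hl : l.length = M.df) (hlt : ∀ j ∈ l, j < i) : ∃ S : Finset (SPar × List ℕ),
    (∀ x, x ∈ S ↔ Step κ i M l x.1 x.2 ∧ x.1.deg = M.deg + a ∧ x.1.df = M.df + b.toNat) ∧
    ∀ P : ℕ →₀ ℕ, ∑ x ∈ S with x.1.rows = P, (-1 : ℚ) ^ inversions x.2 • rowWedge x.1.circleRows =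
      if HStrip M.rows P ∧ P.degree = M.rows.degree + a then
        (-1 : ℚ) ^ inversions l • transfer κ b M.rows P (rowWedge M.circleRows) else 0 := by
  have key : ∀ P : ℕ →₀ ℕ, HStrip M.rows P → ∃ S : Finset (SPar × List ℕ),
      (∀ x, x ∈ S ↔ x.1.rows = P ∧ Step κ i M l x.1 x.2 ∧ x.1.df = M.df + b.toNat) ∧
      ∑ x ∈ S, (-1 : ℚ) ^ inversions x.2 • rowWedge x.1.circleRows =
        (-1 : ℚ) ^ inversions l • transfer κ b M.rows P (rowWedge M.circleRows) := by
    intro P hs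
    cases b
    · exact exists_next_unbarred hs
    · exact exists_next_barred hs hl hlt
  choose S hS1 hS2 using key
  set Ps := (Finset.finsuppAntidiag (range (rowBound M.rows)) (M.rows.degree + a)).filter
    (fun P : ℕ →₀ ℕ => HStrip M.rows P) with hPs
  have hmemPs : ∀ P : ℕ →₀ ℕ, P ∈ Ps ↔ HStrip M.rows P ∧ P.degree = M.rows.degree + a := by
    intro P
    rw [hPs, mem_filter]
    constructor
    · rintro ⟨h1, h2⟩
      refine ⟨h2, ?_⟩
      have h3 := degree_finite h2
      rw [Finset.mem_finsuppAntidiag] at h1 h3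
      rw [← h3.1, ← h1.1]
    · rintro ⟨h1, h2⟩
      exact ⟨h2 ▸ degree_finite h1, h1⟩
  have hmem : ∀ x, x ∈ Ps.attach.biUnion (fun P => S P.1 ((hmemPs _).1 P.2).1) ↔
      Step κ i M l x.1 x.2 ∧ x.1.deg = M.deg + a ∧ x.1.df = M.df + b.toNat := by
    intro x
    simp only [mem_biUnion, mem_attach, true_and, Subtype.exists, hS1]
    constructor
    · rintro ⟨P, hP, rfl, h1, h2⟩
      have := ((hmemPs _).1 hP).2
      rw [SPar.degree_rows, SPar.degree_rows] at this
      exact ⟨h1, this, h2⟩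
    · rintro ⟨h1, h2, h3⟩
      refine ⟨x.1.rows, (hmemPs _).2 ⟨h1.1, ?_⟩, rfl, h1, h3⟩
      rw [SPar.degree_rows, SPar.degree_rows, h2]
  refine ⟨_, hmem, fun P => ?_⟩
  split_ifs with h
  · rw [← hS2 P h.1]
    refine sum_congr ?_ fun _ _ => rfl
    ext x
    rw [mem_filter, hmem, hS1]
    constructor
    · rintro ⟨⟨h1, -, h3⟩, h4⟩; exact ⟨h4, h1, h3⟩
    · rintro ⟨h4, h1, h3⟩
      refine ⟨⟨h1, ?_, h3⟩, h4⟩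
      rw [← SPar.degree_rows, ← SPar.degree_rows, h4, h.2]
  · refine sum_eq_zero fun x hx => ?_
    rw [mem_filter, hmem] at hx
    exfalso
    refine h ?_
    rw [← hx.2]
    refine ⟨hx.1.1.1, ?_⟩
    rw [SPar.degree_rows, SPar.degree_rows, hx.1.2.1]

/-! ### Coefficients in the exterior algebra -/

/-- The matrix minor with columns `C`, as an alternating map. -/
def rowMinor (C : List ℕ) : RowSpace [⋀^Fin C.length]→ₗ[ℚ] ℚ :=
  (Matrix.detRowAlternating (n := Fin C.length) (R := ℚ)).compLinearMap
    (LinearMap.pi fun i => Finsupp.lapply (C.get i))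

lemma rowMinor_apply (C : List ℕ) (v : Fin C.length → RowSpace) :
    rowMinor C v = Matrix.det (Matrix.of fun i j => v i (C.get j)) := rfl

/-- The coefficient of the exterior product of the rows `C`. -/
def rowCoeff (C : List ℕ) : Wedge →ₗ[ℚ] ℚ :=
  ExteriorAlgebra.liftAlternating fun i =>
    if h : C.length = i then h ▸ rowMinor C else 0

lemma rowCoeff_rowWedge {C D : List ℕ} (hC : C.Pairwise (· < ·)) (hD : D.Pairwise (· < ·)) :
    rowCoeff C (rowWedge D) = if C = D then 1 else 0 := by
  rw [rowWedge_eq_ιMulti, rowCoeff, ExteriorAlgebra.liftAlternating_apply_ιMulti]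
  by_cases h : C.length = D.length
  · rw [dif_pos h]
    have hcast : ∀ {m : ℕ} (h : C.length = m) (v : Fin m → RowSpace),
        (h ▸ rowMinor C : RowSpace [⋀^Fin m]→ₗ[ℚ] ℚ) v = rowMinor C fun i => v (Fin.cast h i) := by
      rintro m rfl v; rfl
    rw [hcast, rowMinor_apply]
    split_ifs with hCD
    · subst hCD
      rw [← Matrix.det_one (n := Fin C.length)]
      congr 1
      ext i j
      have hinj := List.nodup_iff_injective_get.1 (hC.imp fun h => Nat.ne_of_lt h)
      simp only [Matrix.of_apply, Matrix.one_apply, Fin.cast_refl, id]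
      rw [Finsupp.single_apply]
      by_cases hij : i = j
      · subst hij; simp
      · rw [if_neg hij, if_neg fun e => hij (hinj e)]
    · have : ∃ r ∈ D, r ∉ C := by
        by_contra! hsub
        have hp : D.Perm C := (List.subperm_of_subset (hD.imp fun h => Nat.ne_of_lt h)
          hsub).perm_of_length_le h.le
        exact hCD (List.Perm.eq_of_pairwise (fun a b _ _ h h' => absurd (h.trans h')
          (lt_irrefl _)) hC hD hp.symm)
      obtain ⟨r, hrD, hrC⟩ := this
      obtain ⟨i, rfl⟩ := List.get_of_mem hrD
      refine Matrix.det_eq_zero_of_row_eq_zero (Fin.cast h.symm i) fun j => ?_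
      rw [Matrix.of_apply, Finsupp.single_apply, if_neg]
      intro e
      exact hrC (e ▸ List.get_mem C j)
  · rw [dif_neg h, if_neg fun e => h (congrArg _ e)]
    rfl

/-! ### Sequences of steps -/

/-- The operator of a step as a linear map. -/
def transferLin (κ : Kind) (b : Bool) (M P : ℕ →₀ ℕ) : Wedge →ₗ[ℚ] Wedge :=
  LinearMap.mulRight ℚ (bif b then rowι (stepVec κ M P) else 1) ∘ₗ
    (ExteriorAlgebra.map (stepMap κ M P)).toLinearMap

lemma transferLin_apply (κ : Kind) (b : Bool) (M P : ℕ →₀ ℕ) (ω : Wedge) :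
    transferLin κ b M P ω = transfer κ b M P ω := rfl

open Classical in
/-- The signed sum of the circles over all sequences of `K` steps that reach `P`. -/
def transferSum (κ : Kind) (b : ℕ → Bool) (a : ℕ → ℕ) : ℕ → (ℕ →₀ ℕ) → Wedge
  | 0, P => if P = 0 then 1 else 0
  | K + 1, P => ∑ M ∈ Iic P, if HStrip M P ∧ P.degree = M.degree + a K then
      transferLin κ (b K) M P (transferSum κ b a K M) else 0

lemma transferSum_congr {κ : Kind} {b b' : ℕ → Bool} {a a' : ℕ → ℕ} {K : ℕ}
    (hb : ∀ i < K, b i = b' i) (ha : ∀ i < K, a i = a' i) (P : ℕ →₀ ℕ) :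
    transferSum κ b a K P = transferSum κ b' a' K P := by
  induction K generalizing P with
  | zero => rfl
  | succ K ih =>
    rw [transferSum, transferSum, hb K (Nat.lt_succ_self K), ha K (Nat.lt_succ_self K)]
    refine sum_congr rfl fun M _ => ?_
    rw [ih (fun i hi => hb i (by omega)) fun i hi => ha i (by omega)]

lemma HStrip.le {M P : ℕ →₀ ℕ} (h : HStrip M P) : M ≤ P := fun r => (h r).1

open Classical in
lemma sum_two_steps (κ : Kind) (b b' : Bool) (a a' : ℕ) (Y : (ℕ →₀ ℕ) → Wedge) (N : ℕ →₀ ℕ) :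
    (∑ P ∈ Iic N, if HStrip P N ∧ N.degree = P.degree + a' then transferLin κ b' P N
      (∑ M ∈ Iic P, if HStrip M P ∧ P.degree = M.degree + a then
        transferLin κ b M P (Y M) else 0) else 0) =
    ∑ M ∈ Iic N, if N.degree = M.degree + a + a' then
      ∑ P ∈ Icc (lowRow M N) (highRow M N), if P.degree = M.degree + a then
        transfer κ b' P N (transfer κ b M P (Y M)) else 0 else 0 := by
  have e1 : ∀ P ∈ Iic N, (if HStrip P N ∧ N.degree = P.degree + a' then transferLin κ b' P N
      (∑ M ∈ Iic P, if HStrip M P ∧ P.degree = M.degree + a then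
        transferLin κ b M P (Y M) else 0) else 0) =
      ∑ M ∈ Iic N, if (HStrip M P ∧ HStrip P N) ∧ P.degree = M.degree + a ∧
        N.degree = M.degree + a + a' then transfer κ b' P N (transfer κ b M P (Y M)) else 0 := by
    intro P hP
    split_ifs with h
    · rw [map_sum]
      refine (sum_subset (Iic_subset_Iic.2 (mem_Iic.1 hP)) fun M _ hM => ?_).trans
        (sum_congr rfl fun M _ => ?_)
      · rw [if_neg fun h' => hM (mem_Iic.2 h'.1.le), map_zero]
      · rw [apply_ite (transferLin κ b' P N), map_zero]
        refine if_congr ⟨fun h' => ⟨⟨h'.1, h.1⟩, h'.2, ?_⟩, fun h' => ⟨h'.1.1, h'.2.1⟩⟩ rfl rfl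
        rw [h.2, h'.2]
    · refine (sum_eq_zero fun M _ => if_neg fun h' => h ⟨h'.1.2, ?_⟩).symm
      rw [h'.2.2, h'.2.1]
  rw [sum_congr rfl e1, sum_comm]
  refine sum_congr rfl fun M hM => ?_
  have e2 : Icc (lowRow M N) (highRow M N) =
      (Iic N).filter fun P : ℕ →₀ ℕ => HStrip M P ∧ HStrip P N := by
    ext P
    rw [mem_Icc_row, mem_filter, mem_Iic]
    exact ⟨fun h => ⟨h.2.le, h⟩, fun h => h.2⟩
  split_ifs with h
  · rw [e2, sum_filter]
    refine sum_congr rfl fun P _ => ?_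
    rw [← ite_and]
    exact if_congr ⟨fun h' => ⟨h'.1, h'.2.1⟩, fun h' => ⟨h'.1, h'.2, h⟩⟩ rfl rfl
  · exact sum_eq_zero fun P _ => if_neg fun h' => h h'.2.2

theorem transferSum_swap (κ : Kind) (b : ℕ → Bool) (a : ℕ → ℕ) (j K : ℕ) (hK : j + 2 ≤ K)
    (P : ℕ →₀ ℕ) :
    transferSum κ (b ∘ Equiv.swap j (j + 1)) (a ∘ Equiv.swap j (j + 1)) K P =
      (if b j && b (j + 1) then (-1 : ℚ) else 1) • transferSum κ b a K P := by
  classical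
  induction K, hK using Nat.le_induction generalizing P with
  | base =>
    have hlow : ∀ Q, transferSum κ (b ∘ Equiv.swap j (j + 1)) (a ∘ Equiv.swap j (j + 1)) j Q =
        transferSum κ b a j Q := by
      intro Q
      refine transferSum_congr (fun i hi => ?_) (fun i hi => ?_) Q <;>
        rw [Function.comp_apply, Equiv.swap_apply_of_ne_of_ne (by omega) (by omega)]
    simp only [transferSum, hlow, Function.comp_apply, Equiv.swap_apply_left,
      Equiv.swap_apply_right, sum_two_steps, smul_sum]
    refine sum_congr rfl fun M _ => ?_
    by_cases h : P.degree = M.degree + a j + a (j + 1)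
    · rw [if_pos h, if_pos (by omega),
        transfer_comm κ (b (j + 1)) (b j) M P _ (a j) (by omega), Bool.and_comm]
    · rw [if_neg h, if_neg (by omega), smul_zero]
  | succ K hK ih =>
    rw [transferSum, transferSum, smul_sum]
    refine sum_congr rfl fun M _ => ?_
    rw [ih, Function.comp_apply, Function.comp_apply,
      Equiv.swap_apply_of_ne_of_ne (by omega) (by omega), smul_ite, smul_zero, map_smul]

/-- `s` is a sequence of `K` steps, barred as told by `b`, that add the numbers of boxes given
by `a`; it is constant afterwards. -/
structure IsPath (κ : Kind) (b : ℕ → Bool) (a : ℕ → ℕ) (K : ℕ) (s : ℕ → SPar × List ℕ) : Prop where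
  zero : s 0 = (SPar.empty, [])
  step : ∀ i < K, Step κ i (s i).1 (s i).2 (s (i + 1)).1 (s (i + 1)).2
  deg : ∀ i < K, (s (i + 1)).1.deg = (s i).1.deg + a i
  df : ∀ i < K, (s (i + 1)).1.df = (s i).1.df + (b i).toNat
  const : ∀ i, K ≤ i → s i = s K

lemma Step.lab {κ : Kind} {i : ℕ} {M N : SPar} {l l' : List ℕ} (h : Step κ i M l N l')
    (hl : l.length = M.df) : l'.length = N.df ∧
      ((N.df = M.df ∧ l' = l) ∨ (N.df = M.df + 1 ∧ ∃ k ≤ l.length, l' = l.insertIdx k i)) := by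
  obtain ⟨-, ⟨h1, rfl⟩ | ⟨k, t, hk, -, h1, rfl⟩⟩ := h
  · have h2 := h1.length_eq
    rw [SPar.length_circleRows, SPar.length_circleRows] at h2
    exact ⟨by rw [hl, h2], Or.inl ⟨h2.symm, rfl⟩⟩
  · have h2 := h1.length_eq
    have h3 := (List.getElem?_eq_some_iff.1 hk).1
    rw [List.length_eraseIdx_of_lt h3, SPar.length_circleRows, SPar.length_circleRows] at h2
    rw [SPar.length_circleRows] at h3
    have hk' : k ≤ l.length := by omega
    refine ⟨?_, Or.inr ⟨by omega, k, hk', rfl⟩⟩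
    rw [List.length_insertIdx_of_le_length hk']
    omega

lemma Step.lab_lt {κ : Kind} {i : ℕ} {M N : SPar} {l l' : List ℕ} (h : Step κ i M l N l')
    (hl : l.length = M.df) (hlt : ∀ j ∈ l, j < i) : ∀ j ∈ l', j < i + 1 := by
  rcases (h.lab hl).2 with ⟨-, rfl⟩ | ⟨-, k, hk, rfl⟩
  · exact fun j hj => (hlt j hj).trans (Nat.lt_succ_self i)
  · intro j hj
    rcases (List.mem_insertIdx hk).1 hj with rfl | hj
    · exact Nat.lt_succ_self _
    · exact (hlt j hj).trans (Nat.lt_succ_self i)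

lemma IsPath.lab {κ : Kind} {b : ℕ → Bool} {a : ℕ → ℕ} {K : ℕ} {s : ℕ → SPar × List ℕ}
    (h : IsPath κ b a K s) (i : ℕ) (hi : i ≤ K) :
    (s i).2.length = (s i).1.df ∧ ∀ j ∈ (s i).2, j < i := by
  induction i with
  | zero => rw [h.zero]; exact ⟨rfl, by simp⟩
  | succ i ih =>
    have h1 := ih (by omega)
    exact ⟨((h.step i hi).lab h1.1).1, (h.step i hi).lab_lt h1.1 h1.2⟩

lemma empty_rows : SPar.empty.rows = 0 := by
  ext r
  exact SPar.plus_eq_zero SPar.empty (r := r) (Nat.zero_le r)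

theorem exists_paths (κ : Kind) (b : ℕ → Bool) (a : ℕ → ℕ) (K : ℕ) :
    ∃ S : Finset (ℕ → SPar × List ℕ), (∀ s, s ∈ S ↔ IsPath κ b a K s) ∧
      ∀ P, (∑ s ∈ S, if (s K).1.rows = P then
        (-1 : ℚ) ^ inversions (s K).2 • rowWedge (s K).1.circleRows else 0) =
          transferSum κ b a K P := by
  classical
  induction K with
  | zero =>
    refine ⟨{fun _ => (SPar.empty, [])}, fun s => ?_, fun P => ?_⟩
    · rw [mem_singleton]
      constructor
      · rintro rfl
        exact ⟨rfl, fun i hi => absurd hi (by omega), fun i hi => absurd hi (by omega),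
          fun i hi => absurd hi (by omega), fun _ _ => rfl⟩
      · intro h
        funext i
        rw [h.const i (Nat.zero_le _), h.zero]
    · rw [sum_singleton, transferSum, empty_rows]
      refine if_congr eq_comm ?_ rfl
      rw [inversions_nil, pow_zero, one_smul]
      rfl
  | succ K ih =>
    obtain ⟨S, hS, hsum⟩ := ih
    have hex : ∀ s : ℕ → SPar × List ℕ, ∃ X : Finset (SPar × List ℕ), IsPath κ b a K s →
        (∀ x, x ∈ X ↔ Step κ K (s K).1 (s K).2 x.1 x.2 ∧ x.1.deg = (s K).1.deg + a K ∧
          x.1.df = (s K).1.df + (b K).toNat) ∧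
        ∀ P : ℕ →₀ ℕ, ∑ x ∈ X with x.1.rows = P,
          (-1 : ℚ) ^ inversions x.2 • rowWedge x.1.circleRows =
          if HStrip (s K).1.rows P ∧ P.degree = (s K).1.rows.degree + a K then
            (-1 : ℚ) ^ inversions (s K).2 •
              transfer κ (b K) (s K).1.rows P (rowWedge (s K).1.circleRows) else 0 := by
      intro s
      by_cases h : IsPath κ b a K s
      · have hl := h.lab K le_rfl
        obtain ⟨X, hX⟩ := exists_next κ (b K) (a K) hl.1 hl.2
        exact ⟨X, fun _ => hX⟩
      · exact ⟨∅, fun h' => absurd h' h⟩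
    choose X hX using hex
    let g : (Σ _ : ℕ → SPar × List ℕ, SPar × List ℕ) → ℕ → SPar × List ℕ :=
      fun p i => if i ≤ K then p.1 i else p.2
    have g1 : ∀ p i, i ≤ K → g p i = p.1 i := fun p i hi => if_pos hi
    have g2 : ∀ p i, K < i → g p i = p.2 := fun p i hi => if_neg (by omega)
    have ginj : Set.InjOn g (S.sigma X) := by
      rintro ⟨s, x⟩ h ⟨s', x'⟩ h' e
      rw [mem_coe, mem_sigma] at h h'
      have hs := (hS s).1 h.1
      have hs' := (hS s').1 h'.1
      have e1 : s = s' := by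
        funext i
        rcases le_total i K with hi | hi
        · have := congrFun e i
          rwa [g1 _ _ hi, g1 _ _ hi] at this
        · have := congrFun e K
          rw [g1 _ _ le_rfl, g1 _ _ le_rfl] at this
          rw [hs.const i hi, hs'.const i hi]; exact this
      have e2 : x = x' := by
        have := congrFun e (K + 1)
        rwa [g2 _ _ (Nat.lt_succ_self K), g2 _ _ (Nat.lt_succ_self K)] at this
      rw [e1, e2]
    refine ⟨(S.sigma X).image g, fun s => ?_, fun P => ?_⟩
    · rw [mem_image]
      constructor
      · rintro ⟨⟨s, x⟩, h, rfl⟩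
        rw [mem_sigma, hS] at h
        obtain ⟨hs, hx⟩ := h
        rw [((hX s hs).1 x)] at hx
        have hlt : ∀ i < K + 1, i = K ∨ i + 1 ≤ K := fun i hi => by omega
        refine ⟨by rw [g1 _ _ (Nat.zero_le _)]; exact hs.zero, fun i hi => ?_, fun i hi => ?_,
          fun i hi => ?_, fun i hi => by rw [g2 _ _ (by omega), g2 _ _ (by omega)]⟩
        · rcases hlt i hi with rfl | h
          · rw [g1 _ _ le_rfl, g2 _ _ (Nat.lt_succ_self _)]; exact hx.1
          · rw [g1 _ i (by omega), g1 _ (i + 1) h]; exact hs.step i h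
        · rcases hlt i hi with rfl | h
          · rw [g1 _ _ le_rfl, g2 _ _ (Nat.lt_succ_self _)]; exact hx.2.1
          · rw [g1 _ i (by omega), g1 _ (i + 1) h]; exact hs.deg i h
        · rcases hlt i hi with rfl | h
          · rw [g1 _ _ le_rfl, g2 _ _ (Nat.lt_succ_self _)]; exact hx.2.2
          · rw [g1 _ i (by omega), g1 _ (i + 1) h]; exact hs.df i h
      · intro h
        have h' : IsPath κ b a K fun i => if i ≤ K then s i else s K := by
          refine ⟨by simpa using h.zero, fun i hi => ?_, fun i hi => ?_, fun i hi => ?_,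
            fun i hi => ?_⟩
          · rw [if_pos (by omega), if_pos (by omega)]; exact h.step i (by omega)
          · rw [if_pos (by omega), if_pos (by omega)]; exact h.deg i (by omega)
          · rw [if_pos (by omega), if_pos (by omega)]; exact h.df i (by omega)
          · rw [if_pos le_rfl]
            split_ifs with h1
            · rw [le_antisymm h1 hi]
            · rfl
        refine ⟨⟨_, s (K + 1)⟩, mem_sigma.2 ⟨(hS _).2 h', ((hX _ h').1 _).2 ?_⟩, ?_⟩
        · dsimp only
          rw [if_pos le_rfl]
          exact ⟨h.step K (by omega), h.deg K (by omega), h.df K (by omega)⟩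
        · funext i
          rcases Nat.lt_or_ge K i with hi | hi
          · rw [g2 _ _ hi, h.const i (by omega)]
          · rw [g1 _ _ hi]; exact if_pos hi
    · rw [sum_image ginj, sum_sigma, transferSum]
      have e1 : ∀ s ∈ S, (∑ x ∈ X s, if (g ⟨s, x⟩ (K + 1)).1.rows = P then
          (-1 : ℚ) ^ inversions (g ⟨s, x⟩ (K + 1)).2 • rowWedge (g ⟨s, x⟩ (K + 1)).1.circleRows
            else 0) = ∑ M ∈ Iic P, if HStrip M P ∧ P.degree = M.degree + a K then
              transferLin κ (b K) M P (if (s K).1.rows = M then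
                (-1 : ℚ) ^ inversions (s K).2 • rowWedge (s K).1.circleRows else 0) else 0 := by
        intro s hs
        simp only [g2 _ _ (Nat.lt_succ_self K)]
        rw [← sum_filter, (hX s ((hS s).1 hs)).2 P]
        simp only [apply_ite (transferLin κ (b K) _ P), map_zero, map_smul, transferLin_apply,
          ← ite_and]
        split_ifs with h
        · rw [sum_eq_single (s K).1.rows]
          · rw [if_pos ⟨h, rfl⟩]
          · exact fun M _ hM => if_neg fun h' => hM h'.2.symm
          · exact fun h' => absurd (mem_Iic.2 h.1.le) h'
        · refine (sum_eq_zero fun M _ => if_neg ?_).symm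
          rintro ⟨h', rfl⟩
          exact h h'
      rw [sum_congr rfl e1, sum_comm]
      refine sum_congr rfl fun M _ => ?_
      rw [← hsum M]
      split_ifs
      · rw [map_sum]
      · exact sum_const_zero

/-! ### Rearrangements of words -/

/-- The multiplicities of the letters of a word. -/
def content (w : List ℕ) : ℕ →₀ ℕ := Multiset.toFinsupp (w : Multiset ℕ)

lemma content_apply (w : List ℕ) (i : ℕ) : content w i = w.count i := by
  rw [content, Multiset.toFinsupp_apply, Multiset.coe_count]

lemma content_eq_iff {v w : List ℕ} : content v = content w ↔ v.Perm w := by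
  rw [content, content, EmbeddingLike.apply_eq_iff_eq, Multiset.coe_eq_coe]

lemma support_content (w : List ℕ) : (content w).support = w.toFinset := rfl

lemma degree_content (w : List ℕ) : (content w).degree = w.length := by
  have := Multiset.toFinsupp_sum_eq (w : Multiset ℕ)
  rwa [Multiset.coe_card] at this

/-- The words with given multiplicities of the letters. -/
def words (α : ℕ →₀ ℕ) : Finset (List ℕ) := (Multiset.lists (Finsupp.toMultiset α)).toFinset

lemma mem_words {α : ℕ →₀ ℕ} {w : List ℕ} : w ∈ words α ↔ content w = α := by
  rw [words, Multiset.mem_toFinset, Multiset.mem_lists_iff]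
  exact eq_comm.trans (Multiset.toFinsupp_eq_iff (s := (w : Multiset ℕ)) (f := α)).symm

lemma words_nonempty (α : ℕ →₀ ℕ) : (words α).Nonempty :=
  ⟨(Finsupp.toMultiset α).toList, mem_words.2 (by
    rw [content, Multiset.coe_toList, Finsupp.toMultiset_toFinsupp])⟩

lemma length_of_mem_words {α : ℕ →₀ ℕ} {w : List ℕ} (h : w ∈ words α) : w.length = α.degree := by
  rw [← mem_words.1 h, degree_content]

/-- The product of the factorials of the multiplicities. -/
def contentFact (α : ℕ →₀ ℕ) : ℕ := ∏ i ∈ α.support, (α i)!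

lemma contentFact_pos (α : ℕ →₀ ℕ) : 0 < contentFact α := prod_pos fun _ _ => Nat.factorial_pos _

section Perm

variable {X Y : Type*} [Fintype X] [DecidableEq X] [DecidableEq Y]

/-- The permutations of the positions that turn a word into another one. -/
lemma card_perm_comp (u : X → Y) (π₀ : Equiv.Perm X) :
    ((univ : Finset (Equiv.Perm X)).filter fun π : Equiv.Perm X => u ∘ π = u ∘ π₀).card =
      ∏ y ∈ univ.image u, ((univ.filter fun x => u x = y).card)! := by
  have h1 : ((univ : Finset (Equiv.Perm X)).filter fun π : Equiv.Perm X => u ∘ π = u ∘ π₀).card =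
      ((univ : Finset (Equiv.Perm X)).filter fun π : Equiv.Perm X => u ∘ π = u).card := by
    refine card_nbij' (fun π => π * π₀⁻¹) (fun π => π * π₀) ?_ ?_ ?_ ?_
    · intro π hπ
      have hπ' : u ∘ π = u ∘ π₀ := by simpa using hπ
      simp only [coe_filter, mem_univ, true_and, Set.mem_ofPred_eq]
      funext x
      have := congrFun hπ' (π₀⁻¹ x)
      simpa using this
    · intro π hπ
      have hπ' : u ∘ π = u := by simpa using hπ
      simp only [coe_filter, mem_univ, true_and, Set.mem_ofPred_eq]
      funext x
      exact congrFun hπ' (π₀ x)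
    · intro π _; simp
    · intro π _; simp
  rw [h1, ← Fintype.card_subtype, DomMulAct.stabilizer_card' u]
  refine prod_congr rfl fun y _ => ?_
  rw [Fintype.card_subtype]

omit [DecidableEq X] in
lemma exists_perm_comp {u v : X → Y}
    (h : ∀ y, (univ.filter fun x => u x = y).card = (univ.filter fun x => v x = y).card) :
    ∃ π : Equiv.Perm X, u ∘ π = v := by
  have e : ∀ y, Nonempty ({x // v x = y} ≃ {x // u x = y}) := fun y =>
    ⟨Fintype.equivOfCardEq (by rw [Fintype.card_subtype, Fintype.card_subtype, h])⟩
  refine ⟨(Equiv.sigmaFiberEquiv v).symm.trans ((Equiv.sigmaCongrRight fun y =>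
    (e y).some).trans (Equiv.sigmaFiberEquiv u)), ?_⟩
  funext x
  exact ((e (v x)).some ⟨x, rfl⟩).2

end Perm

lemma count_ofFn {n : ℕ} (u : Fin n → ℕ) (y : ℕ) :
    (List.ofFn u).count y = (univ.filter fun x => u x = y).card := by
  induction n with
  | zero => simp
  | succ n ih =>
    rw [List.ofFn_succ, List.count_cons, ih, card_filter, card_filter, Fin.sum_univ_succ, add_comm]
    simp

lemma contentFact_ofFn {n : ℕ} (u : Fin n → ℕ) : contentFact (content (List.ofFn u)) =
    ∏ y ∈ univ.image u, ((univ.filter fun x => u x = y).card)! := by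
  rw [contentFact, support_content]
  refine prod_congr ?_ fun y _ => by rw [content_apply, count_ofFn]
  ext y
  simp [List.mem_ofFn]

lemma card_perm_ofFn {n : ℕ} (u : Fin n → ℕ) (w : List ℕ) :
    ((univ : Finset (Equiv.Perm (Fin n))).filter fun σ : Equiv.Perm (Fin n) =>
      List.ofFn (u ∘ σ) = w).card =
      if content w = content (List.ofFn u) then contentFact (content w) else 0 := by
  split_ifs with h
  · obtain ⟨v, rfl⟩ : ∃ v : Fin n → ℕ, List.ofFn v = w := by
      have hl := (content_eq_iff.1 h).length_eq
      rw [List.length_ofFn] at hl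
      subst hl
      exact ⟨w.get, List.ofFn_get w⟩
    obtain ⟨π, rfl⟩ := exists_perm_comp (u := u) (v := v) fun y => by
      rw [← count_ofFn, ← count_ofFn, ← content_apply, ← content_apply, h]
    rw [h, contentFact_ofFn, ← card_perm_comp u π]
    congr 1
    ext σ
    simp only [mem_filter, mem_univ, true_and]
    exact List.ofFn_injective.eq_iff
  · rw [card_eq_zero, filter_eq_empty_iff]
    rintro σ - rfl
    exact h (content_eq_iff.2 (σ.ofFn_comp_perm u))

lemma sum_perm_ofFn {n : ℕ} (u : Fin n → ℕ) (F : List ℕ → ℚ) :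
    ∑ σ : Equiv.Perm (Fin n), F (List.ofFn (u ∘ σ)) =
      contentFact (content (List.ofFn u)) * ∑ w ∈ words (content (List.ofFn u)), F w := by
  have hmaps : ∀ σ ∈ (univ : Finset (Equiv.Perm (Fin n))),
      List.ofFn (u ∘ σ) ∈ words (content (List.ofFn u)) :=
    fun σ _ => mem_words.2 (content_eq_iff.2 (σ.ofFn_comp_perm u))
  rw [← sum_fiberwise_of_maps_to hmaps, mul_sum]
  refine sum_congr rfl fun w hw => ?_
  rw [sum_congr rfl fun σ hσ => by rw [(mem_filter.1 hσ).2], sum_const, card_perm_ofFn,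
    if_pos (mem_words.1 hw), nsmul_eq_mul, mem_words.1 hw]

lemma card_words (α : ℕ →₀ ℕ) : contentFact α * (words α).card = (α.degree)! := by
  obtain ⟨w, hw⟩ := words_nonempty α
  have h := sum_perm_ofFn w.get fun _ => 1
  rw [List.ofFn_get, mem_words.1 hw] at h
  simp only [sum_const, card_univ, Fintype.card_perm, Fintype.card_fin, nsmul_eq_mul, mul_one] at h
  rw [length_of_mem_words hw] at h
  exact_mod_cast h.symm

/-- The enumerations of a finite set. -/
def enum (A : Finset ℕ) : Finset (List ℕ) := (Multiset.lists A.val).toFinset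

lemma mem_enum {A : Finset ℕ} {a : List ℕ} : a ∈ enum A ↔ a.Nodup ∧ a.toFinset = A := by
  rw [enum, Multiset.mem_toFinset, Multiset.mem_lists_iff]
  change A.val = (a : Multiset ℕ) ↔ _
  constructor
  · intro h
    have hnd : a.Nodup := by
      have := A.nodup; rw [h] at this; exact Multiset.coe_nodup.1 this
    refine ⟨hnd, Finset.ext fun x => ?_⟩
    rw [List.mem_toFinset, ← Finset.mem_val, h, Multiset.mem_coe]
  · rintro ⟨h, rfl⟩
    rw [List.toFinset_val, h.dedup]

/-! ### Signs of rearrangements -/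

lemma exists_perm_of_perm {a b : List ℕ} (h : a.Perm b) {m : ℕ} (f : Fin m → ℕ)
    (hf : List.ofFn f = a) : ∃ τ : Equiv.Perm (Fin m), b = List.ofFn (f ∘ τ) := by
  obtain ⟨g, rfl⟩ : ∃ g : Fin m → ℕ, List.ofFn g = b := by
    have hl := h.length_eq
    rw [← hf, List.length_ofFn] at hl
    subst hl
    exact ⟨b.get, List.ofFn_get b⟩
  obtain ⟨τ, rfl⟩ := exists_perm_comp (u := f) (v := g) fun y => by
    rw [← count_ofFn, ← count_ofFn, hf]; exact h.count_eq y
  exact ⟨τ, rfl⟩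

lemma thetaSign_map_mul {a b : List ℕ} (h : a.Perm b) (ha : a.Nodup) {σ : ℕ → ℕ}
    (hσ : Function.Injective σ) :
    thetaSign (a.map σ) * thetaSign (b.map σ) = thetaSign a * thetaSign b := by
  obtain ⟨m, f, rfl⟩ : ∃ (m : ℕ) (f : Fin m → ℕ), List.ofFn f = a := ⟨_, a.get, List.ofFn_get a⟩
  obtain ⟨τ, rfl⟩ := exists_perm_of_perm h f rfl
  have h1 := thetaSign_mul_self ha
  have h2 := thetaSign_mul_self (ha.map hσ)
  rw [List.map_ofFn] at h2
  rw [List.map_ofFn, List.map_ofFn, ← Function.comp_assoc, thetaSign_ofFn_comp,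
    thetaSign_ofFn_comp, mul_left_comm, h2, mul_left_comm, h1]

lemma perm_sort {a : List ℕ} {A : Finset ℕ} (ha : a.Nodup) (h : a.toFinset = A) :
    a.Perm A.sort := by
  rw [List.perm_ext_iff_of_nodup ha (Finset.sort_nodup _ _)]
  intro x
  rw [Finset.mem_sort, ← h, List.mem_toFinset]

/-! ### Tableaux with given content -/

lemma Step.eq_of_trivial {κ : Kind} {i : ℕ} {M N : SPar} {l l' : List ℕ} (h : Step κ i M l N l')
    (hdeg : N.deg = M.deg) (hdf : N.df = M.df) : N = M ∧ l' = l := by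
  have hle : M.rows ≤ N.rows := fun r => (h.1 r).1
  have hplus : N.plus = M.plus := by
    have h1 : N.rows = M.rows + (N.rows - M.rows) := (add_tsub_cancel_of_le hle).symm
    have h2 : (N.rows - M.rows).degree = 0 := by
      have := congrArg Finsupp.degree h1
      rw [map_add, SPar.degree_rows, SPar.degree_rows] at this
      omega
    rw [Finsupp.degree_eq_zero_iff] at h2
    rw [h2, add_zero] at h1
    exact congrArg DFunLike.coe h1
  obtain ⟨-, ⟨h1, rfl⟩ | ⟨k, t, hk, -, h1, -⟩⟩ := h
  · refine ⟨SPar.ext_rows hplus ?_, rfl⟩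
    have : ∀ r t, CircleMove κ M N r t → r = t := by
      intro r t h
      unfold CircleMove at h
      rw [hplus, if_pos rfl] at h
      exact h.symm
    have h2 := h1.imp this
    rw [List.forall₂_eq_eq_eq] at h2
    exact h2.symm
  · exfalso
    have h2 := h1.length_eq
    have h3 := (List.getElem?_eq_some_iff.1 hk).1
    rw [List.length_eraseIdx_of_lt h3, SPar.length_circleRows, SPar.length_circleRows] at h2
    rw [SPar.length_circleRows] at h3
    omega

lemma Step.trivial (κ : Kind) (i : ℕ) (M : SPar) (l : List ℕ) : Step κ i M l M l := by
  refine ⟨fun r => ⟨le_rfl, M.plus_succ_le r⟩, Or.inl ⟨?_, rfl⟩⟩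
  rw [List.forall₂_same]
  intro r _
  unfold CircleMove
  rw [if_pos rfl]

namespace Tableau

variable {κ : Kind} {L : SPar} (T : Tableau κ L)

/-- `T` has the barred labels `A` and the multiplicities `α` of the labels of boxes. -/
structure HasContent (A : Finset ℕ) (α : ℕ →₀ ℕ) : Prop where
  deg : ∀ i, (T.shape (i + 1)).deg = (T.shape i).deg + α i
  df : ∀ i, (T.shape (i + 1)).df = (T.shape i).df + if i ∈ A then 1 else 0

lemma lab_spec (i : ℕ) : (T.lab i).length = (T.shape i).df ∧ (∀ j ∈ T.lab i, j < i) ∧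
    (T.lab i).Nodup ∧ ∀ j, j ∈ T.lab i ↔ j < i ∧ (T.shape (j + 1)).df = (T.shape j).df + 1 := by
  induction i with
  | zero => rw [T.lab_zero, T.shape_zero]; exact ⟨rfl, by simp, by simp, by simp⟩
  | succ i ih =>
    obtain ⟨h1, h2, h3, h4⟩ := ih
    obtain ⟨h5, h6⟩ := (T.step i).lab h1
    refine ⟨h5, (T.step i).lab_lt h1 h2, ?_⟩
    rcases h6 with ⟨h6, h7⟩ | ⟨h6, k, hk, h7⟩
    · rw [h7]
      refine ⟨h3, fun j => ?_⟩
      rw [h4, Nat.lt_succ_iff_lt_or_eq]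
      refine ⟨fun h => ⟨Or.inl h.1, h.2⟩, ?_⟩
      rintro ⟨h | rfl, h'⟩
      · exact ⟨h, h'⟩
      · omega
    · rw [h7]
      have hi : i ∉ T.lab i := fun h => lt_irrefl _ (h2 i h)
      refine ⟨?_, fun j => ?_⟩
      · rw [(List.perm_insertIdx i _ hk).nodup_iff, List.nodup_cons]
        exact ⟨hi, h3⟩
      · rw [List.mem_insertIdx hk, h4, Nat.lt_succ_iff_lt_or_eq]
        constructor
        · rintro (rfl | h)
          · exact ⟨Or.inr rfl, h6⟩
          · exact ⟨Or.inl h.1, h.2⟩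
        · rintro ⟨h | rfl, h'⟩
          · exact Or.inr ⟨h, h'⟩
          · exact Or.inl rfl

lemma circ_eq : ∃ N, T.circ = T.lab N ∧ L = T.shape N ∧ ∀ i, N ≤ i → T.shape i = L := by
  obtain ⟨N, hN⟩ := T.eventually
  exact ⟨N, (hN N le_rfl).2.symm, (hN N le_rfl).1.symm, fun i hi => (hN i hi).1⟩

lemma circ_nodup : T.circ.Nodup := by
  obtain ⟨N, h, -⟩ := T.circ_eq
  rw [h]; exact (T.lab_spec N).2.2.1

lemma circ_length : T.circ.length = L.df := by
  obtain ⟨N, h, h', -⟩ := T.circ_eq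
  rw [h, (T.lab_spec N).1, ← h']

lemma mem_circ (j : ℕ) : j ∈ T.circ ↔ (T.shape (j + 1)).df = (T.shape j).df + 1 := by
  obtain ⟨N, h, h', h''⟩ := T.circ_eq
  rw [h, (T.lab_spec N).2.2.2]
  refine and_iff_right_of_imp fun hj => ?_
  by_contra hlt
  rw [h'' j (by omega), h'' (j + 1) (by omega)] at hj
  omega

lemma df_succ (j : ℕ) :
    (T.shape (j + 1)).df = (T.shape j).df + if j ∈ T.circ.toFinset then 1 else 0 := by
  simp only [List.mem_toFinset, mem_circ]
  rcases ((T.step j).lab (T.lab_spec j).1).2 with h | h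
  · rw [if_neg (by omega), h.1]; rfl
  · rw [if_pos h.1, h.1]

lemma plus_mono (r : ℕ) : Monotone fun i => (T.shape i).plus r :=
  monotone_nat_of_le_succ fun i => ((T.step i).1 r).1

lemma plus_le (i r : ℕ) : (T.shape i).plus r ≤ L.plus r := by
  obtain ⟨N, -, -, h⟩ := T.circ_eq
  have h1 := T.plus_mono r (le_max_left i N)
  dsimp only at h1
  rwa [h (max i N) (le_max_right _ _)] at h1

lemma label_eq_iff {r c : ℕ} (hc : c < L.plus r) (i : ℕ) :
    sInf {i | c < (T.shape (i + 1)).plus r} = i ↔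
      (T.shape i).plus r ≤ c ∧ c < (T.shape (i + 1)).plus r := by
  have hne : {i | c < (T.shape (i + 1)).plus r}.Nonempty := by
    obtain ⟨N, -, -, h⟩ := T.circ_eq
    exact ⟨N, by rw [Set.mem_ofPred_eq, h (N + 1) (by omega)]; exact hc⟩
  constructor
  · rintro rfl
    refine ⟨?_, Nat.sInf_mem hne⟩
    rcases h : sInf {i | c < (T.shape (i + 1)).plus r} with _ | k
    · rw [T.shape_zero, SPar.plus_eq_zero SPar.empty (Nat.zero_le r)]; omega
    · exact not_lt.1 (Nat.notMem_of_lt_sInf (m := k) (s := {i | c < (T.shape (i + 1)).plus r})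
        (by omega))
  · rintro ⟨h1, h2⟩
    refine le_antisymm (Nat.sInf_le h2) ?_
    by_contra h
    have h3 : c < (T.shape (_ + 1)).plus r := Nat.sInf_mem hne
    have h4 := T.plus_mono r (show sInf {i | c < (T.shape (i + 1)).plus r} + 1 ≤ i by omega)
    dsimp only at h4
    omega

lemma countP_range (p q n : ℕ) (hq : q ≤ n) :
    (List.range n).countP (fun c => decide (p ≤ c ∧ c < q)) = q - p := by
  rw [← Nat.card_Ico, List.countP_eq_length_filter, ← List.toFinset_card_of_nodup
    (List.nodup_range.filter _)]
  congr 1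
  ext c
  simp only [List.mem_toFinset, List.mem_filter, List.mem_range, decide_eq_true_eq, mem_Ico]
  omega

lemma content_boxWord (i : ℕ) :
    (T.shape (i + 1)).deg = (T.shape i).deg + content T.boxWord i := by
  rw [content_apply, boxWord, List.count_flatMap]
  have e : ∀ r, List.count i ((List.range (L.plus r)).map
      fun c => sInf {i | c < (T.shape (i + 1)).plus r}) =
      (T.shape (i + 1)).plus r - (T.shape i).plus r := by
    intro r
    rw [← countP_range _ _ _ (T.plus_le (i + 1) r),
      List.count, List.countP_map]
    refine List.countP_congr fun c hc => ?_
    rw [Function.comp_apply, beq_iff_eq, T.label_eq_iff (List.mem_range.1 hc), decide_eq_true_eq]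
  have e2 : (List.range L.parts.length).map (List.count i ∘ fun r => (List.range (L.plus r)).map
      fun c => sInf {i | c < (T.shape (i + 1)).plus r}) = (List.range L.parts.length).map
      fun r => (T.shape (i + 1)).plus r - (T.shape i).plus r :=
    List.map_congr_left fun r _ => e r
  have hb : ∀ j r, (T.shape j).rows r ≠ 0 → r < L.parts.length := by
    intro j r h
    by_contra h'
    have h1 := T.plus_le j r
    rw [L.plus_eq_zero (by omega)] at h1
    exact h (by rw [SPar.coe_rows]; omega)
  rw [e2, ← SPar.degree_rows, ← SPar.degree_rows, degree_eq_sum_range (hb (i + 1)),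
    degree_eq_sum_range (hb i)]
  change _ = _ + (Multiset.map _ (Multiset.range L.parts.length)).sum
  rw [← Finset.range_val]
  change _ = _ + ∑ r ∈ range L.parts.length, _
  rw [← sum_add_distrib]
  refine sum_congr rfl fun r _ => ?_
  have : (T.shape i).plus r ≤ (T.shape (i + 1)).plus r := T.plus_mono r (Nat.le_succ i)
  rw [SPar.coe_rows, SPar.coe_rows]
  omega

lemma boxWord_length : T.boxWord.length = L.deg := by
  rw [boxWord, List.length_flatMap, ← L.degree_rows,
    degree_eq_sum_range (B := L.parts.length)]
  · simp only [List.length_map, List.length_range]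
    change (Multiset.map _ (Multiset.range L.parts.length)).sum = _
    rw [← Finset.range_val]
    rfl
  · intro r h
    by_contra h'
    exact h (L.plus_eq_zero (by omega))

lemma hasContent_iff {A : Finset ℕ} {α : ℕ →₀ ℕ} :
    T.HasContent A α ↔ T.circ.toFinset = A ∧ content T.boxWord = α := by
  constructor
  · intro h
    refine ⟨Finset.ext fun j => ?_, Finsupp.ext fun i => ?_⟩
    · have h1 := T.df_succ j
      have h2 := h.df j
      by_cases h3 : j ∈ T.circ.toFinset <;> by_cases h4 : j ∈ A <;> simp only [h3, h4, if_true,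
        if_false] at h1 h2 ⊢ <;> omega
    · have h1 := T.content_boxWord i
      have h2 := h.deg i
      omega
  · rintro ⟨rfl, rfl⟩
    exact ⟨T.content_boxWord, T.df_succ⟩

lemma term_apply (A : Finset ℕ) (w : List ℕ) [Decidable (T.HasContent A (content w))] :
    T.term A w = if T.HasContent A (content w) then
      (contentFact (content w) : ℚ) * (-1) ^ inversions T.circ else 0 := by
  have e : T.term A w = ∑ σ : Equiv.Perm (Fin T.boxWord.length),
      if List.ofFn (T.boxWord.get ∘ σ) = w then (if T.circ.toFinset = A then thetaSign T.circ else 0)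
        else 0 := by
    rw [term, Finset.sum_apply, Finset.sum_apply]
    refine sum_congr rfl fun σ _ => ?_
    simp only [NC.mono, and_comm (a := T.circ.toFinset = A), ite_and]
    rfl
  rw [e, ← sum_filter, sum_const, card_perm_ofFn, List.ofFn_get, thetaSign, if_pos T.circ_nodup,
    nsmul_eq_mul]
  simp only [T.hasContent_iff]
  by_cases h1 : T.circ.toFinset = A <;> by_cases h2 : content w = content T.boxWord <;>
    simp [h1, h2, eq_comm]

/-- The states of a tableau. -/
def toPath (i : ℕ) : SPar × List ℕ := (T.shape i, T.lab i)

lemma toPath_injective : Function.Injective (toPath : Tableau κ L → ℕ → SPar × List ℕ) := by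
  rintro ⟨s, l, c, h1, h2, h3, N, hN⟩ ⟨s', l', c', h1', h2', h3', N', hN'⟩ h
  have e1 : s = s' := funext fun i => (Prod.mk.inj (congrFun h i)).1
  have e2 : l = l' := funext fun i => (Prod.mk.inj (congrFun h i)).2
  subst e1 e2
  have e3 : c = c' := by
    rw [← (hN (max N N') (le_max_left _ _)).2, ← (hN' (max N N') (le_max_right _ _)).2]
  subst e3
  rfl

lemma HasContent.isPath {T : Tableau κ L} {A : Finset ℕ} {α : ℕ →₀ ℕ} (h : T.HasContent A α)
    {K : ℕ} (hA : ∀ i ∈ A, i < K) (hα : ∀ i, α i ≠ 0 → i < K) :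
    IsPath κ (fun i => decide (i ∈ A)) α K T.toPath ∧ T.toPath K = (L, T.circ) := by
  have hconst : ∀ i, K ≤ i → T.toPath i = T.toPath K := by
    intro i hi
    induction i, hi using Nat.le_induction with
    | base => rfl
    | succ i hi ih =>
      rw [← ih]
      have h1 := h.deg i
      have h2 := h.df i
      have h3 : α i = 0 := by by_contra h0; have := hα i h0; omega
      have h4 : i ∉ A := fun h0 => by have := hA i h0; omega
      rw [if_neg h4] at h2
      rw [h3] at h1
      obtain ⟨e1, e2⟩ := (T.step i).eq_of_trivial h1 h2
      rw [toPath, e1, e2, toPath]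
  refine ⟨⟨?_, fun i _ => T.step i, fun i _ => h.deg i, fun i _ => ?_, hconst⟩, ?_⟩
  · rw [toPath, T.shape_zero, T.lab_zero]
  · rw [toPath, toPath, h.df i]
    by_cases hi : i ∈ A <;> simp [hi]
  · obtain ⟨N, hN⟩ := T.eventually
    rw [← hconst (max K N) (le_max_left _ _), toPath, (hN _ (le_max_right _ _)).1,
      (hN _ (le_max_right _ _)).2]

end Tableau

/-- The tableau of a sequence of steps. -/
def IsPath.tableau {κ : Kind} {b : ℕ → Bool} {a : ℕ → ℕ} {K : ℕ} {s : ℕ → SPar × List ℕ}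
    (h : IsPath κ b a K s) : Tableau κ (s K).1 where
  shape i := (s i).1
  lab i := (s i).2
  circ := (s K).2
  shape_zero := by rw [h.zero]
  lab_zero := by rw [h.zero]
  step i := by
    rcases Nat.lt_or_ge i K with hi | hi
    · exact h.step i hi
    · rw [h.const i hi, h.const (i + 1) (by omega)]
      exact Step.trivial κ i _ _
  eventually := ⟨K, fun i hi => by rw [h.const i hi]; exact ⟨rfl, rfl⟩⟩

lemma IsPath.hasContent {κ : Kind} {A : Finset ℕ} {α : ℕ →₀ ℕ} {K : ℕ} {s : ℕ → SPar × List ℕ}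
    (h : IsPath κ (fun i => decide (i ∈ A)) α K s) (hA : ∀ i ∈ A, i < K)
    (hα : ∀ i, α i ≠ 0 → i < K) : h.tableau.HasContent A α := by
  constructor
  · intro i
    change (s (i + 1)).1.deg = (s i).1.deg + α i
    rcases Nat.lt_or_ge i K with hi | hi
    · exact h.deg i hi
    · have h3 : α i = 0 := by by_contra h0; have := hα i h0; omega
      rw [h.const i hi, h.const (i + 1) (by omega), h3, add_zero]
  · intro i
    change (s (i + 1)).1.df = (s i).1.df + _
    rcases Nat.lt_or_ge i K with hi | hi
    · rw [h.df i hi]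
      by_cases hi : i ∈ A <;> simp [hi]
    · have h4 : i ∉ A := fun h0 => by have := hA i h0; omega
      rw [h.const i hi, h.const (i + 1) (by omega), if_neg h4, add_zero]

theorem exists_tableaux (κ : Kind) (L : SPar) (A : Finset ℕ) (α : ℕ →₀ ℕ) {K : ℕ}
    (hA : ∀ i ∈ A, i < K) (hα : ∀ i, α i ≠ 0 → i < K) :
    ∃ S : Finset (Tableau κ L), (∀ T, T ∈ S ↔ T.HasContent A α) ∧
      ∑ T ∈ S, (-1 : ℚ) ^ inversions T.circ =
        rowCoeff L.circleRows (transferSum κ (fun i => decide (i ∈ A)) α K L.rows) := by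
  classical
  obtain ⟨S, hS, hsum⟩ := exists_paths κ (fun i => decide (i ∈ A)) α K
  set S' := S.filter fun s => (s K).1 = L with hS'
  set X : Finset (Tableau κ L) :=
    S'.preimage Tableau.toPath Tableau.toPath_injective.injOn with hX
  have hmem : ∀ T : Tableau κ L, T ∈ X ↔ T.HasContent A α := by
    intro T
    rw [hX, mem_preimage, hS', mem_filter, hS]
    constructor
    · rintro ⟨h1, -⟩
      have h2 := h1.hasContent hA hα
      exact ⟨h2.deg, h2.df⟩
    · intro h
      have := h.isPath hA hα
      exact ⟨this.1, by rw [this.2]⟩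
  refine ⟨X, hmem, ?_⟩
  have e1 : ∑ T ∈ X, (-1 : ℚ) ^ inversions T.circ =
      ∑ T ∈ X, (-1 : ℚ) ^ inversions (T.toPath K).2 :=
    sum_congr rfl fun T hT => by rw [(((hmem T).1 hT).isPath hA hα).2]
  rw [e1, hX, sum_preimage Tableau.toPath S' _ fun s => (-1 : ℚ) ^ inversions (s K).2]
  · rw [hS', sum_filter, ← hsum L.rows, map_sum]
    refine sum_congr rfl fun s _ => ?_
    rw [apply_ite (rowCoeff L.circleRows), map_zero, map_smul,
      rowCoeff_rowWedge L.circleRows_pairwise (s K).1.circleRows_pairwise]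
    by_cases h : (s K).1 = L
    · simp [h]
    · rw [if_neg h]
      split_ifs with h1 h2
      · exact absurd (SPar.ext_rows (congrArg DFunLike.coe h1) h2.symm) h
      · simp
      · rfl
  · intro s hs hs'
    rw [hS', mem_filter, hS] at hs
    obtain ⟨h1, rfl⟩ := hs
    exact absurd ⟨h1.tableau, rfl⟩ hs'

/-- The signed number of tableaux of given shape and content. -/
def tableauSum (κ : Kind) (L : SPar) : Comm := fun A α =>
  ∑ᶠ (T : Tableau κ L) (_ : T.HasContent A α), (-1 : ℚ) ^ inversions T.circ

lemma tableauSum_eq_sum {κ : Kind} {L : SPar} {A : Finset ℕ} {α : ℕ →₀ ℕ}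
    {S : Finset (Tableau κ L)} (hS : ∀ T, T ∈ S ↔ T.HasContent A α) :
    tableauSum κ L A α = ∑ T ∈ S, (-1 : ℚ) ^ inversions T.circ := by
  rw [tableauSum]
  simp only [← hS]
  exact finsum_mem_finset_eq_sum _ _

theorem tableauSum_eq (κ : Kind) (L : SPar) (A : Finset ℕ) (α : ℕ →₀ ℕ) {K : ℕ}
    (hA : ∀ i ∈ A, i < K) (hα : ∀ i, α i ≠ 0 → i < K) : tableauSum κ L A α =
      rowCoeff L.circleRows (transferSum κ (fun i => decide (i ∈ A)) α K L.rows) := by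
  obtain ⟨S, hS, h⟩ := exists_tableaux κ L A α hA hα
  rw [tableauSum_eq_sum hS, h]

lemma exists_bound (A : Finset ℕ) (α : ℕ →₀ ℕ) :
    ∃ K, (∀ i ∈ A, i < K) ∧ ∀ i, α i ≠ 0 → i < K := by
  refine ⟨(A ∪ α.support).sup id + 1, fun i hi => ?_, fun i hi => ?_⟩
  · exact Nat.lt_succ_of_le (le_sup (f := id) (mem_union_left _ hi))
  · exact Nat.lt_succ_of_le (le_sup (f := id) (mem_union_right _ (Finsupp.mem_support_iff.2 hi)))

theorem schurNC_apply (κ : Kind) (L : SPar) (A : Finset ℕ) (w : List ℕ) :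
    schurNC κ L A w = contentFact (content w) * tableauSum κ L A (content w) := by
  classical
  obtain ⟨K, hA, hα⟩ := exists_bound A (content w)
  obtain ⟨S, hS, -⟩ := exists_tableaux κ L A (content w) hA hα
  rw [tableauSum_eq_sum hS, schurNC, NC.formalSum, mul_sum]
  rw [finsum_eq_sum_of_support_subset (s := S)]
  · refine sum_congr rfl fun T hT => ?_
    rw [T.term_apply, if_pos ((hS T).1 hT)]
  · intro T hT
    rw [Function.mem_support, T.term_apply] at hT
    rw [mem_coe, hS]
    by_contra h
    exact hT (if_neg h)

lemma tableauSum_ne_zero {κ : Kind} {L : SPar} {A : Finset ℕ} {α : ℕ →₀ ℕ}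
    (h : tableauSum κ L A α ≠ 0) : A.card = L.df ∧ α.degree = L.deg := by
  obtain ⟨K, hA, hα⟩ := exists_bound A α
  obtain ⟨S, hS, -⟩ := exists_tableaux κ L A α hA hα
  rw [tableauSum_eq_sum hS] at h
  obtain ⟨T, hT, -⟩ := exists_ne_zero_of_sum_ne_zero h
  obtain ⟨rfl, rfl⟩ := T.hasContent_iff.1 ((hS T).1 hT)
  rw [List.toFinset_card_of_nodup T.circ_nodup, T.circ_length, degree_content, T.boxWord_length]
  exact ⟨rfl, rfl⟩

/-- The exponents of the leading monomial of `m_Ω`. -/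
def SPar.exponents (O : SPar) : ℕ →₀ ℕ :=
  Finsupp.onFinset (range O.parts.length) (fun i => O.parts.getD i 0) fun i h => by
    rw [mem_range]
    by_contra h'
    exact h (List.getD_eq_default _ _ (by omega))

theorem kostka_eq (κ : Kind) (L O : SPar) :
    (kostka κ L O : ℚ) = tableauSum κ L (range O.df) O.exponents := by
  obtain ⟨K, hA, hα⟩ := exists_bound (range O.df) O.exponents
  obtain ⟨S, hS, -⟩ := exists_tableaux κ L _ _ hA hα
  have hw : ∀ T : Tableau κ L, T.HasWeight O ↔ T ∈ S := by
    intro T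
    rw [hS]
    constructor
    · intro h
      exact ⟨fun i => (h i).1, fun i => by simpa using (h i).2⟩
    · intro h i
      exact ⟨h.deg i, by simpa using h.df i⟩
  rw [tableauSum_eq_sum hS, kostka]
  simp only [hw]
  rw [finsum_mem_finset_eq_sum]
  push_cast
  rfl

/-! ### Symmetry -/

lemma swap_lt {j x y : ℕ} (hxy : x < y) (h : ¬ (x = j ∧ y = j + 1)) :
    Equiv.swap j (j + 1) x < Equiv.swap j (j + 1) y := by
  simp only [Equiv.swap_apply_def]
  split_ifs <;> omega

lemma thetaSign_map_swap {l : List ℕ} (hl : l.Pairwise (· < ·)) (j : ℕ) :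
    thetaSign (l.map (Equiv.swap j (j + 1))) = if j ∈ l ∧ j + 1 ∈ l then -1 else 1 := by
  induction l with
  | nil => simp [thetaSign, inversions_nil]
  | cons x t ih =>
    have hl' := List.pairwise_cons.1 hl
    have hone : ∀ {z : ℕ} {t : List ℕ}, (∀ y ∈ t, z < y) →
        (t.map fun y : ℕ => (((y : ℤ) - (z : ℤ)).sign : ℚ)).prod = 1 := by
      intro z t h
      refine List.prod_eq_one fun q hq => ?_
      obtain ⟨y, hy, rfl⟩ := List.mem_map.1 hq
      rw [Int.sign_eq_one_of_pos (by have := h y hy; omega)]; simp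
    rw [List.map_cons, thetaSign_cons, ih hl'.2]
    by_cases hx : x = j ∧ j + 1 ∈ t
    · obtain ⟨rfl, hx⟩ := hx
      have hxt : x ∉ t := fun h => lt_irrefl _ (hl'.1 x h)
      rw [if_neg fun h => hxt h.1, if_pos ⟨by simp, by simp [hx]⟩, mul_one]
      obtain ⟨y, t', rfl⟩ : ∃ y t', t = y :: t' := by
        cases t with
        | nil => simp at hx
        | cons y t' => exact ⟨y, t', rfl⟩
      have hl2 := List.pairwise_cons.1 hl'.2
      obtain rfl : y = x + 1 := by
        have h1 := hl'.1 y List.mem_cons_self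
        rcases List.mem_cons.1 hx with h | h
        · exact h.symm
        · have := hl2.1 _ h; omega
      rw [List.map_cons, List.map_cons, List.prod_cons, hone]
      · simp
      · intro z hz
        obtain ⟨y, hy, rfl⟩ := List.mem_map.1 hz
        have := hl2.1 y hy
        rw [Equiv.swap_apply_left, Equiv.swap_apply_of_ne_of_ne (by omega) (by omega)]
        exact this
    · rw [hone, one_mul]
      · refine if_congr ?_ rfl rfl
        constructor
        · exact fun h => ⟨List.mem_cons_of_mem _ h.1, List.mem_cons_of_mem _ h.2⟩
        · rintro ⟨h1, h2⟩
          rcases List.mem_cons.1 h1 with rfl | h1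
          · rcases List.mem_cons.1 h2 with h2 | h2
            · omega
            · exact absurd ⟨rfl, h2⟩ hx
          · rcases List.mem_cons.1 h2 with h2 | h2
            · have := hl'.1 j h1; omega
            · exact ⟨h1, h2⟩
      · intro z hz
        obtain ⟨y, hy, rfl⟩ := List.mem_map.1 hz
        exact swap_lt (hl'.1 y hy) fun h => hx ⟨h.1, h.2 ▸ hy⟩

lemma mem_of_swap_mem (H : Subgroup (Equiv.Perm ℕ)) (h : ∀ j, Equiv.swap j (j + 1) ∈ H)
    {σ : Equiv.Perm ℕ} (hσ : {i | σ i ≠ i}.Finite) : σ ∈ H := by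
  have hlt : ∀ x k, Equiv.swap x (x + k + 1) ∈ H := by
    intro x k
    induction k with
    | zero => exact h x
    | succ k ih => exact SubmonoidClass.swap_mem_trans H ih (h (x + k + 1))
  have hle : Subgroup.closure {σ : Equiv.Perm ℕ | σ.IsSwap} ≤ H := by
    rw [Subgroup.closure_le]
    rintro _ ⟨x, y, hxy, rfl⟩
    rcases lt_or_gt_of_ne hxy with h' | h'
    · have := hlt x (y - x - 1)
      rwa [show x + (y - x - 1) + 1 = y by omega] at this
    · have := hlt y (x - y - 1)
      rwa [show y + (x - y - 1) + 1 = x by omega, Equiv.swap_comm] at this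
  refine hle (mem_closure_isSwap'.2 (hσ.subset fun i hi => hi))

theorem tableauSum_swap (κ : Kind) (L : SPar) (j : ℕ) (A : Finset ℕ) (α : ℕ →₀ ℕ) :
    tableauSum κ L (A.map (Equiv.swap j (j + 1)).toEmbedding)
        (α.mapDomain (Equiv.swap j (j + 1))) =
      (if j ∈ A ∧ j + 1 ∈ A then -1 else 1) * tableauSum κ L A α := by
  set σ := Equiv.swap j (j + 1) with hσ
  obtain ⟨K, hA, hα⟩ := exists_bound (A ∪ A.map σ.toEmbedding) (α + α.mapDomain σ)
  have h1 : ∀ i ∈ A, i < K + j + 2 := fun i hi => by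
    have := hA i (mem_union_left _ hi); omega
  have h2 : ∀ i ∈ A.map σ.toEmbedding, i < K + j + 2 := fun i hi => by
    have := hA i (mem_union_right _ hi); omega
  have h3 : ∀ i, α i ≠ 0 → i < K + j + 2 := fun i hi => by
    have := hα i (by rw [Finsupp.add_apply]; omega); omega
  have h4 : ∀ i, α.mapDomain σ i ≠ 0 → i < K + j + 2 := fun i hi => by
    have := hα i (by rw [Finsupp.add_apply]; omega); omega
  rw [tableauSum_eq κ L _ _ h1 h3, tableauSum_eq κ L _ _ h2 h4]
  have e := transferSum_swap κ (fun i => decide (i ∈ A)) α j (K + j + 2) (by omega) L.rows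
  have hinv : ∀ i, σ (σ i) = i := fun i => by simp [hσ]
  have e1 : (fun i => decide (i ∈ A.map σ.toEmbedding)) = (fun i => decide (i ∈ A)) ∘ σ := by
    funext i
    rw [Function.comp_apply, decide_eq_decide, mem_map_equiv]
    rfl
  have e2 : ⇑(α.mapDomain σ) = α ∘ σ := by
    funext i
    conv_lhs => rw [← hinv i]
    rw [Finsupp.mapDomain_apply σ.injective]
    rfl
  rw [e1, e2, e, map_smul, smul_eq_mul]
  congr 1
  simp

/-! ### Values of series at unordered monomials -/

/-- The coefficient of `θ_{a_1} ⋯ θ_{a_m} x_{w_1} ⋯ x_{w_n}`, for an arbitrary word `a`. -/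
def NC.val (f : NC) (a w : List ℕ) : ℚ := thetaSign a * f a.toFinset w

/-- The coefficient of `θ_{a_1} ⋯ θ_{a_m} x^α`, for an arbitrary word `a`. -/
def Comm.val (g : Comm) (a : List ℕ) (α : ℕ →₀ ℕ) : ℚ := thetaSign a * g a.toFinset α

lemma toFinset_map_perm (a : List ℕ) (σ : Equiv.Perm ℕ) :
    (a.map σ).toFinset = a.toFinset.map σ.toEmbedding := by
  ext x
  simp only [List.mem_toFinset, List.mem_map, mem_map, Equiv.coe_toEmbedding]

lemma map_symm_map (A : Finset ℕ) (σ : Equiv.Perm ℕ) :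
    (A.map σ.toEmbedding).map σ.symm.toEmbedding = A := by
  rw [Finset.map_map]
  convert Finset.map_refl
  ext x; simp

lemma NC.act_eq_iff (f : NC) (σ : Equiv.Perm ℕ) : NC.act σ f = f ↔
    ∀ a w : List ℕ, a.Nodup → f.val (a.map σ) (w.map σ) = f.val a w := by
  constructor
  · intro h a w ha
    rw [NC.val, ← h]
    change thetaSign (a.map σ) * (thetaSign (((Finset.map σ.symm.toEmbedding
      (a.map σ).toFinset).sort).map σ) * f (Finset.map σ.symm.toEmbedding (a.map σ).toFinset)
        ((w.map σ).map σ.symm)) = _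
    rw [toFinset_map_perm, map_symm_map, ← mul_assoc,
      thetaSign_map_mul (perm_sort ha rfl) ha σ.injective, thetaSign_sort, mul_one, h, NC.val,
      List.map_map, σ.symm_comp_self, List.map_id]
  · intro h
    funext A w
    change thetaSign (((A.map σ.symm.toEmbedding).sort).map σ) *
      f (A.map σ.symm.toEmbedding) (w.map σ.symm) = f A w
    set S := (A.map σ.symm.toEmbedding).sort with hS
    have hnd : S.Nodup := Finset.sort_nodup _ _
    have h1 := h S (w.map σ.symm) hnd
    rw [NC.val, NC.val, thetaSign_sort, one_mul, List.map_map, σ.self_comp_symm, List.map_id,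
      toFinset_map_perm, hS, Finset.sort_toFinset] at h1
    have h2 := map_symm_map A σ.symm
    rw [Equiv.symm_symm] at h2
    rw [h2, ← hS] at h1
    rw [← h1, ← mul_assoc, thetaSign_mul_self (hnd.map σ.injective), one_mul]

lemma mem_sNCSym_iff {f : NC} : f ∈ sNCSym ↔ (∃ d, ∀ A w, f A w ≠ 0 → A.card + w.length ≤ d) ∧
    ∀ σ : Equiv.Perm ℕ, {i | σ i ≠ i}.Finite → ∀ a w : List ℕ, a.Nodup →
      f.val (a.map σ) (w.map σ) = f.val a w := by
  change (_ ∧ _) ↔ _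
  simp only [NC.act_eq_iff]

/-- The invariant series of bounded degree in commuting variables. -/
def symComm : Submodule ℚ Comm where
  carrier := {g | (∃ d, ∀ A α, g A α ≠ 0 → A.card + α.degree ≤ d) ∧
    ∀ σ : Equiv.Perm ℕ, {i | σ i ≠ i}.Finite → ∀ (a : List ℕ) (α : ℕ →₀ ℕ), a.Nodup →
      g.val (a.map σ) (α.mapDomain σ) = g.val a α}
  zero_mem' := ⟨⟨0, fun A w h => absurd rfl h⟩, fun σ _ a α _ => by simp [Comm.val]⟩
  add_mem' := by
    rintro f g ⟨⟨d, hd⟩, hf⟩ ⟨⟨e, he⟩, hg⟩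
    refine ⟨⟨max d e, fun A w h => ?_⟩, fun σ hσ a α ha => ?_⟩
    · by_cases h1 : f A w = 0
      · have h2 : g A w ≠ 0 := fun h2 => h (by simp [h1, h2])
        exact (he A w h2).trans (le_max_right _ _)
      · exact (hd A w h1).trans (le_max_left _ _)
    · have h1 := hf σ hσ a α ha
      have h2 := hg σ hσ a α ha
      simp only [Comm.val, Pi.add_apply, mul_add] at h1 h2 ⊢
      rw [h1, h2]
  smul_mem' := by
    rintro c f ⟨⟨d, hd⟩, hf⟩
    refine ⟨⟨d, fun A w h => hd A w fun h0 => h (by simp [h0])⟩, fun σ hσ a α ha => ?_⟩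
    have h1 := hf σ hσ a α ha
    simp only [Comm.val, Pi.smul_apply, smul_eq_mul, mul_left_comm _ c] at h1 ⊢
    rw [h1]

lemma content_map (w : List ℕ) (σ : Equiv.Perm ℕ) :
    content (w.map σ) = (content w).mapDomain σ := by
  ext i
  obtain ⟨i, rfl⟩ := σ.surjective i
  rw [Finsupp.mapDomain_apply σ.injective, content_apply, content_apply,
    List.count_map_of_injective _ _ σ.injective]

lemma words_mapDomain (α : ℕ →₀ ℕ) (σ : Equiv.Perm ℕ) :
    words (α.mapDomain σ) = (words α).map ⟨List.map σ, List.map_injective_iff.2 σ.injective⟩ := by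
  ext w
  rw [mem_words, mem_map]
  constructor
  · intro h
    refine ⟨w.map σ.symm, ?_, ?_⟩
    · rw [mem_words, content_map, h, ← Finsupp.mapDomain_comp, σ.symm_comp_self,
        Finsupp.mapDomain_id]
    · change (w.map σ.symm).map σ = w
      rw [List.map_map, σ.self_comp_symm, List.map_id]
  · rintro ⟨v, hv, rfl⟩
    rw [← mem_words.1 hv]
    exact content_map v σ

lemma rho_apply (f : NC) (A : Finset ℕ) (α : ℕ →₀ ℕ) : rho f A α = ∑ w ∈ words α, f A w := rfl

lemma rho_mem_symComm {f : NC} (hf : f ∈ sNCSym) : rho f ∈ symComm := by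
  obtain ⟨⟨d, hd⟩, hf⟩ := mem_sNCSym_iff.1 hf
  refine ⟨⟨d, fun A α h => ?_⟩, fun σ hσ a α ha => ?_⟩
  · obtain ⟨w, hw, h⟩ := exists_ne_zero_of_sum_ne_zero h
    rw [← length_of_mem_words hw]
    exact hd A w h
  · rw [Comm.val, Comm.val, rho_apply, rho_apply, words_mapDomain, sum_map, mul_sum, mul_sum]
    exact sum_congr rfl fun w _ => hf σ hσ a w ha

/-- The symmetrization of a series in commuting variables, a section of `rho`. -/
def spread : Comm →ₗ[ℚ] NC where
  toFun g := fun A w => (contentFact (content w) : ℚ) / (w.length)! * g A (content w)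
  map_add' f g := by funext A w; simp [mul_add]
  map_smul' c f := by funext A w; simp [mul_left_comm]

lemma spread_apply (g : Comm) (A : Finset ℕ) (w : List ℕ) :
    spread g A w = (contentFact (content w) : ℚ) / (w.length)! * g A (content w) := rfl

lemma rho_spread (g : Comm) : rho (spread g) = g := by
  funext A α
  have h : ∀ w ∈ words α, spread g A w = (contentFact α : ℚ) / (α.degree)! * g A α := by
    intro w hw
    rw [spread_apply, mem_words.1 hw, length_of_mem_words hw]
  rw [rho_apply, sum_congr rfl h, sum_const, nsmul_eq_mul, ← card_words α]
  have h1 : (contentFact α : ℚ) ≠ 0 := Nat.cast_ne_zero.2 (contentFact_pos α).ne'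
  have h2 : ((words α).card : ℚ) ≠ 0 := Nat.cast_ne_zero.2 (words_nonempty α).card_pos.ne'
  push_cast
  field_simp

lemma contentFact_mapDomain (α : ℕ →₀ ℕ) (σ : Equiv.Perm ℕ) :
    contentFact (α.mapDomain σ) = contentFact α := by
  rw [contentFact, contentFact, Finsupp.mapDomain_support_of_injective σ.injective,
    prod_image σ.injective.injOn]
  exact prod_congr rfl fun i _ => by rw [Finsupp.mapDomain_apply σ.injective]

lemma spread_mem_sNCSym {g : Comm} (hg : g ∈ symComm) : spread g ∈ sNCSym := by
  obtain ⟨⟨d, hd⟩, hg⟩ := hg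
  refine mem_sNCSym_iff.2 ⟨⟨d, fun A w h => ?_⟩, fun σ hσ a w ha => ?_⟩
  · rw [← degree_content w]
    exact hd A _ fun h0 => h (by rw [spread_apply, h0, mul_zero])
  · have := hg σ hσ a (content w) ha
    rw [Comm.val, Comm.val] at this
    rw [NC.val, NC.val, spread_apply, spread_apply, content_map, contentFact_mapDomain,
      List.length_map, mul_left_comm, this, mul_left_comm]

theorem sSym_eq_symComm : sSym = symComm := by
  apply le_antisymm
  · rintro _ ⟨f, hf, rfl⟩
    exact rho_mem_symComm hf
  · intro g hg
    exact ⟨spread g, spread_mem_sNCSym hg, rho_spread g⟩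

/-- The lifting map. -/
def lift : sSym →ₗ[ℚ] sNCSym :=
  (spread.comp sSym.subtype).codRestrict sNCSym fun g =>
    spread_mem_sNCSym (sSym_eq_symComm ▸ g.2)

lemma coe_lift (g : sSym) : (lift g : NC) = spread g := rfl

/-! ### Consequences of the symmetry -/

lemma thetaSign_swap {a : List ℕ} (ha : a.Nodup) {x y : ℕ} (hx : x ∈ a) (hy : y ∈ a)
    (hxy : x ≠ y) : thetaSign (a.map (Equiv.swap x y)) = -thetaSign a := by
  obtain ⟨i, rfl⟩ := List.get_of_mem hx
  obtain ⟨j, rfl⟩ := List.get_of_mem hy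
  have hij : i ≠ j := fun h => hxy (by rw [h])
  have hinj := List.nodup_iff_injective_get.1 ha
  have e : a.map (Equiv.swap (a.get i) (a.get j)) = List.ofFn (a.get ∘ Equiv.swap i j) := by
    conv_lhs => rhs; rw [← List.ofFn_get a]
    rw [List.map_ofFn]
    congr 1
    funext k
    exact hinj.swap_apply i j k
  rw [e, thetaSign_ofFn_comp, List.ofFn_get, Equiv.Perm.sign_swap hij]
  simp

lemma toFinset_map_swap {a : List ℕ} {x y : ℕ} (hx : x ∈ a) (hy : y ∈ a) :
    (a.map (Equiv.swap x y)).toFinset = a.toFinset := by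
  ext z
  simp only [List.mem_toFinset, List.mem_map]
  constructor
  · rintro ⟨u, hu, rfl⟩
    rw [Equiv.swap_apply_def]
    split_ifs <;> assumption
  · intro hz
    refine ⟨Equiv.swap x y z, ?_, by simp⟩
    rw [Equiv.swap_apply_def]
    split_ifs <;> assumption

lemma finite_swap (x y : ℕ) : {i | Equiv.swap x y i ≠ i}.Finite :=
  (finite_compl_fixedBy_swap (x := x) (y := y)).subset fun _ h => h

lemma val_perm {X : Type*} {f : Finset ℕ → X → ℚ} {a b : List ℕ} (h : a.Perm b) (ha : a.Nodup)
    (x : X) : thetaSign b * f b.toFinset x =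
      thetaSign a * thetaSign b * (thetaSign a * f a.toFinset x) := by
  rw [List.toFinset_eq_of_perm _ _ h, mul_comm (thetaSign a) (thetaSign b), mul_assoc, ← mul_assoc
    (thetaSign a), thetaSign_mul_self ha, one_mul]

lemma exists_finite_perm {k : ℕ} {f g : Fin k → ℕ} (hf : Function.Injective f)
    (hg : Function.Injective g) :
    ∃ σ : Equiv.Perm ℕ, {i | σ i ≠ i}.Finite ∧ ∀ i, σ (f i) = g i := by
  classical
  set S : Finset ℕ := univ.image f ∪ univ.image g with hS
  have hfS : ∀ i, f i ∈ S := fun i => mem_union_left _ (mem_image_of_mem f (mem_univ i))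
  have hgS : ∀ i, g i ∈ S := fun i => mem_union_right _ (mem_image_of_mem g (mem_univ i))
  let f' : Fin k → S := fun i => ⟨f i, hfS i⟩
  let g' : Fin k → S := fun i => ⟨g i, hgS i⟩
  have hf' : Function.Injective f' := fun i j h => hf (congrArg Subtype.val h)
  have hg' : Function.Injective g' := fun i j h => hg (congrArg Subtype.val h)
  let e : {x // x ∈ Set.range f'} ≃ {x // x ∈ Set.range g'} :=
    (Equiv.ofInjective f' hf').symm.trans (Equiv.ofInjective g' hg')
  refine ⟨Equiv.Perm.ofSubtype e.extendSubtype, ?_, fun i => ?_⟩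
  · refine S.finite_toSet.subset fun i hi => ?_
    by_contra h
    exact hi (Equiv.Perm.ofSubtype_apply_of_not_mem _ h)
  · rw [Equiv.Perm.ofSubtype_apply_of_mem _ (hfS i)]
    have : e.extendSubtype (f' i) = g' i := by
      rw [Equiv.extendSubtype_apply_of_mem _ _ ⟨i, rfl⟩]
      change ((Equiv.ofInjective g' hg') ((Equiv.ofInjective f' hf').symm _)).1 = _
      rw [Equiv.ofInjective_symm_apply, Equiv.ofInjective_apply]
    exact congrArg Subtype.val this

/-- A basis from a dual system of functionals. -/
def basisOfDual {ι V : Type*} [AddCommGroup V] [Module ℚ V] [DecidableEq ι] (m : ι → V)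
    (e : ι → V →ₗ[ℚ] ℚ) (h1 : ∀ i j, e j (m i) = if i = j then 1 else 0)
    (h2 : ∀ v, (∀ j, e j v = 0) → v = 0) (h3 : ∀ v, {j | e j v ≠ 0}.Finite) :
    Module.Basis ι ℚ V :=
  Module.Basis.mk (v := m)
    (by
      rw [linearIndependent_iff]
      intro l hl
      ext j
      have := congrArg (e j) hl
      rw [Finsupp.linearCombination_apply, map_finsuppSum, map_zero, Finsupp.sum] at this
      simp only [map_smul, h1, smul_eq_mul, mul_ite, mul_one, mul_zero, sum_ite_eq'] at this
      by_contra hj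
      rw [if_pos (Finsupp.mem_support_iff.2 hj)] at this
      exact hj this)
    (by
      intro v _
      have : v = ∑ i ∈ (h3 v).toFinset, e i v • m i := by
        rw [← sub_eq_zero]
        refine h2 _ fun j => ?_
        rw [map_sub, map_sum]
        simp only [map_smul, h1, smul_eq_mul, mul_ite, mul_one, mul_zero, sum_ite_eq']
        split_ifs with h
        · exact sub_self _
        · rw [Set.Finite.mem_toFinset, Set.mem_ofPred_eq, not_not] at h
          rw [h, sub_zero]
      rw [this]
      exact Submodule.sum_mem _ fun i _ => Submodule.smul_mem _ _ (Submodule.subset_span ⟨i, rfl⟩))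

lemma basisOfDual_apply {ι V : Type*} [AddCommGroup V] [Module ℚ V] [DecidableEq ι] {m : ι → V}
    {e : ι → V →ₗ[ℚ] ℚ} (h1 : ∀ i j, e j (m i) = if i = j then 1 else 0)
    (h2 : ∀ v, (∀ j, e j v = 0) → v = 0) (h3 : ∀ v, {j | e j v ≠ 0}.Finite) (i : ι) :
    basisOfDual m e h1 h2 h3 i = m i := by
  rw [basisOfDual, Module.Basis.mk_apply]

/-- A sorted enumeration of a finite set. -/
lemma exists_sorted_enum (A : Finset ℕ) (f : ℕ → ℕ) :
    ∃ a : List ℕ, a.Nodup ∧ a.toFinset = A ∧ a.Pairwise fun x y => f x ≤ f y := by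
  refine ⟨A.toList.mergeSort fun x y => decide (f x ≤ f y), ?_, ?_, ?_⟩
  · exact (List.mergeSort_perm _ _).nodup_iff.2 A.nodup_toList
  · rw [List.toFinset_eq_of_perm _ _ (List.mergeSort_perm _ _), Finset.toList_toFinset]
  · have := List.pairwise_mergeSort (le := fun x y => decide (f x ≤ f y))
      (fun x y z h h' => by simp at h h' ⊢; omega) (fun x y => by simp; omega) A.toList
    exact this.imp fun h => by simpa using h

/-! ### The monomial basis in commuting variables -/

/-- `θ_a x^α` (with `a` in decreasing order of the exponents) is a monomial of `m_Λ`. -/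
def SPar.Matches (L : SPar) (a : List ℕ) (α : ℕ →₀ ℕ) : Prop :=
  ∃ r : List ℕ, (a ++ r).Nodup ∧ a.map α = L.a ∧ r.map α = L.s ∧ ∀ x ∉ a ++ r, α x = 0

lemma zipWith_single_eq_iff {i l : List ℕ} (hi : i.Nodup) (hl : i.length = l.length)
    (α : ℕ →₀ ℕ) : (List.zipWith Finsupp.single i l).sum = α ↔
      i.map α = l ∧ ∀ x ∉ i, α x = 0 := by
  induction i generalizing l α with
  | nil =>
    obtain rfl : l = [] := List.length_eq_zero_iff.1 hl.symm
    simp only [List.zipWith_nil_left, List.sum_nil, List.map_nil, true_and, List.not_mem_nil,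
      not_false_eq_true, forall_const]
    constructor
    · rintro rfl x; rfl
    · intro h; ext x; exact (h x).symm
  | cons y i ih =>
    rcases l with _ | ⟨c, l⟩
    · simp at hl
    · rw [List.nodup_cons] at hi
      have hl' : i.length = l.length := by simpa using hl
      rw [List.zipWith_cons_cons, List.sum_cons]
      constructor
      · rintro rfl
        obtain ⟨h1, h2⟩ := (ih hi.2 hl' _).1 rfl
        refine ⟨?_, fun x hx => ?_⟩
        · rw [List.map_cons, Finsupp.add_apply, Finsupp.single_eq_same, h2 y hi.1, add_zero]
          congr 1
          conv_rhs => rw [← h1]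
          refine List.map_congr_left fun x hx => ?_
          rw [Finsupp.add_apply, Finsupp.single_eq_of_ne, zero_add]
          rintro rfl; exact hi.1 hx
        · rw [List.mem_cons, not_or] at hx
          rw [Finsupp.add_apply, h2 x hx.2, Finsupp.single_eq_of_ne hx.1]
      · rintro ⟨h1, h2⟩
        rw [List.map_cons, List.cons.injEq] at h1
        have e : (List.zipWith Finsupp.single i l).sum = α.erase y := by
          refine (ih hi.2 hl' _).2 ⟨?_, fun x hx => ?_⟩
          · rw [← h1.2]
            refine List.map_congr_left fun x hx => ?_
            exact Finsupp.erase_ne fun h => hi.1 (h ▸ hx)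
          · by_cases hxy : x = y
            · rw [hxy, Finsupp.erase_same]
            · rw [Finsupp.erase_ne hxy]
              exact h2 x (by simp [hxy, hx])
        rw [e, ← h1.1, Finsupp.single_add_erase]

namespace SPar

variable {L O : SPar} {a a' : List ℕ} {α α' : ℕ →₀ ℕ}

lemma matches_iff : L.Matches a α ↔ ∃ i : List ℕ, i.Nodup ∧ i.length = L.parts.length ∧
    a = i.take L.df ∧ (List.zipWith Finsupp.single i L.parts).sum = α := by
  constructor
  · rintro ⟨r, h1, h2, h3, h4⟩
    have hla : a.length = L.df := by rw [df, ← h2, List.length_map]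
    have hl : (a ++ r).length = L.parts.length := by
      rw [parts, ← h2, ← h3, ← List.map_append, List.length_map]
    refine ⟨a ++ r, h1, hl, ?_, ?_⟩
    · rw [← hla, List.take_left']; rfl
    · rw [zipWith_single_eq_iff h1 hl]
      exact ⟨by rw [List.map_append, h2, h3, parts], h4⟩
  · rintro ⟨i, h1, hl, rfl, h2⟩
    obtain ⟨h3, h4⟩ := (zipWith_single_eq_iff h1 hl _).1 h2
    refine ⟨i.drop L.df, ?_, ?_, ?_, ?_⟩
    · rwa [List.take_append_drop]
    · rw [List.map_take, h3, parts, df, List.take_left']; rfl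
    · rw [List.map_drop, h3, parts, df, List.drop_left']; rfl
    · rwa [List.take_append_drop]

lemma Matches.pairwise (h : L.Matches a α) : a.Pairwise fun x y => α x > α y := by
  obtain ⟨r, -, h2, -⟩ := h
  have := L.a_sorted
  rwa [← h2, List.pairwise_map] at this

lemma Matches.nodup (h : L.Matches a α) : a.Nodup := by
  obtain ⟨r, h1, -⟩ := h
  exact h1.of_append_left

lemma Matches.unique (h : L.Matches a α) (h' : O.Matches a' α) (ha : a.toFinset = a'.toFinset) :
    a = a' ∧ L = O := by
  obtain rfl : a = a' := by
    have hp : a.Perm a' := (List.perm_ext_iff_of_nodup h.nodup h'.nodup).2 fun x => by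
      rw [← List.mem_toFinset, ha, List.mem_toFinset]
    exact hp.eq_of_pairwise (fun x y _ _ h1 h2 => absurd (h1.trans h2) (lt_irrefl _))
      h.pairwise h'.pairwise
  refine ⟨rfl, ?_⟩
  obtain ⟨r, h1, h2, h3, h4⟩ := h
  obtain ⟨r', h1', h2', h3', h4'⟩ := h'
  refine SPar.ext (by rw [← h2, h2']) ?_
  have key : ∀ {L O : SPar} {r r' : List ℕ}, (a ++ r).Nodup → r.map α = L.s →
      (∀ x ∉ a ++ r', α x = 0) → ∀ x ∈ r, x ∈ r' := by
    intro L O r r' h1 h2 h3 x hx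
    have hpos : 0 < α x := L.s_pos _ (h2 ▸ List.mem_map_of_mem hx)
    by_contra hx'
    have := h3 x (by
      rw [List.mem_append, not_or]
      exact ⟨fun hxa => (List.nodup_append.1 h1).2.2 x hxa x hx rfl, hx'⟩)
    omega
  have hp : r.Perm r' := (List.perm_ext_iff_of_nodup h1.of_append_right
    h1'.of_append_right).2 fun x => ⟨key (O := O) h1 h3 h4' x, key (O := L) h1' h3' h4 x⟩
  have := hp.map α
  rw [h3, h3'] at this
  exact this.eq_of_pairwise (fun a b _ _ h h' => le_antisymm h' h) L.s_sorted O.s_sorted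

lemma Matches.map (h : L.Matches a α) (σ : Equiv.Perm ℕ) :
    L.Matches (a.map σ) (α.mapDomain σ) := by
  obtain ⟨r, h1, h2, h3, h4⟩ := h
  have e : ∀ l : List ℕ, (l.map σ).map (α.mapDomain σ) = l.map α := by
    intro l
    rw [List.map_map]
    exact List.map_congr_left fun x _ => Finsupp.mapDomain_apply σ.injective α x
  refine ⟨r.map σ, ?_, by rw [e, h2], by rw [e, h3], fun x hx => ?_⟩
  · rw [← List.map_append]; exact h1.map σ.injective
  · obtain ⟨x, rfl⟩ := σ.surjective x
    rw [Finsupp.mapDomain_apply σ.injective]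
    refine h4 x fun hx' => hx ?_
    rw [← List.map_append]
    exact List.mem_map_of_mem hx'

lemma matches_exponents (L : SPar) : L.Matches (List.range L.df) L.exponents := by
  rw [matches_iff]
  refine ⟨List.range L.parts.length, List.nodup_range, List.length_range, ?_, ?_⟩
  · rw [List.take_range, min_eq_left]
    rw [parts, List.length_append, df]; omega
  · rw [zipWith_single_eq_iff List.nodup_range List.length_range]
    constructor
    · refine List.ext_getElem (by simp) fun i h1 h2 => ?_
      rw [List.getElem_map, List.getElem_range]
      exact List.getD_eq_getElem _ _ h2
    · intro x hx
      rw [List.mem_range, not_lt] at hx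
      exact List.getD_eq_default _ _ hx

lemma degree_exponents (L : SPar) : L.exponents.degree = L.deg := by
  rw [degree_eq_sum_range (B := L.parts.length)]
  · exact sum_range_getD L.parts
  · intro r h
    by_contra h'
    exact h (List.getD_eq_default _ _ (by omega))

lemma Matches.exists_perm (h : L.Matches a α) (h' : L.Matches a' α') :
    ∃ σ : Equiv.Perm ℕ, {i | σ i ≠ i}.Finite ∧ a' = a.map σ ∧ α' = α.mapDomain σ := by
  obtain ⟨i, h1, hl, rfl, h2⟩ := matches_iff.1 h
  obtain ⟨i', h1', hl', rfl, h2'⟩ := matches_iff.1 h'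
  have hii : i.length = i'.length := hl.trans hl'.symm
  obtain ⟨σ, hσ, hσi⟩ := exists_finite_perm (f := i.get) (g := fun k => i'.get (k.cast hii))
    (List.nodup_iff_injective_get.1 h1)
    ((List.nodup_iff_injective_get.1 h1').comp (Fin.cast_injective hii))
  have e : i' = i.map σ := by
    refine List.ext_getElem (by simp [hii]) fun k hk hk' => ?_
    rw [List.getElem_map]
    exact (hσi ⟨k, by omega⟩).symm
  refine ⟨σ, hσ, by rw [e, List.map_take], ?_⟩
  rw [← h2', zipWith_single_eq_iff h1' hl']
  obtain ⟨h3, h4⟩ := (zipWith_single_eq_iff h1 hl _).1 h2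
  constructor
  · rw [e, List.map_map, ← h3]
    exact List.map_congr_left fun x _ => Finsupp.mapDomain_apply σ.injective α x
  · intro x hx
    obtain ⟨x, rfl⟩ := σ.surjective x
    rw [Finsupp.mapDomain_apply σ.injective]
    exact h4 x fun hx' => hx (e ▸ List.mem_map_of_mem hx')

lemma Matches.eq_mapDomain (h : L.Matches a α) : ∃ σ : Equiv.Perm ℕ, {i | σ i ≠ i}.Finite ∧
    a = (List.range L.df).map σ ∧ α = L.exponents.mapDomain σ :=
  L.matches_exponents.exists_perm h

lemma exists_matches {A : Finset ℕ} (hA : Set.InjOn α A) :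
    ∃ L a, SPar.Matches L a α ∧ a.toFinset = A := by
  obtain ⟨a, h1, rfl, h2⟩ := exists_sorted_enum A α
  obtain ⟨r, h3, h4, h5⟩ := exists_sorted_enum (α.support \ a.toFinset) α
  have hr : ∀ x, x ∈ r ↔ α x ≠ 0 ∧ x ∉ a := by
    intro x
    rw [← List.mem_toFinset, h4, mem_sdiff, Finsupp.mem_support_iff, List.mem_toFinset]
  refine ⟨⟨a.reverse.map α, r.reverse.map α, ?_, ?_, ?_⟩, a.reverse, ⟨r.reverse, ?_, rfl, rfl, ?_⟩,
    ?_⟩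
  · rw [List.pairwise_map, List.pairwise_reverse]
    refine (h2.and h1).imp_of_mem fun {x y} hx hy h => lt_of_le_of_ne h.1 fun e => h.2 ?_
    exact hA (by simpa using hx) (by simpa using hy) e
  · rw [List.pairwise_map, List.pairwise_reverse]
    exact h5
  · intro c hc
    obtain ⟨x, hx, rfl⟩ := List.mem_map.1 hc
    exact Nat.pos_of_ne_zero ((hr x).1 (List.mem_reverse.1 hx)).1
  · rw [List.nodup_append]
    refine ⟨List.nodup_reverse.2 h1, List.nodup_reverse.2 h3, ?_⟩
    rintro x hx _ hy rfl
    exact ((hr x).1 (List.mem_reverse.1 hy)).2 (List.mem_reverse.1 hx)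
  · intro x hx
    rw [List.mem_append, List.mem_reverse, List.mem_reverse, hr, not_or] at hx
    by_contra h
    exact hx.2 ⟨h, hx.1⟩
  · simp

lemma length_s_le (L : SPar) : L.s.length ≤ L.s.sum := by
  have : ∀ l : List ℕ, (∀ x ∈ l, 0 < x) → l.length ≤ l.sum := by
    intro l
    induction l with
    | nil => simp
    | cons x t ih =>
      intro h
      have h1 := h x List.mem_cons_self
      have h2 := ih fun y hy => h y (List.mem_cons_of_mem _ hy)
      rw [List.length_cons, List.sum_cons]; omega
  exact this L.s L.s_pos

lemma finite_le (d : ℕ) : {L : SPar | L.df + L.deg ≤ d}.Finite := by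
  refine Set.Finite.of_injOn (f := fun L : SPar => (L.df, L.exponents))
    (t := ((range (d + 1) ×ˢ (range (d + 1)).biUnion fun k => (range d).finsuppAntidiag k :
      Finset (ℕ × (ℕ →₀ ℕ))) : Set (ℕ × (ℕ →₀ ℕ)))) ?_ ?_ (Finset.finite_toSet _)
  · intro L hL
    rw [Set.mem_ofPred_eq] at hL
    have h1 := L.length_s_le
    have h2 : L.deg = L.a.sum + L.s.sum := by rw [deg, parts, List.sum_append]
    have h3 : L.parts.length = L.df + L.s.length := by rw [parts, List.length_append, df]
    rw [mem_coe, mem_product, mem_biUnion]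
    refine ⟨mem_range.2 (by dsimp only; omega), L.deg, mem_range.2 (by omega), ?_⟩
    rw [mem_finsuppAntidiag]
    have hsub : L.exponents.support ⊆ range d := by
      intro i hi
      rw [Finsupp.mem_support_iff] at hi
      rw [mem_range]
      by_contra h
      exact hi (List.getD_eq_default _ _ (by omega))
    refine ⟨?_, hsub⟩
    rw [← degree_exponents, Finsupp.degree_apply]
    exact (sum_subset hsub fun r _ hr => by simpa using hr).symm
  · intro L _ O _ h
    obtain ⟨h1, h2⟩ := Prod.mk.inj h
    have h3 := O.matches_exponents
    rw [← h1, ← h2] at h3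
    exact (L.matches_exponents.unique h3 rfl).2

end SPar

lemma monomialComm_of_matches {L : SPar} {a : List ℕ} {α : ℕ →₀ ℕ} (h : L.Matches a α) :
    monomialComm L a.toFinset α = thetaSign a := by
  rw [monomialComm, Comm.formalSum]
  obtain ⟨i, h1, h2, h3, h4⟩ := SPar.matches_iff.1 h
  rw [finsum_eq_single _ ⟨Comm.mono a α, i, h1, h2, by rw [h3, h4]⟩]
  · simp [Comm.mono]
  · rintro ⟨_, i', h1', h2', rfl⟩ hne
    change (if _ ∧ _ then _ else 0) = _
    rw [if_neg]
    rintro ⟨e1, e2⟩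
    have h' : L.Matches (i'.take L.df) α := SPar.matches_iff.2 ⟨i', h1', h2', rfl, e2⟩
    refine hne (Subtype.ext ?_)
    change Comm.mono _ _ = Comm.mono _ _
    rw [(h'.unique h e1).1, e2]

lemma monomialComm_ne_zero {L : SPar} {A : Finset ℕ} {α : ℕ →₀ ℕ} (h : monomialComm L A α ≠ 0) :
    ∃ a, L.Matches a α ∧ a.toFinset = A := by
  by_contra! h'
  refine h ?_
  rw [monomialComm, Comm.formalSum, finsum_eq_zero_of_forall_eq_zero]
  rintro ⟨_, i', h1', h2', rfl⟩
  change (if _ ∧ _ then _ else 0) = _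
  rw [if_neg]
  rintro ⟨e1, e2⟩
  exact h' _ (SPar.matches_iff.2 ⟨i', h1', h2', rfl, e2⟩) e1

lemma monomialComm_val_of_matches {L : SPar} {a : List ℕ} {α : ℕ →₀ ℕ} (h : L.Matches a α) :
    (monomialComm L).val a α = 1 := by
  rw [Comm.val, monomialComm_of_matches h, thetaSign_mul_self h.nodup]

lemma SPar.Matches.card_degree {L : SPar} {a : List ℕ} {α : ℕ →₀ ℕ} (h : L.Matches a α) :
    a.toFinset.card = L.df ∧ α.degree = L.deg := by
  obtain ⟨σ, -, rfl, rfl⟩ := h.eq_mapDomain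
  constructor
  · rw [toFinset_map_perm, card_map, List.toFinset_card_of_nodup List.nodup_range,
      List.length_range]
  · rw [← L.degree_exponents]
    exact Finsupp.degree_mapDomain _ _

lemma monomialComm_mem (L : SPar) : monomialComm L ∈ symComm := by
  refine ⟨⟨L.df + L.deg, fun A α h => ?_⟩, fun σ _ a α ha => ?_⟩
  · obtain ⟨a, h1, rfl⟩ := monomialComm_ne_zero h
    rw [h1.card_degree.1, h1.card_degree.2]
  · have key : ∀ (σ : Equiv.Perm ℕ) (a : List ℕ) (α : ℕ →₀ ℕ), a.Nodup →
        (monomialComm L).val a α ≠ 0 →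
        (monomialComm L).val (a.map σ) (α.mapDomain σ) = (monomialComm L).val a α := by
      intro σ a α ha h
      obtain ⟨b, h1, h2⟩ := monomialComm_ne_zero (right_ne_zero_of_mul h)
      have hp : b.Perm a := (List.perm_ext_iff_of_nodup h1.nodup ha).2 fun x => by
        rw [← List.mem_toFinset, h2, List.mem_toFinset]
      have e1 := val_perm (f := monomialComm L) hp h1.nodup α
      have e2 := val_perm (f := monomialComm L) (hp.map σ) (h1.nodup.map σ.injective)
        (α.mapDomain σ)
      rw [Comm.val, Comm.val, e1, e2, thetaSign_map_mul hp h1.nodup σ.injective]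
      have e3 := monomialComm_val_of_matches h1
      have e4 := monomialComm_val_of_matches (h1.map σ)
      rw [Comm.val] at e3 e4
      rw [e3, e4]
    by_cases h : (monomialComm L).val a α = 0
    · by_contra h'
      rw [h] at h'
      have := key σ.symm (a.map σ) (α.mapDomain σ) (ha.map σ.injective) h'
      rw [List.map_map, σ.symm_comp_self, List.map_id, ← Finsupp.mapDomain_comp,
        σ.symm_comp_self, Finsupp.mapDomain_id] at this
      exact h' (this ▸ h)
    · exact key σ a α ha h

/-- `m_Λ` as an element of `sSym`. -/
def mComm (L : SPar) : sSym := ⟨monomialComm L, sSym_eq_symComm ▸ monomialComm_mem L⟩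

lemma sSym_val {g : Comm} (hg : g ∈ sSym) {σ : Equiv.Perm ℕ} (hσ : {i | σ i ≠ i}.Finite)
    {a : List ℕ} (ha : a.Nodup) (α : ℕ →₀ ℕ) : g.val (a.map σ) (α.mapDomain σ) = g.val a α :=
  (sSym_eq_symComm ▸ hg : g ∈ symComm).2 σ hσ a α ha

/-- The coefficient of `m_Λ`. -/
def evComm (L : SPar) : sSym →ₗ[ℚ] ℚ where
  toFun g := (g : Comm) (range L.df) L.exponents
  map_add' _ _ := rfl
  map_smul' _ _ := rfl

lemma evComm_eq_val (L : SPar) (g : sSym) :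
    evComm L g = (g : Comm).val (List.range L.df) L.exponents := by
  rw [Comm.val, thetaSign_of_pairwise List.pairwise_lt_range, one_mul, List.toFinset_range]
  rfl

lemma val_eq_evComm (g : sSym) {L : SPar} {a : List ℕ} {α : ℕ →₀ ℕ} (h : L.Matches a α) :
    (g : Comm).val a α = evComm L g := by
  obtain ⟨σ, hσ, rfl, rfl⟩ := h.eq_mapDomain
  rw [sSym_val g.2 hσ List.nodup_range, evComm_eq_val]

lemma sSym_eq_zero {g : Comm} (hg : g ∈ sSym) {A : Finset ℕ} {α : ℕ →₀ ℕ}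
    (hA : ¬ Set.InjOn α A) : g A α = 0 := by
  simp only [Set.InjOn, not_forall] at hA
  obtain ⟨x, hx, y, hy, hxy, hne⟩ := hA
  have hx' : x ∈ A.sort := (Finset.mem_sort _).2 hx
  have hy' : y ∈ A.sort := (Finset.mem_sort _).2 hy
  have hnd : A.sort.Nodup := Finset.sort_nodup _ _
  have h := sSym_val hg (finite_swap x y) hnd α
  have e : α.mapDomain (Equiv.swap x y) = α := by
    ext z
    obtain ⟨z, rfl⟩ := (Equiv.swap x y).surjective z
    rw [Finsupp.mapDomain_apply (Equiv.injective _), Equiv.swap_apply_def]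
    split_ifs with h1 h2
    · rw [h1, hxy]
    · rw [h2, hxy]
    · rfl
  rw [e, Comm.val, Comm.val, thetaSign_swap hnd hx' hy' hne, toFinset_map_swap hx' hy',
    Finset.sort_toFinset, thetaSign_sort] at h
  linarith

lemma evComm_mComm (L O : SPar) [Decidable (L = O)] :
    evComm O (mComm L) = if L = O then 1 else 0 := by
  split_ifs with h
  · subst h
    rw [evComm_eq_val]
    exact monomialComm_val_of_matches L.matches_exponents
  · by_contra h'
    obtain ⟨a, h1, h2⟩ := monomialComm_ne_zero (L := L) h'
    refine h (h1.unique O.matches_exponents ?_).2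
    rw [h2, List.toFinset_range]

lemma evComm_separates (g : sSym) (h : ∀ L, evComm L g = 0) : g = 0 := by
  refine Subtype.ext (funext fun A => funext fun α => ?_)
  by_cases hA : Set.InjOn α A
  · obtain ⟨L, a, hL, rfl⟩ := SPar.exists_matches hA
    have h1 := val_eq_evComm g hL
    rw [h, Comm.val] at h1
    exact (mul_eq_zero.1 h1).resolve_left (thetaSign_ne_zero hL.nodup)
  · exact sSym_eq_zero g.2 hA

lemma evComm_finite (g : sSym) : {L | evComm L g ≠ 0}.Finite := by
  obtain ⟨⟨d, hd⟩, -⟩ := (sSym_eq_symComm ▸ g.2 : (g : Comm) ∈ symComm)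
  refine (SPar.finite_le d).subset fun L hL => ?_
  have := hd _ _ hL
  rwa [card_range, L.degree_exponents] at this

open Classical in
/-- The basis of the `m_Λ`. -/
def commBasis : Module.Basis SPar ℚ sSym :=
  basisOfDual mComm evComm (fun L O => evComm_mComm L O) evComm_separates evComm_finite

open Classical in
lemma commBasis_apply (L : SPar) : commBasis L = mComm L := basisOfDual_apply ..

/-! ### The monomial basis in noncommuting variables -/

/-- The first position of a letter in a word, and `0` for letters that do not occur. -/
def firstPos (w : List ℕ) (x : ℕ) : ℕ := if x ∈ w then w.idxOf x + 1 else 0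

lemma firstPos_inj {w : List ℕ} {x y : ℕ} (h : firstPos w x = firstPos w y) :
    x = y ∨ (x ∉ w ∧ y ∉ w) := by
  unfold firstPos at h
  split_ifs at h with hx hy hy
  · exact Or.inl ((List.idxOf_inj hx).1 (by omega))
  · exact Or.inr ⟨hx, hy⟩

lemma sInf_eq_firstPos {n : ℕ} (g : Fin n → ℕ) (x : ℕ) :
    sInf ((fun l : Fin n => (l : ℕ) + 1) '' {l | x = g l}) = firstPos (List.ofFn g) x := by
  unfold firstPos
  split_ifs with h
  · have hlt := List.idxOf_lt_length_of_mem h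
    have hlt' : (List.ofFn g).idxOf x < n := by rwa [List.length_ofFn] at hlt
    have hx : g ⟨_, hlt'⟩ = x := by
      have := List.getElem_idxOf hlt
      rwa [List.getElem_ofFn] at this
    refine le_antisymm (Nat.sInf_le ⟨⟨_, hlt'⟩, hx.symm, rfl⟩) ?_
    have hne : ((fun l : Fin n => (l : ℕ) + 1) '' {l | x = g l}).Nonempty :=
      ⟨_, ⟨_, hlt'⟩, hx.symm, rfl⟩
    obtain ⟨l, hl, hl'⟩ := Nat.sInf_mem hne
    rw [← hl']
    have hl2 : x = g l := hl
    by_contra hcon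
    have hcon' : (l : ℕ) < (List.ofFn g).idxOf x := by dsimp only at hcon; omega
    have := List.not_of_lt_findIdx (p := (· == x)) (xs := List.ofFn g) (i := l) hcon'
    simp [hl2] at this
  · have : {l | x = g l} = ∅ := by
      ext l
      simp only [Set.mem_ofPred_eq, Set.mem_empty_iff_false, iff_false]
      rintro rfl
      exact h ((List.mem_ofFn' g _).2 ⟨l, rfl⟩)
    rw [this, Set.image_empty, Nat.sInf_empty]

namespace SetSPar

/-- `θ_a x_w` is a monomial of `m_I`. -/
def Matches (I : SetSPar) (a w : List ℕ) : Prop :=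
  ∃ (f : Fin I.m → ℕ) (g : Fin I.n → ℕ), (∀ i j, f i = g j ↔ I.rel (Sum.inl i) (Sum.inr j)) ∧
    (∀ i j, g i = g j ↔ I.rel (Sum.inr i) (Sum.inr j)) ∧ List.ofFn f = a ∧ List.ofFn g = w

variable {I J : SetSPar} {a a' w w' : List ℕ}

lemma firstPos_lt {f : Fin I.m → ℕ} {g : Fin I.n → ℕ}
    (h : ∀ i j, f i = g j ↔ I.rel (Sum.inl i) (Sum.inr j)) {i j : Fin I.m} (hij : i < j) :
    firstPos (List.ofFn g) (f i) < firstPos (List.ofFn g) (f j) := by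
  rw [← sInf_eq_firstPos, ← sInf_eq_firstPos]
  simp only [h]
  exact I.sorted i j hij

lemma injective_of_rel {f : Fin I.m → ℕ} {g : Fin I.n → ℕ}
    (h : ∀ i j, f i = g j ↔ I.rel (Sum.inl i) (Sum.inr j)) : Function.Injective f := by
  intro i j hij
  by_contra hne
  rcases lt_or_gt_of_ne hne with h' | h'
  · have := firstPos_lt h h'; rw [hij] at this; exact lt_irrefl _ this
  · have := firstPos_lt h h'; rw [hij] at this; exact lt_irrefl _ this

lemma ker_eq {f : Fin I.m → ℕ} {g : Fin I.n → ℕ}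
    (h : ∀ i j, f i = g j ↔ I.rel (Sum.inl i) (Sum.inr j))
    (h' : ∀ i j, g i = g j ↔ I.rel (Sum.inr i) (Sum.inr j)) :
    Setoid.ker (Sum.elim f g) = I.rel := by
  ext x y
  rw [Setoid.ker_def]
  rcases x with i | i <;> rcases y with j | j
  · exact ⟨fun e => injective_of_rel h e ▸ I.rel.refl _, fun e => congrArg f (I.sep i j e)⟩
  · exact h i j
  · exact eq_comm.trans ((h j i).trans ⟨I.rel.symm, I.rel.symm⟩)
  · exact h' i j

lemma Matches.pairwise (h : I.Matches a w) :
    a.Pairwise fun x y => firstPos w x < firstPos w y := by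
  obtain ⟨f, g, h1, h2, rfl, rfl⟩ := h
  rw [List.pairwise_ofFn]
  exact fun i j hij => firstPos_lt h1 hij

lemma Matches.nodup (h : I.Matches a w) : a.Nodup := by
  obtain ⟨f, g, h1, h2, rfl, rfl⟩ := h
  exact List.nodup_ofFn.2 (injective_of_rel h1)

lemma Matches.length (h : I.Matches a w) : a.length = I.m ∧ w.length = I.n := by
  obtain ⟨f, g, h1, h2, rfl, rfl⟩ := h
  exact ⟨List.length_ofFn, List.length_ofFn⟩

lemma Matches.unique (h : I.Matches a w) (h' : J.Matches a' w) (ha : a.toFinset = a'.toFinset) :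
    a = a' ∧ I = J := by
  obtain rfl : a = a' := by
    have hp : a.Perm a' := (List.perm_ext_iff_of_nodup h.nodup h'.nodup).2 fun x => by
      rw [← List.mem_toFinset, ha, List.mem_toFinset]
    exact hp.eq_of_pairwise (fun x y _ _ h1 h2 => absurd (h1.trans h2) (lt_irrefl _))
      h.pairwise h'.pairwise
  refine ⟨rfl, ?_⟩
  have hm := h.length.1.symm.trans h'.length.1
  have hn := h.length.2.symm.trans h'.length.2
  obtain ⟨f, g, h1, h2, h3, h4⟩ := h
  obtain ⟨f', g', h1', h2', h3', h4'⟩ := h'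
  have e1 := ker_eq h1 h2
  have e2 := ker_eq h1' h2'
  obtain ⟨n, m, r, s1, s2⟩ := I
  obtain ⟨n', m', r', s1', s2'⟩ := J
  dsimp only at hm hn f g f' g' e1 e2
  subst hm hn
  obtain rfl : f = f' := List.ofFn_injective (h3.trans h3'.symm)
  obtain rfl : g = g' := List.ofFn_injective (h4.trans h4'.symm)
  obtain rfl : r = r' := e1.symm.trans e2
  rfl

lemma Matches.map (h : I.Matches a w) (σ : Equiv.Perm ℕ) : I.Matches (a.map σ) (w.map σ) := by
  obtain ⟨f, g, h1, h2, rfl, rfl⟩ := h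
  refine ⟨σ ∘ f, σ ∘ g, fun i j => ?_, fun i j => ?_, List.map_ofFn.symm, List.map_ofFn.symm⟩
  · rw [← h1]; exact σ.injective.eq_iff
  · rw [← h2]; exact σ.injective.eq_iff

lemma Matches.exists_perm (h : I.Matches a w) (h' : I.Matches a' w') :
    ∃ σ : Equiv.Perm ℕ, {i | σ i ≠ i}.Finite ∧ a' = a.map σ ∧ w' = w.map σ := by
  classical
  obtain ⟨f, g, h1, h2, rfl, rfl⟩ := h
  obtain ⟨f', g', h1', h2', rfl, rfl⟩ := h'
  have e := ker_eq h1 h2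
  have e' := ker_eq h1' h2'
  have key : ∀ {u : Fin I.m ⊕ Fin I.n → ℕ}, Setoid.ker u = I.rel →
      ∃ v : Quotient I.rel → ℕ, Function.Injective v ∧ ∀ x, v (Quotient.mk _ x) = u x := by
    intro u hu
    refine ⟨Quotient.lift u fun x y hxy => ?_, ?_, fun x => rfl⟩
    · have : I.rel x y := hxy
      rwa [← hu, Setoid.ker_def] at this
    · rintro ⟨x⟩ ⟨y⟩ hxy
      refine Quotient.sound ?_
      change I.rel x y
      rw [← hu, Setoid.ker_def]
      exact hxy
  obtain ⟨v, hv, hvu⟩ := key e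
  obtain ⟨v', hv', hvu'⟩ := key e'
  let q := Fintype.equivFin (Quotient I.rel)
  obtain ⟨σ, hσ, hσi⟩ := exists_finite_perm (hv.comp q.symm.injective)
    (hv'.comp q.symm.injective)
  have hx : ∀ x, σ (Sum.elim f g x) = Sum.elim f' g' x := by
    intro x
    have := hσi (q (Quotient.mk _ x))
    simpa only [Function.comp_apply, Equiv.symm_apply_apply, hvu, hvu'] using this
  refine ⟨σ, hσ, ?_, ?_⟩
  · rw [List.map_ofFn]; congr 1; funext i; exact (hx (Sum.inl i)).symm
  · rw [List.map_ofFn]; congr 1; funext i; exact (hx (Sum.inr i)).symm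

lemma exists_matches {A : Finset ℕ} (hA : Set.InjOn (firstPos w) A) :
    ∃ (I : SetSPar) (a : List ℕ), I.Matches a w ∧ a.toFinset = A := by
  obtain ⟨a, h1, rfl, h2⟩ := exists_sorted_enum A (firstPos w)
  have h3 : a.Pairwise fun x y => firstPos w x < firstPos w y :=
    (h2.and h1).imp_of_mem fun {x y} hx hy h => lt_of_le_of_ne h.1 fun e => h.2
      (hA (by simpa using hx) (by simpa using hy) e)
  refine ⟨⟨w.length, a.length, Setoid.ker (Sum.elim a.get w.get), fun i j h => ?_,
    fun i j hij => ?_⟩, a, ⟨a.get, w.get, fun i j => Iff.rfl, fun i j => Iff.rfl, List.ofFn_get a,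
    List.ofFn_get w⟩, rfl⟩
  · exact List.nodup_iff_injective_get.1 h1 h
  · have e : ∀ i, {l | Setoid.ker (Sum.elim a.get w.get) (Sum.inl i) (Sum.inr l)} =
        {l | a.get i = w.get l} := fun i => rfl
    rw [e, e, sInf_eq_firstPos, sInf_eq_firstPos, List.ofFn_get]
    exact List.pairwise_iff_get.1 h3 i j hij

variable (I)

lemma exists_rep : ∃ p : List ℕ × List ℕ, I.Matches p.1 p.2 := by
  classical
  let q : Fin I.m ⊕ Fin I.n → ℕ := fun x => Fintype.equivFin (Quotient I.rel) (Quotient.mk _ x)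
  have hq : ∀ x y, q x = q y ↔ I.rel x y := by
    intro x y
    rw [Fin.val_inj, EmbeddingLike.apply_eq_iff_eq]
    exact Quotient.eq
  exact ⟨(_, _), fun i => q (Sum.inl i), fun i => q (Sum.inr i), fun i j => hq _ _,
    fun i j => hq _ _, rfl, rfl⟩

/-- A monomial of `m_I`. -/
def rep : List ℕ × List ℕ := I.exists_rep.choose

lemma matches_rep : I.Matches I.rep.1 I.rep.2 := I.exists_rep.choose_spec

lemma finite_le (d : ℕ) : {I : SetSPar | I.m + I.n ≤ d}.Finite := by
  have hfin : ∀ m n : ℕ, {I : SetSPar | I.m = m ∧ I.n = n}.Finite := by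
    intro m n
    have : Finite (Setoid (Fin m ⊕ Fin n)) :=
      Finite.of_injective (fun r : Setoid (Fin m ⊕ Fin n) => fun x y => r x y) fun r s h =>
        Setoid.ext fun x y => iff_of_eq (congrFun (congrFun h x) y)
    refine (Set.finite_range fun r : {r : Setoid (Fin m ⊕ Fin n) //
      (∀ i j : Fin m, r (Sum.inl i) (Sum.inl j) → i = j) ∧ ∀ i j : Fin m, i < j →
        sInf ((fun l : Fin n => (l : ℕ) + 1) '' {l | r (Sum.inl i) (Sum.inr l)}) <
        sInf ((fun l : Fin n => (l : ℕ) + 1) '' {l | r (Sum.inl j) (Sum.inr l)})} =>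
      (⟨n, m, r.1, r.2.1, r.2.2⟩ : SetSPar)).subset ?_
    rintro ⟨n, m, r, h1, h2⟩ ⟨rfl, rfl⟩
    exact ⟨⟨r, h1, h2⟩, rfl⟩
  refine (((range (d + 1)) ×ˢ (range (d + 1))).finite_toSet.biUnion
    fun p _ => hfin p.1 p.2).subset fun I hI => ?_
  rw [Set.mem_ofPred_eq] at hI
  refine Set.mem_biUnion (x := (I.m, I.n)) ?_ ⟨rfl, rfl⟩
  rw [mem_coe, mem_product, mem_range, mem_range]
  dsimp only
  omega

end SetSPar

lemma monomial_of_matches {I : SetSPar} {a w : List ℕ} (h : I.Matches a w) :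
    I.monomial a.toFinset w = thetaSign a := by
  rw [SetSPar.monomial, NC.formalSum]
  have h' := h
  obtain ⟨f, g, h1, h2, rfl, rfl⟩ := h'
  rw [finsum_eq_single _ ⟨(f, g), h1, h2⟩]
  · simp [NC.mono]
  · rintro ⟨⟨f', g'⟩, h1', h2'⟩ hne
    change (if _ ∧ _ then _ else 0) = _
    rw [if_neg]
    rintro ⟨e1, e2⟩
    have h3 : I.Matches (List.ofFn f') (List.ofFn g) := ⟨f', g', h1', h2', rfl, e2⟩
    have e3 := List.ofFn_injective (h3.unique h e1).1
    have e4 := List.ofFn_injective e2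
    dsimp only at e4
    subst e3 e4
    exact hne rfl

lemma monomial_ne_zero {I : SetSPar} {A : Finset ℕ} {w : List ℕ} (h : I.monomial A w ≠ 0) :
    ∃ a, I.Matches a w ∧ a.toFinset = A := by
  by_contra! h'
  refine h ?_
  rw [SetSPar.monomial, NC.formalSum, finsum_eq_zero_of_forall_eq_zero]
  rintro ⟨⟨f, g⟩, h1, h2⟩
  change (if _ ∧ _ then _ else 0) = _
  rw [if_neg]
  rintro ⟨e1, e2⟩
  exact h' _ ⟨f, g, h1, h2, rfl, e2⟩ e1

lemma monomial_val_of_matches {I : SetSPar} {a w : List ℕ} (h : I.Matches a w) :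
    I.monomial.val a w = 1 := by
  rw [NC.val, monomial_of_matches h, thetaSign_mul_self h.nodup]

lemma SetSPar.Matches.card_length {I : SetSPar} {a w : List ℕ} (h : I.Matches a w) :
    a.toFinset.card = I.m ∧ w.length = I.n := by
  rw [List.toFinset_card_of_nodup h.nodup]
  exact h.length

lemma monomial_mem (I : SetSPar) : I.monomial ∈ sNCSym := by
  refine mem_sNCSym_iff.2 ⟨⟨I.m + I.n, fun A w h => ?_⟩, fun σ _ a w ha => ?_⟩
  · obtain ⟨a, h1, rfl⟩ := monomial_ne_zero h
    rw [h1.card_length.1, h1.card_length.2]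
  · have key : ∀ (σ : Equiv.Perm ℕ) (a w : List ℕ), a.Nodup → I.monomial.val a w ≠ 0 →
        I.monomial.val (a.map σ) (w.map σ) = I.monomial.val a w := by
      intro σ a w ha h
      obtain ⟨b, h1, h2⟩ := monomial_ne_zero (right_ne_zero_of_mul h)
      have hp : b.Perm a := (List.perm_ext_iff_of_nodup h1.nodup ha).2 fun x => by
        rw [← List.mem_toFinset, h2, List.mem_toFinset]
      have e1 := val_perm (f := I.monomial) hp h1.nodup w
      have e2 := val_perm (f := I.monomial) (hp.map σ) (h1.nodup.map σ.injective) (w.map σ)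
      rw [NC.val, NC.val, e1, e2, thetaSign_map_mul hp h1.nodup σ.injective]
      have e3 := monomial_val_of_matches h1
      have e4 := monomial_val_of_matches (h1.map σ)
      rw [NC.val] at e3 e4
      rw [e3, e4]
    by_cases h : I.monomial.val a w = 0
    · by_contra h'
      rw [h] at h'
      have := key σ.symm (a.map σ) (w.map σ) (ha.map σ.injective) h'
      rw [List.map_map, List.map_map, σ.symm_comp_self, List.map_id, List.map_id] at this
      exact h' (this ▸ h)
    · exact key σ a w ha h

/-- `m_I` as an element of `sNCSym`. -/
def mNC (I : SetSPar) : sNCSym := ⟨I.monomial, monomial_mem I⟩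

/-- The coefficient of `m_I`. -/
def evNC (I : SetSPar) : sNCSym →ₗ[ℚ] ℚ where
  toFun f := (f : NC).val I.rep.1 I.rep.2
  map_add' f g := by simp [NC.val, mul_add]
  map_smul' c f := by simp [NC.val, mul_left_comm]

lemma val_eq_evNC (f : sNCSym) {I : SetSPar} {a w : List ℕ} (h : I.Matches a w) :
    (f : NC).val a w = evNC I f := by
  obtain ⟨σ, hσ, rfl, rfl⟩ := I.matches_rep.exists_perm h
  exact (mem_sNCSym_iff.1 f.2).2 σ hσ _ _ I.matches_rep.nodup

lemma sNCSym_eq_zero {f : NC} (hf : f ∈ sNCSym) {A : Finset ℕ} {w : List ℕ}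
    (hA : ¬ Set.InjOn (firstPos w) A) : f A w = 0 := by
  simp only [Set.InjOn, not_forall] at hA
  obtain ⟨x, hx, y, hy, hxy, hne⟩ := hA
  have hx' : x ∈ A.sort := (Finset.mem_sort _).2 hx
  have hy' : y ∈ A.sort := (Finset.mem_sort _).2 hy
  have hnd : A.sort.Nodup := Finset.sort_nodup _ _
  obtain ⟨hxw, hyw⟩ := (firstPos_inj hxy).resolve_left hne
  have h := (mem_sNCSym_iff.1 hf).2 _ (finite_swap x y) A.sort w hnd
  have e : w.map (Equiv.swap x y) = w := by
    conv_rhs => rw [← List.map_id w]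
    refine List.map_congr_left fun z hz => Equiv.swap_apply_of_ne_of_ne ?_ ?_
    · rintro rfl; exact hxw hz
    · rintro rfl; exact hyw hz
  rw [e, NC.val, NC.val, thetaSign_swap hnd hx' hy' hne, toFinset_map_swap hx' hy',
    Finset.sort_toFinset, thetaSign_sort] at h
  linarith

lemma evNC_mNC (I J : SetSPar) [Decidable (I = J)] :
    evNC J (mNC I) = if I = J then 1 else 0 := by
  split_ifs with h
  · subst h
    exact monomial_val_of_matches I.matches_rep
  · by_contra h'
    obtain ⟨a, h1, h2⟩ := monomial_ne_zero (I := I) (right_ne_zero_of_mul h')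
    exact h (h1.unique J.matches_rep h2).2

lemma evNC_separates (f : sNCSym) (h : ∀ I, evNC I f = 0) : f = 0 := by
  refine Subtype.ext (funext fun A => funext fun w => ?_)
  by_cases hA : Set.InjOn (firstPos w) A
  · obtain ⟨I, a, hI, rfl⟩ := SetSPar.exists_matches hA
    have h1 := val_eq_evNC f hI
    rw [h, NC.val] at h1
    exact (mul_eq_zero.1 h1).resolve_left (thetaSign_ne_zero hI.nodup)
  · exact sNCSym_eq_zero f.2 hA

lemma evNC_finite (f : sNCSym) : {I | evNC I f ≠ 0}.Finite := by
  obtain ⟨⟨d, hd⟩, -⟩ := mem_sNCSym_iff.1 f.2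
  refine (SetSPar.finite_le d).subset fun I hI => ?_
  have := hd _ _ (right_ne_zero_of_mul hI)
  rwa [I.matches_rep.card_length.1, I.matches_rep.card_length.2] at this

open Classical in
/-- The basis of the `m_I`. -/
def ncBasis : Module.Basis SetSPar ℚ sNCSym :=
  basisOfDual mNC evNC (fun I J => evNC_mNC I J) evNC_separates evNC_finite

open Classical in
lemma ncBasis_apply (I : SetSPar) : ncBasis I = mNC I := basisOfDual_apply ..

/-! ### The lift of the monomial functions -/

lemma exists_perm_map {l l' : List ℕ} {f : ℕ → ℕ} (h : (l.map f).Perm l') :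
    ∃ k : List ℕ, k.Perm l ∧ k.map f = l' := by
  obtain ⟨τ, rfl⟩ := exists_perm_of_perm h (f ∘ l.get) (by rw [← List.map_ofFn, List.ofFn_get])
  refine ⟨List.ofFn (l.get ∘ τ), ?_, List.map_ofFn⟩
  have := τ.ofFn_comp_perm l.get
  rwa [List.ofFn_get] at this

lemma wordSign_eq_pow {m : ℕ} {g : Fin m → ℤ} (hg : Function.Injective g) :
    wordSign g = (-1) ^ ((univ : Finset (Fin m × Fin m)).filter
      fun p => p.1 < p.2 ∧ g p.2 < g p.1).card := by
  rw [← prod_const, prod_filter, ← univ_product_univ, prod_product_right, wordSign]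
  refine prod_congr rfl fun j _ => ?_
  rw [← filter_gt_eq_Iio, prod_filter]
  refine prod_congr rfl fun i _ => ?_
  by_cases hij : i < j
  · have hne : g j ≠ g i := fun h => hij.ne' (hg h)
    rcases lt_or_gt_of_ne hne with h | h
    · rw [if_pos hij, if_pos ⟨hij, h⟩, Int.sign_eq_neg_one_of_neg (by omega)]; simp
    · rw [if_pos hij, if_neg fun h' => lt_asymm h h'.2, Int.sign_eq_one_of_pos (by omega)]; simp
  · rw [if_neg hij, if_neg fun h => hij h.1]

lemma SPar.Matches.fact_eq {L : SPar} {a : List ℕ} {α : ℕ →₀ ℕ} (h : L.Matches a α) :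
    contentFact α = L.fact := by
  obtain ⟨r, h1, h2, h3, h4⟩ := h
  rw [SPar.fact, SPar.parts, ← h2, ← h3, ← List.map_append, List.map_map, ← List.prod_toFinset _ h1,
    contentFact]
  refine prod_subset (fun x hx => ?_) fun x _ hx => ?_
  · rw [List.mem_toFinset]
    by_contra hx'
    exact Finsupp.mem_support_iff.1 hx (h4 x hx')
  · rw [Finsupp.notMem_support_iff.1 hx, Nat.factorial_zero]

namespace SetSPar

variable {I : SetSPar} {L : SPar} {a w : List ℕ}

lemma ferSize_eq {f : Fin I.m → ℕ} {g : Fin I.n → ℕ}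
    (h : ∀ i j, f i = g j ↔ I.rel (Sum.inl i) (Sum.inr j)) (i : Fin I.m) :
    I.ferSize i = content (List.ofFn g) (f i) := by
  rw [content_apply, count_ofFn, ferSize]
  congr 1
  ext l
  simp only [mem_filter, mem_univ, true_and, ← h, eq_comm]

lemma bosBlocks_eq {f : Fin I.m → ℕ} {g : Fin I.n → ℕ}
    (h : ∀ i j, f i = g j ↔ I.rel (Sum.inl i) (Sum.inr j))
    (h' : ∀ i j, g i = g j ↔ I.rel (Sum.inr i) (Sum.inr j)) :
    I.bosBlocks.val.map card = ((content (List.ofFn g)).support \ (List.ofFn f).toFinset).val.map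
      (content (List.ofFn g)) := by
  classical
  set S := (content (List.ofFn g)).support \ (List.ofFn f).toFinset with hS
  have hmem : ∀ y, y ∈ S ↔ (∃ j, g j = y) ∧ ∀ i, f i ≠ y := by
    intro y
    rw [hS, mem_sdiff, support_content, List.mem_toFinset, List.mem_toFinset, List.mem_ofFn',
      List.mem_ofFn', Set.mem_range, Set.mem_range, not_exists]
  have e : I.bosBlocks = S.image fun y => univ.filter fun l => y = g l := by
    ext C
    rw [bosBlocks, mem_image, mem_image]
    constructor
    · rintro ⟨j, hj, rfl⟩
      rw [mem_filter] at hj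
      refine ⟨g j, (hmem _).2 ⟨⟨j, rfl⟩, fun i hi => hj.2 i ((h i j).1 hi)⟩, ?_⟩
      ext l
      simp only [mem_filter, mem_univ, true_and, h']
    · rintro ⟨y, hy, rfl⟩
      obtain ⟨⟨j, rfl⟩, h2⟩ := (hmem y).1 hy
      refine ⟨j, mem_filter.2 ⟨mem_univ _, fun i hi => h2 i ((h i j).2 hi)⟩, ?_⟩
      ext l
      simp only [mem_filter, mem_univ, true_and, h']
  rw [e, image_val_of_injOn, Multiset.map_map]
  · refine Multiset.map_congr rfl fun y _ => ?_
    rw [Function.comp_apply, content_apply, count_ofFn]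
    congr 1
    ext l
    simp only [mem_filter, mem_univ, true_and, eq_comm]
  · intro y hy z _ hyz
    obtain ⟨⟨j, rfl⟩, -⟩ := (hmem y).1 hy
    have : j ∈ univ.filter fun l => g j = g l := by simp
    dsimp only at hyz
    rw [hyz, mem_filter] at this
    exact this.2.symm

lemma hasType_iff (h : I.Matches a w) :
    I.HasType L ↔ ∃ b, b.Perm a ∧ L.Matches b (content w) := by
  obtain ⟨f, g, h1, h2, rfl, rfl⟩ := h
  have hf := injective_of_rel h1
  set α := content (List.ofFn g) with hα
  have e : List.ofFn I.ferSize = (List.ofFn f).map α := by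
    rw [List.map_ofFn]
    congr 1
    funext i
    exact ferSize_eq h1 i
  rw [HasType, bosBlocks_eq h1 h2, e, ← hα]
  constructor
  · rintro ⟨h3, h4⟩
    obtain ⟨b, hb, hb'⟩ := exists_perm_map h3
    have h5 : ((α.support \ (List.ofFn f).toFinset).toList.map α).Perm L.s := by
      rw [← Multiset.coe_eq_coe, ← h4, ← Multiset.map_coe, Finset.coe_toList]
    obtain ⟨r, hr, hr'⟩ := exists_perm_map h5
    have hmr : ∀ x, x ∈ r ↔ α x ≠ 0 ∧ x ∉ List.ofFn f := by
      intro x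
      rw [hr.mem_iff, Finset.mem_toList, mem_sdiff, Finsupp.mem_support_iff, List.mem_toFinset]
    refine ⟨b, hb, r, ?_, hb', hr', fun x hx => ?_⟩
    · rw [List.nodup_append]
      refine ⟨hb.nodup_iff.2 (List.nodup_ofFn.2 hf), hr.nodup_iff.2 (Finset.nodup_toList _), ?_⟩
      rintro x hx _ hy rfl
      exact ((hmr x).1 hy).2 (hb.mem_iff.1 hx)
    · rw [List.mem_append, not_or, hmr, hb.mem_iff] at hx
      by_contra h
      exact hx.2 ⟨h, hx.1⟩
  · rintro ⟨b, hb, r, h3, h4, h5, h6⟩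
    refine ⟨h4 ▸ (hb.map α).symm, ?_⟩
    rw [← h5, ← Multiset.map_coe]
    congr 1
    refine (Multiset.Nodup.ext (Finset.nodup _)
      (Multiset.coe_nodup.2 h3.of_append_right)).2 fun x => ?_
    rw [Finset.mem_val, mem_sdiff, Finsupp.mem_support_iff, List.mem_toFinset, Multiset.mem_coe,
      ← hb.mem_iff]
    constructor
    · rintro ⟨h7, h8⟩
      by_contra h9
      exact h7 (h6 x (by rw [List.mem_append, not_or]; exact ⟨h8, h9⟩))
    · intro hx
      refine ⟨?_, fun hxb => (List.nodup_append.1 h3).2.2 x hxb x hx rfl⟩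
      have := L.s_pos _ (h5 ▸ List.mem_map_of_mem hx)
      omega

lemma thetaSign_mul_of_matches (h : I.Matches a w) {b : List ℕ} (hb : b.Perm a)
    (hL : L.Matches b (content w)) : thetaSign a * thetaSign b = (-1) ^ I.eps := by
  have hnd := h.nodup
  obtain ⟨f, g, h1, h2, rfl, rfl⟩ := h
  obtain ⟨τ, rfl⟩ := exists_perm_of_perm hb.symm f rfl
  set α := content (List.ofFn g) with hα
  have hp := hL.pairwise
  rw [List.pairwise_ofFn] at hp
  have hmono : StrictMono ((fun i => -(α (f i) : ℤ)) ∘ τ) := by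
    intro i j hij
    have := hp hij
    simp only [Function.comp_apply] at this ⊢
    omega
  have hinj : Function.Injective fun i => -(α (f i) : ℤ) := by
    have := hmono.injective.comp τ.symm.injective
    rwa [Function.comp_assoc, τ.self_comp_symm, Function.comp_id] at this
  have e1 := wordSign_comp_perm (fun i => -(α (f i) : ℤ)) τ
  rw [wordSign_of_strictMono hmono] at e1
  have e2 : wordSign (fun i => -(α (f i) : ℤ)) = (-1) ^ I.eps := by
    rw [wordSign_eq_pow hinj, eps]
    congr 2
    ext p
    simp only [mem_filter, mem_univ, true_and, ferSize_eq h1, ← hα]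
    omega
  rw [thetaSign_ofFn_comp, mul_left_comm, thetaSign_mul_self hnd, mul_one, ← e2]
  have e3 := wordSign_mul_self hinj
  linear_combination (-(wordSign fun i => -(α (f i) : ℤ))) * e1 -
    ((Equiv.Perm.sign τ : ℤ) : ℚ) * e3

lemma HasType.bidegree (h : I.HasType L) : I.m = L.df ∧ I.n = L.deg := by
  obtain ⟨b, hb, hL⟩ := (hasType_iff I.matches_rep).1 h
  have h1 := hL.card_degree
  have h2 := I.matches_rep.card_length
  rw [List.toFinset_eq_of_perm _ _ hb] at h1
  rw [degree_content] at h1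
  exact ⟨h2.1.symm.trans h1.1, h2.2.symm.trans h1.2⟩

lemma finite_hasType (L : SPar) : {I : SetSPar | I.HasType L}.Finite :=
  (finite_le (L.df + L.deg)).subset fun I hI => by
    rw [Set.mem_ofPred_eq, HasType.bidegree hI |>.1, HasType.bidegree hI |>.2]

lemma HasType.unique {O : SPar} (h : I.HasType L) (h' : I.HasType O) : L = O := by
  obtain ⟨b, hb, hL⟩ := (hasType_iff I.matches_rep).1 h
  obtain ⟨c, hc, hO⟩ := (hasType_iff I.matches_rep).1 h'
  exact (hL.unique hO (List.toFinset_eq_of_perm _ _ (hb.trans hc.symm))).2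

end SetSPar

open Classical in
lemma evNC_lift_mComm (I : SetSPar) (L : SPar) : evNC I (lift (mComm L)) =
    if I.HasType L then (L.fact : ℚ) / (L.deg)! * (-1) ^ I.eps else 0 := by
  have hI := I.matches_rep
  have e : evNC I (lift (mComm L)) = (contentFact (content I.rep.2) : ℚ) / (I.rep.2.length)! *
      (thetaSign I.rep.1 * monomialComm L I.rep.1.toFinset (content I.rep.2)) := by
    rw [mul_left_comm]; rfl
  split_ifs with h
  · obtain ⟨b, hb, hL⟩ := (SetSPar.hasType_iff hI).1 h
    rw [e, hL.fact_eq, hI.length.2, h.bidegree.2, ← List.toFinset_eq_of_perm _ _ hb,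
      monomialComm_of_matches hL, SetSPar.thetaSign_mul_of_matches hI hb hL]
  · have : monomialComm L I.rep.1.toFinset (content I.rep.2) = 0 := by
      by_contra h0
      obtain ⟨b, h1, h2⟩ := monomialComm_ne_zero h0
      refine h ((SetSPar.hasType_iff hI).2 ⟨b, ?_, h1⟩)
      exact (List.perm_ext_iff_of_nodup h1.nodup hI.nodup).2 fun x => by
        rw [← List.mem_toFinset, h2, List.mem_toFinset]
    rw [e, this, mul_zero, mul_zero]

lemma lift_mComm (L : SPar) : lift (mComm L) = ((L.fact : ℚ) / (L.deg)!) •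
    ∑ I ∈ (SetSPar.finite_hasType L).toFinset, ((-1 : ℚ) ^ I.eps) • mNC I := by
  classical
  rw [← sub_eq_zero]
  refine evNC_separates _ fun J => ?_
  rw [map_sub, map_smul, map_sum, evNC_lift_mComm]
  simp only [map_smul, evNC_mNC, smul_eq_mul, mul_ite, mul_one, mul_zero, sum_ite_eq',
    Set.Finite.mem_toFinset, Set.mem_ofPred_eq]
  split_ifs <;> simp

theorem isLift_lift : IsLift lift := by
  intro L
  refine ⟨mComm L, rfl, ?_⟩
  rw [lift_mComm]
  have e : (∑ᶠ (I : SetSPar) (_ : I.HasType L), ((-1 : ℚ) ^ I.eps) • I.monomial) =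
      ∑ I ∈ (SetSPar.finite_hasType L).toFinset, ((-1 : ℚ) ^ I.eps) • I.monomial := by
    rw [← finsum_mem_eq_finite_toFinset_sum]
    rfl
  rw [e, Submodule.coe_smul, Submodule.coe_sum]
  rfl

theorem isLift_unique (R : sSym →ₗ[ℚ] sNCSym) (hR : IsLift R) : R = lift := by
  refine commBasis.ext fun L => ?_
  obtain ⟨f, hf, h⟩ := hR L
  obtain ⟨f', hf', h'⟩ := isLift_lift L
  obtain rfl : f = mComm L := Subtype.ext hf
  obtain rfl : f' = mComm L := Subtype.ext hf'
  rw [commBasis_apply]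
  exact Subtype.ext (h.trans h'.symm)

/-! ### Permutations that preserve the blocks of a relation -/

section
variable {m n : ℕ} (r s : Setoid (Fin m ⊕ Fin n))

lemma blockFact_eq_card [DecidablePred fun π : Equiv.Perm (Fin m ⊕ Fin n) => ∀ x, r x (π x)] :
    SetSPar.blockFact r =
    ((univ : Finset (Equiv.Perm (Fin m ⊕ Fin n))).filter fun π => ∀ x, r x (π x)).card := by
  classical
  let u : Fin m ⊕ Fin n → Finset (Fin m ⊕ Fin n) := fun x => univ.filter fun y => r x y
  have hu : ∀ x y, u x = u y ↔ r x y := by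
    intro x y
    constructor
    · intro h
      have : y ∈ u y := mem_filter.2 ⟨mem_univ _, r.refl y⟩
      rw [← h] at this
      exact (mem_filter.1 this).2
    · intro h
      ext z
      simp only [u, mem_filter, mem_univ, true_and]
      exact ⟨fun h' => r.trans (r.symm h) h', fun h' => r.trans h h'⟩
  have key := card_perm_comp u 1
  have e : ∀ π : Equiv.Perm (Fin m ⊕ Fin n), u ∘ π = u ∘ (1 : Equiv.Perm (Fin m ⊕ Fin n)) ↔ ∀ x, r x (π x) := by
    intro π
    rw [funext_iff]
    refine forall_congr' fun x => ?_
    rw [Function.comp_apply, Function.comp_apply, Equiv.Perm.one_apply, hu]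
    exact ⟨r.symm, r.symm⟩
  rw [filter_congr fun π _ => (e π).symm, key, SetSPar.blockFact]
  refine prod_congr rfl fun C hC => ?_
  obtain ⟨x, -, rfl⟩ := mem_image.1 hC
  congr 2
  ext y
  simp only [u, mem_filter, mem_univ, true_and]
  change r x y ↔ u y = u x
  rw [hu]
  exact ⟨r.symm, r.symm⟩

lemma blockFact_comap (e : Equiv.Perm (Fin m ⊕ Fin n)) :
    SetSPar.blockFact (r.comap e) = SetSPar.blockFact r := by
  classical
  rw [blockFact_eq_card, blockFact_eq_card]
  refine card_equiv (e.permCongr) fun π => ?_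
  simp only [mem_filter, mem_univ, true_and, Setoid.comap_rel, Equiv.permCongr_apply]
  refine ⟨fun h x => ?_, fun h x => ?_⟩
  · simpa using h (e.symm x)
  · simpa using h (e x)

lemma exists_perm_blocks : ∃ π : Equiv.Perm (Fin m ⊕ Fin n), (∀ x, r x (π x)) ∧
    ∀ s : Setoid (Fin m ⊕ Fin n), (∀ x, s x (π x)) → r ≤ s := by
  classical
  let u : Fin m ⊕ Fin n → Finset (Fin m ⊕ Fin n) := fun x => univ.filter fun y => r x y
  have hu : ∀ {x y}, r x y → u x = u y := by
    intro x y h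
    ext z
    simp only [u, mem_filter, mem_univ, true_and]
    exact ⟨fun h' => r.trans (r.symm h) h', fun h' => r.trans h h'⟩
  have hm : ∀ {x y}, y ∈ u x ↔ r x y := by
    intro x y
    simp only [u, mem_filter, mem_univ, true_and]
  choose F hF _ using fun s : Finset (Fin m ⊕ Fin n) => s.exists_cycleOn
  have h1 : ∀ x, r x (F (u x) x) := fun x =>
    hm.1 ((hF (u x)).1.mapsTo (show x ∈ (u x : Set _) from hm.2 (r.refl x)))
  have hinj : Function.Injective fun x => F (u x) x := by
    intro x y hxy
    dsimp only at hxy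
    have h2 : r x y := r.trans (h1 x) (hxy ▸ r.symm (h1 y))
    rw [hu h2] at hxy
    exact (F (u y)).injective hxy
  refine ⟨Equiv.ofBijective _ (Finite.injective_iff_bijective.1 hinj), h1, fun s hs x y hxy => ?_⟩
  obtain ⟨k, -, rfl⟩ := (hF (u x)).exists_pow_eq (hm.2 (r.refl x)) (hm.2 hxy)
  clear hxy
  suffices h : s x ((F (u x) ^ k) x) ∧ r x ((F (u x) ^ k) x) from h.1
  induction k with
  | zero => exact ⟨s.refl x, r.refl x⟩
  | succ k ih =>
    rw [pow_succ', Equiv.Perm.mul_apply]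
    have h3 := hs ((F (u x) ^ k) x)
    have h4 := h1 ((F (u x) ^ k) x)
    rw [Equiv.ofBijective_apply] at h3
    rw [← hu ih.2] at h3 h4
    exact ⟨s.trans ih.1 h3, r.trans ih.2 h4⟩

end

/-! ### Bases from families that respect a degree -/

section
variable {ι V : Type*} [AddCommGroup V] [Module ℚ V] (b : Module.Basis ι ℚ V) (d : ι → ℕ)

lemma linearIndependent_iff_span_of_degree (hd : ∀ N, {i | d i ≤ N}.Finite) (v : ι → V)
    (hv : ∀ i j, b.repr (v i) j ≠ 0 → d j = d i) :
    LinearIndependent ℚ v ↔ ⊤ ≤ Submodule.span ℚ (Set.range v) := by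
  set T : V →ₗ[ℚ] V := b.constr ℚ v with hT
  have hTb : ∀ i, T (b i) = v i := fun i => b.constr_basis ℚ v i
  let P : ℕ → V →ₗ[ℚ] V := fun N => b.constr ℚ fun i => if d i ≤ N then b i else 0
  have hPb : ∀ N i, P N (b i) = if d i ≤ N then b i else 0 := fun N i => b.constr_basis ℚ _ i
  have hrepr : ∀ N x j, b.repr (P N x) j = if d j ≤ N then b.repr x j else 0 := by
    intro N x j
    have : (b.coord j).comp (P N) = if d j ≤ N then b.coord j else 0 := by
      refine b.ext fun i => ?_
      rw [LinearMap.comp_apply, hPb]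
      by_cases hij : i = j
      · subst hij
        split_ifs <;> simp
      · split_ifs <;> simp [Finsupp.single_eq_of_ne (Ne.symm hij)]
    have h := LinearMap.congr_fun this x
    rw [LinearMap.comp_apply, b.coord_apply] at h
    rw [h]
    split_ifs <;> simp
  have hcomm : ∀ N x, P N (T x) = T (P N x) := by
    intro N x
    have : (P N).comp T = T.comp (P N) := by
      refine b.ext fun i => ?_
      rw [LinearMap.comp_apply, LinearMap.comp_apply, hTb, hPb]
      refine b.ext_elem fun j => ?_
      rw [hrepr]
      by_cases h0 : b.repr (v i) j = 0
      · split_ifs <;> simp [hTb, h0]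
      · rw [hv i j h0]
        split_ifs <;> simp [hTb]
    exact LinearMap.congr_fun this x
  have hfix : ∀ x, ∃ N, P N x = x := by
    intro x
    refine ⟨(b.repr x).support.sup d, b.ext_elem fun j => ?_⟩
    rw [hrepr]
    split_ifs with h
    · rfl
    · by_contra h0
      exact h (le_sup (Finsupp.mem_support_iff.2 (Ne.symm h0)))
  let W : ℕ → Submodule ℚ V := fun N => LinearMap.range (P N)
  have hidem : ∀ N x, P N (P N x) = P N x := by
    intro N x
    refine b.ext_elem fun j => ?_
    rw [hrepr, hrepr]
    split_ifs <;> rfl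
  have hW : ∀ {N x}, x ∈ W N ↔ P N x = x := by
    intro N x
    refine ⟨?_, fun h => ⟨x, h⟩⟩
    rintro ⟨y, rfl⟩
    exact hidem N y
  have hfin : ∀ N, FiniteDimensional ℚ (W N) := by
    intro N
    have h1 : W N ≤ Submodule.span ℚ (b '' {i | d i ≤ N}) := by
      rintro _ ⟨x, rfl⟩
      rw [b.mem_span_image]
      intro j hj
      have := Finsupp.mem_support_iff.1 hj
      rw [hrepr] at this
      by_contra h
      exact this (if_neg h)
    have := FiniteDimensional.span_of_finite ℚ ((hd N).image b)
    exact Submodule.finiteDimensional_of_le h1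
  have hmap : ∀ N, ∀ x ∈ W N, T x ∈ W N := by
    intro N x hx
    rw [hW, hcomm, hW.1 hx]
  have hiff : Function.Injective T ↔ Function.Surjective T := by
    constructor
    · intro h y
      obtain ⟨N, hN⟩ := hfix y
      have h1 : Function.Injective (T.restrict (hmap N)) := fun x x' hxx =>
        Subtype.ext (h (congrArg Subtype.val hxx))
      have := hfin N
      obtain ⟨x, hx⟩ := LinearMap.injective_iff_surjective.1 h1 ⟨y, hW.2 hN⟩
      exact ⟨x, congrArg Subtype.val hx⟩
    · intro h
      rw [← LinearMap.ker_eq_bot, LinearMap.ker_eq_bot']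
      intro x hx
      obtain ⟨N, hN⟩ := hfix x
      have h1 : Function.Surjective (T.restrict (hmap N)) := by
        rintro ⟨y, hy⟩
        obtain ⟨z, rfl⟩ := h y
        refine ⟨⟨P N z, ⟨z, rfl⟩⟩, Subtype.ext ?_⟩
        change T (P N z) = T z
        rw [← hcomm, hW.1 hy]
      have := hfin N
      have h2 := LinearMap.injective_iff_surjective.2 h1
      have h3 : T.restrict (hmap N) ⟨x, hW.2 hN⟩ = T.restrict (hmap N) 0 :=
        Subtype.ext (by rw [map_zero]; exact hx)
      exact congrArg Subtype.val (h2 h3)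
  have e1 : LinearIndependent ℚ v ↔ Function.Injective T := by
    have : v = T ∘ b := funext fun i => (hTb i).symm
    constructor
    · intro h
      have h1 : T = (Finsupp.linearCombination ℚ v).comp b.repr.toLinearMap :=
        b.ext fun i => by simp [hTb]
      rw [h1, LinearMap.coe_comp]
      exact Function.Injective.comp (show Function.Injective (Finsupp.linearCombination ℚ v) from h)
        b.repr.injective
    · intro h
      rw [this]
      exact b.linearIndependent.map' T (LinearMap.ker_eq_bot.2 h)
  have e2 : Function.Surjective T ↔ ⊤ ≤ Submodule.span ℚ (Set.range v) := by
    rw [← LinearMap.range_eq_top, hT, b.constr_range, top_le_iff]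
  rw [e1, hiff, e2]

end

/-! ### Complete homogeneous functions in noncommuting variables -/

namespace SetSPar

variable (J : SetSPar)

lemma complete_ne_zero {A : Finset ℕ} {w : List ℕ} (h : J.complete A w ≠ 0) :
    ∃ (f : Fin J.m → ℕ) (g : Fin J.n → ℕ), Function.Injective f ∧
      (Set.range f \ Set.range g).Subsingleton ∧ (List.ofFn f).toFinset = A ∧ List.ofFn g = w := by
  by_contra! h'
  refine h ?_
  rw [complete, NC.formalSum, finsum_eq_zero_of_forall_eq_zero]
  rintro ⟨⟨f, g⟩, h1, h2⟩
  rw [Pi.smul_apply, Pi.smul_apply, NC.mono, if_neg, smul_zero]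
  rintro ⟨h3, h4⟩
  exact h' f g h1 h2 h3 h4

variable {J}

lemma thetaSign_mul_complete {f : Fin J.m → ℕ} {g : Fin J.n → ℕ} (hf : Function.Injective f)
    (hfg : (Set.range f \ Set.range g).Subsingleton) :
    thetaSign (List.ofFn f) * J.complete (List.ofFn f).toFinset (List.ofFn g) =
      ∑ τ : Equiv.Perm (Fin J.m), ((Equiv.Perm.sign τ : ℤ) : ℚ) *
        blockFact (J.rel ⊓ Setoid.ker (Sum.elim (f ∘ τ) g)) := by
  classical
  let e : Equiv.Perm (Fin J.m) → {p : (Fin J.m → ℕ) × (Fin J.n → ℕ) //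
      Function.Injective p.1 ∧ (Set.range p.1 \ Set.range p.2).Subsingleton} := fun τ =>
    ⟨(f ∘ τ, g), hf.comp τ.injective, by rwa [EquivLike.range_comp]⟩
  have he : Function.Injective e := by
    intro τ τ' h
    have h1 : f ∘ τ = f ∘ τ' := congrArg (fun p => p.1.1) h
    exact Equiv.ext fun i => hf (congrFun h1 i)
  have hsupp : ∀ p : {p : (Fin J.m → ℕ) × (Fin J.n → ℕ) //
      Function.Injective p.1 ∧ (Set.range p.1 \ Set.range p.2).Subsingleton},
      ((blockFact (J.rel ⊓ Setoid.ker (Sum.elim p.1.1 p.1.2)) : ℚ) •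
        NC.mono (List.ofFn p.1.1) (List.ofFn p.1.2)) (List.ofFn f).toFinset (List.ofFn g) ≠ 0 →
      ∃ τ, e τ = p := by
    rintro ⟨⟨f', g'⟩, h1, h2⟩ h
    rw [Pi.smul_apply, Pi.smul_apply, NC.mono] at h
    split_ifs at h with h3
    · obtain ⟨h3, h4⟩ := h3
      have hp : (List.ofFn f).Perm (List.ofFn f') :=
        (List.perm_ext_iff_of_nodup (List.nodup_ofFn.2 hf) (List.nodup_ofFn.2 h1)).2 fun x => by
          rw [← List.mem_toFinset, ← h3, List.mem_toFinset]
      obtain ⟨τ, hτ⟩ := exists_perm_of_perm hp f rfl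
      exact ⟨τ, Subtype.ext (Prod.ext (List.ofFn_injective hτ.symm) (List.ofFn_injective h4.symm))⟩
    · rw [smul_zero] at h
      exact absurd rfl h
  rw [complete, NC.formalSum, finsum_eq_sum_of_support_subset (s := univ.image e) _ (by
    intro p hp
    obtain ⟨τ, rfl⟩ := hsupp p hp
    rw [Finset.coe_image]
    exact ⟨τ, by simp, rfl⟩), sum_image he.injOn, mul_sum]
  refine sum_congr rfl fun τ _ => ?_
  rw [Pi.smul_apply, Pi.smul_apply, NC.mono, if_pos
    ⟨List.toFinset_eq_of_perm _ _ (τ.ofFn_comp_perm f), rfl⟩, thetaSign_ofFn_comp, smul_eq_mul]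
  have := thetaSign_mul_self (List.nodup_ofFn.2 hf)
  linear_combination ((Equiv.Perm.sign τ : ℤ) : ℚ) *
    (blockFact (J.rel ⊓ Setoid.ker (Sum.elim (f ∘ τ) g))) * this

lemma exists_ofFn {n : ℕ} {a : List ℕ} (h : a.length = n) : ∃ f : Fin n → ℕ, List.ofFn f = a := by
  subst h
  exact ⟨a.get, List.ofFn_get a⟩

lemma complete_eq_zero {f : Fin J.m → ℕ} {g : Fin J.n → ℕ}
    (h : ¬ (Set.range f \ Set.range g).Subsingleton) :
    J.complete (List.ofFn f).toFinset (List.ofFn g) = 0 := by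
  by_contra h0
  obtain ⟨f', g', -, h2, h3, h4⟩ := J.complete_ne_zero h0
  refine h ?_
  have h5 : Set.range f' = Set.range f := by
    ext x
    rw [← List.mem_ofFn', ← List.mem_toFinset, h3, List.mem_toFinset, List.mem_ofFn']
  rwa [← h5, ← List.ofFn_injective h4]

lemma complete_mem (J : SetSPar) : J.complete ∈ sNCSym := by
  have hlen : ∀ {A : Finset ℕ} {w : List ℕ}, J.complete A w ≠ 0 → A.card = J.m ∧ w.length = J.n := by
    intro A w h
    obtain ⟨f, g, h1, -, rfl, rfl⟩ := J.complete_ne_zero h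
    rw [List.toFinset_card_of_nodup (List.nodup_ofFn.2 h1)]
    exact ⟨List.length_ofFn, List.length_ofFn⟩
  refine mem_sNCSym_iff.2 ⟨⟨J.m + J.n, fun A w h => ?_⟩, fun σ _ a w ha => ?_⟩
  · rw [(hlen h).1, (hlen h).2]
  have ha' : (a.map σ).Nodup := ha.map σ.injective
  by_cases hl : a.length = J.m ∧ w.length = J.n
  · obtain ⟨f, rfl⟩ := exists_ofFn hl.1
    obtain ⟨g, rfl⟩ := exists_ofFn hl.2
    have hf := List.nodup_ofFn.1 ha
    have hsf : Function.Injective (σ ∘ f) := σ.injective.comp hf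
    have hset : Set.range (σ ∘ f) \ Set.range (σ ∘ g) = σ '' (Set.range f \ Set.range g) := by
      rw [Set.range_comp, Set.range_comp, Set.image_sdiff σ.injective]
    rw [List.map_ofFn, List.map_ofFn, NC.val, NC.val]
    by_cases hs : (Set.range f \ Set.range g).Subsingleton
    · rw [thetaSign_mul_complete hf hs, thetaSign_mul_complete hsf (hset ▸ hs.image σ)]
      refine sum_congr rfl fun τ _ => ?_
      congr 4
      ext x y
      rw [Setoid.ker_def, Setoid.ker_def, Function.comp_assoc, ← Sum.comp_elim]
      exact σ.injective.eq_iff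
    · rw [complete_eq_zero hs, complete_eq_zero (f := σ ∘ f) (g := σ ∘ g) (by
        rw [hset]
        exact fun h => hs (Set.subsingleton_of_image σ.injective _ h)), mul_zero, mul_zero]
  · rw [NC.val, NC.val]
    have h1 : J.complete a.toFinset w = 0 := by
      by_contra h
      refine hl ?_
      rw [← List.toFinset_card_of_nodup ha]
      exact hlen h
    have h2 : J.complete (a.map σ).toFinset (w.map σ) = 0 := by
      by_contra h
      refine hl ?_
      have := hlen h
      rwa [List.toFinset_card_of_nodup ha', List.length_map, List.length_map] at this
    rw [h1, h2, mul_zero, mul_zero]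

end SetSPar

def hNC (J : SetSPar) : sNCSym := ⟨J.complete, J.complete_mem⟩

lemma evNC_hNC_ne_zero {I J : SetSPar} (h : evNC I (hNC J) ≠ 0) : I.m = J.m ∧ I.n = J.n := by
  have h1 : J.complete I.rep.1.toFinset I.rep.2 ≠ 0 := fun h0 =>
    h (show thetaSign _ * J.complete _ _ = 0 by rw [h0, mul_zero])
  obtain ⟨f, g, h2, -, h3, h4⟩ := J.complete_ne_zero h1
  have h5 := I.matches_rep.card_length
  rw [← h3, ← h4, List.toFinset_card_of_nodup (List.nodup_ofFn.2 h2), List.length_ofFn,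
    List.length_ofFn] at h5
  exact ⟨h5.1.symm, h5.2.symm⟩

/-! ### Their linear independence -/

section
variable (m n : ℕ)

/-- The relations that define the set superpartitions of bidegree `(n, m)`. -/
structure StdRel where
  rel : Setoid (Fin m ⊕ Fin n)
  sep : ∀ i j : Fin m, rel (Sum.inl i) (Sum.inl j) → i = j
  sorted : ∀ i j : Fin m, i < j →
    sInf ((fun l : Fin n => (l : ℕ) + 1) '' {l | rel (Sum.inl i) (Sum.inr l)}) <
      sInf ((fun l : Fin n => (l : ℕ) + 1) '' {l | rel (Sum.inl j) (Sum.inr l)})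

variable {m n}

namespace StdRel

def toSetSPar (r : StdRel m n) : SetSPar := ⟨n, m, r.rel, r.sep, r.sorted⟩

lemma toSetSPar_injective : Function.Injective (toSetSPar (m := m) (n := n)) := by
  rintro ⟨r, h1, h2⟩ ⟨r', h1', h2'⟩ h
  injection h with _ _ h
  congr

lemma exists_eq_toSetSPar (I : SetSPar) : ∃ r : StdRel I.m I.n, r.toSetSPar = I :=
  ⟨⟨I.rel, I.sep, I.sorted⟩, rfl⟩

instance : Fintype (StdRel m n) :=
  have : Finite (StdRel m n) := by
    have := (SetSPar.finite_le (m + n)).to_subtype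
    exact Finite.of_injective
      (fun r : StdRel m n => (⟨r.toSetSPar, le_refl (m + n)⟩ : {I : SetSPar | I.m + I.n ≤ m + n}))
      fun r r' h => toSetSPar_injective (congrArg Subtype.val h)
  Fintype.ofFinite _

/-- Permutations of the zeros. -/
def zeros (τ : Equiv.Perm (Fin m)) : Equiv.Perm (Fin m ⊕ Fin n) := Equiv.sumCongr τ (Equiv.refl _)

lemma eq_of_le_comap {r s : StdRel m n} {τ : Equiv.Perm (Fin m)}
    (h : r.rel = s.rel.comap (zeros τ)) : τ = 1 ∧ r = s := by
  have hτ : StrictMono τ := by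
    have hs : StrictMono fun i : Fin m =>
        sInf ((fun l : Fin n => (l : ℕ) + 1) '' {l | s.rel (Sum.inl i) (Sum.inr l)}) := s.sorted
    intro i j hij
    have h1 := r.sorted i j hij
    rw [h] at h1
    exact hs.lt_iff_lt.1 h1
  have h1 : τ = 1 := by
    have : hτ.orderIsoOfSurjective _ τ.surjective = OrderIso.refl _ := Subsingleton.elim _ _
    ext i
    exact congrArg Fin.val (congrArg (fun e : Fin m ≃o Fin m => e i) this)
  refine ⟨h1, ?_⟩
  have h2 : r.rel = s.rel := by
    rw [h, h1]
    ext x y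
    rcases x with x | x <;> rcases y with y | y <;> rfl
  cases r; cases s
  subst h2
  rfl

end StdRel

open StdRel in
lemma blockFact_inf_comap (r s : Setoid (Fin m ⊕ Fin n)) (τ ρ : Equiv.Perm (Fin m)) :
    SetSPar.blockFact (r ⊓ s.comap (zeros (ρ * τ))) =
      SetSPar.blockFact (r.comap (zeros τ⁻¹) ⊓ s.comap (zeros ρ)) := by
  rw [← blockFact_comap (r.comap (zeros τ⁻¹) ⊓ s.comap (zeros ρ)) (zeros τ)]
  congr 1
  ext x y
  rw [Setoid.comap_rel]
  refine and_congr ?_ ?_ <;> rcases x with x | x <;> rcases y with y | y <;>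
    simp [Setoid.comap_rel, zeros]

open StdRel in
open Classical in
lemma eq_zero_of_gram (c : StdRel m n → ℚ)
    (h : ∀ (s : StdRel m n) (ρ : Equiv.Perm (Fin m)), ∑ r, c r *
      ∑ τ : Equiv.Perm (Fin m), ((Equiv.Perm.sign τ : ℤ) : ℚ) *
        SetSPar.blockFact (r.rel ⊓ s.rel.comap (zeros (ρ * τ))) = 0) : c = 0 := by
  let A : StdRel m n → Equiv.Perm (Fin m ⊕ Fin n) → Equiv.Perm (Fin m) → ℚ := fun r π τ =>
    if ∀ x, r.rel.comap (zeros τ) x (π x) then 1 else 0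
  let Q : Equiv.Perm (Fin m ⊕ Fin n) → ℚ := fun π =>
    ∑ r, ∑ τ : Equiv.Perm (Fin m), c r * ((Equiv.Perm.sign τ : ℤ) : ℚ) * A r π τ
  have hN : ∀ (r s : StdRel m n) (τ ρ : Equiv.Perm (Fin m)),
      (SetSPar.blockFact (r.rel.comap (zeros τ) ⊓ s.rel.comap (zeros ρ)) : ℚ) =
        ∑ π, A r π τ * A s π ρ := by
    intro r s τ ρ
    rw [blockFact_eq_card, card_filter, Nat.cast_sum]
    refine sum_congr rfl fun π _ => ?_
    simp only [A, ite_zero_mul_ite_zero, mul_one, Setoid.inf_def, Pi.inf_apply, inf_Prop_eq,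
      forall_and]
    split_ifs <;> simp
  have h1 : ∀ (s : StdRel m n) (ρ : Equiv.Perm (Fin m)), ∑ π, Q π * A s π ρ = 0 := by
    intro s ρ
    rw [← h s ρ]
    simp only [Q, sum_mul]
    rw [sum_comm]
    refine sum_congr rfl fun r _ => ?_
    rw [sum_comm, mul_sum, ← Equiv.sum_comp (Equiv.inv (Equiv.Perm (Fin m)))]
    refine sum_congr rfl fun τ _ => ?_
    rw [blockFact_inf_comap, hN, mul_sum, mul_sum]
    refine sum_congr rfl fun π _ => ?_
    rw [Equiv.inv_apply, Equiv.Perm.sign_inv]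
    ring
  have h2 : ∑ π, Q π * Q π = 0 := by
    have : ∀ π, Q π * Q π = ∑ s, ∑ ρ : Equiv.Perm (Fin m),
        c s * ((Equiv.Perm.sign ρ : ℤ) : ℚ) * (Q π * A s π ρ) := by
      intro π
      nth_rewrite 2 [show Q π = ∑ r, ∑ τ : Equiv.Perm (Fin m),
        c r * ((Equiv.Perm.sign τ : ℤ) : ℚ) * A r π τ from rfl]
      simp only [mul_sum]
      refine sum_congr rfl fun s _ => sum_congr rfl fun ρ _ => by ring
    simp only [this]
    rw [sum_comm]
    refine sum_eq_zero fun s _ => ?_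
    rw [sum_comm]
    refine sum_eq_zero fun ρ _ => ?_
    rw [← mul_sum, h1, mul_zero]
  have h3 : ∀ π, Q π = 0 := fun π =>
    mul_self_eq_zero.1 ((sum_eq_zero_iff_of_nonneg fun π _ => mul_self_nonneg (Q π)).1 h2 π
      (mem_univ π))
  by_contra hc
  let pairs : Setoid (Fin m ⊕ Fin n) → Finset ((Fin m ⊕ Fin n) × (Fin m ⊕ Fin n)) := fun r =>
    univ.filter fun p => r p.1 p.2
  have hne : (univ.filter fun r => c r ≠ 0).Nonempty := by
    by_contra hne
    rw [not_nonempty_iff_eq_empty, filter_eq_empty_iff] at hne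
    exact hc (funext fun r => not_not.1 (hne (mem_univ r)))
  obtain ⟨r, hr, hmax⟩ := exists_max_image _ (fun r : StdRel m n => (pairs r.rel).card) hne
  obtain ⟨π, hπ, hπr⟩ := exists_perm_blocks r.rel
  have hA : ∀ s τ, c s ≠ 0 → A s π τ ≠ 0 → τ = 1 ∧ r = s := by
    intro s τ hs hA
    have h4 : ∀ x, s.rel.comap (zeros τ) x (π x) := by
      by_contra h4
      exact hA (if_neg h4)
    have h5 := hπr _ h4
    have h6 : (pairs (s.rel.comap (zeros τ))).card = (pairs s.rel).card := by
      refine card_equiv (Equiv.prodCongr (zeros τ) (zeros τ)) fun p => ?_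
      simp [pairs, Setoid.comap_rel]
    have h7 : pairs r.rel = pairs (s.rel.comap (zeros τ)) := by
      refine eq_of_subset_of_card_le (fun p hp => ?_) ?_
      · exact mem_filter.2 ⟨mem_univ _, h5 (mem_filter.1 hp).2⟩
      · rw [h6]
        exact hmax s (mem_filter.2 ⟨mem_univ _, hs⟩)
    refine eq_of_le_comap (Setoid.ext fun x y => ?_)
    have h8 := Finset.ext_iff.1 h7 (x, y)
    simpa [pairs] using h8
  refine (mem_filter.1 hr).2 ?_
  have h4 := h3 π
  rw [show Q π = ∑ r, ∑ τ : Equiv.Perm (Fin m),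
    c r * ((Equiv.Perm.sign τ : ℤ) : ℚ) * A r π τ from rfl, sum_eq_single r, sum_eq_single 1] at h4
  · have : A r π 1 = 1 := by
      refine if_pos fun x => ?_
      have h5 := hπ x
      have h6 : (zeros (1 : Equiv.Perm (Fin m)) : Equiv.Perm (Fin m ⊕ Fin n)) = 1 := by
        ext x
        rcases x with x | x <;> rfl
      rw [h6]
      exact h5
    rw [this] at h4
    simpa using h4
  · intro τ _ hτ
    by_contra h5
    exact hτ (hA r τ (mem_filter.1 hr).2 (right_ne_zero_of_mul h5)).1
  · intro h5
    exact absurd (mem_univ _) h5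
  · intro s _ hs
    refine sum_eq_zero fun τ _ => ?_
    by_contra h5
    exact hs (hA s τ (left_ne_zero_of_mul (left_ne_zero_of_mul h5)) (right_ne_zero_of_mul h5)).2.symm
  · intro h5
    exact absurd (mem_univ _) h5

end

open StdRel in
theorem linearIndependent_hNC : LinearIndependent ℚ hNC := by
  classical
  rw [linearIndependent_iff]
  intro l hl
  ext I
  obtain ⟨r, hr⟩ := exists_eq_toSetSPar I
  rw [← congrArg l hr]
  refine congrFun (eq_zero_of_gram (fun r : StdRel I.m I.n => l r.toSetSPar) fun s ρ => ?_) r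
  obtain ⟨f, g, h1, h2⟩ : ∃ (f : Fin I.m → ℕ) (g : Fin I.n → ℕ),
      (∀ i j, f i = g j ↔ s.rel (Sum.inl i) (Sum.inr j)) ∧
      ∀ i j, g i = g j ↔ s.rel (Sum.inr i) (Sum.inr j) := by
    obtain ⟨f, g, h1, h2, -⟩ := s.toSetSPar.matches_rep
    exact ⟨f, g, h1, h2⟩
  have hf : Function.Injective f := SetSPar.injective_of_rel (I := s.toSetSPar) h1
  have hker : Setoid.ker (Sum.elim f g) = s.rel := SetSPar.ker_eq (I := s.toSetSPar) h1 h2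
  have hsub : (Set.range (f ∘ ρ) \ Set.range g).Subsingleton := by
    rw [EquivLike.range_comp]
    rintro _ ⟨⟨i, rfl⟩, hi⟩ _ ⟨⟨j, rfl⟩, hj⟩
    have h5 : ∀ i, f i ∉ Set.range g → firstPos (List.ofFn g) (f i) = 0 := by
      intro i hi
      rw [firstPos, if_neg]
      rwa [List.mem_ofFn']
    have h6 : ∀ i j, i < j → firstPos (List.ofFn g) (f i) < firstPos (List.ofFn g) (f j) :=
      fun i j h => SetSPar.firstPos_lt (I := s.toSetSPar) h1 h
    have h7 := h5 i hi
    have h8 := h5 j hj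
    by_contra hne
    rcases lt_or_gt_of_ne (fun e => hne (congrArg f e)) with h | h
    · have := h6 i j h
      omega
    · have := h6 j i h
      omega
  have h6 : thetaSign (List.ofFn (f ∘ ρ)) * ∑ J ∈ l.support,
      l J * J.complete (List.ofFn (f ∘ ρ)).toFinset (List.ofFn g) = 0 := by
    have : (Finsupp.linearCombination ℚ hNC l : NC) (List.ofFn (f ∘ ρ)).toFinset (List.ofFn g) = 0 := by
      rw [hl]; rfl
    rw [Finsupp.linearCombination_apply, Finsupp.sum, Submodule.coe_sum, Finset.sum_apply,
      Finset.sum_apply] at this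
    rw [← mul_zero (thetaSign (List.ofFn (f ∘ ρ))), ← this]
    rfl
  rw [← h6]
  have h7 : ∑ J ∈ l.support, l J * J.complete (List.ofFn (f ∘ ρ)).toFinset (List.ofFn g) =
      ∑ J ∈ univ.image (toSetSPar (m := I.m) (n := I.n)),
        l J * J.complete (List.ofFn (f ∘ ρ)).toFinset (List.ofFn g) := by
    refine sum_congr_of_eq_on_inter ?_ ?_ fun _ _ _ => rfl
    · intro J _ hJ
      by_contra h0
      obtain ⟨f', g', h1', -, h3', h4'⟩ := J.complete_ne_zero (right_ne_zero_of_mul h0)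
      have e1 := congrArg List.length h4'
      have e2 := congrArg Finset.card h3'
      rw [List.length_ofFn, List.length_ofFn] at e1
      rw [List.toFinset_card_of_nodup (List.nodup_ofFn.2 h1'), List.toFinset_card_of_nodup
        (List.nodup_ofFn.2 (hf.comp ρ.injective)), List.length_ofFn, List.length_ofFn] at e2
      refine hJ (mem_image.2 ?_)
      change J.n = I.n at e1
      change J.m = I.m at e2
      rw [← e1, ← e2]
      obtain ⟨r, hr⟩ := exists_eq_toSetSPar J
      exact ⟨r, mem_univ _, hr⟩
    · intro J _ hJ
      rw [Finsupp.notMem_support_iff.1 hJ, zero_mul]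
  rw [h7, sum_image toSetSPar_injective.injOn, mul_sum]
  refine sum_congr rfl fun r _ => ?_
  rw [mul_left_comm]
  congr 1
  refine Eq.trans ?_ (SetSPar.thetaSign_mul_complete (J := r.toSetSPar) (hf.comp ρ.injective)
    hsub).symm
  refine sum_congr rfl fun τ _ => ?_
  congr 3
  change r.rel ⊓ _ = r.rel ⊓ _
  congr 1
  rw [← hker]
  ext x y
  rcases x with x | x <;> rcases y with y | y <;> rfl

lemma repr_ncBasis (f : sNCSym) (I : SetSPar) : ncBasis.repr f I = evNC I f := by
  classical
  have : ncBasis.coord I = evNC I := ncBasis.ext fun J => by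
    rw [ncBasis.coord_apply, ncBasis.repr_self, ncBasis_apply, evNC_mNC, Finsupp.single_apply]
  exact LinearMap.congr_fun this f

lemma top_le_span_hNC : ⊤ ≤ Submodule.span ℚ (Set.range hNC) := by
  refine (linearIndependent_iff_span_of_degree ncBasis (fun I => I.m + I.n) SetSPar.finite_le hNC
    fun I J h => ?_).1 linearIndependent_hNC
  rw [repr_ncBasis] at h
  obtain ⟨h1, h2⟩ := evNC_hNC_ne_zero h
  rw [h1, h2]

def completeNCBasis : Module.Basis SetSPar ℚ sNCSym :=
  Module.Basis.mk linearIndependent_hNC top_le_span_hNC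

lemma completeNCBasis_apply (J : SetSPar) : completeNCBasis J = hNC J := by
  rw [completeNCBasis, Module.Basis.mk_apply]

/-! ### The bilinear form -/

/-- The bilinear form with given values on two bases. -/
def formOfBases {ι V : Type*} [AddCommGroup V] [Module ℚ V] (b c : Module.Basis ι ℚ V)
    (u : ι → ι → ℚ) : LinearMap.BilinForm ℚ V :=
  b.constr ℚ fun i => c.constr ℚ (u i)

lemma formOfBases_apply {ι V : Type*} [AddCommGroup V] [Module ℚ V] (b c : Module.Basis ι ℚ V)
    (u : ι → ι → ℚ) (i j : ι) : formOfBases b c u (b i) (c j) = u i j := by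
  rw [formOfBases, b.constr_basis, c.constr_basis]

open Classical in
def innerNC : LinearMap.BilinForm ℚ sNCSym :=
  formOfBases ncBasis completeNCBasis
    fun I J => if I = J then (-1) ^ (I.m.choose 2) * (I.n ! : ℚ) else 0

open Classical in
lemma innerNC_mNC_hNC (I J : SetSPar) : innerNC (mNC I) (hNC J) =
    if I = J then (-1) ^ (I.m.choose 2) * (I.n ! : ℚ) else 0 := by
  rw [← ncBasis_apply, ← completeNCBasis_apply, innerNC, formOfBases_apply]

theorem isInnerNC_innerNC : IsInnerNC innerNC := fun I J =>
  ⟨mNC I, hNC J, rfl, rfl, innerNC_mNC_hNC I J⟩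

theorem isInnerNC_unique (B : LinearMap.BilinForm ℚ sNCSym) (hB : IsInnerNC B) : B = innerNC := by
  refine ncBasis.ext fun I => completeNCBasis.ext fun J => ?_
  obtain ⟨f, g, hf, hg, h⟩ := hB I J
  obtain rfl : f = mNC I := Subtype.ext hf
  obtain rfl : g = hNC J := Subtype.ext hg
  rw [ncBasis_apply, completeNCBasis_apply, h, innerNC_mNC_hNC]

/-! ### Finite combinations of monomial functions of one bidegree -/

lemma finite_bidegree (n m : ℕ) : {L : SPar | L.deg = n ∧ L.df = m}.Finite :=
  (SPar.finite_le (m + n)).subset fun L hL => by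
    rw [Set.mem_ofPred_eq] at hL ⊢
    rw [hL.1, hL.2]

/-- The element of bidegree `(n, m)` with given coefficients on the monomial functions. -/
def expansion (n m : ℕ) (c : SPar → ℚ) : sSym :=
  ∑ L ∈ (finite_bidegree n m).toFinset, c L • mComm L

lemma coe_expansion (n m : ℕ) (c : SPar → ℚ) : (expansion n m c : Comm) =
    ∑ᶠ (L : SPar) (_ : L.deg = n ∧ L.df = m), c L • monomialComm L := by
  have e : (∑ᶠ (L : SPar) (_ : L.deg = n ∧ L.df = m), c L • monomialComm L) =
      ∑ L ∈ (finite_bidegree n m).toFinset, c L • monomialComm L := by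
    rw [← finsum_mem_eq_finite_toFinset_sum]
    rfl
  rw [e, expansion, Submodule.coe_sum]
  rfl

lemma evComm_expansion (n m : ℕ) (c : SPar → ℚ) (O : SPar) : evComm O (expansion n m c) =
    if O.deg = n ∧ O.df = m then c O else 0 := by
  classical
  rw [expansion, map_sum]
  simp only [map_smul, evComm_mComm, smul_eq_mul, mul_ite, mul_one, mul_zero, sum_ite_eq',
    Set.Finite.mem_toFinset, Set.mem_ofPred_eq]

lemma expansion_ne_zero {n m : ℕ} {c : SPar → ℚ} {A : Finset ℕ} {α : ℕ →₀ ℕ}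
    (h : (expansion n m c : Comm) A α ≠ 0) : A.card = m := by
  have hA : Set.InjOn α A := by
    by_contra hA
    exact h (sSym_eq_zero (expansion n m c).2 hA)
  obtain ⟨O, a, hO, rfl⟩ := SPar.exists_matches hA
  have h1 : evComm O (expansion n m c) ≠ 0 := by
    rw [← val_eq_evComm _ hO]
    exact mul_ne_zero (thetaSign_ne_zero hO.nodup) h
  rw [evComm_expansion] at h1
  split_ifs at h1 with h2
  · rw [hO.card_degree.1, h2.2]
  · exact absurd rfl h1

lemma hBos_eq (r : ℕ) : hBos r = expansion r 0 fun _ => 1 := by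
  rw [coe_expansion, hBos]
  simp only [one_smul]

lemma hFer_eq (k : ℕ) : hFer k = expansion k 1 fun L => (L.parts.headD 0 : ℚ) + 1 := by
  rw [coe_expansion, hFer]

lemma hBos_apply (r : ℕ) (A : Finset ℕ) (α : ℕ →₀ ℕ) :
    hBos r A α = if A = ∅ then if α.degree = r then 1 else 0 else 0 := by
  split_ifs with hA hr
  all_goals try subst hA
  · obtain ⟨O, a, hO, h⟩ := SPar.exists_matches (α := α) (A := ∅) (by simp)
    obtain rfl := List.toFinset_eq_empty_iff _ |>.1 h
    have h1 := val_eq_evComm (expansion r 0 fun _ => 1) hO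
    rw [evComm_expansion, if_pos ⟨hO.card_degree.2.symm.trans hr, hO.card_degree.1.symm⟩,
      ← hBos_eq, Comm.val, thetaSign_of_pairwise List.Pairwise.nil, one_mul] at h1
    exact h1
  · obtain ⟨O, a, hO, h⟩ := SPar.exists_matches (α := α) (A := ∅) (by simp)
    obtain rfl := List.toFinset_eq_empty_iff _ |>.1 h
    have h1 := val_eq_evComm (expansion r 0 fun _ => 1) hO
    rw [evComm_expansion, if_neg fun h => hr (hO.card_degree.2.trans h.1),
      ← hBos_eq, Comm.val, thetaSign_of_pairwise List.Pairwise.nil, one_mul] at h1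
    exact h1
  · by_contra h
    rw [hBos_eq] at h
    exact hA (card_eq_zero.1 (expansion_ne_zero h))

lemma hFer_singleton (k x : ℕ) (α : ℕ →₀ ℕ) :
    hFer k {x} α = if α.degree = k then (α x : ℚ) + 1 else 0 := by
  obtain ⟨O, a, hO, h⟩ := SPar.exists_matches (α := α) (A := {x}) (by simp)
  obtain rfl : a = [x] := by
    have hp : a.Perm [x] := (List.perm_ext_iff_of_nodup hO.nodup (by simp)).2 fun y => by
      rw [← List.mem_toFinset, h, mem_singleton, List.mem_singleton]
    exact List.perm_singleton.1 hp
  have h1 := val_eq_evComm (expansion k 1 fun L => (L.parts.headD 0 : ℚ) + 1) hO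
  rw [← hFer_eq, Comm.val, thetaSign_of_pairwise (List.pairwise_singleton _ _), one_mul,
    evComm_expansion] at h1
  have h2 : O.parts.headD 0 = α x := by
    obtain ⟨r, -, h3, -⟩ := hO
    rw [SPar.parts, ← h3]
    rfl
  have h3 := hO.card_degree
  rw [show ([x] : List ℕ).toFinset = {x} from rfl] at h1 h3
  rw [h1, h2, ← h3.1, ← h3.2]
  simp

lemma hFer_ne_zero {k : ℕ} {A : Finset ℕ} {α : ℕ →₀ ℕ} (h : hFer k A α ≠ 0) : ∃ x, A = {x} := by
  rw [hFer_eq] at h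
  exact card_eq_one.1 (expansion_ne_zero h)

/-! ### Products of complete homogeneous functions -/

/-- The factor by which a fermionic variable `θ_x` weights a monomial. -/
def optWeight : Option ℕ → (ℕ →₀ ℕ) → ℕ
  | none, _ => 1
  | some x, β => β x + 1

/-- The number of factorizations of `x^α` into monomials of given degrees, with weights. -/
def factorizations : List (ℕ × Option ℕ) → (ℕ →₀ ℕ) → ℕ
  | [], α => if α = 0 then 1 else 0
  | i :: t, α => ∑ p ∈ antidiagonal α,
      if p.1.degree = i.1 then optWeight i.2 p.1 * factorizations t p.2 else 0

lemma Comm.mul_hBos_apply (r : ℕ) (g : Comm) (A : Finset ℕ) (α : ℕ →₀ ℕ) :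
    Comm.mul (hBos r) g A α = ∑ p ∈ antidiagonal α, if p.1.degree = r then g A p.2 else 0 := by
  rw [Comm.mul, sum_eq_single ∅]
  · refine sum_congr rfl fun p _ => ?_
    rw [hBos_apply, if_pos rfl, sdiff_empty, sort_empty, List.nil_append, thetaSign_sort]
    split_ifs <;> simp
  · intro B _ hB
    refine sum_eq_zero fun p _ => ?_
    rw [hBos_apply, if_neg hB, zero_mul, mul_zero]
  · simp

lemma Comm.mul_hFer_apply (r : ℕ) (g : Comm) (A : Finset ℕ) (α : ℕ →₀ ℕ) :
    Comm.mul (hFer r) g A α = ∑ x ∈ A, ∑ p ∈ antidiagonal α,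
      if p.1.degree = r then ((p.1 x : ℚ) + 1) * (thetaSign (x :: (A.erase x).sort) *
        g (A.erase x) p.2) else 0 := by
  rw [Comm.mul]
  have e : ∑ x ∈ A, ∑ p ∈ antidiagonal α, (if p.1.degree = r then
      ((p.1 x : ℚ) + 1) * (thetaSign (x :: (A.erase x).sort) * g (A.erase x) p.2) else 0) =
      ∑ B ∈ A.image fun x => {x}, ∑ p ∈ antidiagonal α,
        thetaSign (B.sort ++ (A \ B).sort) * (hFer r B p.1 * g (A \ B) p.2) := by
    rw [sum_image (singleton_injective.injOn)]
    refine sum_congr rfl fun x hx => sum_congr rfl fun p _ => ?_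
    rw [hFer_singleton, sort_singleton, sdiff_singleton_eq_erase, List.singleton_append]
    split_ifs
    · ring
    · ring
  rw [e]
  symm
  refine sum_subset (fun B hB => ?_) fun B hB hB' => sum_eq_zero fun p _ => ?_
  · obtain ⟨x, hx, rfl⟩ := mem_image.1 hB
    rw [mem_powerset, singleton_subset_iff]
    exact hx
  · by_contra h
    obtain ⟨x, rfl⟩ := hFer_ne_zero (left_ne_zero_of_mul (right_ne_zero_of_mul h))
    exact hB' (mem_image.2 ⟨x, singleton_subset_iff.1 (mem_powerset.1 hB), rfl⟩)

/-- The factors of `h_Λ`, with fermionic variables. -/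
def factors (la a ls : List ℕ) : List (ℕ × Option ℕ) :=
  List.zipWith (fun r x => (r, some x)) la a ++ ls.map fun r => (r, none)

lemma foldr_mul_hBos_apply (ls : List ℕ) (A : Finset ℕ) (α : ℕ →₀ ℕ) :
    (ls.map hBos).foldr Comm.mul (Comm.mono [] 0) A α =
      if A = ∅ then (factorizations (factors [] [] ls) α : ℚ) else 0 := by
  induction ls generalizing α with
  | nil =>
    rw [List.map_nil, List.foldr_nil, Comm.mono, thetaSign_of_pairwise List.Pairwise.nil]
    by_cases hA : A = ∅
    · subst hA
      simp [factors, factorizations, eq_comm]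
    · simp [hA, Ne.symm hA]
  | cons r ls ih =>
    rw [List.map_cons, List.foldr_cons, Comm.mul_hBos_apply]
    simp only [ih]
    split_ifs with hA
    · change _ = ((∑ p ∈ antidiagonal α, if p.1.degree = r then optWeight none p.1 *
        factorizations (factors [] [] ls) p.2 else 0 : ℕ) : ℚ)
      rw [Nat.cast_sum]
      refine sum_congr rfl fun p _ => ?_
      split_ifs <;> simp [optWeight]
    · simp

lemma sum_enum_cons {A : Finset ℕ} (F : ℕ → List ℕ → ℚ) :
    ∑ x ∈ A, ∑ a ∈ enum (A.erase x), F x a =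
      ∑ a ∈ enum A, (match a with | [] => 0 | x :: a => F x a) := by
  rw [sum_sigma']
  refine sum_bij_ne_zero (fun p _ _ => p.1 :: p.2) ?_ ?_ ?_ ?_
  · rintro ⟨x, a⟩ h _
    rw [mem_sigma, mem_enum] at h
    obtain ⟨h1, h2, h3⟩ := h
    dsimp only at h1 h2 h3
    rw [mem_enum, List.nodup_cons, ← List.mem_toFinset, h3, List.toFinset_cons, h3]
    exact ⟨⟨notMem_erase _ _, h2⟩, insert_erase h1⟩
  · rintro ⟨x, a⟩ _ _ ⟨y, b⟩ _ _ h
    obtain ⟨rfl, rfl⟩ := List.cons.inj h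
    rfl
  · rintro (_ | ⟨x, a⟩) h h0
    · exact absurd rfl h0
    · rw [mem_enum, List.nodup_cons, List.toFinset_cons] at h
      obtain ⟨⟨h1, h2⟩, rfl⟩ := h
      refine ⟨⟨x, a⟩, mem_sigma.2 ⟨mem_insert_self _ _, mem_enum.2 ⟨h2, ?_⟩⟩, h0, rfl⟩
      rw [erase_insert (by rwa [List.mem_toFinset])]
  · rintro ⟨x, a⟩ _ _
    rfl

lemma thetaSign_cons_sort {x : ℕ} {A : Finset ℕ} {a : List ℕ} (ha : a ∈ enum A) :
    thetaSign (x :: A.sort) * thetaSign a = thetaSign (x :: a) := by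
  obtain ⟨h1, h2⟩ := mem_enum.1 ha
  rw [thetaSign_cons, thetaSign_cons, thetaSign_sort, mul_one,
    ((perm_sort h1 h2).map _).prod_eq]

lemma foldr_mul_apply (la ls : List ℕ) (A : Finset ℕ) (α : ℕ →₀ ℕ) :
    (la.map hFer ++ ls.map hBos).foldr Comm.mul (Comm.mono [] 0) A α =
      ∑ a ∈ enum A, if a.length = la.length then
        thetaSign a * (factorizations (factors la a ls) α : ℚ) else 0 := by
  induction la generalizing A α with
  | nil =>
    rw [List.map_nil, List.nil_append, foldr_mul_hBos_apply]
    split_ifs with hA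
    · subst hA
      have : enum ∅ = {[]} := by
        ext a
        rw [mem_enum, mem_singleton, List.toFinset_eq_empty_iff]
        exact ⟨fun h => h.2, by rintro rfl; exact ⟨List.nodup_nil, rfl⟩⟩
      rw [this, sum_singleton, if_pos rfl, thetaSign_of_pairwise List.Pairwise.nil, one_mul]
    · refine (sum_eq_zero fun a ha => if_neg fun h => hA ?_).symm
      rw [List.length_nil, List.length_eq_zero_iff] at h
      rw [← (mem_enum.1 ha).2, h]
      rfl
  | cons r la ih =>
    rw [List.map_cons, List.cons_append, List.foldr_cons, Comm.mul_hFer_apply]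
    simp only [ih]
    have e : ∀ x, ∑ p ∈ antidiagonal α, (if p.1.degree = r then ((p.1 x : ℚ) + 1) *
        (thetaSign (x :: (A.erase x).sort) * ∑ a ∈ enum (A.erase x),
          if a.length = la.length then
            thetaSign a * (factorizations (factors la a ls) p.2 : ℚ) else 0) else 0) =
        ∑ a ∈ enum (A.erase x), if a.length + 1 = la.length + 1 then thetaSign (x :: a) *
          (factorizations (factors (r :: la) (x :: a) ls) α : ℚ) else 0 := by
      intro x
      have e1 : ∀ a, (factorizations (factors (r :: la) (x :: a) ls) α : ℚ) =
          ∑ p ∈ antidiagonal α, if p.1.degree = r then ((p.1 x : ℚ) + 1) *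
            (factorizations (factors la a ls) p.2 : ℚ) else 0 := by
        intro a
        change ((∑ p ∈ antidiagonal α, if p.1.degree = r then optWeight (some x) p.1 *
          factorizations (factors la a ls) p.2 else 0 : ℕ) : ℚ) = _
        rw [Nat.cast_sum]
        refine sum_congr rfl fun p _ => ?_
        split_ifs <;> simp [optWeight]
      have e2 : ∀ p ∈ antidiagonal α, (if p.1.degree = r then ((p.1 x : ℚ) + 1) *
          (thetaSign (x :: (A.erase x).sort) * ∑ a ∈ enum (A.erase x),
            if a.length = la.length then
              thetaSign a * (factorizations (factors la a ls) p.2 : ℚ) else 0) else 0) =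
          ∑ a ∈ enum (A.erase x), if a.length + 1 = la.length + 1 then thetaSign (x :: a) *
            (if p.1.degree = r then ((p.1 x : ℚ) + 1) *
            (factorizations (factors la a ls) p.2 : ℚ) else 0) else 0 := by
        intro p _
        split_ifs with hp
        · rw [mul_sum, mul_sum]
          refine sum_congr rfl fun a ha => ?_
          rw [← thetaSign_cons_sort ha]
          simp only [add_left_inj]
          split_ifs
          · ring
          · ring
        · simp
      rw [sum_congr rfl e2, sum_comm]
      refine sum_congr rfl fun a _ => ?_
      rw [e1]
      split_ifs
      · rw [mul_sum]
      · simp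
    rw [sum_congr rfl fun x _ => e x, sum_enum_cons]
    refine sum_congr rfl fun a _ => ?_
    rcases a with _ | ⟨x, a⟩
    · rw [if_neg (by simp)]
    · rfl

lemma completeComm_apply (L : SPar) (A : Finset ℕ) (α : ℕ →₀ ℕ) :
    completeComm L A α = ∑ a ∈ enum A, if a.length = L.df then
      thetaSign a * (factorizations (factors L.a a L.s) α : ℚ) else 0 :=
  foldr_mul_apply L.a L.s A α

/-! ### Factorizations and words -/

lemma content_append (v w : List ℕ) : content (v ++ w) = content v + content w := by
  ext i
  rw [Finsupp.add_apply, content_apply, content_apply, content_apply, List.count_append]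

lemma sum_words_split (r : ℕ) (F : List ℕ → List ℕ → ℕ) (α : ℕ →₀ ℕ) :
    ∑ p ∈ antidiagonal α, ∑ v ∈ words p.1, ∑ w ∈ words p.2, (if v.length = r then F v w else 0) =
      ∑ w ∈ words α, if r ≤ w.length then F (w.take r) (w.drop r) else 0 := by
  simp only [← sum_product']
  rw [sum_sigma']
  refine sum_bij_ne_zero (fun q _ _ => q.2.1 ++ q.2.2) ?_ ?_ ?_ ?_
  · rintro ⟨p, v, w⟩ h _
    simp only [mem_sigma, mem_product, HasAntidiagonal.mem_antidiagonal, mem_words] at h ⊢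
    rw [content_append, h.2.1, h.2.2, h.1]
  · rintro ⟨p, v, w⟩ h h0 ⟨p', v', w'⟩ h' h0' e
    simp only [mem_sigma, mem_product, HasAntidiagonal.mem_antidiagonal, mem_words] at h h'
    have hv : v.length = r := by
      by_contra hv
      exact h0 (if_neg hv)
    have hv' : v'.length = r := by
      by_contra hv
      exact h0' (if_neg hv)
    obtain ⟨rfl, rfl⟩ := List.append_inj e (hv.trans hv'.symm)
    obtain rfl : p = p' := Prod.ext (h.2.1.symm.trans h'.2.1) (h.2.2.symm.trans h'.2.2)
    rfl
  · intro w hw h0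
    have hr : r ≤ w.length := by
      by_contra hr
      exact h0 (if_neg hr)
    refine ⟨⟨(content (w.take r), content (w.drop r)), w.take r, w.drop r⟩, ?_, ?_, ?_⟩
    · simp only [mem_sigma, mem_product, HasAntidiagonal.mem_antidiagonal, mem_words, and_self, and_true]
      rw [← content_append, List.take_append_drop, mem_words.1 hw]
    · rw [if_pos hr] at h0
      dsimp only
      rwa [if_pos (by rw [List.length_take, min_eq_left hr])]
    · exact List.take_append_drop r w
  · rintro ⟨p, v, w⟩ _ h0
    have hv : v.length = r := by
      by_contra hv
      exact h0 (if_neg hv)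
    subst hv
    simp

/-- The weight of a word that is cut into segments of given lengths. -/
def segmentWeight : List (ℕ × Option ℕ) → List ℕ → ℕ
  | [], w => if w = [] then 1 else 0
  | i :: t, w => if i.1 ≤ w.length then
      contentFact (content (w.take i.1)) * optWeight i.2 (content (w.take i.1)) *
        segmentWeight t (w.drop i.1) else 0

lemma segmentWeight_ne_zero {l : List (ℕ × Option ℕ)} {w : List ℕ} (h : segmentWeight l w ≠ 0) :
    w.length = (l.map Prod.fst).sum := by
  induction l generalizing w with
  | nil =>
    unfold segmentWeight at h
    split_ifs at h with hw
    · rw [hw]; rfl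
    · exact absurd rfl h
  | cons i t ih =>
    unfold segmentWeight at h
    split_ifs at h with hw
    · have := ih (right_ne_zero_of_mul h)
      rw [List.length_drop] at this
      rw [List.map_cons, List.sum_cons, ← this]
      omega
    · exact absurd rfl h

lemma factorial_mul_factorizations (l : List (ℕ × Option ℕ)) (α : ℕ →₀ ℕ) :
    (l.map fun i => (i.1)!).prod * factorizations l α = ∑ w ∈ words α, segmentWeight l w := by
  induction l generalizing α with
  | nil =>
    rw [List.map_nil, List.prod_nil, one_mul]
    unfold factorizations
    have h : ∀ w ∈ words α, segmentWeight [] w = if w = [] then 1 else 0 := fun _ _ => rfl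
    rw [sum_congr rfl h, sum_ite_eq']
    congr 1
    rw [mem_words, eq_iff_iff, eq_comm]
    have : content [] = 0 := by ext i; rw [content_apply]; rfl
    rw [this]
  | cons i t ih =>
    have e : ∀ w, segmentWeight (i :: t) w = if i.1 ≤ w.length then
        (fun v w => contentFact (content v) * optWeight i.2 (content v) * segmentWeight t w)
          (w.take i.1) (w.drop i.1) else 0 := fun _ => rfl
    rw [sum_congr rfl fun w _ => e w, ← sum_words_split i.1
      (fun v w => contentFact (content v) * optWeight i.2 (content v) * segmentWeight t w) α]
    rw [List.map_cons, List.prod_cons, factorizations, mul_sum]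
    refine sum_congr rfl fun p _ => ?_
    have e2 : ∀ v ∈ words p.1, (∑ w ∈ words p.2, if v.length = i.1 then
        contentFact (content v) * optWeight i.2 (content v) * segmentWeight t w else 0) =
        if p.1.degree = i.1 then contentFact p.1 * optWeight i.2 p.1 *
          ((t.map fun i => (i.1)!).prod * factorizations t p.2) else 0 := by
      intro v hv
      rw [ih, mem_words.1 hv, length_of_mem_words hv]
      split_ifs
      · rw [mul_sum]
      · exact sum_const_zero
    rw [sum_congr rfl e2, sum_const, smul_eq_mul]
    split_ifs with h
    · rw [← h, ← card_words]
      ring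
    · simp

lemma segmentWeight_flatMap (ks : List ℕ) (seg : ℕ → List ℕ) (o : ℕ → Option ℕ) :
    segmentWeight (ks.map fun k => ((seg k).length, o k)) (ks.flatMap seg) =
      (ks.map fun k => contentFact (content (seg k)) * optWeight (o k) (content (seg k))).prod := by
  induction ks with
  | nil => rfl
  | cons k ks ih =>
    rw [List.map_cons, List.flatMap_cons, List.map_cons, List.prod_cons, segmentWeight,
      if_pos (by simp), ← ih]
    simp

/-! ### Block factorials -/

/-- The functions whose values form a rearrangement of `x^α`. -/
def wordFuns (n : ℕ) (α : ℕ →₀ ℕ) : Finset (Fin n → ℕ) :=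
  (words α).preimage List.ofFn List.ofFn_injective.injOn

lemma mem_wordFuns {n : ℕ} {α : ℕ →₀ ℕ} {g : Fin n → ℕ} :
    g ∈ wordFuns n α ↔ content (List.ofFn g) = α := by
  rw [wordFuns, mem_preimage, mem_words]

lemma sum_wordFuns {M : Type*} [AddCommMonoid M] (n : ℕ) (α : ℕ →₀ ℕ) (F : List ℕ → M)
    (hF : ∀ w, w.length ≠ n → F w = 0) :
    ∑ g ∈ wordFuns n α, F (List.ofFn g) = ∑ w ∈ words α, F w := by
  refine sum_preimage _ _ _ F fun w _ hw => hF w fun h => hw ?_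
  obtain ⟨f, hf⟩ := SetSPar.exists_ofFn h
  exact ⟨f, hf⟩

lemma blockFact_ker {m n : ℕ} {Y : Type*} [DecidableEq Y] (u : Fin m ⊕ Fin n → Y) :
    SetSPar.blockFact (Setoid.ker u) =
      ∏ y ∈ univ.image u, ((univ.filter fun x => u x = y).card)! := by
  classical
  rw [← card_perm_comp u 1, blockFact_eq_card]
  congr 1
  ext π
  rw [mem_filter, mem_filter, funext_iff]
  exact and_congr_right fun _ => forall_congr' fun x => eq_comm

section
variable {m n : ℕ} (f₀ : Fin m → ℕ) (g₀ : Fin n → ℕ)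

/-- The word formed by the values of `g` on a fibre of `g₀`. -/
def fibreWord (g : Fin n → ℕ) (k : ℕ) : List ℕ := ((univ.filter fun j => g₀ j = k).toList).map g

lemma length_fibreWord (g : Fin n → ℕ) (k : ℕ) :
    (fibreWord g₀ g k).length = content (List.ofFn g₀) k := by
  rw [fibreWord, List.length_map, length_toList, content_apply, count_ofFn]

lemma content_fibreWord (g : Fin n → ℕ) (k v : ℕ) :
    content (fibreWord g₀ g k) v = (univ.filter fun j => g₀ j = k ∧ g j = v).card := by
  rw [content, Multiset.toFinsupp_apply, fibreWord, ← Multiset.map_coe, coe_toList,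
    Multiset.count_map, ← filter_filter]
  simp only [eq_comm (a := v)]
  rfl

variable {f₀ g₀}

/-- The fermionic variable attached to a block. -/
def fermionicVar (f₀ f : Fin m → ℕ) : ℕ → Option ℕ :=
  Function.extend f₀ (fun i => some (f i)) fun _ => none

lemma blockFact_inf_ker (hf₀ : Function.Injective f₀) (f : Fin m → ℕ) (g : Fin n → ℕ) {ks : List ℕ}
    (hnd : ks.Nodup) (hks : ∀ x, Sum.elim f₀ g₀ x ∈ ks) :
    SetSPar.blockFact (Setoid.ker (Sum.elim f₀ g₀) ⊓ Setoid.ker (Sum.elim f g)) =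
      (ks.map fun k => contentFact (content (fibreWord g₀ g k)) *
        optWeight (fermionicVar f₀ f k) (content (fibreWord g₀ g k))).prod := by
  classical
  set q := Sum.elim f₀ g₀ with hq
  set p := Sum.elim f g with hp
  set V := univ.image p with hV
  have e : Setoid.ker q ⊓ Setoid.ker p = Setoid.ker fun x => (q x, p x) := by
    ext x y
    rw [Setoid.ker_def, Prod.mk.injEq]
    exact Iff.rfl
  have hsub : univ.image (fun x => (q x, p x)) ⊆ ks.toFinset ×ˢ V := by
    intro y hy
    obtain ⟨x, -, rfl⟩ := mem_image.1 hy
    exact mem_product.2 ⟨List.mem_toFinset.2 (hks x), mem_image_of_mem _ (mem_univ _)⟩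
  rw [e, blockFact_ker, prod_subset hsub (fun y _ hy => ?_), prod_product,
    ← List.prod_toFinset _ hnd]
  swap
  · rw [card_eq_zero.2, Nat.factorial_zero]
    refine filter_eq_empty_iff.2 fun x _ hx => hy ?_
    exact mem_image.2 ⟨x, mem_univ _, hx⟩
  refine prod_congr rfl fun k _ => ?_
  set β := content (fibreWord g₀ g k) with hβ
  have hcard : ∀ v, (univ.filter fun x => (q x, p x) = (k, v)).card =
      (univ.filter fun i => f₀ i = k ∧ f i = v).card + β v := by
    intro v
    rw [hβ, content_fibreWord]
    simp only [card_filter, Fintype.sum_sum_type, Prod.mk.injEq]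
    rfl
  have hβV : ∏ v ∈ V, (β v)! = contentFact β := by
    symm
    refine prod_subset (fun v hv => ?_) fun v _ hv => by
      rw [Finsupp.notMem_support_iff.1 hv, Nat.factorial_zero]
    rw [Finsupp.mem_support_iff, hβ, content_fibreWord] at hv
    obtain ⟨j, hj⟩ := card_ne_zero.1 hv
    exact mem_image.2 ⟨Sum.inr j, mem_univ _, (mem_filter.1 hj).2.2⟩
  simp only [hcard]
  by_cases hk : ∃ i, f₀ i = k
  · obtain ⟨i, rfl⟩ := hk
    have h1 : ∀ v, (univ.filter fun i' => f₀ i' = f₀ i ∧ f i' = v).card =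
        if f i = v then 1 else 0 := by
      intro v
      split_ifs with h
      · rw [card_eq_one]
        refine ⟨i, ?_⟩
        ext i'
        rw [mem_filter, mem_singleton]
        exact ⟨fun h' => hf₀ h'.2.1, fun h' => ⟨mem_univ _, by rw [h'], by rw [h', h]⟩⟩
      · rw [card_eq_zero, filter_eq_empty_iff]
        rintro i' _ ⟨h2, h3⟩
        exact h (hf₀ h2 ▸ h3)
    have hiV : f i ∈ V := mem_image.2 ⟨Sum.inl i, mem_univ _, rfl⟩
    rw [fermionicVar, hf₀.extend_apply, optWeight, ← hβV, ← mul_prod_erase _ _ hiV,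
      ← mul_prod_erase _ (fun v => (β v)!) hiV, h1, if_pos rfl, add_comm 1, Nat.factorial_succ]
    have h2 : ∀ v ∈ V.erase (f i),
        ((univ.filter fun i' => f₀ i' = f₀ i ∧ f i' = v).card + β v)! = (β v)! := by
      intro v hv
      rw [h1, if_neg (ne_of_mem_erase hv).symm, zero_add]
    rw [prod_congr rfl h2]
    ring
  · rw [fermionicVar, Function.extend_apply' _ _ _ hk, optWeight, mul_one, ← hβV]
    refine prod_congr rfl fun v _ => ?_
    rw [card_eq_zero.2, zero_add]
    exact filter_eq_empty_iff.2 fun i _ h => hk ⟨i, h.1⟩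

lemma sum_blockFact (hf₀ : Function.Injective f₀) (f : Fin m → ℕ) {ks : List ℕ} (hnd : ks.Nodup)
    (hks : ∀ x, Sum.elim f₀ g₀ x ∈ ks) (α : ℕ →₀ ℕ) :
    ∑ g ∈ wordFuns n α,
        SetSPar.blockFact (Setoid.ker (Sum.elim f₀ g₀) ⊓ Setoid.ker (Sum.elim f g)) =
      (ks.map fun k => (content (List.ofFn g₀) k)!).prod * factorizations
        (ks.map fun k => (content (List.ofFn g₀) k, fermionicVar f₀ f k)) α := by
  classical
  set l := ks.map fun k => (content (List.ofFn g₀) k, fermionicVar f₀ f k) with hl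
  let P : List (Fin n) := ks.flatMap fun k => (univ.filter fun j => g₀ j = k).toList
  have hP : P.Perm (List.finRange n) := by
    refine (List.perm_ext_iff_of_nodup ?_ (List.nodup_finRange n)).2 fun j => ?_
    · rw [List.nodup_flatMap]
      refine ⟨fun k _ => nodup_toList _, hnd.imp fun {k k'} hkk j hj hj' => hkk ?_⟩
      rw [mem_toList, mem_filter] at hj hj'
      exact hj.2.symm.trans hj'.2
    · simp only [P, List.mem_flatMap, mem_toList, mem_filter, mem_univ, true_and, List.mem_finRange,
        iff_true]
      exact ⟨g₀ j, hks (Sum.inr j), rfl⟩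
  have hPn : P.length = n := by rw [hP.length_eq, List.length_finRange]
  let π₀ : Fin n → Fin n := fun j => P.get (j.cast hPn.symm)
  have hπ₀ : Function.Injective π₀ := by
    have h1 : P.Nodup := hP.nodup_iff.2 (List.nodup_finRange n)
    intro i j hij
    have := List.nodup_iff_injective_get.1 h1 hij
    simpa using this
  let π : Equiv.Perm (Fin n) := Equiv.ofBijective π₀ (Finite.injective_iff_bijective.1 hπ₀)
  have hπ : ∀ g : Fin n → ℕ, List.ofFn (g ∘ π) = ks.flatMap (fibreWord g₀ g) := by
    intro g
    have h1 : List.ofFn π₀ = P := by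
      refine List.ext_getElem (by rw [List.length_ofFn, hPn]) fun i _ _ => ?_
      rw [List.getElem_ofFn]
      rfl
    rw [show g ∘ π = g ∘ π₀ from rfl, ← List.map_ofFn, h1, List.map_flatMap]
    rfl
  have hlen : (l.map Prod.fst).sum = n := by
    refine Eq.trans ?_ hPn
    rw [hl, List.map_map, List.length_flatMap]
    congr 1
    refine List.map_congr_left fun k _ => ?_
    rw [Function.comp_apply, length_toList, content_apply, count_ofFn]
  have h1 : (ks.map fun k => (content (List.ofFn g₀) k)!).prod = (l.map fun i => (i.1)!).prod := by
    rw [hl, List.map_map]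
    rfl
  rw [h1, factorial_mul_factorizations, ← sum_wordFuns n α _ fun w hw => by
    by_contra h
    exact hw ((segmentWeight_ne_zero h).trans hlen)]
  refine sum_equiv (Equiv.arrowCongr π.symm (Equiv.refl ℕ)) (fun g => ?_) fun g _ => ?_
  · rw [mem_wordFuns, mem_wordFuns]
    change _ ↔ content (List.ofFn (g ∘ π)) = α
    rw [content_eq_iff.2 (π.ofFn_comp_perm g)]
  · change _ = segmentWeight l (List.ofFn (g ∘ π))
    rw [hπ, blockFact_inf_ker hf₀ f g hnd hks, ← segmentWeight_flatMap, hl]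
    simp only [length_fibreWord]

end

/-! ### Projections of complete homogeneous functions -/

namespace SetSPar

variable {J : SetSPar}

lemma thetaSign_mul_complete_eq {f : Fin J.m → ℕ} (hf : Function.Injective f) (g : Fin J.n → ℕ) :
    thetaSign (List.ofFn f) * J.complete (List.ofFn f).toFinset (List.ofFn g) =
      ∑ τ : Equiv.Perm (Fin J.m), ((Equiv.Perm.sign τ : ℤ) : ℚ) *
        blockFact (J.rel ⊓ Setoid.ker (Sum.elim (f ∘ τ) g)) := by
  by_cases h : (Set.range f \ Set.range g).Subsingleton
  · exact thetaSign_mul_complete hf h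
  rw [complete_eq_zero h, mul_zero]
  rw [Set.not_subsingleton_iff] at h
  obtain ⟨_, ⟨⟨i, rfl⟩, hi⟩, _, ⟨⟨j, rfl⟩, hj⟩, hij⟩ := h
  have hne : i ≠ j := fun h => hij (congrArg f h)
  set F : Equiv.Perm (Fin J.m) → ℚ := fun τ => ((Equiv.Perm.sign τ : ℤ) : ℚ) *
    blockFact (J.rel ⊓ Setoid.ker (Sum.elim (f ∘ τ) g)) with hF
  have key : ∀ τ, F (Equiv.swap i j * τ) = -F τ := by
    intro τ
    have e : Sum.elim (f ∘ (Equiv.swap i j * τ : Equiv.Perm _)) g =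
        Equiv.swap (f i) (f j) ∘ Sum.elim (f ∘ τ) g := by
      funext x
      rcases x with x | x
      · simp only [Sum.elim_inl, Function.comp_apply, Equiv.Perm.mul_apply]
        exact (hf.swap_apply i j (τ x)).symm
      · simp only [Sum.elim_inr, Function.comp_apply]
        exact (Equiv.swap_apply_of_ne_of_ne (fun h => hi ⟨x, h⟩) fun h => hj ⟨x, h⟩).symm
    have e2 : Setoid.ker (Sum.elim (f ∘ (Equiv.swap i j * τ : Equiv.Perm _)) g) =
        Setoid.ker (Sum.elim (f ∘ τ) g) := by
      rw [e]
      ext x y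
      exact (Equiv.swap (f i) (f j)).injective.eq_iff
    rw [hF]
    dsimp only
    rw [e2, Equiv.Perm.sign_mul, Equiv.Perm.sign_swap hne]
    simp
  have h1 : ∑ τ, F τ = -∑ τ, F τ := by
    rw [← sum_neg_distrib, ← Equiv.sum_comp (Equiv.mulLeft (Equiv.swap i j))]
    exact sum_congr rfl fun τ _ => key τ
  linarith

lemma thetaSign_mul_rho_complete {f : Fin J.m → ℕ} (hf : Function.Injective f) (α : ℕ →₀ ℕ) :
    thetaSign (List.ofFn f) * rho J.complete (List.ofFn f).toFinset α =
      ∑ τ : Equiv.Perm (Fin J.m), ((Equiv.Perm.sign τ : ℤ) : ℚ) *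
        ((∑ g ∈ wordFuns J.n α,
          blockFact (J.rel ⊓ Setoid.ker (Sum.elim (f ∘ τ) g)) : ℕ) : ℚ) := by
  rw [rho_apply, ← sum_wordFuns J.n α _ fun w hw => ?_, mul_sum]
  · simp only [thetaSign_mul_complete_eq hf]
    rw [sum_comm]
    refine sum_congr rfl fun τ _ => ?_
    rw [Nat.cast_sum, mul_sum]
  · by_contra h
    obtain ⟨f', g', -, -, -, rfl⟩ := J.complete_ne_zero h
    exact hw List.length_ofFn

lemma rho_complete_ne_zero {A : Finset ℕ} {α : ℕ →₀ ℕ} (h : rho J.complete A α ≠ 0) :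
    A.card = J.m ∧ α.degree = J.n := by
  obtain ⟨w, hw, hw0⟩ := exists_ne_zero_of_sum_ne_zero h
  obtain ⟨f, g, h1, -, rfl, rfl⟩ := J.complete_ne_zero hw0
  rw [← length_of_mem_words hw, List.toFinset_card_of_nodup (List.nodup_ofFn.2 h1),
    List.length_ofFn, List.length_ofFn]
  exact ⟨rfl, rfl⟩

lemma zipWith_ofFn {α β γ : Type*} {n : ℕ} (F : α → β → γ) (u : Fin n → α) (v : Fin n → β) :
    List.zipWith F (List.ofFn u) (List.ofFn v) = List.ofFn fun i => F (u i) (v i) := by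
  refine List.ext_getElem (by simp) fun i _ _ => ?_
  simp

lemma sum_blockFact_eq {f₀ : Fin J.m → ℕ} {g₀ : Fin J.n → ℕ}
    (h1 : ∀ i j, f₀ i = g₀ j ↔ J.rel (Sum.inl i) (Sum.inr j))
    (h2 : ∀ i j, g₀ i = g₀ j ↔ J.rel (Sum.inr i) (Sum.inr j)) {r : List ℕ}
    (hnd : (List.ofFn f₀ ++ r).Nodup)
    (hr : ∀ x ∉ List.ofFn f₀ ++ r, content (List.ofFn g₀) x = 0)
    (τ₀ : Equiv.Perm (Fin J.m)) {la ls : List ℕ}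
    (hla : (List.ofFn (f₀ ∘ τ₀)).map (content (List.ofFn g₀)) = la)
    (hls : r.map (content (List.ofFn g₀)) = ls) (f : Fin J.m → ℕ) (α : ℕ →₀ ℕ) :
    ∑ g ∈ wordFuns J.n α, blockFact (J.rel ⊓ Setoid.ker (Sum.elim f g)) =
      ((la ++ ls).map Nat.factorial).prod *
        factorizations (factors la (List.ofFn (f ∘ τ₀)) ls) α := by
  have hf₀ := injective_of_rel h1
  have hp : (List.ofFn (f₀ ∘ τ₀) ++ r).Perm (List.ofFn f₀ ++ r) :=
    (τ₀.ofFn_comp_perm f₀).append_right r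
  rw [← ker_eq h1 h2, sum_blockFact hf₀ f (hp.nodup_iff.2 hnd) fun x => hp.mem_iff.2 ?_]
  · subst hla hls
    rw [← List.map_append, List.map_map]
    congr 2
    rw [List.map_append, factors]
    congr 1
    · rw [List.map_ofFn, List.map_ofFn, zipWith_ofFn]
      congr 1
      funext i
      simp only [Function.comp_apply, fermionicVar]
      rw [hf₀.extend_apply]
    · rw [List.map_map]
      refine List.map_congr_left fun k hk => ?_
      rw [fermionicVar, Function.extend_apply' _ _ _ ?_, Function.comp_apply]
      rintro ⟨i, rfl⟩
      exact (List.nodup_append.1 hnd).2.2 _ ((List.mem_ofFn' _ _).2 ⟨i, rfl⟩) _ hk rfl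
  · by_contra h
    rcases x with i | j
    · exact h (List.mem_append_left _ ((List.mem_ofFn' _ _).2 ⟨i, rfl⟩))
    · have := hr _ h
      rw [content_apply, List.count_eq_zero] at this
      exact this ((List.mem_ofFn' _ _).2 ⟨j, rfl⟩)

end SetSPar

lemma sum_enum_ofFn {m : ℕ} {f : Fin m → ℕ} (hf : Function.Injective f) (G : List ℕ → ℚ) :
    ∑ a ∈ enum (List.ofFn f).toFinset, G a =
      ∑ τ : Equiv.Perm (Fin m), G (List.ofFn (f ∘ τ)) := by
  have e : enum (List.ofFn f).toFinset =
      univ.image fun τ : Equiv.Perm (Fin m) => List.ofFn (f ∘ τ) := by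
    ext a
    rw [mem_enum, mem_image]
    constructor
    · rintro ⟨h1, h2⟩
      have hp : (List.ofFn f).Perm a :=
        (List.perm_ext_iff_of_nodup (List.nodup_ofFn.2 hf) h1).2 fun x => by
          rw [← List.mem_toFinset, ← h2, List.mem_toFinset]
      obtain ⟨τ, rfl⟩ := exists_perm_of_perm hp f rfl
      exact ⟨τ, mem_univ _, rfl⟩
    · rintro ⟨τ, -, rfl⟩
      exact ⟨List.nodup_ofFn.2 (hf.comp τ.injective),
        List.toFinset_eq_of_perm _ _ (τ.ofFn_comp_perm f)⟩
  rw [e, sum_image]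
  intro τ _ τ' _ h
  exact Equiv.ext fun i => hf (congrFun (List.ofFn_injective h) i)

lemma thetaSign_mul_completeComm {L : SPar} {m : ℕ} (hm : m = L.df) {f : Fin m → ℕ}
    (hf : Function.Injective f) (α : ℕ →₀ ℕ) :
    thetaSign (List.ofFn f) * completeComm L (List.ofFn f).toFinset α =
      ∑ τ : Equiv.Perm (Fin m), ((Equiv.Perm.sign τ : ℤ) : ℚ) *
        (factorizations (factors L.a (List.ofFn (f ∘ τ)) L.s) α : ℚ) := by
  rw [completeComm_apply, sum_enum_ofFn hf, mul_sum]
  refine sum_congr rfl fun τ _ => ?_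
  rw [if_pos (by rw [List.length_ofFn, hm]), thetaSign_ofFn_comp]
  have := thetaSign_mul_self (List.nodup_ofFn.2 hf)
  linear_combination ((Equiv.Perm.sign τ : ℤ) : ℚ) *
    (factorizations (factors L.a (List.ofFn (f ∘ τ)) L.s) α : ℚ) * this

lemma exists_ofFn_toFinset {m : ℕ} {A : Finset ℕ} (hA : A.card = m) :
    ∃ f : Fin m → ℕ, Function.Injective f ∧ (List.ofFn f).toFinset = A := by
  obtain ⟨f, hf⟩ := SetSPar.exists_ofFn ((length_toList A).trans hA)
  refine ⟨f, List.nodup_ofFn.1 (hf ▸ nodup_toList A), ?_⟩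
  rw [hf, toList_toFinset]

lemma rho_complete_of_hasType {J : SetSPar} {L : SPar} (h : J.HasType L) :
    rho J.complete = ((-1 : ℚ) ^ J.eps * L.fact) • completeComm L := by
  have hm := h.bidegree.1
  funext A α
  by_cases hA : A.card = J.m
  swap
  · rw [Pi.smul_apply, Pi.smul_apply, completeComm_apply]
    have h1 : rho J.complete A α = 0 := by
      by_contra h0
      exact hA (SetSPar.rho_complete_ne_zero h0).1
    rw [h1, sum_eq_zero, smul_zero]
    intro a ha
    refine if_neg fun hl => hA ?_
    rw [hm, ← hl, ← (mem_enum.1 ha).2, List.toFinset_card_of_nodup (mem_enum.1 ha).1]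
  obtain ⟨f, hf, rfl⟩ := exists_ofFn_toFinset hA
  obtain ⟨b, hb, hL⟩ := (SetSPar.hasType_iff J.matches_rep).1 h
  have heps := SetSPar.thetaSign_mul_of_matches J.matches_rep hb hL
  obtain ⟨f₀, g₀, h1, h2, h3, h4⟩ := J.matches_rep
  rw [← h3] at hb heps
  rw [← h4] at hL
  have hf₀ := SetSPar.injective_of_rel h1
  obtain ⟨τ₀, rfl⟩ := exists_perm_of_perm hb.symm f₀ rfl
  rw [thetaSign_ofFn_comp, mul_left_comm, thetaSign_mul_self (List.nodup_ofFn.2 hf₀), mul_one]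
    at heps
  obtain ⟨r, hr1, hr2, hr3, hr4⟩ := hL
  have hp : (List.ofFn (f₀ ∘ τ₀) ++ r).Perm (List.ofFn f₀ ++ r) :=
    (τ₀.ofFn_comp_perm f₀).append_right r
  refine mul_left_cancel₀ (thetaSign_ne_zero (List.nodup_ofFn.2 hf)) ?_
  rw [SetSPar.thetaSign_mul_rho_complete hf, Pi.smul_apply, Pi.smul_apply, smul_eq_mul,
    mul_left_comm, thetaSign_mul_completeComm hm hf, SPar.fact, SPar.parts,
    mul_assoc, ← heps, ← Equiv.sum_comp (Equiv.mulRight τ₀) fun τ : Equiv.Perm (Fin J.m) =>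
      ((Equiv.Perm.sign τ : ℤ) : ℚ) *
        (factorizations (factors L.a (List.ofFn (f ∘ τ)) L.s) α : ℚ), mul_sum, mul_sum]
  refine sum_congr rfl fun τ _ => ?_
  rw [SetSPar.sum_blockFact_eq h1 h2 (hp.nodup_iff.1 hr1)
    (fun x hx => hr4 x fun h => hx (hp.mem_iff.1 h)) τ₀ hr2 hr3, Equiv.coe_mulRight,
    Equiv.Perm.sign_mul, Nat.cast_mul, Units.val_mul, Int.cast_mul, Equiv.Perm.coe_mul,
    Function.comp_assoc]
  have hs : ((Equiv.Perm.sign τ₀ : ℤ) : ℚ) * ((Equiv.Perm.sign τ₀ : ℤ) : ℚ) = 1 := by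
    rw [← Int.cast_mul, ← Units.val_mul, Int.units_mul_self]
    simp
  linear_combination (-((Equiv.Perm.sign τ : ℤ) : ℚ) *
    (((((L.a ++ L.s).map Nat.factorial).prod : ℕ) : ℚ) *
    (factorizations (factors L.a (List.ofFn (f ∘ τ ∘ τ₀)) L.s) α : ℚ))) * hs

lemma rho_complete_of_not_hasType {J : SetSPar} (h : ∀ L, ¬ J.HasType L) : rho J.complete = 0 := by
  obtain ⟨f₀, g₀, h1, h2, h3, h4⟩ := J.matches_rep
  have hf₀ := SetSPar.injective_of_rel h1
  set β := content (List.ofFn g₀) with hβ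
  have hA : ¬ Set.InjOn β (List.ofFn f₀).toFinset := by
    intro hA
    obtain ⟨L, a, hL, ha⟩ := SPar.exists_matches hA
    refine h L ((SetSPar.hasType_iff J.matches_rep).2 ⟨a, ?_, h4 ▸ hL⟩)
    rw [← h3]
    refine (List.perm_ext_iff_of_nodup hL.nodup (List.nodup_ofFn.2 hf₀)).2 fun x => ?_
    rw [← List.mem_toFinset, ha, List.mem_toFinset]
  simp only [Set.InjOn, not_forall] at hA
  obtain ⟨x, hx, y, hy, hxy, hne⟩ := hA
  rw [mem_coe, List.mem_toFinset, List.mem_ofFn'] at hx hy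
  obtain ⟨i, rfl⟩ := hx
  obtain ⟨j, rfl⟩ := hy
  have hij : i ≠ j := fun h => hne (congrArg f₀ h)
  obtain ⟨r, hr1, hr2⟩ : ∃ r : List ℕ, (List.ofFn f₀ ++ r).Nodup ∧
      ∀ x ∉ List.ofFn f₀ ++ r, β x = 0 := by
    refine ⟨(β.support \ (List.ofFn f₀).toFinset).toList, ?_, fun x hx => ?_⟩
    · rw [List.nodup_append]
      refine ⟨List.nodup_ofFn.2 hf₀, nodup_toList _, ?_⟩
      rintro x hx _ hy rfl
      rw [mem_toList, mem_sdiff, List.mem_toFinset] at hy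
      exact hy.2 hx
    · rw [List.mem_append, mem_toList, mem_sdiff, List.mem_toFinset, Finsupp.mem_support_iff] at hx
      by_contra h0
      exact hx (or_iff_not_imp_left.2 fun h => ⟨h0, h⟩)
  funext A α
  by_contra h0
  obtain ⟨f, hf, rfl⟩ := exists_ofFn_toFinset (SetSPar.rho_complete_ne_zero h0).1
  refine mul_ne_zero (thetaSign_ne_zero (List.nodup_ofFn.2 hf)) h0 ?_
  rw [SetSPar.thetaSign_mul_rho_complete hf]
  set F : Equiv.Perm (Fin J.m) → ℚ := fun τ => ((Equiv.Perm.sign τ : ℤ) : ℚ) *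
    ((∑ g ∈ wordFuns J.n α,
      SetSPar.blockFact (J.rel ⊓ Setoid.ker (Sum.elim (f ∘ τ) g)) : ℕ) : ℚ) with hF
  have hla : (List.ofFn (f₀ ∘ Equiv.swap i j)).map β = (List.ofFn (f₀ ∘ (1 : Equiv.Perm (Fin J.m)))).map β := by
    rw [List.map_ofFn, List.map_ofFn]
    congr 1
    funext k
    simp only [Function.comp_apply, Equiv.Perm.one_apply]
    rw [Equiv.swap_apply_def]
    split_ifs with hi hj
    · rw [hi, hxy]
    · rw [hj, hxy]
    · rfl
  have key : ∀ τ, F (τ * Equiv.swap i j) = -F τ := by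
    intro τ
    rw [hF]
    dsimp only
    rw [SetSPar.sum_blockFact_eq h1 h2 hr1 hr2 (Equiv.swap i j) hla (ls := r.map β) rfl,
      SetSPar.sum_blockFact_eq h1 h2 hr1 hr2 1
      (la := (List.ofFn (f₀ ∘ (1 : Equiv.Perm (Fin J.m)))).map β) rfl (ls := r.map β) rfl, Equiv.Perm.sign_mul,
      Equiv.Perm.sign_swap hij]
    have e : (f ∘ (τ * Equiv.swap i j : Equiv.Perm _)) ∘ Equiv.swap i j =
        (f ∘ τ) ∘ (1 : Equiv.Perm (Fin J.m)) := by
      funext k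
      simp
    rw [e]
    simp
  have hsum : ∑ τ, F τ = -∑ τ, F τ := by
    rw [← sum_neg_distrib, ← Equiv.sum_comp (Equiv.mulRight (Equiv.swap i j))]
    exact sum_congr rfl fun τ _ => key τ
  linarith

/-! ### The basis of complete homogeneous functions in commuting variables -/

lemma exists_hasType (L : SPar) : ∃ J : SetSPar, J.HasType L := by
  obtain ⟨w, hw⟩ := words_nonempty L.exponents
  have hL := L.matches_exponents
  rw [← mem_words.1 hw] at hL
  have hinj : Set.InjOn (firstPos w) (List.range L.df).toFinset := by
    intro x hx y hy hxy
    rw [mem_coe, List.mem_toFinset] at hx hy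
    rcases firstPos_inj hxy with h | ⟨h1, h2⟩
    · exact h
    · rw [← List.count_eq_zero, ← content_apply] at h1 h2
      have hp := hL.pairwise
      by_contra hne
      have h3 : (List.range L.df).Pairwise fun x y => content w x ≠ content w y :=
        hp.imp fun h => ne_of_gt h
      have : Std.Symm fun x y => content w x ≠ content w y := ⟨fun _ _ h => Ne.symm h⟩
      exact h3.forall hx hy hne (h1.trans h2.symm)
  obtain ⟨J, a, hJ, ha⟩ := SetSPar.exists_matches hinj
  refine ⟨J, (SetSPar.hasType_iff hJ).2 ⟨_, ?_, hL⟩⟩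
  refine (List.perm_ext_iff_of_nodup List.nodup_range hJ.nodup).2 fun x => ?_
  rw [← List.mem_toFinset, ← ha, List.mem_toFinset]

lemma neg_one_pow_mul_fact_ne_zero (k : ℕ) (L : SPar) : (-1 : ℚ) ^ k * L.fact ≠ 0 := by
  refine mul_ne_zero (pow_ne_zero _ (by norm_num)) (Nat.cast_ne_zero.2 ?_)
  rw [SPar.fact]
  exact (List.prod_pos fun x hx => by
    obtain ⟨k, -, rfl⟩ := List.mem_map.1 hx
    exact Nat.factorial_pos k).ne'

lemma completeComm_mem (L : SPar) : completeComm L ∈ sSym := by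
  obtain ⟨J, hJ⟩ := exists_hasType L
  have h := rho_complete_of_hasType hJ
  have h1 : completeComm L = ((-1 : ℚ) ^ J.eps * L.fact)⁻¹ • rho J.complete := by
    rw [h, smul_smul, inv_mul_cancel₀ (neg_one_pow_mul_fact_ne_zero _ _), one_smul]
  rw [h1]
  exact Submodule.smul_mem _ _ ⟨_, J.complete_mem, rfl⟩

def hComm (L : SPar) : sSym := ⟨completeComm L, completeComm_mem L⟩

/-- The projection as a map from `sNCSym` to `sSym`. -/
def project : sNCSym →ₗ[ℚ] sSym := rho.restrict fun _ h => ⟨_, h, rfl⟩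

lemma project_hNC_of_hasType {J : SetSPar} {L : SPar} (h : J.HasType L) :
    project (hNC J) = ((-1 : ℚ) ^ J.eps * L.fact) • hComm L :=
  Subtype.ext (rho_complete_of_hasType h)

lemma project_hNC_of_not_hasType {J : SetSPar} (h : ∀ L, ¬ J.HasType L) : project (hNC J) = 0 :=
  Subtype.ext (rho_complete_of_not_hasType h)

lemma top_le_span_hComm : ⊤ ≤ Submodule.span ℚ (Set.range hComm) := by
  rintro ⟨_, g, hg, rfl⟩ -
  have h1 : Submodule.map project (Submodule.span ℚ (Set.range hNC)) ≤
      Submodule.span ℚ (Set.range hComm) := by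
    rw [Submodule.map_span_le]
    rintro _ ⟨J, rfl⟩
    by_cases h : ∃ L, J.HasType L
    · obtain ⟨L, hL⟩ := h
      rw [project_hNC_of_hasType hL]
      exact Submodule.smul_mem _ _ (Submodule.subset_span ⟨L, rfl⟩)
    · rw [project_hNC_of_not_hasType (not_exists.1 h)]
      exact Submodule.zero_mem _
  exact h1 ⟨⟨g, hg⟩, top_le_span_hNC trivial, rfl⟩

lemma repr_commBasis (f : sSym) (L : SPar) : commBasis.repr f L = evComm L f := by
  classical
  have : commBasis.coord L = evComm L := commBasis.ext fun O => by
    rw [commBasis.coord_apply, commBasis.repr_self, commBasis_apply, evComm_mComm,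
      Finsupp.single_apply]
  exact LinearMap.congr_fun this f

lemma linearIndependent_hComm : LinearIndependent ℚ hComm := by
  refine (linearIndependent_iff_span_of_degree commBasis (fun L => L.df + L.deg) SPar.finite_le
    hComm fun L O h => ?_).2 top_le_span_hComm
  rw [repr_commBasis] at h
  obtain ⟨J, hJ⟩ := exists_hasType L
  have h1 : rho J.complete (range O.df) O.exponents ≠ 0 := by
    rw [rho_complete_of_hasType hJ]
    exact mul_ne_zero (neg_one_pow_mul_fact_ne_zero _ _) h
  obtain ⟨h2, h3⟩ := SetSPar.rho_complete_ne_zero h1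
  rw [card_range] at h2
  rw [O.degree_exponents] at h3
  rw [h2, h3, hJ.bidegree.1, hJ.bidegree.2]

def completeCommBasis : Module.Basis SPar ℚ sSym :=
  Module.Basis.mk linearIndependent_hComm top_le_span_hComm

lemma completeCommBasis_apply (L : SPar) : completeCommBasis L = hComm L := by
  rw [completeCommBasis, Module.Basis.mk_apply]

open Classical in
def innerComm : LinearMap.BilinForm ℚ sSym :=
  formOfBases commBasis completeCommBasis fun L O => if L = O then (-1) ^ (L.df.choose 2) else 0

open Classical in
lemma innerComm_mComm_hComm (L O : SPar) : innerComm (mComm L) (hComm O) =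
    if L = O then (-1) ^ (L.df.choose 2) else 0 := by
  rw [← commBasis_apply, ← completeCommBasis_apply, innerComm, formOfBases_apply]

theorem isInnerComm_innerComm : IsInnerComm innerComm := fun L O =>
  ⟨mComm L, hComm O, rfl, rfl, innerComm_mComm_hComm L O⟩

theorem isInnerComm_unique (B : LinearMap.BilinForm ℚ sSym) (hB : IsInnerComm B) :
    B = innerComm := by
  refine commBasis.ext fun L => completeCommBasis.ext fun O => ?_
  obtain ⟨f, g, hf, hg, h⟩ := hB L O
  obtain rfl : f = mComm L := Subtype.ext hf
  obtain rfl : g = hComm O := Subtype.ext hg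
  rw [commBasis_apply, completeCommBasis_apply, h, innerComm_mComm_hComm]

/-! ### Adjunction -/

lemma project_lift (f : sSym) : project (lift f) = f := Subtype.ext (rho_spread f)

lemma innerNC_lift (f : sSym) (g : sNCSym) : innerNC (lift f) g = innerComm f (project g) := by
  classical
  have key : innerNC.compl₁₂ lift LinearMap.id = innerComm.compl₁₂ LinearMap.id project := by
    refine commBasis.ext fun L => completeNCBasis.ext fun J => ?_
    rw [LinearMap.compl₁₂_apply, LinearMap.compl₁₂_apply, LinearMap.id_apply, LinearMap.id_apply,
      commBasis_apply, completeNCBasis_apply, lift_mComm, map_smul, LinearMap.smul_apply, map_sum,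
      LinearMap.sum_apply]
    simp only [map_smul, LinearMap.smul_apply, innerNC_mNC_hNC, smul_eq_mul, mul_ite, mul_zero,
      sum_ite_eq', Set.Finite.mem_toFinset, Set.mem_ofPred_eq]
    by_cases h : ∃ O, J.HasType O
    · obtain ⟨O, hO⟩ := h
      rw [project_hNC_of_hasType hO, map_smul, innerComm_mComm_hComm, smul_eq_mul]
      by_cases hLO : L = O
      · subst hLO
        rw [if_pos hO, if_pos rfl, ← hO.bidegree.1, hO.bidegree.2]
        have : ((L.deg)! : ℚ) ≠ 0 := Nat.cast_ne_zero.2 (Nat.factorial_ne_zero _)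
        field_simp
      · rw [if_neg fun hL => hLO (hL.unique hO), if_neg hLO]
        simp
    · rw [project_hNC_of_not_hasType (not_exists.1 h), if_neg (not_exists.1 h L)]
      simp
  exact LinearMap.congr_fun (LinearMap.congr_fun key f) g

/-! ### Schur functions -/

lemma val_tableauSum_swap (κ : Kind) (L : SPar) (j : ℕ) {a : List ℕ} (ha : a.Nodup) (α : ℕ →₀ ℕ) :
    (tableauSum κ L).val (a.map (Equiv.swap j (j + 1))) (α.mapDomain (Equiv.swap j (j + 1))) =
      (tableauSum κ L).val a α := by
  have h := thetaSign_map_mul (perm_sort ha rfl) ha (Equiv.swap j (j + 1)).injective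
  rw [thetaSign_map_swap (sortedLT_sort _).pairwise, thetaSign_sort, mul_one] at h
  simp only [mem_sort] at h
  rw [Comm.val, Comm.val, toFinset_map_perm, tableauSum_swap, ← mul_assoc, h]

lemma tableauSum_mem (κ : Kind) (L : SPar) : tableauSum κ L ∈ symComm := by
  refine ⟨⟨L.df + L.deg, fun A α h => ?_⟩, fun σ hσ => ?_⟩
  · rw [(tableauSum_ne_zero h).1, (tableauSum_ne_zero h).2]
  let H : Subgroup (Equiv.Perm ℕ) :=
    { carrier := {σ | ∀ (a : List ℕ) (α : ℕ →₀ ℕ), a.Nodup →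
        (tableauSum κ L).val (a.map σ) (α.mapDomain σ) = (tableauSum κ L).val a α}
      one_mem' := fun a α _ => by
        rw [Equiv.Perm.coe_one, List.map_id, Finsupp.mapDomain_id]
      mul_mem' := fun {σ τ} hσ hτ a α ha => by
        rw [Equiv.Perm.coe_mul, ← List.map_map, Finsupp.mapDomain_comp,
          hσ _ _ (ha.map τ.injective), hτ a α ha]
      inv_mem' := fun {σ} hσ a α ha => by
        have h := hσ (a.map ⇑σ⁻¹) (α.mapDomain ⇑σ⁻¹) (ha.map σ⁻¹.injective)
        rw [List.map_map, ← Finsupp.mapDomain_comp, ← Equiv.Perm.coe_mul, mul_inv_cancel,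
          Equiv.Perm.coe_one, List.map_id, Finsupp.mapDomain_id] at h
        exact h.symm }
  exact mem_of_swap_mem H (fun j a α ha => val_tableauSum_swap κ L j ha α) hσ

/-- The Schur function in commuting variables. -/
def schur (κ : Kind) (L : SPar) : sSym := ⟨tableauSum κ L, sSym_eq_symComm ▸ tableauSum_mem κ L⟩

lemma coe_schur (κ : Kind) (L : SPar) : (schur κ L : Comm) = schurComm κ L := by
  rw [schurComm, ← coe_expansion]
  congr 1
  rw [← sub_eq_zero]
  refine evComm_separates _ fun O => ?_
  have h : evComm O (schur κ L) = kostka κ L O := (kostka_eq κ L O).symm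
  rw [map_sub, evComm_expansion, h]
  split_ifs with hO
  · exact sub_self _
  · rw [sub_zero, kostka_eq]
    by_contra h0
    obtain ⟨h1, h2⟩ := tableauSum_ne_zero h0
    rw [card_range] at h1
    rw [O.degree_exponents] at h2
    exact hO ⟨h2, h1⟩

lemma coe_lift_schur (κ : Kind) (L : SPar) :
    (lift (((L.deg)! : ℚ) • schur κ L) : NC) = schurNC κ L := by
  funext A w
  rw [coe_lift, spread_apply, schurNC_apply]
  change _ * (((L.deg)! : ℚ) * tableauSum κ L A (content w)) = _
  by_cases h : tableauSum κ L A (content w) = 0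
  · rw [h, mul_zero, mul_zero, mul_zero]
  · rw [← (tableauSum_ne_zero h).2, degree_content]
    have : ((w.length)! : ℚ) ≠ 0 := Nat.cast_ne_zero.2 (Nat.factorial_ne_zero _)
    field_simp

end Superspace

end

open Superspace in
theorem mainTheorem11 :
    ∃ (B : LinearMap.BilinForm ℚ sNCSym) (B' : LinearMap.BilinForm ℚ sSym)
      (R : sSym →ₗ[ℚ] sNCSym),
      (IsInnerNC B ∧ ∀ B₁, IsInnerNC B₁ → B₁ = B) ∧
      (IsInnerComm B' ∧ ∀ B₁, IsInnerComm B₁ → B₁ = B') ∧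
      (IsLift R ∧ ∀ R₁, IsLift R₁ → R₁ = R) ∧
      ∀ (κ : Kind) (n m : ℕ) (L O : SPar), L.deg = n → L.df = m → O.deg = n → O.df = m →
        ∃ (SL SO : sNCSym) (sL sO : sSym),
          (SL : NC) = schurNC κ L ∧ (SO : NC) = schurNC κ O ∧
          (sL : Comm) = schurComm κ L ∧ (sO : Comm) = schurComm κ O ∧
          rho SL = (n.factorial : ℚ) • (sL : Comm) ∧
          R ((n.factorial : ℚ) • sL) = SL ∧
          B SL SO = (n.factorial : ℚ) ^ 2 * B' sL sO := by
  refine ⟨innerNC, innerComm, lift, ⟨isInnerNC_innerNC, isInnerNC_unique⟩,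
    ⟨isInnerComm_innerComm, isInnerComm_unique⟩, ⟨isLift_lift, isLift_unique⟩, ?_⟩
  rintro κ n m L O rfl - hO -
  refine ⟨lift ((L.deg.factorial : ℚ) • schur κ L), lift ((L.deg.factorial : ℚ) • schur κ O),
    schur κ L, schur κ O, coe_lift_schur κ L, hO ▸ coe_lift_schur κ O, coe_schur κ L,
    coe_schur κ O, rho_spread _, rfl, ?_⟩
  rw [innerNC_lift, project_lift, map_smul, map_smul, LinearMap.smul_apply, smul_eq_mul,
    smul_eq_mul]
  ring
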